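/- **Spaces.** Let $n\ge 2$, $\mathbb T=\mathbb R^n/\mathbb Z^n$, $\varrho(\xi)=2\pi(1+|\xi|^2)^{1/2}$ for $\xi\in\mathbb Z^n$. For $s\in\mathbb R$ let $H^s$ be the space of real-valued distributions $g$ on $\mathbb T$ with Fourier coefficients $\hat g(\xi)$ and $\|g\|_{H^s}^2=\sum_{\xi}\varrho(\xi)^{2s}|\hat g(\xi)|^2<\infty$; $\dot H^s=\{g\in H^s:\hat g(0)=0\}$; boldface denotes vector fields with $n$ components; $\dot{\mathbf H}^s_\sigma=\{w\in\dot{\mathbf H}^s:\operatorname{div}w=0\}$. The dual product is $\langle g,h\rangle=\sum_\xi\hat g(\xi)\hat h(-\xi)$ (summed over components for vectors), $\mathbb P_\sigma$ is the Leray projector onto divergence-free fields with zero mean, $E_{j\beta}(u)=\frac12(\partial_ju_\beta+\partial_\beta u_j)$, and $(Ku^0)(\cdot,t)=\sum_\xi \hat u^0(\xi)e^{-(2\pi|\xi|)^2t+2\pi i x\cdot\xi}$. Repeated indices are summed from $1$ to $n$. **Coefficients.** Let $T>0$ and let $\mathbb A=\{a_{kj}^{\alpha\beta}\}$ be real functions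 in $L_\infty((0,T)\times\mathbb T)$ with $a_{kj}^{\alpha\beta}=a_{\alpha j}^{k\beta}=a_{k\beta}^{\alpha j}$ a.e., which satisfy the relaxed ellipticity condition with a constant $C_{\mathbb A}>0$: for a.e. $(x,t)$, $C_{\mathbb A}\,a_{kj}^{\alpha\beta}(x,t)\zeta_{k\alpha}\zeta_{j\beta}\ge|\zeta|^2$ for all symmetric matrices $\zeta\in\mathbb R^{n\times n}$ with zero trace. Put $\|\mathbb A\|_{\tilde\sigma}=\big(\sum\|a_{kj}^{\alpha\beta}\|^2_{L_\infty(0,T;H^{\tilde\sigma+1})}\big)^{1/2}$, the sum being over all $k,j,\alpha,\beta$, and $a(t;u,w)=\langle a_{ij}^{\alpha\beta}(\cdot,t)E_{j\beta}(u),E_{i\alpha}(w)\rangle$. **Solutions.** For $f\in L_2(0,S;\dot{\mathbf H}^{-1})$, $u^0\in\dot{\mathbf H}^0_\sigma$, a *Serrin-type solution* on $[0,S]$ is $u\in L_\infty(0,S;\dot{\mathbf H}^0_\sigma)\cap L_2(0,S;\dot{\mathbf H}^1_\sigma)\cap L_2(0,S;\dot{\mathbf H}^{n/2}_\sigma)$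 such that, for a.e. $t\in(0,S)$, the distribution $u'+\mathbb P_\sigma[(u\cdot\nabla)u]$ takes a value in $\mathbf H^{-1}$ and $$\langle u'(\cdot,t)+\mathbb P_\sigma[(u\cdot\nabla)u](\cdot,t),w\rangle+a(t;u(\cdot,t),w)=\langle f(\cdot,t),w\rangle\qquad\forall\,w\in\dot{\mathbf H}^1_\sigma,$$ and $u$ has a representative that is weakly continuous from $[0,S]$ to $\dot{\mathbf H}^0_\sigma$ with value $u^0$ at $t=0$. An *associated pressure* is a scalar $p$ with, for a.e. $t\in(0,S)$, $$\langle u'+(u\cdot\nabla)u,w\rangle+a(t;u,w)+\langle\nabla p,w\rangle=\langle f,w\rangle\qquad\forall\,w\in\mathbf C^\infty(\mathbb T).$$ **Theorem.** Let $n\ge2$, $T>0$, and let $\tilde\sigma\in\mathbb R$, $C_{\mathbb A}>0$ and $M$ be given. There are constants $A_1\ge0$, $A_2\ge0$, $A_3>0$, which depend only on $n,T,\tilde\sigma,C_{\mathbb A},M$, such that the following holds for every tensor $\mathbb A$ as above with $\|\mathbb A\|_{\tilde\sigma}\le M$, and every $r>n/2-1$ with $\tilde\sigma>\frac n2+\max\{|r-1|,|\frac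 n2-2|\}$. Let $f\in L_2(0,T;\dot{\mathbf H}^{r-1})$, $u^0\in\dot{\mathbf H}^r_\sigma$ and $T_*\in(0,T]$ satisfy $$\int_0^{T_*}\|f(\cdot,t)\|^2_{\mathbf H^{n/2-2}}dt+\big(A_1\|u^0\|^2_{\mathbf H^{n/2-1}}+A_2\big)\int_0^{T_*}\|(Ku^0)(\cdot,t)\|^2_{\mathbf H^{n/2}}dt<A_3 .$$ Then there is a Serrin-type solution $u$ on $[0,T_*]$, it is unique up to equality for a.e. $t$, and $$u\in L_\infty(0,T_*;\dot{\mathbf H}^r_\sigma)\cap L_2(0,T_*;\dot{\mathbf H}^{r+1}_\sigma),\qquad u'\in L_2(0,T_*;\dot{\mathbf H}^{r-1}_\sigma).$$ Moreover $u\in C^0([0,T_*];\dot{\mathbf H}^r_\sigma)$ after a change on a null set of times, with $\lim_{t\to0}\|u(\cdot,t)-u^0\|_{\mathbf H^r}=0$. There is an associated pressure $p\in L_2(0,T_*;\dot H^r)$, and every associated pressure that belongs to $L_2(0,T_*;\dot H^s)$ for some $s\in\mathbb R$ is equal to $p$ for a.e. $t$. -/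

import Mathlib

open MeasureTheory Set Filter Topology
open scoped ENNReal ComplexConjugate

noncomputable section

namespace PeriodicNS

/-! ### Periodic distributions and Sobolev spaces on the torus `ℝⁿ / ℤⁿ`

A periodic distribution `g` is identified with the family `ξ ↦ ĝ(ξ)`, `ξ ∈ ℤⁿ`, of its Fourier
coefficients `ĝ(ξ) = ⟨g, exp(-2πi x·ξ)⟩`.  Every family with finite norm `sobolevNorm s` is of
polynomial growth, hence is the family of coefficients of exactly one periodic distribution. -/

/-- The frequency lattice `ℤⁿ`. -/
abbrev Freq (n : ℕ) := Fin n → ℤ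

/-- Scalar periodic distributions, through their Fourier coefficients. -/
abbrev SDist (n : ℕ) := Freq n → ℂ

/-- Vector periodic distributions with `n` components, through their Fourier coefficients. -/
abbrev VDist (n : ℕ) := Fin n → SDist n

/-- `|ξ|²`, the square of the Euclidean norm of a frequency. -/
def freqSq {n : ℕ} (ξ : Freq n) : ℝ := ∑ j, (ξ j : ℝ) ^ 2

/-- `ϱ(ξ) = 2π (1 + |ξ|²)^{1/2}`. -/
def rho {n : ℕ} (ξ : Freq n) : ℝ := 2 * Real.pi * Real.sqrt (1 + freqSq ξ)

/-- `‖g‖_{H^s} = (∑_ξ ϱ(ξ)^{2s} |ĝ(ξ)|²)^{1/2}`, with value `∞` if the series diverges. -/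
def sobolevNorm {n : ℕ} (s : ℝ) (g : SDist n) : ℝ≥0∞ :=
  (∑' ξ, ENNReal.ofReal (rho ξ ^ (2 * s)) * ‖g ξ‖ₑ ^ 2) ^ (1 / 2 : ℝ)

/-- The norm of a vector distribution in `(H^s)ⁿ`. -/
def sobolevNormV {n : ℕ} (s : ℝ) (v : VDist n) : ℝ≥0∞ :=
  (∑ k, sobolevNorm s (v k) ^ 2) ^ (1 / 2 : ℝ)

/-- The distribution is real-valued. -/
def IsRealDist {n : ℕ} (g : SDist n) : Prop := ∀ ξ, g (-ξ) = conj (g ξ)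

/-- The real space `H^s` on the torus. -/
def H {n : ℕ} (s : ℝ) : Set (SDist n) := {g | IsRealDist g ∧ sobolevNorm s g < ∞}

/-- The subspace `Ḣ^s` of the elements of `H^s` with zero mean value. -/
def dotH {n : ℕ} (s : ℝ) : Set (SDist n) := {g | g ∈ H s ∧ g 0 = 0}

/-- The space `(H^s)ⁿ` of vector distributions. -/
def HV {n : ℕ} (s : ℝ) : Set (VDist n) := {v | ∀ k, v k ∈ H s}

/-- The space `(Ḣ^s)ⁿ` of vector distributions. -/
def dotHV {n : ℕ} (s : ℝ) : Set (VDist n) := {v | ∀ k, v k ∈ dotH s}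

/-- The partial derivative `∂_j g`. -/
def partialD {n : ℕ} (j : Fin n) (g : SDist n) : SDist n :=
  fun ξ => 2 * (Real.pi : ℂ) * Complex.I * (ξ j : ℂ) * g ξ

/-- The divergence of a vector distribution. -/
def divergence {n : ℕ} (v : VDist n) : SDist n := fun ξ => ∑ j, partialD j (v j) ξ

/-- The gradient of a scalar distribution. -/
def gradient {n : ℕ} (p : SDist n) : VDist n := fun k => partialD k p

/-- The space `Ḣ^s_σ` of divergence-free vector distributions with zero mean value. -/
def dotHsigma {n : ℕ} (s : ℝ) : Set (VDist n) := {v | v ∈ dotHV s ∧ divergence v = 0}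

/-- Infinitely smooth periodic vector fields: `C^∞ = ⋂_s H^s`. -/
def smoothV (n : ℕ) : Set (VDist n) := {v | ∀ s : ℝ, v ∈ HV s}

/-- The dual product `⟨g, h⟩ = ∑_ξ ĝ(ξ) ĥ(-ξ)` of scalar distributions. -/
def pairing {n : ℕ} (g h : SDist n) : ℂ := ∑' ξ, g ξ * h (-ξ)

/-- The dual product of vector distributions. -/
def pairingV {n : ℕ} (g h : VDist n) : ℂ := ∑ k, pairing (g k) (h k)

/-- The pointwise product: its Fourier coefficients are given by the discrete convolution, which
converges absolutely for two factors in `L₂`. -/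
def mul {n : ℕ} (g h : SDist n) : SDist n := fun ξ => ∑' η, g η * h (ξ - η)

/-- The advection term `(u · ∇) u`. -/
def advection {n : ℕ} (u : VDist n) : VDist n :=
  fun k ξ => ∑ j, mul (u j) (partialD j (u k)) ξ

/-- The Leray projector: the orthogonal projector onto divergence-free fields with zero mean. -/
def leray {n : ℕ} (F : VDist n) : VDist n := fun k ξ =>
  if ξ = 0 then 0 else F k ξ - (ξ k : ℂ) * (∑ j, (ξ j : ℂ) * F j ξ) / (freqSq ξ : ℂ)

/-- The entries `E_{jβ}(u) = (∂_j u_β + ∂_β u_j) / 2` of the symmetric gradient. -/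
def strain {n : ℕ} (u : VDist n) (j β : Fin n) : SDist n :=
  fun ξ => (partialD j (u β) ξ + partialD β (u j) ξ) / 2

/-- The solution operator of the heat equation: the value at time `t` of the solution with initial
value `u⁰`, that is `∑_ξ û⁰(ξ) exp(-(2π|ξ|)² t + 2πi x·ξ)`. -/
def heat {n : ℕ} (u₀ : VDist n) (t : ℝ) : VDist n :=
  fun k ξ => u₀ k ξ * (Real.exp (-(4 * Real.pi ^ 2 * freqSq ξ) * t) : ℂ)

/-! ### Functions of time with values in Sobolev spaces -/

/-- Lebesgue measure on the time interval `(0,T)`. -/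
def timeMeasure (T : ℝ) : Measure ℝ := volume.restrict (Ioo 0 T)

/-- `h ∈ L_q(0,T; Ḣ^s)`.  As `Ḣ^s` is a separable Hilbert space, measurability is that of the
Fourier coefficients. -/
def MemLqDot {n : ℕ} (q : ℝ≥0∞) (T s : ℝ) (h : ℝ → SDist n) : Prop :=
  (∀ ξ, AEStronglyMeasurable (fun t => h t ξ) (timeMeasure T)) ∧
  (∀ᵐ t ∂(timeMeasure T), h t ∈ dotH s) ∧
  eLpNorm (fun t => sobolevNorm s (h t)) q (timeMeasure T) < ∞

/-- `v ∈ L_q(0,T; (Ḣ^s)ⁿ)`. -/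
def MemLqDotV {n : ℕ} (q : ℝ≥0∞) (T s : ℝ) (v : ℝ → VDist n) : Prop :=
  ∀ k, MemLqDot q T s (fun t => v t k)

/-- `v ∈ L_q(0,T; Ḣ^s_σ)`. -/
def MemLqSigma {n : ℕ} (q : ℝ≥0∞) (T s : ℝ) (v : ℝ → VDist n) : Prop :=
  MemLqDotV q T s v ∧ ∀ᵐ t ∂(timeMeasure T), divergence (v t) = 0

/-- `v ∈ C⁰([0,T]; Ḣ^s_σ)`. -/
def ContSigma {n : ℕ} (T s : ℝ) (v : ℝ → VDist n) : Prop :=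
  (∀ t ∈ Icc 0 T, v t ∈ dotHsigma s) ∧
  ∀ t₀ ∈ Icc 0 T, Tendsto (fun t => sobolevNormV s (v t - v t₀)) (𝓝[Icc 0 T] t₀) (𝓝 0)

/-- `v'` is the time derivative of `v` in the sense of distributions on `(0,T)`. -/
def IsTimeDeriv {n : ℕ} (T : ℝ) (v v' : ℝ → VDist n) : Prop :=
  ∀ k ξ, LocallyIntegrableOn (fun t => v t k ξ) (Ioo 0 T) ∧
    LocallyIntegrableOn (fun t => v' t k ξ) (Ioo 0 T) ∧
    ∀ φ : ℝ → ℝ, ContDiff ℝ (⊤ : ℕ∞) φ → HasCompactSupport φ → tsupport φ ⊆ Ioo 0 T →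
      ∫ t in Ioo 0 T, (φ t : ℂ) * v' t k ξ = -∫ t in Ioo 0 T, ((deriv φ t : ℝ) : ℂ) * v t k ξ

/-! ### The anisotropic viscosity tensor -/

/-- The tensor of coefficients `a_{kj}^{αβ}(x,t)`, written `a k j α β t x`. -/
abbrev Tensor (n : ℕ) := Fin n → Fin n → Fin n → Fin n → ℝ → UnitAddTorus (Fin n) → ℝ

/-- The normalised Haar (Lebesgue) measure on the torus. -/
def torusMeasure (n : ℕ) : Measure (UnitAddTorus (Fin n)) :=
  Measure.pi fun _ => AddCircle.haarAddCircle

/-- The product measure on `(0,T) × 𝕋`. -/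
def spaceTimeMeasure (n : ℕ) (T : ℝ) : Measure (ℝ × UnitAddTorus (Fin n)) :=
  (timeMeasure T).prod (torusMeasure n)

/-- The Fourier coefficients of a real function on the torus. -/
def ofFun {n : ℕ} (g : UnitAddTorus (Fin n) → ℝ) : SDist n :=
  UnitAddTorus.mFourierCoeff fun x => (g x : ℂ)

/-- The coefficients are (measurable and) essentially bounded on `(0,T) × 𝕋`. -/
def TensorBounded {n : ℕ} (T : ℝ) (a : Tensor n) : Prop :=
  ∀ k j α β, MemLp (fun z : ℝ × UnitAddTorus (Fin n) => a k j α β z.1 z.2) ∞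
    (spaceTimeMeasure n T)

/-- The symmetry conditions `a_{kj}^{αβ} = a_{αj}^{kβ} = a_{kβ}^{αj}`. -/
def TensorSymmetric {n : ℕ} (T : ℝ) (a : Tensor n) : Prop :=
  ∀ᵐ z ∂(spaceTimeMeasure n T), ∀ k j α β,
    a k j α β z.1 z.2 = a α j k β z.1 z.2 ∧ a k j α β z.1 z.2 = a k β α j z.1 z.2

/-- The relaxed ellipticity condition, on symmetric matrices with zero trace. -/
def RelaxedElliptic {n : ℕ} (T CA : ℝ) (a : Tensor n) : Prop :=
  ∀ᵐ z ∂(spaceTimeMeasure n T), ∀ ζ : Matrix (Fin n) (Fin n) ℝ,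
    ζ.transpose = ζ → ζ.trace = 0 →
    ∑ k, ∑ α, ζ k α ^ 2 ≤
      CA * ∑ k, ∑ j, ∑ α, ∑ β, a k j α β z.1 z.2 * ζ k α * ζ j β

/-- The norm of the tensor: the Frobenius norm of the norms of the coefficients in
`L_∞(0,T; H^s)`. -/
def tensorNorm {n : ℕ} (T s : ℝ) (a : Tensor n) : ℝ≥0∞ :=
  (∑ k, ∑ j, ∑ α, ∑ β,
    eLpNorm (fun t => sobolevNorm s (ofFun (a k j α β t))) ∞ (timeMeasure T) ^ 2) ^ (1 / 2 : ℝ)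

/-- The bilinear form `a(t; u, w) = ⟨a_{ij}^{αβ}(·,t) E_{jβ}(u), E_{iα}(w)⟩`. -/
def viscForm {n : ℕ} (a : Tensor n) (t : ℝ) (u w : VDist n) : ℂ :=
  ∑ i, ∑ j, ∑ α, ∑ β, pairing (mul (ofFun (a i j α β t)) (strain u j β)) (strain w i α)

/-! ### Solutions -/

/-- `u` is a weak solution on `[0,T]`: it belongs to `L_∞(0,T; Ḣ⁰_σ) ∩ L₂(0,T; Ḣ¹_σ)` and solves the
initial-variational problem.  The functional `u' + P_σ[(u·∇)u]` is tested with all `w ∈ Ḣ¹_σ`, which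
means that its values are in `H⁻¹`.  The initial condition is meant for the representative of `u`
that is weakly continuous in time. -/
structure IsWeakSolution {n : ℕ} (T : ℝ) (a : Tensor n) (f : ℝ → VDist n) (u₀ : VDist n)
    (u : ℝ → VDist n) : Prop where
  mem_energy : MemLqSigma ∞ T 0 u
  mem_grad : MemLqSigma 2 T 1 u
  equation : ∃ u' : ℝ → VDist n, IsTimeDeriv T u u' ∧
    ∀ᵐ t ∂(timeMeasure T),
      u' t + leray (advection (u t)) ∈ HV (-1) ∧
      ∀ w ∈ dotHsigma 1,
        pairingV (u' t + leray (advection (u t))) w + viscForm a t (u t) w = pairingV (f t) w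
  initial : ∃ ut : ℝ → VDist n, (∀ᵐ t ∂(timeMeasure T), ut t = u t) ∧
    (∀ t ∈ Icc 0 T, ut t ∈ dotHsigma 0) ∧
    (∀ w ∈ HV 0, ContinuousOn (fun t => pairingV (ut t) w) (Icc 0 T)) ∧
    ∀ w ∈ dotHsigma 0, pairingV (ut 0) w = pairingV u₀ w

/-- A Serrin-type solution on `[0,T]`: a weak solution in `L₂(0,T; Ḣ^{n/2}_σ)`. -/
def IsSerrinSolution {n : ℕ} (T : ℝ) (a : Tensor n) (f : ℝ → VDist n) (u₀ : VDist n)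
    (u : ℝ → VDist n) : Prop :=
  IsWeakSolution T a f u₀ u ∧ MemLqSigma 2 T ((n : ℝ) / 2) u

/-- `p` is a pressure associated with the velocity `u`:
`u' - 𝔏u + ∇p + (u·∇)u = f` in the sense of distributions. -/
def IsPressure {n : ℕ} (T : ℝ) (a : Tensor n) (f : ℝ → VDist n) (u : ℝ → VDist n)
    (p : ℝ → SDist n) : Prop :=
  ∃ u' : ℝ → VDist n, IsTimeDeriv T u u' ∧
    ∀ᵐ t ∂(timeMeasure T), ∀ w ∈ smoothV n,
      pairingV (u' t + advection (u t)) w + viscForm a t (u t) w + pairingV (gradient (p t)) w =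
        pairingV (f t) w

/-- The smallness condition on the data and on the length of the time interval:
`∫₀^{T*} ‖f‖²_{H^{n/2-2}} dt + (A₁ ‖u⁰‖²_{H^{n/2-1}} + A₂) ∫₀^{T*} ‖K u⁰‖²_{H^{n/2}} dt < A₃`. -/
def SmallData {n : ℕ} (A₁ A₂ A₃ Ts : ℝ) (f : ℝ → VDist n) (u₀ : VDist n) : Prop :=
  (∫⁻ t in Ioo 0 Ts, sobolevNormV ((n : ℝ) / 2 - 2) (f t) ^ 2) +
    (ENNReal.ofReal A₁ * sobolevNormV ((n : ℝ) / 2 - 1) u₀ ^ 2 + ENNReal.ofReal A₂) *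
      (∫⁻ t in Ioo 0 Ts, sobolevNormV ((n : ℝ) / 2) (heat u₀ t) ^ 2) < ENNReal.ofReal A₃

end PeriodicNS

end

open PeriodicNS

open MeasureTheory Set Filter Topology
open scoped ENNReal ComplexConjugate

noncomputable section

namespace PeriodicNS

/-! ### Weights on the frequency lattice -/

/-! The result is small-data (or short-time) well-posedness at the scale-invariant level
`H^{n/2-1}`, with higher regularity carried along. Solutions are limits of Galerkin approximations
with frequencies in the cubes `box n N`, and everything is done on Fourier coefficients.

Critical level. Write `u = w + Ku⁰`, so that `w` starts from zero. With `y = ‖w‖²` in `H^{n/2-1}`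
and `W = ‖w‖²` in `H^{n/2}`, the energy method gives `y' ≤ -(c/2) W + C W y + C y + C (F + (U+1)
H)`, where `F`, `U`, `H` bound the squared norms of `f`, `u⁰`, `Ku⁰` that occur in the smallness
condition. While `y ≤ c/(4C)` the term `C W y` is absorbed by the dissipation, and Grönwall's
inequality keeps `y` below this threshold if the data are small. This is the smallness condition,
with `A₁ = A₂ = 1` (`exists_critical_inequality`, `exists_critical_bound`).

Level `r`. Once `u` is bounded in `L_∞ H^{n/2-1} ∩ L₂ H^{n/2}`, the energy inequality in `H^r` is
linear in `‖u‖_r²` with a coefficient integrable in time, so no further smallness is needed and `A₃`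
does not depend on `r` (`exists_subcritical_bound`).

Dissipation. The relaxed ellipticity condition speaks of trace-free symmetric matrices, which are
the values of `E(u)` for solenoidal `u`; with Korn's identity it yields coercivity in `H¹`
(`coercive_of_elliptic`). Passing to `H^s` costs the commutator of the coefficients with `ϱ^s`,
which is one order lower if the coefficients are in a Wiener algebra with weight `ϱ^{1+|s-1|}`
(`garding`). The embedding of `H^{σ+1}` into that algebra needs `σ > n/2 + |s-1|`; for `s = r` and
`s = n/2 - 1` this is the hypothesis on `σ`.

Convergence and uniqueness. The difference of two approximations has squared `L₂` norm of order
`N^{-r}`, uniformly in time (`exists_approx_difference`), so the sequence is Cauchy and no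
compactness argument is needed. Uniqueness is of weak-strong type: any Serrin-type solution is
compared with the regular one in `L₂` (`EnergySolution.eq_regularSolution`). Continuity in `H^r`
follows from `u ∈ L₂ H^{r+1}` and `u' ∈ L₂ H^{r-1}`, and the pressure is the potential of the part
of the equation that the Leray projector removes. -/

theorem freqSq_nonneg {n : ℕ} (ξ : Freq n) : 0 ≤ freqSq ξ :=
  Finset.sum_nonneg fun _ _ => sq_nonneg _

theorem sq_le_freqSq {n : ℕ} (ξ : Freq n) (j : Fin n) : (ξ j : ℝ) ^ 2 ≤ freqSq ξ :=
  Finset.single_le_sum (f := fun j => (ξ j : ℝ) ^ 2) (fun _ _ => sq_nonneg _) (Finset.mem_univ j)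

theorem freqSq_neg {n : ℕ} (ξ : Freq n) : freqSq (-ξ) = freqSq ξ := by simp [freqSq]

theorem freqSq_pos {n : ℕ} {ξ : Freq n} (h : ξ ≠ 0) : 1 ≤ freqSq ξ := by
  obtain ⟨j, hj⟩ := Function.ne_iff.mp h
  refine le_trans ?_ (sq_le_freqSq ξ j)
  have h1 : 1 ≤ |ξ j| := Int.one_le_abs hj
  have h2 : (1 : ℝ) ≤ |(ξ j : ℝ)| := by exact_mod_cast h1
  nlinarith [sq_abs (ξ j : ℝ)]

theorem rho_neg {n : ℕ} (ξ : Freq n) : rho (-ξ) = rho ξ := by simp [rho, freqSq_neg]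

theorem rho_sq {n : ℕ} (ξ : Freq n) : rho ξ ^ 2 = 4 * Real.pi ^ 2 * (1 + freqSq ξ) := by
  rw [rho, mul_pow, Real.sq_sqrt (by linarith [freqSq_nonneg ξ])]; ring

/-- Compares `ϱ` with one-dimensional weights, so that lattice sums factor over the coordinates. The
factor `2π` leaves enough room for the clean constant `1`. -/
theorem one_add_abs_le_rho {n : ℕ} (ξ : Freq n) (j : Fin n) : 1 + |(ξ j : ℝ)| ≤ rho ξ := by
  have h0 := Real.pi_gt_three
  have h1 : (1 + |(ξ j : ℝ)|) / 2 ≤ Real.sqrt (1 + freqSq ξ) := by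
    apply Real.le_sqrt_of_sq_le
    nlinarith [sq_le_freqSq ξ j, sq_abs (ξ j : ℝ), sq_nonneg (|(ξ j : ℝ)| - 1)]
  have h2 : 0 ≤ Real.sqrt (1 + freqSq ξ) := Real.sqrt_nonneg _
  unfold rho
  nlinarith

theorem one_le_rho {n : ℕ} (ξ : Freq n) : 1 ≤ rho ξ := by
  have h0 := Real.pi_gt_three
  have h1 : 1 ≤ Real.sqrt (1 + freqSq ξ) := by
    rw [Real.one_le_sqrt]; linarith [freqSq_nonneg ξ]
  unfold rho
  nlinarith

theorem rho_pos {n : ℕ} (ξ : Freq n) : 0 < rho ξ := zero_lt_one.trans_le (one_le_rho ξ)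

theorem two_pi_abs_le_rho {n : ℕ} (ξ : Freq n) (j : Fin n) : 2 * Real.pi * |(ξ j : ℝ)| ≤ rho ξ := by
  unfold rho
  gcongr
  apply Real.le_sqrt_of_sq_le
  rw [sq_abs]
  linarith [sq_le_freqSq ξ j]

/-- Poincaré's inequality at one frequency: away from the mean value the homogeneous symbol
`(2π|ξ|)²` controls the full weight. -/
theorem rho_sq_le {n : ℕ} {ξ : Freq n} (h : ξ ≠ 0) :
    rho ξ ^ 2 ≤ 2 * (4 * Real.pi ^ 2 * freqSq ξ) := by
  rw [rho_sq]
  nlinarith [freqSq_pos h, sq_nonneg Real.pi]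

theorem rho_le_add {n : ℕ} (ξ η : Freq n) : rho ξ ≤ rho η + rho (ξ - η) := by
  have key : ∀ ξ : Freq n, Real.sqrt (1 + freqSq ξ) =
      Real.sqrt (1 + ‖(WithLp.toLp 2 fun j => (ξ j : ℝ) : EuclideanSpace ℝ (Fin n))‖ ^ 2) := by
    intro ξ
    rw [EuclideanSpace.real_norm_sq_eq]; rfl
  have htri : ‖(WithLp.toLp 2 fun j => (ξ j : ℝ) : EuclideanSpace ℝ (Fin n))‖ ≤
      ‖(WithLp.toLp 2 fun j => (η j : ℝ) : EuclideanSpace ℝ (Fin n))‖ +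
      ‖(WithLp.toLp 2 fun j => ((ξ - η) j : ℝ) : EuclideanSpace ℝ (Fin n))‖ := by
    refine le_trans (le_of_eq ?_) (norm_add_le _ _)
    congr 1
    ext j
    simp
  unfold rho
  rw [key, key, key, ← mul_add]
  have hx := norm_nonneg (WithLp.toLp 2 fun j => (ξ j : ℝ) : EuclideanSpace ℝ (Fin n))
  generalize ‖(WithLp.toLp 2 fun j => (ξ j : ℝ) : EuclideanSpace ℝ (Fin n))‖ = x at *
  have hy := norm_nonneg (WithLp.toLp 2 fun j => (η j : ℝ) : EuclideanSpace ℝ (Fin n))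
  have hz := norm_nonneg (WithLp.toLp 2 fun j => ((ξ - η) j : ℝ) : EuclideanSpace ℝ (Fin n))
  generalize ‖(WithLp.toLp 2 fun j => (η j : ℝ) : EuclideanSpace ℝ (Fin n))‖ = y at *
  generalize ‖(WithLp.toLp 2 fun j => ((ξ - η) j : ℝ) : EuclideanSpace ℝ (Fin n))‖ = z at *
  have h2pi : 0 ≤ 2 * Real.pi := by positivity
  apply mul_le_mul_of_nonneg_left _ h2pi
  have ay : y ≤ Real.sqrt (1 + y ^ 2) := Real.le_sqrt_of_sq_le (by linarith)
  have az : z ≤ Real.sqrt (1 + z ^ 2) := Real.le_sqrt_of_sq_le (by linarith)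
  -- After squaring, only the mixed term `y z ≤ √(1+y²) √(1+z²)` has to be checked.
  rw [Real.sqrt_le_left (by positivity), add_sq, Real.sq_sqrt (by positivity),
    Real.sq_sqrt (by positivity)]
  nlinarith [mul_le_mul ay az hz (hy.trans ay)]

theorem rho_le_two_mul {n : ℕ} (ξ η : Freq n) : rho ξ ≤ 2 * (rho (ξ - η) * rho η) := by
  nlinarith [rho_le_add ξ η, one_le_rho η, one_le_rho (ξ - η)]

theorem abs_rho_sub_le {n : ℕ} (ξ η : Freq n) : |rho ξ - rho η| ≤ rho (ξ - η) := by
  rw [abs_le]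
  have h1 := rho_le_add ξ η
  have h2 := rho_le_add η ξ
  rw [← neg_sub, rho_neg] at h2
  constructor <;> linarith

/-- Peetre's inequality. -/
theorem rho_rpow_le {n : ℕ} (s : ℝ) (ξ η : Freq n) :
    rho ξ ^ s ≤ 2 ^ |s| * rho (ξ - η) ^ |s| * rho η ^ s := by
  have h1 := rho_pos ξ
  have h2 := rho_pos η
  have h3 := rho_pos (ξ - η)
  rcases le_total 0 s with hs | hs
  · rw [abs_of_nonneg hs, ← Real.mul_rpow (by norm_num) h3.le,
      ← Real.mul_rpow (by positivity) h2.le, mul_assoc]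
    exact Real.rpow_le_rpow h1.le (rho_le_two_mul ξ η) hs
  -- For negative `s` the roles of `ξ` and `η` are exchanged and the inequality is raised to the
  -- power `-s`.
  · have h := rho_le_two_mul η ξ
    rw [← neg_sub, rho_neg, ← mul_assoc] at h
    have h' := Real.rpow_le_rpow h2.le h (neg_nonneg.2 hs)
    rw [Real.mul_rpow (by positivity) h1.le, Real.mul_rpow (by norm_num) h3.le] at h'
    rw [abs_of_nonpos hs]
    calc rho ξ ^ s = rho η ^ (-s) * (rho η ^ s * rho ξ ^ s) := by
          rw [← mul_assoc, ← Real.rpow_add h2]; simp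
      _ ≤ 2 ^ (-s) * rho (ξ - η) ^ (-s) * rho ξ ^ (-s) * (rho η ^ s * rho ξ ^ s) := by gcongr
      _ = 2 ^ (-s) * rho (ξ - η) ^ (-s) * rho η ^ s * (rho ξ ^ (-s) * rho ξ ^ s) := by ring
      _ = _ := by rw [← Real.rpow_add h1]; simp

/-- Mean value theorem. The power `z^(s-1)` is monotone or antitone according to the sign of `s-1`;
in both cases the sum of its endpoint values bounds it. -/
theorem abs_rpow_sub_rpow_le {x y : ℝ} (s : ℝ) (hx : 0 < x) (hy : 0 < y) :
    |x ^ s - y ^ s| ≤ |s| * |x - y| * (x ^ (s - 1) + y ^ (s - 1)) := by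
  wlog hxy : y ≤ x generalizing x y
  · have := this hy hx (le_of_not_ge hxy)
    rw [abs_sub_comm, abs_sub_comm x y, add_comm (x ^ (s - 1))]
    exact this
  have hd : ∀ z ∈ Icc y x, HasDerivWithinAt (fun z : ℝ => z ^ s) (s * z ^ (s - 1)) (Icc y x) z :=
    fun z hz => (Real.hasDerivAt_rpow_const (Or.inl (hy.trans_le hz.1).ne')).hasDerivWithinAt
  have hb : ∀ z ∈ Icc y x, ‖s * z ^ (s - 1)‖ ≤ |s| * (x ^ (s - 1) + y ^ (s - 1)) := by
    intro z hz
    have hz0 := hy.trans_le hz.1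
    rw [norm_mul, Real.norm_eq_abs, Real.norm_of_nonneg (by positivity)]
    gcongr
    rcases le_total 0 (s - 1) with h | h
    · have := Real.rpow_le_rpow hz0.le hz.2 h
      have : 0 ≤ y ^ (s - 1) := by positivity
      linarith
    · have := Real.rpow_le_rpow_of_nonpos hy hz.1 h
      have : 0 ≤ x ^ (s - 1) := by positivity
      linarith
  have := (convex_Icc y x).norm_image_sub_le_of_norm_hasDerivWithin_le hd hb
    (left_mem_Icc.2 hxy) (right_mem_Icc.2 hxy)
  rw [Real.norm_eq_abs, Real.norm_eq_abs] at this
  linarith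

/-- The symbol form of the commutator estimate: one order is gained in `η`, at the price of `1 +
|s-1|` powers of `ξ - η`, the frequency of the coefficient. This exponent fixes the smoothness
required of the viscosity tensor. -/
theorem abs_rho_rpow_sub_le {n : ℕ} (s : ℝ) (ξ η : Freq n) :
    |rho ξ ^ s - rho η ^ s| ≤
      |s| * (2 ^ |s - 1| + 1) * rho (ξ - η) ^ (1 + |s - 1|) * rho η ^ (s - 1) := by
  have h1 := rho_pos ξ
  have h2 := rho_pos η
  have h3 := rho_pos (ξ - η)
  have h4 : 1 ≤ rho (ξ - η) ^ |s - 1| := Real.one_le_rpow (one_le_rho _) (abs_nonneg _)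
  calc |rho ξ ^ s - rho η ^ s| ≤ |s| * |rho ξ - rho η| * (rho ξ ^ (s - 1) + rho η ^ (s - 1)) :=
        abs_rpow_sub_rpow_le s h1 h2
    _ ≤ |s| * rho (ξ - η) * (2 ^ |s - 1| * rho (ξ - η) ^ |s - 1| * rho η ^ (s - 1) +
          rho (ξ - η) ^ |s - 1| * rho η ^ (s - 1)) := by
        gcongr
        · exact abs_rho_sub_le ξ η
        · exact rho_rpow_le _ _ _
        · exact le_mul_of_one_le_left (by positivity) h4
    _ = _ := by rw [Real.rpow_add h3, Real.rpow_one]; ring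

/-! ### Lattice sums -/

/-- The cube of frequencies with all components at most `N` in absolute value. -/
def box (n N : ℕ) : Finset (Freq n) := Fintype.piFinset fun _ => Finset.Icc (-(N : ℤ)) N

theorem mem_box {n N : ℕ} {ξ : Freq n} : ξ ∈ box n N ↔ ∀ j, |ξ j| ≤ N := by
  simp [box, Fintype.mem_piFinset, abs_le]

theorem neg_mem_box {n N : ℕ} {ξ : Freq n} : -ξ ∈ box n N ↔ ξ ∈ box n N := by
  simp [mem_box]

theorem box_mono (n : ℕ) : Monotone (box n) := by
  intro N M h ξ hξ
  rw [mem_box] at hξ ⊢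
  exact fun j => (hξ j).trans (by exact_mod_cast h)

theorem exists_mem_box {n : ℕ} (ξ : Freq n) : ∃ N, ξ ∈ box n N := by
  refine ⟨∑ j, (ξ j).natAbs, mem_box.2 fun j => ?_⟩
  rw [Int.abs_eq_natAbs]
  exact_mod_cast Finset.single_le_sum (f := fun j => (ξ j).natAbs) (fun _ _ => Nat.zero_le _)
    (Finset.mem_univ j)

theorem tendsto_box_atTop (n : ℕ) : Tendsto (box n) atTop atTop :=
  tendsto_atTop_finset_of_monotone (box_mono n) exists_mem_box

theorem lt_rho_of_notMem_box {n N : ℕ} {ξ : Freq n} (h : ξ ∉ box n N) : (N : ℝ) < rho ξ := by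
  rw [mem_box] at h
  push Not at h
  obtain ⟨j, hj⟩ := h
  have : (N : ℝ) < |(ξ j : ℝ)| := by exact_mod_cast hj
  linarith [one_add_abs_le_rho ξ j]

theorem sum_Icc_succ (f : ℤ → ℝ) (N : ℕ) :
    ∑ m ∈ Finset.Icc (-((N + 1 : ℕ) : ℤ)) ((N + 1 : ℕ) : ℤ), f m =
      f (-((N + 1 : ℕ) : ℤ)) + (f ((N + 1 : ℕ) : ℤ) + ∑ m ∈ Finset.Icc (-(N : ℤ)) N, f m) := by
  have : Finset.Icc (-((N + 1 : ℕ) : ℤ)) ((N + 1 : ℕ) : ℤ) =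
      insert (-((N + 1 : ℕ) : ℤ)) (insert ((N + 1 : ℕ) : ℤ) (Finset.Icc (-(N : ℤ)) N)) := by
    ext m
    simp only [Finset.mem_insert, Finset.mem_Icc]
    push_cast
    omega
  rw [this, Finset.sum_insert, Finset.sum_insert]
  · simp
  · simp only [Finset.mem_insert, Finset.mem_Icc]
    push_cast
    omega

/-- Induction on `N`. The increment `(1+x)^(1-β) - x^(1-β) ≥ (1-β) (1+x)^(-β)` is Bernoulli's
inequality for the exponent `1-β ≤ 1`, and the factor `2` counts the two new terms `±(N+1)`. -/
theorem sum_Icc_rpow_le {β : ℝ} (h0 : 0 ≤ β) (h1 : β < 1) (N : ℕ) :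
    ∑ m ∈ Finset.Icc (-(N : ℤ)) N, (1 + |(m : ℝ)|) ^ (-β) ≤
      2 / (1 - β) * ((N : ℝ) + 1) ^ (1 - β) := by
  have h2 : 0 < 1 - β := by linarith
  induction N with
  | zero =>
    simp
    rw [le_div_iff₀ h2]
    linarith
  | succ N ih =>
    rw [sum_Icc_succ]
    have habs : |((-((N + 1 : ℕ) : ℤ) : ℤ) : ℝ)| = N + 1 := by
      push_cast
      rw [abs_neg, abs_of_nonneg (by positivity)]
    have habs' : |(((N + 1 : ℕ) : ℤ) : ℝ)| = N + 1 := by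
      push_cast
      rw [abs_of_nonneg (by positivity)]
    rw [habs, habs']
    set x : ℝ := N + 1 with hx
    have hx0 : 0 < x := by positivity
    have hb : (1 + -1 / (1 + x)) ^ (1 - β) ≤ 1 + (1 - β) * (-1 / (1 + x)) :=
      rpow_one_add_le_one_add_mul_self (by rw [le_div_iff₀ (by positivity)]; linarith)
        h2.le (by linarith)
    have hx1 : 0 < 1 + x := by positivity
    have e1 : 1 + -1 / (1 + x) = x / (1 + x) := by field_simp; ring
    rw [e1, Real.div_rpow hx0.le hx1.le] at hb
    have hp : 0 < (1 + x) ^ (1 - β) := by positivity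
    rw [div_le_iff₀ hp] at hb
    have e2 : (1 + x) ^ (-β) = (1 + x) ^ (1 - β) / (1 + x) := by
      rw [show -β = (1 - β) - 1 by ring, Real.rpow_sub_one hx1.ne']
    have e3 : ((N + 1 : ℕ) : ℝ) + 1 = 1 + x := by push_cast; ring
    rw [e3, e2]
    have e4 : (1 + (1 - β) * (-1 / (1 + x))) * (1 + x) ^ (1 - β) =
      (1 + x) ^ (1 - β) - (1 - β) * ((1 + x) ^ (1 - β) / (1 + x)) := by field_simp; ring
    rw [e4] at hb
    have : 2 / (1 - β) * x ^ (1 - β) ≤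
      2 / (1 - β) * ((1 + x) ^ (1 - β) - (1 - β) * ((1 + x) ^ (1 - β) / (1 + x))) := by gcongr
    have e5 : 2 / (1 - β) * ((1 + x) ^ (1 - β) - (1 - β) * ((1 + x) ^ (1 - β) / (1 + x))) =
      2 / (1 - β) * (1 + x) ^ (1 - β) - 2 * ((1 + x) ^ (1 - β) / (1 + x)) := by
      field_simp
    linarith

theorem exists_sum_Icc_rpow_le {β : ℝ} (h1 : 1 < β) :
    ∃ C : ℝ, 0 ≤ C ∧ ∀ N : ℕ, ∑ m ∈ Finset.Icc (-(N : ℤ)) N, (1 + |(m : ℝ)|) ^ (-β) ≤ C := by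
  have hs : Summable fun m : ℤ => (1 + |(m : ℝ)|) ^ (-β) := by
    have hn : Summable fun m : ℕ => (1 + (m : ℝ)) ^ (-β) := by
      have := (summable_nat_add_iff 1).2 (Real.summable_nat_rpow.2 (by linarith : -β < -1))
      refine this.congr fun m => ?_
      push_cast
      rw [add_comm]
    apply Summable.of_nat_of_neg <;> simpa using hn
  exact ⟨∑' m : ℤ, (1 + |(m : ℝ)|) ^ (-β), tsum_nonneg fun m => by positivity,
    fun N => hs.sum_le_tsum _ fun m _ => by positivity⟩

/-- Writing `ϱ^(-α)` as a product of `n` equal factors `ϱ^(-α/n)` and comparing each with one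
coordinate turns the sum over a cube into the `n`-th power of a one-dimensional sum. Hence `α < n`
and `α > n` reduce to the exponents `α/n < 1` and `α/n > 1`. -/
theorem sum_box_rpow_le {n : ℕ} (hn : 0 < n) {α C : ℝ} (hα : 0 ≤ α) (N : ℕ)
    (h : ∑ m ∈ Finset.Icc (-(N : ℤ)) N, (1 + |(m : ℝ)|) ^ (-(α / n)) ≤ C) :
    ∑ ξ ∈ box n N, rho ξ ^ (-α) ≤ C ^ n := by
  have hn' : (0 : ℝ) < n := by exact_mod_cast hn
  calc ∑ ξ ∈ box n N, rho ξ ^ (-α) ≤ ∑ ξ ∈ box n N, ∏ j, (1 + |(ξ j : ℝ)|) ^ (-(α / n)) := by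
        refine Finset.sum_le_sum fun ξ _ => ?_
        have : rho ξ ^ (-α) = ∏ _j : Fin n, rho ξ ^ (-(α / n)) := by
          rw [Finset.prod_const, Finset.card_univ, Fintype.card_fin, ← Real.rpow_mul_natCast
            (rho_pos ξ).le]
          congr 1
          field_simp
        rw [this]
        refine Finset.prod_le_prod (fun j _ => Real.rpow_nonneg (rho_pos ξ).le _) fun j _ => ?_
        apply Real.rpow_le_rpow_of_nonpos (by positivity) (one_add_abs_le_rho ξ j)
        have : 0 ≤ α / n := by positivity
        linarith
    _ = (∑ m ∈ Finset.Icc (-(N : ℤ)) N, (1 + |(m : ℝ)|) ^ (-(α / n))) ^ n := by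
        rw [box, ← Finset.prod_univ_sum (fun _ : Fin n => Finset.Icc (-(N : ℤ)) N)
          (fun _ m => (1 + |(m : ℝ)|) ^ (-(α / n)))]
        simp
    _ ≤ C ^ n := by
        gcongr

theorem exists_tsum_rho_rpow_le {n : ℕ} (hn : 0 < n) {α : ℝ} (h0 : 0 ≤ α) (h1 : α < n) :
    ∃ C : ℝ, 0 ≤ C ∧ ∀ R : ℝ, 1 ≤ R →
      ∑' ξ : Freq n, (if rho ξ ≤ R then ENNReal.ofReal (rho ξ ^ (-α)) else 0) ≤
        ENNReal.ofReal (C * R ^ ((n : ℝ) - α)) := by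
  have hn' : (0 : ℝ) < n := by exact_mod_cast hn
  set β := α / n with hβ
  have hb0 : 0 ≤ β := by positivity
  have hb1 : β < 1 := by rw [hβ, div_lt_one hn']; exact h1
  have hb2 : 0 < 1 - β := by linarith
  refine ⟨(2 / (1 - β) * 2 ^ (1 - β)) ^ n, by positivity, fun R hR => ?_⟩
  have hR0 : 0 < R := by linarith
  set N := ⌊R⌋₊
  have hsum := sum_box_rpow_le hn h0 N (sum_Icc_rpow_le hb0 hb1 N)
  have hNR : (N : ℝ) + 1 ≤ 2 * R := by
    have := Nat.floor_le hR0.le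
    linarith
  rw [tsum_eq_sum (s := box n N)]
  · calc ∑ ξ ∈ box n N, (if rho ξ ≤ R then ENNReal.ofReal (rho ξ ^ (-α)) else 0)
        ≤ ∑ ξ ∈ box n N, ENNReal.ofReal (rho ξ ^ (-α)) := by
          refine Finset.sum_le_sum fun ξ _ => ?_
          split_ifs <;> simp
      _ = ENNReal.ofReal (∑ ξ ∈ box n N, rho ξ ^ (-α)) :=
          (ENNReal.ofReal_sum_of_nonneg fun ξ _ => Real.rpow_nonneg (rho_pos ξ).le _).symm
      _ ≤ ENNReal.ofReal ((2 / (1 - β) * (2 * R) ^ (1 - β)) ^ n) := by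
          apply ENNReal.ofReal_le_ofReal
          refine hsum.trans ?_
          gcongr
      _ = _ := by
          congr 1
          rw [Real.mul_rpow (by norm_num) hR0.le, ← mul_assoc, mul_pow _ (R ^ (1 - β)),
            ← Real.rpow_mul_natCast hR0.le]
          congr 2
          rw [hβ]; field_simp
  · intro ξ hξ
    -- The condition `ϱ(ξ) ≤ R` forces `|ξ_j| ≤ ⌊R⌋` for all `j`, so nothing is lost outside the
    -- cube.
    rw [if_neg]
    intro hle
    apply hξ
    rw [mem_box]
    intro j
    rw [Int.abs_eq_natAbs]
    have h3 : ((ξ j).natAbs : ℝ) ≤ R := by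
      rw [Nat.cast_natAbs, Int.cast_abs]
      linarith [one_add_abs_le_rho ξ j]
    exact_mod_cast Nat.le_floor h3

theorem tsum_rho_rpow_lt_top {n : ℕ} (hn : 0 < n) {α : ℝ} (h1 : (n : ℝ) < α) :
    ∑' ξ : Freq n, ENNReal.ofReal (rho ξ ^ (-α)) < ∞ := by
  have hn' : (0 : ℝ) < n := by exact_mod_cast hn
  obtain ⟨C, hC0, hC⟩ := exists_sum_Icc_rpow_le (β := α / n) (by rw [lt_div_iff₀ hn']; linarith)
  refine lt_of_le_of_lt ?_ (ENNReal.ofReal_lt_top (r := C ^ n))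
  rw [ENNReal.tsum_eq_iSup_sum' (box n) (fun t => ?_)]
  · refine iSup_le fun N => ?_
    rw [← ENNReal.ofReal_sum_of_nonneg fun ξ _ => Real.rpow_nonneg (rho_pos ξ).le _]
    exact ENNReal.ofReal_le_ofReal (sum_box_rpow_le hn (by linarith) N (hC N))
  · obtain ⟨N, hN⟩ := ((tendsto_box_atTop n).eventually (eventually_ge_atTop t)).exists
    exact ⟨N, hN⟩

/-! ### Weighted `ℓ²` norms and convolutions of nonnegative sequences -/

/-- The weight `ϱ(ξ)^s` as an extended nonnegative real. -/
def wt {n : ℕ} (s : ℝ) (ξ : Freq n) : ℝ≥0∞ := ENNReal.ofReal (rho ξ ^ s)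

theorem wt_add {n : ℕ} (s t : ℝ) (ξ : Freq n) : wt (s + t) ξ = wt s ξ * wt t ξ := by
  rw [wt, wt, wt, Real.rpow_add (rho_pos ξ),
    ENNReal.ofReal_mul (Real.rpow_nonneg (rho_pos ξ).le _)]

theorem wt_zero {n : ℕ} (ξ : Freq n) : wt 0 ξ = 1 := by simp [wt]

theorem wt_two_mul {n : ℕ} (s : ℝ) (ξ : Freq n) : wt (2 * s) ξ = wt s ξ ^ 2 := by
  rw [two_mul, wt_add, sq]

theorem wt_ne_top {n : ℕ} (s : ℝ) (ξ : Freq n) : wt s ξ ≠ ∞ := ENNReal.ofReal_ne_top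

theorem wt_mono {n : ℕ} {s t : ℝ} (h : s ≤ t) (ξ : Freq n) : wt s ξ ≤ wt t ξ :=
  ENNReal.ofReal_le_ofReal (Real.rpow_le_rpow_of_exponent_le (one_le_rho ξ) h)

/-- `∑_ξ ϱ(ξ)^{2s} G(ξ)²`. -/
def wsq {n : ℕ} (s : ℝ) (G : Freq n → ℝ≥0∞) : ℝ≥0∞ := ∑' ξ, wt (2 * s) ξ * G ξ ^ 2

/-- The convolution of nonnegative sequences. -/
def conv {n : ℕ} (G H : Freq n → ℝ≥0∞) : Freq n → ℝ≥0∞ := fun ξ => ∑' η, G η * H (ξ - η)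

/-- Cauchy–Schwarz, as Hölder's inequality for the counting measure. With values in `ℝ≥0∞` no
summability has to be discussed; all product estimates rest on it. -/
theorem tsum_mul_sq_le {ι : Type*} (f g : ι → ℝ≥0∞) :
    (∑' i, f i * g i) ^ 2 ≤ (∑' i, f i ^ 2) * ∑' i, g i ^ 2 := by
  let _ : MeasurableSpace ι := ⊤
  have h := ENNReal.lintegral_mul_le_Lp_mul_Lq (Measure.count : Measure ι)
    Real.HolderConjugate.two_two (f := f) (g := g) measurable_from_top.aemeasurable
    measurable_from_top.aemeasurable
  rw [lintegral_count, lintegral_count, lintegral_count] at h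
  simp only [Pi.mul_apply, ENNReal.rpow_two] at h
  calc (∑' i, f i * g i) ^ 2 ≤ ((∑' i, f i ^ 2) ^ (1 / 2 : ℝ) * (∑' i, g i ^ 2) ^ (1 / 2 : ℝ)) ^ 2 := by
        gcongr
    _ = _ := by
        rw [mul_pow, ← ENNReal.rpow_two, ← ENNReal.rpow_two, ← ENNReal.rpow_mul,
          ← ENNReal.rpow_mul]
        norm_num

theorem wsq_mono {n : ℕ} {s t : ℝ} (h : s ≤ t) (G : Freq n → ℝ≥0∞) : wsq s G ≤ wsq t G :=
  ENNReal.tsum_le_tsum fun ξ => by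
    gcongr
    exact wt_mono (by linarith) ξ

theorem wsq_le_wsq {n : ℕ} (s : ℝ) {G H : Freq n → ℝ≥0∞} (h : ∀ ξ, G ξ ≤ H ξ) :
    wsq s G ≤ wsq s H :=
  ENNReal.tsum_le_tsum fun ξ => by
    gcongr
    exact h ξ

theorem wsq_weight {n : ℕ} (s t : ℝ) (G : Freq n → ℝ≥0∞) :
    wsq s (fun ξ => wt t ξ * G ξ) = wsq (s + t) G := by
  unfold wsq
  congr 1 with ξ
  rw [mul_pow, ← wt_two_mul, ← mul_assoc, ← wt_add]
  congr 2
  ring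

theorem wsq_zero {n : ℕ} (G : Freq n → ℝ≥0∞) : wsq 0 G = ∑' ξ, G ξ ^ 2 := by
  simp [wsq, wt_zero]

theorem wsq_const_mul {n : ℕ} (s : ℝ) (c : ℝ≥0∞) (G : Freq n → ℝ≥0∞) :
    wsq s (fun ξ => c * G ξ) = c ^ 2 * wsq s G := by
  unfold wsq
  rw [← ENNReal.tsum_mul_left]
  congr 1 with ξ
  ring

theorem ennreal_add_sq_le (a b : ℝ≥0∞) : (a + b) ^ 2 ≤ 2 * a ^ 2 + 2 * b ^ 2 := by
  have := ENNReal.rpow_add_le_mul_rpow_add_rpow a b (p := 2) (by norm_num)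
  rw [ENNReal.rpow_two, ENNReal.rpow_two, ENNReal.rpow_two] at this
  norm_num at this
  rwa [mul_add] at this

theorem wsq_add_le {n : ℕ} (s : ℝ) (G H : Freq n → ℝ≥0∞) :
    wsq s (fun ξ => G ξ + H ξ) ≤ 2 * wsq s G + 2 * wsq s H := by
  unfold wsq
  rw [← ENNReal.tsum_mul_left, ← ENNReal.tsum_mul_left, ← ENNReal.tsum_add]
  refine ENNReal.tsum_le_tsum fun ξ => ?_
  calc _ ≤ wt (2 * s) ξ * (2 * G ξ ^ 2 + 2 * H ξ ^ 2) := by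
        gcongr
        exact ennreal_add_sq_le _ _
    _ = _ := by ring

/-- Interpolation between weighted norms. -/
theorem wsq_interp {n : ℕ} {s t u : ℝ} (h : 2 * u = s + t) (G : Freq n → ℝ≥0∞) :
    wsq u G ^ 2 ≤ wsq s G * wsq t G := by
  have := tsum_mul_sq_le (fun ξ => wt s ξ * G ξ) (fun ξ => wt t ξ * G ξ)
  unfold wsq
  rw [h]
  calc _ = (∑' ξ, wt s ξ * G ξ * (wt t ξ * G ξ)) ^ 2 := by
        congr 2 with ξ
        rw [wt_add]
        ring
    _ ≤ _ := this
    _ = _ := by simp only [mul_pow, ← wt_two_mul]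

/-! ### Product estimates in Sobolev spaces -/

theorem conv_comm {n : ℕ} (G H : Freq n → ℝ≥0∞) : conv G H = conv H G := by
  ext ξ
  unfold conv
  rw [← (Equiv.subLeft ξ).tsum_eq]
  congr 1 with η
  simp [mul_comm]

theorem tsum_tsum_sub {n : ℕ} (F : Freq n → Freq n → ℝ≥0∞) :
    ∑' ξ, ∑' η, F η (ξ - η) = ∑' ζ, ∑' η, F η ζ := by
  rw [ENNReal.tsum_comm]
  rw [ENNReal.tsum_comm (f := fun ζ η => F η ζ)]
  congr 1 with η
  exact (Equiv.subRight η).tsum_eq (fun ζ => F η ζ)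

/-- The part of the convolution in which `G` carries the lower frequency. Cauchy–Schwarz puts the
weight `ϱ^θ` on `G`; the sum of `ϱ(η)^(-2θ)` over `ϱ(η) ≤ ϱ(ζ)` is at most a constant times
`ϱ(ζ)^(n-2θ)`, which is the weight of `H` in `H^{n/2-θ}`. -/
theorem wsq_half_conv_le {n : ℕ} (hn : 0 < n) {θ : ℝ} (h0 : 0 ≤ θ) (h1 : 2 * θ < n) :
    ∃ C : ℝ≥0∞, C ≠ ∞ ∧ ∀ G H : Freq n → ℝ≥0∞,
      ∑' ξ, (∑' η, if rho η ≤ rho (ξ - η) then G η * H (ξ - η) else 0) ^ 2 ≤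
        C * (wsq θ G * wsq ((n : ℝ) / 2 - θ) H) := by
  obtain ⟨C, hC0, hC⟩ := exists_tsum_rho_rpow_le hn (α := 2 * θ) (by linarith) h1
  refine ⟨ENNReal.ofReal C, ENNReal.ofReal_ne_top, fun G H => ?_⟩
  have cs : ∀ ξ : Freq n, (∑' η, if rho η ≤ rho (ξ - η) then G η * H (ξ - η) else 0) ^ 2 ≤
      wsq θ G * ∑' η, if rho η ≤ rho (ξ - η) then wt (-(2 * θ)) η * H (ξ - η) ^ 2 else 0 := by
    intro ξ
    refine le_trans (le_of_eq ?_) ((tsum_mul_sq_le (fun η => wt θ η * G η) (fun η =>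
      if rho η ≤ rho (ξ - η) then wt (-θ) η * H (ξ - η) else 0)).trans (le_of_eq ?_))
    · congr 2 with η
      split_ifs
      · have : wt θ η * wt (-θ) η = 1 := by rw [← wt_add, add_neg_cancel, wt_zero]
        calc G η * H (ξ - η) = (wt θ η * wt (-θ) η) * (G η * H (ξ - η)) := by rw [this, one_mul]
          _ = _ := by ring
      · simp
    · congr 1
      · unfold wsq
        congr 1 with η
        rw [mul_pow, ← wt_two_mul]
      · congr 1 with η
        split_ifs
        · rw [mul_pow, ← wt_two_mul]
          congr 2
          ring
        · simp
  calc _ ≤ ∑' ξ, wsq θ G * ∑' η, if rho η ≤ rho (ξ - η) then wt (-(2 * θ)) η * H (ξ - η) ^ 2 else 0 :=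
        ENNReal.tsum_le_tsum cs
    _ = wsq θ G * ∑' ζ, ∑' η, if rho η ≤ rho ζ then wt (-(2 * θ)) η * H ζ ^ 2 else 0 := by
        rw [ENNReal.tsum_mul_left,
          tsum_tsum_sub (fun η ζ => if rho η ≤ rho ζ then wt (-(2 * θ)) η * H ζ ^ 2 else 0)]
    _ ≤ wsq θ G * ∑' ζ, ENNReal.ofReal C * (wt (2 * ((n : ℝ) / 2 - θ)) ζ * H ζ ^ 2) := by
        gcongr with ζ
        calc ∑' η, (if rho η ≤ rho ζ then wt (-(2 * θ)) η * H ζ ^ 2 else 0)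
            = (∑' η, if rho η ≤ rho ζ then ENNReal.ofReal (rho η ^ (-(2 * θ))) else 0) * H ζ ^ 2 := by
              rw [← ENNReal.tsum_mul_right]
              congr 1 with η
              rw [ite_mul, zero_mul, wt]
          _ ≤ ENNReal.ofReal (C * rho ζ ^ ((n : ℝ) - 2 * θ)) * H ζ ^ 2 := by
              gcongr
              exact hC _ (one_le_rho ζ)
          _ = _ := by
              rw [ENNReal.ofReal_mul hC0, mul_assoc, wt]
              congr 4
              ring
    _ = _ := by
        rw [ENNReal.tsum_mul_left]
        unfold wsq
        ring

/-- The product estimate `H^θ · H^{n/2-θ} ⊂ L₂` for `0 < θ < n/2`. -/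
theorem wsq_conv_critical {n : ℕ} (hn : 0 < n) {θ : ℝ} (h0 : 0 < θ) (h1 : 2 * θ < n) :
    ∃ C : ℝ≥0∞, C ≠ ∞ ∧ ∀ G H : Freq n → ℝ≥0∞,
      wsq 0 (conv G H) ≤ C * (wsq θ G * wsq ((n : ℝ) / 2 - θ) H) := by
  obtain ⟨C₁, hC₁, h₁⟩ := wsq_half_conv_le hn h0.le h1
  obtain ⟨C₂, hC₂, h₂⟩ := wsq_half_conv_le hn (θ := (n : ℝ) / 2 - θ) (by linarith) (by linarith)
  refine ⟨2 * C₁ + 2 * C₂, by finiteness, fun G H => ?_⟩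
  -- The product is split according to which factor has the lower frequency. The second half is the
  -- first with the factors exchanged, and `θ` replaced by `n/2 - θ`.
  have split : ∀ ξ, conv G H ξ ≤
      (∑' η, if rho η ≤ rho (ξ - η) then G η * H (ξ - η) else 0) +
      ∑' η, if rho η ≤ rho (ξ - η) then H η * G (ξ - η) else 0 := by
    intro ξ
    rw [← (Equiv.subLeft ξ).tsum_eq (fun η => if rho η ≤ rho (ξ - η) then H η * G (ξ - η) else 0),
      ← ENNReal.tsum_add]
    refine ENNReal.tsum_le_tsum fun η => ?_
    simp only [Equiv.subLeft_apply, sub_sub_cancel]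
    rcases le_total (rho η) (rho (ξ - η)) with h | h
    · rw [if_pos h]
      exact le_self_add
    · rw [if_pos h, mul_comm (H _)]
      exact le_add_self
  have e : (n : ℝ) / 2 - ((n : ℝ) / 2 - θ) = θ := by ring
  have h₂' := h₂ H G
  rw [e] at h₂'
  rw [wsq_zero]
  calc _ ≤ ∑' ξ, (2 * (∑' η, if rho η ≤ rho (ξ - η) then G η * H (ξ - η) else 0) ^ 2 +
      2 * (∑' η, if rho η ≤ rho (ξ - η) then H η * G (ξ - η) else 0) ^ 2) :=
        ENNReal.tsum_le_tsum fun ξ => (pow_le_pow_left' (split ξ) 2).trans (ennreal_add_sq_le _ _)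
    _ ≤ 2 * (C₁ * (wsq θ G * wsq ((n : ℝ) / 2 - θ) H)) +
        2 * (C₂ * (wsq ((n : ℝ) / 2 - θ) H * wsq θ G)) := by
        rw [ENNReal.tsum_add, ENNReal.tsum_mul_left, ENNReal.tsum_mul_left]
        gcongr
        exact h₁ G H
    _ = _ := by ring

/-- The product estimate in `H^s`, `s ≥ 0`, with one factor in a scale-invariant space. -/
theorem wsq_conv_tame {n : ℕ} (hn : 2 ≤ n) {s : ℝ} (hs : 0 ≤ s) :
    ∃ C : ℝ≥0∞, C ≠ ∞ ∧ ∀ G H : Freq n → ℝ≥0∞,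
      wsq s (conv G H) ≤ C * (wsq (s + 1 / 2) G * wsq ((n : ℝ) / 2 - 1 / 2) H +
        wsq ((n : ℝ) / 2 - 1 / 2) G * wsq (s + 1 / 2) H) := by
  have hn' : (2 : ℝ) ≤ n := by exact_mod_cast hn
  obtain ⟨C, hC, h⟩ := wsq_conv_critical (n := n) (by omega) (θ := 1 / 2) (by norm_num)
    (by linarith)
  set c : ℝ≥0∞ := ENNReal.ofReal (2 ^ s)
  -- The weight of the product falls on the factor of higher frequency. The critical estimate with
  -- `θ = 1/2` then asks half a derivative more of the weighted factor and `n/2 - 1/2` derivatives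
  -- of the other.
  have hwt : ∀ ξ η : Freq n, wt s ξ ≤ c * (wt s η + wt s (ξ - η)) := by
    intro ξ η
    have h1 := rho_pos η
    have h2 := rho_pos (ξ - η)
    have e : c * (wt s η + wt s (ξ - η)) =
        ENNReal.ofReal (2 ^ s * (rho η ^ s + rho (ξ - η) ^ s)) := by
      rw [ENNReal.ofReal_mul (by positivity), ENNReal.ofReal_add (by positivity) (by positivity)]
      rfl
    rw [e]
    apply ENNReal.ofReal_le_ofReal
    have h3 := rho_le_add ξ η
    rcases le_total (rho η) (rho (ξ - η)) with h | h
    · calc rho ξ ^ s ≤ (2 * rho (ξ - η)) ^ s :=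
            Real.rpow_le_rpow (rho_pos ξ).le (by linarith) hs
        _ ≤ _ := by
            rw [Real.mul_rpow (by norm_num) h2.le]
            gcongr
            linarith [Real.rpow_nonneg h1.le s]
    · calc rho ξ ^ s ≤ (2 * rho η) ^ s :=
            Real.rpow_le_rpow (rho_pos ξ).le (by linarith) hs
        _ ≤ _ := by
            rw [Real.mul_rpow (by norm_num) h1.le]
            gcongr
            linarith [Real.rpow_nonneg h2.le s]
  refine ⟨2 * c ^ 2 * C, by finiteness, fun G H => ?_⟩
  have key : ∀ ξ, wt s ξ * conv G H ξ ≤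
      c * (conv (fun η => wt s η * G η) H ξ + conv (fun η => wt s η * H η) G ξ) := by
    intro ξ
    rw [conv_comm (fun η => wt s η * H η) G]
    unfold conv
    rw [← ENNReal.tsum_mul_left, ← ENNReal.tsum_add, ← ENNReal.tsum_mul_left]
    refine ENNReal.tsum_le_tsum fun η => ?_
    calc wt s ξ * (G η * H (ξ - η)) ≤ c * (wt s η + wt s (ξ - η)) * (G η * H (ξ - η)) := by
          gcongr
          exact hwt ξ η
      _ = _ := by ring
  have e1 : wsq s (conv G H) = wsq 0 (fun ξ => wt s ξ * conv G H ξ) := by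
    rw [wsq_weight, zero_add]
  rw [e1]
  refine (wsq_le_wsq 0 key).trans ?_
  rw [wsq_const_mul]
  have h1 := h (fun η => wt s η * G η) H
  have h2 := h (fun η => wt s η * H η) G
  rw [wsq_weight, add_comm (1 / 2 : ℝ) s] at h1 h2
  calc _ ≤ c ^ 2 * (2 * (C * (wsq (s + 1 / 2) G * wsq ((n : ℝ) / 2 - 1 / 2) H)) +
        2 * (C * (wsq (s + 1 / 2) H * wsq ((n : ℝ) / 2 - 1 / 2) G))) := by
        gcongr
        exact (wsq_add_le _ _ _).trans (by gcongr)
    _ = _ := by ring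

/-- Young's inequality `ℓ¹ * ℓ² ⊂ ℓ²`. -/
theorem wsq_conv_young {n : ℕ} (A G : Freq n → ℝ≥0∞) :
    wsq 0 (conv A G) ≤ (∑' ξ, A ξ) ^ 2 * wsq 0 G := by
  rw [wsq_zero, wsq_zero]
  -- Cauchy–Schwarz after the splitting `A = A^(1/2) * A^(1/2)`.
  have cs : ∀ ξ, conv A G ξ ^ 2 ≤ (∑' η, A η) * ∑' η, A η * G (ξ - η) ^ 2 := by
    intro ξ
    have hr : ∀ a : ℝ≥0∞, (a ^ (1 / 2 : ℝ)) ^ 2 = a := by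
      intro a
      rw [← ENNReal.rpow_two, ← ENNReal.rpow_mul]
      norm_num
    refine le_trans (le_of_eq ?_) ((tsum_mul_sq_le (fun η => A η ^ (1 / 2 : ℝ))
      (fun η => A η ^ (1 / 2 : ℝ) * G (ξ - η))).trans (le_of_eq ?_))
    · unfold conv
      congr 2 with η
      rw [← mul_assoc, ← sq, hr]
    · simp only [mul_pow, hr]
  calc _ ≤ ∑' ξ, (∑' η, A η) * ∑' η, A η * G (ξ - η) ^ 2 := ENNReal.tsum_le_tsum cs
    _ = (∑' η, A η) * ∑' ζ, ∑' η, A η * G ζ ^ 2 := by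
        rw [ENNReal.tsum_mul_left, tsum_tsum_sub (fun η ζ => A η * G ζ ^ 2)]
    _ = _ := by
        simp_rw [ENNReal.tsum_mul_right]
        rw [ENNReal.tsum_mul_left, sq, mul_assoc]

/-- Peetre's inequality moves the weight onto both factors and Young's inequality does the rest.
Since `s` may be any real number, multiplication by a viscosity coefficient is controlled in
negative Sobolev spaces as well. -/
theorem wsq_conv_wiener {n : ℕ} (s : ℝ) (A G : Freq n → ℝ≥0∞) :
    wsq s (conv A G) ≤ ENNReal.ofReal (2 ^ |s|) ^ 2 * ((∑' ξ, wt |s| ξ * A ξ) ^ 2 * wsq s G) := by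
  set c : ℝ≥0∞ := ENNReal.ofReal (2 ^ |s|)
  have key : ∀ ξ, wt s ξ * conv A G ξ ≤
      c * conv (fun η => wt |s| η * A η) (fun η => wt s η * G η) ξ := by
    intro ξ
    unfold conv
    rw [← ENNReal.tsum_mul_left, ← ENNReal.tsum_mul_left]
    refine ENNReal.tsum_le_tsum fun η => ?_
    have h := rho_rpow_le s ξ (ξ - η)
    rw [sub_sub_cancel] at h
    have h1 := rho_pos η
    have h2 := rho_pos (ξ - η)
    have hw : wt s ξ ≤ c * wt |s| η * wt s (ξ - η) := by
      refine (ENNReal.ofReal_le_ofReal h).trans (le_of_eq ?_)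
      rw [ENNReal.ofReal_mul (by positivity), ENNReal.ofReal_mul (by positivity)]
      rfl
    calc _ ≤ c * wt |s| η * wt s (ξ - η) * (A η * G (ξ - η)) := by gcongr
      _ = _ := by ring
  have e1 : wsq s (conv A G) = wsq 0 (fun ξ => wt s ξ * conv A G ξ) := by
    rw [wsq_weight, zero_add]
  rw [e1]
  refine (wsq_le_wsq 0 key).trans ?_
  rw [wsq_const_mul]
  gcongr
  refine (wsq_conv_young _ _).trans ?_
  rw [wsq_weight, zero_add]

/-- The embedding of a Sobolev space into a weighted Wiener algebra. -/
theorem tsum_wt_mul_sq_le {n : ℕ} (hn : 0 < n) {m p : ℝ} (h : m + (n : ℝ) / 2 < p) :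
    ∃ C : ℝ≥0∞, C ≠ ∞ ∧ ∀ A : Freq n → ℝ≥0∞, (∑' ξ, wt m ξ * A ξ) ^ 2 ≤ C * wsq p A := by
  -- The constant is the sum of `ϱ^(-2(p-m))`, finite as `2(p-m) > n`.
  refine ⟨_, (tsum_rho_rpow_lt_top hn (α := 2 * (p - m)) (by linarith)).ne, fun A => ?_⟩
  refine le_trans (le_of_eq ?_) ((tsum_mul_sq_le (fun ξ => wt (m - p) ξ)
    (fun ξ => wt p ξ * A ξ)).trans (le_of_eq ?_))
  · congr 2 with ξ
    rw [← mul_assoc, ← wt_add]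
    congr 2
    ring
  · congr 1
    · congr 1 with ξ
      rw [← wt_two_mul, wt]
      congr 2
      ring
    · unfold wsq
      congr 1 with ξ
      rw [mul_pow, ← wt_two_mul]

/-! ### Squared Sobolev norms -/

/-- The square of the norm of `H^s`. -/
def sq {n : ℕ} (s : ℝ) (g : SDist n) : ℝ≥0∞ := wsq s fun ξ => ‖g ξ‖ₑ

/-- The square of the norm of `(H^s)ⁿ`. -/
def vsq {n : ℕ} (s : ℝ) (u : VDist n) : ℝ≥0∞ := ∑ k, sq s (u k)

theorem ennreal_sq_rpow_half (a : ℝ≥0∞) : (a ^ (1 / 2 : ℝ)) ^ 2 = a := by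
  rw [← ENNReal.rpow_two, ← ENNReal.rpow_mul]
  norm_num

theorem sobolevNorm_sq {n : ℕ} (s : ℝ) (g : SDist n) : sobolevNorm s g ^ 2 = sq s g :=
  ennreal_sq_rpow_half _

theorem sobolevNorm_eq {n : ℕ} (s : ℝ) (g : SDist n) : sobolevNorm s g = sq s g ^ (1 / 2 : ℝ) := rfl

theorem sobolevNormV_eq {n : ℕ} (s : ℝ) (u : VDist n) :
    sobolevNormV s u = vsq s u ^ (1 / 2 : ℝ) := by
  unfold sobolevNormV vsq
  simp_rw [sobolevNorm_sq]

theorem sobolevNormV_sq {n : ℕ} (s : ℝ) (u : VDist n) : sobolevNormV s u ^ 2 = vsq s u := by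
  rw [sobolevNormV_eq, ennreal_sq_rpow_half]

theorem sobolevNorm_lt_top {n : ℕ} {s : ℝ} {g : SDist n} : sobolevNorm s g < ∞ ↔ sq s g < ∞ := by
  rw [sobolevNorm_eq, ENNReal.rpow_lt_top_iff_of_pos (by norm_num)]

theorem sq_le_vsq {n : ℕ} (s : ℝ) (u : VDist n) (k : Fin n) : sq s (u k) ≤ vsq s u :=
  Finset.single_le_sum (f := fun k => sq s (u k)) (fun _ _ => zero_le) (Finset.mem_univ k)

theorem vsq_lt_top {n : ℕ} {s : ℝ} {u : VDist n} : vsq s u < ∞ ↔ ∀ k, sq s (u k) < ∞ := by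
  simp [vsq, ENNReal.sum_lt_top]

theorem sq_mono {n : ℕ} {s t : ℝ} (h : s ≤ t) (g : SDist n) : sq s g ≤ sq t g := wsq_mono h _

theorem vsq_mono {n : ℕ} {s t : ℝ} (h : s ≤ t) (u : VDist n) : vsq s u ≤ vsq t u :=
  Finset.sum_le_sum fun _ _ => sq_mono h _

theorem ennreal_sum_sq_le {ι : Type*} [Fintype ι] (f : ι → ℝ≥0∞) :
    (∑ i, f i) ^ 2 ≤ Fintype.card ι * ∑ i, f i ^ 2 := by
  have := tsum_mul_sq_le (fun _ : ι => (1 : ℝ≥0∞)) f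
  simpa [tsum_fintype] using this

theorem wsq_sum_le {n : ℕ} {ι : Type*} [Fintype ι] (s : ℝ) (G : ι → Freq n → ℝ≥0∞) :
    wsq s (fun ξ => ∑ i, G i ξ) ≤ Fintype.card ι * ∑ i, wsq s (G i) := by
  unfold wsq
  rw [← Summable.tsum_finsetSum fun _ _ => ENNReal.summable, ← ENNReal.tsum_mul_left]
  refine ENNReal.tsum_le_tsum fun ξ => ?_
  rw [← Finset.mul_sum, mul_left_comm]
  gcongr
  exact ennreal_sum_sq_le _

theorem sq_sum_le {n : ℕ} {ι : Type*} [Fintype ι] (s : ℝ) (g : ι → SDist n) :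
    sq s (fun ξ => ∑ i, g i ξ) ≤ Fintype.card ι * ∑ i, sq s (g i) :=
  (wsq_le_wsq s fun _ => enorm_sum_le _ _).trans (wsq_sum_le s _)

theorem sq_add_le {n : ℕ} (s : ℝ) (g h : SDist n) :
    sq s (fun ξ => g ξ + h ξ) ≤ 2 * sq s g + 2 * sq s h :=
  (wsq_le_wsq s fun _ => enorm_add_le _ _).trans (wsq_add_le s _ _)

theorem sq_neg {n : ℕ} (s : ℝ) (g : SDist n) : sq s (fun ξ => -g ξ) = sq s g := by
  simp [sq]

theorem sq_sub_le {n : ℕ} (s : ℝ) (g h : SDist n) :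
    sq s (fun ξ => g ξ - h ξ) ≤ 2 * sq s g + 2 * sq s h := by
  simp only [sub_eq_add_neg]
  refine (sq_add_le s g fun ξ => -h ξ).trans ?_
  rw [sq_neg]

theorem vsq_add_le {n : ℕ} (s : ℝ) (u v : VDist n) :
    vsq s (u + v) ≤ 2 * vsq s u + 2 * vsq s v := by
  unfold vsq
  rw [Finset.mul_sum, Finset.mul_sum, ← Finset.sum_add_distrib]
  exact Finset.sum_le_sum fun k _ => sq_add_le s _ _

theorem vsq_sub_le {n : ℕ} (s : ℝ) (u v : VDist n) :
    vsq s (u - v) ≤ 2 * vsq s u + 2 * vsq s v := by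
  unfold vsq
  rw [Finset.mul_sum, Finset.mul_sum, ← Finset.sum_add_distrib]
  exact Finset.sum_le_sum fun k _ => sq_sub_le s _ _

theorem sq_interp {n : ℕ} {s t u : ℝ} (h : 2 * u = s + t) (g : SDist n) :
    sq u g ^ 2 ≤ sq s g * sq t g := wsq_interp h _

theorem vsq_interp {n : ℕ} {s t u : ℝ} (h : 2 * u = s + t) (v : VDist n) :
    vsq u v ^ 2 ≤ n * (vsq s v * vsq t v) := by
  refine (ennreal_sum_sq_le _).trans ?_
  rw [Fintype.card_fin]
  gcongr
  calc ∑ k, sq u (v k) ^ 2 ≤ ∑ k, sq s (v k) * vsq t v :=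
        Finset.sum_le_sum fun k _ => (sq_interp h _).trans (by gcongr; exact sq_le_vsq _ _ _)
    _ = _ := by rw [← Finset.sum_mul]; rfl

theorem enorm_partialD_le {n : ℕ} (j : Fin n) (g : SDist n) (ξ : Freq n) :
    ‖partialD j g ξ‖ₑ ≤ wt 1 ξ * ‖g ξ‖ₑ := by
  have h1 : ‖partialD j g ξ‖ = 2 * Real.pi * |(ξ j : ℝ)| * ‖g ξ‖ := by
    unfold partialD
    simp [abs_of_pos Real.pi_pos]
  have h2 : ‖partialD j g ξ‖ ≤ rho ξ * ‖g ξ‖ := by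
    rw [h1]
    gcongr
    exact two_pi_abs_le_rho ξ j
  rw [← ofReal_norm, ← ofReal_norm, wt, Real.rpow_one,
    ← ENNReal.ofReal_mul (rho_pos ξ).le]
  exact ENNReal.ofReal_le_ofReal h2

theorem sq_partialD_le {n : ℕ} (s : ℝ) (j : Fin n) (g : SDist n) :
    sq (s - 1) (partialD j g) ≤ sq s g := by
  refine (wsq_le_wsq _ (enorm_partialD_le j g)).trans (le_of_eq ?_)
  rw [wsq_weight, sub_add_cancel]
  rfl

theorem sq_half_add_le {n : ℕ} (s : ℝ) (g h : SDist n) :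
    sq s (fun ξ => (g ξ + h ξ) / 2) ≤ sq s g + sq s h := by
  have h0 : ∀ ξ, ‖(g ξ + h ξ) / 2‖ₑ ≤ 2⁻¹ * (‖g ξ‖ₑ + ‖h ξ‖ₑ) := by
    intro ξ
    rw [div_eq_inv_mul, enorm_mul]
    gcongr
    · rw [← ofReal_norm, norm_inv]
      norm_num
      rw [ENNReal.ofReal_div_of_pos two_pos]
      norm_num
    · exact enorm_add_le _ _
  refine (wsq_le_wsq s h0).trans ?_
  rw [wsq_const_mul]
  calc _ ≤ (2⁻¹ : ℝ≥0∞) ^ 2 * (2 * sq s g + 2 * sq s h) := by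
        gcongr
        exact wsq_add_le _ _ _
    _ = (2⁻¹ * 2) * 2⁻¹ * (sq s g + sq s h) := by ring
    _ ≤ 1 * (sq s g + sq s h) := by
        gcongr
        rw [ENNReal.inv_mul_cancel (by norm_num) (by norm_num), one_mul]
        norm_num
    _ = _ := one_mul _

theorem sq_strain_le {n : ℕ} (s : ℝ) (u : VDist n) (j β : Fin n) :
    sq (s - 1) (strain u j β) ≤ 2 * vsq s u := by
  refine (sq_half_add_le (s - 1) _ _).trans ?_
  rw [two_mul]
  gcongr
  · exact (sq_partialD_le s _ _).trans (sq_le_vsq _ _ _)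
  · exact (sq_partialD_le s _ _).trans (sq_le_vsq _ _ _)

/-! ### Products -/

theorem enorm_mul_le {n : ℕ} (g h : SDist n) (ξ : Freq n) :
    ‖mul g h ξ‖ₑ ≤ conv (fun η => ‖g η‖ₑ) (fun η => ‖h η‖ₑ) ξ := by
  unfold mul conv
  refine (enorm_tsum_le_tsum_enorm).trans (le_of_eq ?_)
  simp only [enorm_mul]

theorem conv_sq_le {n : ℕ} (G H : Freq n → ℝ≥0∞) (ξ : Freq n) :
    conv G H ξ ^ 2 ≤ wsq 0 G * wsq 0 H := by
  rw [wsq_zero, wsq_zero]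
  refine (tsum_mul_sq_le _ _).trans (le_of_eq ?_)
  congr 1
  exact (Equiv.subLeft ξ).tsum_eq (fun η => H η ^ 2)

theorem summable_of_tsum_enorm {ι : Type*} {f : ι → ℂ} (h : ∑' i, ‖f i‖ₑ ≠ ∞) : Summable f := by
  apply Summable.of_norm
  simp_rw [← toReal_enorm]
  exact ENNReal.summable_toReal h

theorem summable_mul {n : ℕ} {g h : SDist n} (hg : sq 0 g < ∞) (hh : sq 0 h < ∞) (ξ : Freq n) :
    Summable fun η => g η * h (ξ - η) := by
  apply summable_of_tsum_enorm
  simp only [enorm_mul]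
  have := (conv_sq_le (fun η => ‖g η‖ₑ) (fun η => ‖h η‖ₑ) ξ).trans_lt (ENNReal.mul_lt_top hg hh)
  intro h0
  unfold conv at this
  rw [h0] at this
  simp at this

theorem sq_mul_critical {n : ℕ} (hn : 0 < n) {θ : ℝ} (h0 : 0 < θ) (h1 : 2 * θ < n) :
    ∃ C : ℝ≥0∞, C ≠ ∞ ∧ ∀ g h : SDist n,
      sq 0 (mul g h) ≤ C * (sq θ g * sq ((n : ℝ) / 2 - θ) h) := by
  obtain ⟨C, hC, H⟩ := wsq_conv_critical hn h0 h1
  exact ⟨C, hC, fun g h => (wsq_le_wsq 0 (enorm_mul_le g h)).trans (H _ _)⟩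

theorem sq_mul_tame {n : ℕ} (hn : 2 ≤ n) {s : ℝ} (hs : 0 ≤ s) :
    ∃ C : ℝ≥0∞, C ≠ ∞ ∧ ∀ g h : SDist n,
      sq s (mul g h) ≤ C * (sq (s + 1 / 2) g * sq ((n : ℝ) / 2 - 1 / 2) h +
        sq ((n : ℝ) / 2 - 1 / 2) g * sq (s + 1 / 2) h) := by
  obtain ⟨C, hC, H⟩ := wsq_conv_tame hn hs
  exact ⟨C, hC, fun g h => (wsq_le_wsq s (enorm_mul_le g h)).trans (H _ _)⟩

theorem sq_mul_wiener {n : ℕ} (s : ℝ) (g h : SDist n) :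
    sq s (mul g h) ≤ ENNReal.ofReal (2 ^ |s|) ^ 2 * ((∑' ξ, wt |s| ξ * ‖g ξ‖ₑ) ^ 2 * sq s h) :=
  (wsq_le_wsq s (enorm_mul_le g h)).trans (wsq_conv_wiener s _ _)

theorem mul_comm' {n : ℕ} (g h : SDist n) : mul g h = mul h g := by
  ext ξ
  unfold mul
  rw [← (Equiv.subLeft ξ).tsum_eq]
  congr 1 with η
  simp [_root_.mul_comm]

/-- The product with an element of `H^p`, `p > n/2`, is bounded in `L₂`. -/
theorem sq_mul_of_gt {n : ℕ} (hn : 0 < n) {p : ℝ} (hp : (n : ℝ) / 2 < p) :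
    ∃ C : ℝ≥0∞, C ≠ ∞ ∧ ∀ g h : SDist n, sq 0 (mul g h) ≤ C * (sq p g * sq 0 h) := by
  obtain ⟨C, hC, H⟩ := tsum_wt_mul_sq_le hn (m := 0) (p := p) (by linarith)
  refine ⟨C, hC, fun g h => ?_⟩
  have := sq_mul_wiener 0 g h
  rw [abs_zero] at this
  simp only [Real.rpow_zero, ENNReal.ofReal_one, one_pow, one_mul] at this
  refine this.trans ?_
  rw [← mul_assoc]
  gcongr
  exact H _

theorem mul_sub_left {n : ℕ} {g g' h : SDist n} (hg : sq 0 g < ∞) (hg' : sq 0 g' < ∞)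
    (hh : sq 0 h < ∞) (ξ : Freq n) : mul (fun η => g η - g' η) h ξ = mul g h ξ - mul g' h ξ := by
  unfold mul
  rw [← (summable_mul hg hh ξ).tsum_sub (summable_mul hg' hh ξ)]
  simp only [sub_mul]

theorem mul_sub_right {n : ℕ} {g h h' : SDist n} (hg : sq 0 g < ∞) (hh : sq 0 h < ∞)
    (hh' : sq 0 h' < ∞) (ξ : Freq n) : mul g (fun η => h η - h' η) ξ = mul g h ξ - mul g h' ξ := by
  unfold mul
  rw [← (summable_mul hg hh ξ).tsum_sub (summable_mul hg hh' ξ)]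
  simp only [mul_sub]

theorem isRealDist_mul {n : ℕ} {g h : SDist n} (hg : IsRealDist g) (hh : IsRealDist h) :
    IsRealDist (mul g h) := by
  intro ξ
  unfold mul
  rw [← (Equiv.neg _).tsum_eq, Complex.conj_tsum]
  congr 1 with η
  rw [map_mul, ← hg, ← hh]
  simp only [Equiv.neg_apply]
  congr 2
  abel

theorem isRealDist_partialD {n : ℕ} {g : SDist n} (hg : IsRealDist g) (j : Fin n) :
    IsRealDist (partialD j g) := by
  intro ξ
  simp [partialD, hg ξ, map_ofNat]

theorem isRealDist_strain {n : ℕ} {u : VDist n} (hu : ∀ k, IsRealDist (u k)) (j β : Fin n) :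
    IsRealDist (strain u j β) := by
  intro ξ
  simp [strain, isRealDist_partialD (hu _) _ ξ, map_ofNat]

theorem isRealDist_leray {n : ℕ} {F : VDist n} (hF : ∀ k, IsRealDist (F k)) (k : Fin n) :
    IsRealDist (leray F k) := by
  intro ξ
  by_cases h : ξ = 0
  · simp [leray, h]
  · simp [leray, h, freqSq_neg, fun k => hF k ξ]

theorem isRealDist_sum {n : ℕ} {ι : Type*} {S : Finset ι} {g : ι → SDist n}
    (hg : ∀ i ∈ S, IsRealDist (g i)) : IsRealDist (fun ξ => ∑ i ∈ S, g i ξ) := by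
  intro ξ
  simp only [map_sum]
  exact Finset.sum_congr rfl fun i hi => hg i hi ξ

/-! ### The advection term in divergence form -/

/-- The vector distribution with components `∑_j ∂_j (u_j v_k)`. -/
def tens {n : ℕ} (u v : VDist n) : VDist n := fun k ξ => ∑ j, partialD j (mul (u j) (v k)) ξ

theorem isRealDist_tens {n : ℕ} {u v : VDist n} (hu : ∀ k, IsRealDist (u k))
    (hv : ∀ k, IsRealDist (v k)) (k : Fin n) : IsRealDist (tens u v k) :=
  isRealDist_sum fun j _ => isRealDist_partialD (isRealDist_mul (hu j) (hv k)) j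

theorem sq_zero_partialD_lt {n : ℕ} {g : SDist n} (h : sq 1 g < ∞) (j : Fin n) :
    sq 0 (partialD j g) < ∞ := by
  have := sq_partialD_le 1 j g
  rw [sub_self] at this
  exact this.trans_lt h

/-- By the product rule the two sides differ by `(div u) u_k`. The bound in `H¹` makes the
convolutions absolutely convergent, so that the sum over `j` can be taken inside. The divergence
form puts the derivative outside the product. -/
theorem advection_eq_tens {n : ℕ} {u : VDist n} (h1 : vsq 1 u < ∞) (hdiv : divergence u = 0) :
    advection u = tens u u := by
  have hu1 := fun k => vsq_lt_top.1 h1 k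
  have hu0 := fun k => (sq_mono zero_le_one (u k)).trans_lt (hu1 k)
  ext k ξ
  unfold advection tens
  rw [← sub_eq_zero, ← Finset.sum_sub_distrib]
  have h : ∀ j, mul (u j) (partialD j (u k)) ξ - partialD j (mul (u j) (u k)) ξ =
      ∑' η, -(partialD j (u j) η * u k (ξ - η)) := by
    intro j
    unfold mul
    simp only [partialD]
    rw [← tsum_mul_left, ← Summable.tsum_sub]
    · congr 1 with η
      simp only [Pi.sub_apply]
      push_cast
      ring
    · exact summable_mul (hu0 j) (sq_zero_partialD_lt (hu1 k) j) ξ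
    · exact (summable_mul (hu0 j) (hu0 k) ξ).mul_left _
  simp_rw [h]
  rw [← Summable.tsum_finsetSum fun j _ =>
    (summable_mul (sq_zero_partialD_lt (hu1 j) j) (hu0 k) ξ).neg]
  convert tsum_zero with η
  rw [Finset.sum_neg_distrib, ← Finset.sum_mul]
  have := congrFun hdiv η
  unfold divergence at this
  rw [this]
  simp

theorem tens_sub_tens {n : ℕ} {u v : VDist n} (hu : vsq 0 u < ∞) (hv : vsq 0 v < ∞) :
    tens u u - tens v v = tens (u - v) u + tens v (u - v) := by
  rw [vsq_lt_top] at hu hv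
  ext k ξ
  simp only [Pi.sub_apply, Pi.add_apply]
  unfold tens
  rw [← Finset.sum_sub_distrib, ← Finset.sum_add_distrib]
  refine Finset.sum_congr rfl fun j _ => ?_
  have h1 := mul_sub_left (hu j) (hv j) (hu k) ξ
  have h2 := mul_sub_right (hv j) (hu k) (hv k) ξ
  unfold partialD
  rw [show (u - v) j = fun η => u j η - v j η from rfl,
    show (u - v) k = fun η => u k η - v k η from rfl, h1, h2]
  ring

theorem vsq_tens_le {n : ℕ} (s : ℝ) (u v : VDist n) :
    vsq (s - 1) (tens u v) ≤ n * ∑ k, ∑ j, sq s (mul (u j) (v k)) := by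
  unfold vsq
  rw [Finset.mul_sum]
  refine Finset.sum_le_sum fun k _ => ?_
  refine (sq_sum_le (s - 1) _).trans ?_
  rw [Fintype.card_fin]
  gcongr
  exact sq_partialD_le s _ _

theorem vsq_tens_le_of {n : ℕ} {s a b : ℝ} {C : ℝ≥0∞} {u v : VDist n}
    (h : ∀ j k, sq s (mul (u j) (v k)) ≤ C * (sq a (u j) * sq b (v k))) :
    vsq (s - 1) (tens u v) ≤ n * C * (vsq a u * vsq b v) := by
  refine (vsq_tens_le s u v).trans ?_
  rw [mul_assoc]
  gcongr
  calc ∑ k, ∑ j, sq s (mul (u j) (v k)) ≤ ∑ k, ∑ j, C * (sq a (u j) * sq b (v k)) :=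
        Finset.sum_le_sum fun k _ => Finset.sum_le_sum fun j _ => h j k
    _ = _ := by
        unfold vsq
        simp_rw [← Finset.mul_sum, ← Finset.sum_mul]
        rw [← Finset.mul_sum]

/-- Both intermediate norms on the right are later interpolated, the first between `H^s` and
`H^{s+1}`, the second between `H^{n/2-1}` and `H^{n/2}`. -/
theorem vsq_tens_self_tame {n : ℕ} (hn : 2 ≤ n) {s : ℝ} (hs : 0 ≤ s) :
    ∃ C : ℝ≥0∞, C ≠ ∞ ∧ ∀ u : VDist n,
      vsq (s - 1) (tens u u) ≤ C * (vsq (s + 1 / 2) u * vsq ((n : ℝ) / 2 - 1 / 2) u) := by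
  obtain ⟨C, hC, H⟩ := sq_mul_tame hn hs
  refine ⟨n * (n * (n * (2 * C))), by finiteness, fun u => ?_⟩
  refine (vsq_tens_le s u u).trans ?_
  rw [mul_assoc]
  gcongr
  calc _ ≤ ∑ _k : Fin n, ∑ _j : Fin n, 2 * C * (vsq (s + 1 / 2) u * vsq ((n : ℝ) / 2 - 1 / 2) u) := by
        refine Finset.sum_le_sum fun k _ => Finset.sum_le_sum fun j _ => (H _ _).trans ?_
        calc _ ≤ C * (vsq (s + 1 / 2) u * vsq ((n : ℝ) / 2 - 1 / 2) u +
              vsq ((n : ℝ) / 2 - 1 / 2) u * vsq (s + 1 / 2) u) := by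
              gcongr <;> exact sq_le_vsq _ _ _
          _ = _ := by ring
    _ = _ := by
        simp only [Finset.sum_const, Finset.card_univ, Fintype.card_fin, nsmul_eq_mul]
        ring

theorem vsq_tens_critical {n : ℕ} (hn : 0 < n) {θ : ℝ} (h0 : 0 < θ) (h1 : 2 * θ < n) :
    ∃ C : ℝ≥0∞, C ≠ ∞ ∧ ∀ u v : VDist n,
      vsq (-1) (tens u v) ≤ C * (vsq θ u * vsq ((n : ℝ) / 2 - θ) v) := by
  obtain ⟨C, hC, H⟩ := sq_mul_critical hn h0 h1
  refine ⟨n * C, by finiteness, fun u v => ?_⟩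
  have := vsq_tens_le_of (u := u) (v := v) fun j k => H (u j) (v k)
  rwa [zero_sub] at this

/-- For differences of solutions: one factor is regular enough to lie in the Wiener algebra, so that
the difference itself is needed only in `L₂`. -/
theorem vsq_tens_of_gt {n : ℕ} (hn : 0 < n) {p : ℝ} (hp : (n : ℝ) / 2 < p) :
    ∃ C : ℝ≥0∞, C ≠ ∞ ∧ ∀ u v : VDist n,
      vsq (-1) (tens u v) ≤ C * (vsq p u * vsq 0 v) ∧
      vsq (-1) (tens u v) ≤ C * (vsq 0 u * vsq p v) := by
  obtain ⟨C, hC, H⟩ := sq_mul_of_gt hn hp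
  refine ⟨n * C, by finiteness, fun u v => ⟨?_, ?_⟩⟩
  · have := vsq_tens_le_of (u := u) (v := v) fun j k => H (u j) (v k)
    rwa [zero_sub] at this
  · have := vsq_tens_le_of (s := 0) (a := 0) (b := p) (C := C) (u := u) (v := v) fun j k => by
      rw [mul_comm' (u j), _root_.mul_comm (sq 0 _)]
      exact H (v k) (u j)
    rwa [zero_sub] at this

/-! ### The viscous term -/

/-- The Fourier coefficients of a tensor at a fixed time. -/
abbrev FTensor (n : ℕ) := Fin n → Fin n → Fin n → Fin n → SDist n

/-- The viscous term `½ ∑ ∂_α (a_{kj}^{αβ} E_{jβ}(u) + a_{αj}^{kβ} E_{jβ}(u))`. -/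
def visc {n : ℕ} (A : FTensor n) (u : VDist n) : VDist n := fun k ξ =>
  ∑ α, (partialD α (fun η => ∑ j, ∑ β, mul (A k j α β) (strain u j β) η) ξ +
    partialD α (fun η => ∑ j, ∑ β, mul (A α j k β) (strain u j β) η) ξ) / 2

/-- A bound for the norms of the coefficients in a weighted Wiener algebra. -/
def WienerBound {n : ℕ} (m : ℝ) (K : ℝ≥0∞) (A : FTensor n) : Prop :=
  ∀ i j α β, ∑' ξ, wt m ξ * ‖A i j α β ξ‖ₑ ≤ K

theorem WienerBound.mono {n : ℕ} {m m' : ℝ} {K : ℝ≥0∞} {A : FTensor n} (h : WienerBound m K A)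
    (hm : m' ≤ m) : WienerBound m' K A := fun i j α β =>
  (ENNReal.tsum_le_tsum fun ξ => by gcongr; exact wt_mono hm ξ).trans (h i j α β)

theorem isRealDist_visc {n : ℕ} {A : FTensor n} {u : VDist n}
    (hA : ∀ i j α β, IsRealDist (A i j α β)) (hu : ∀ k, IsRealDist (u k)) (k : Fin n) :
    IsRealDist (visc A u k) := by
  have h : ∀ i α γ, IsRealDist (partialD γ fun η => ∑ j, ∑ β, mul (A i j α β) (strain u j β) η) :=
    fun i α γ => isRealDist_partialD (isRealDist_sum fun j _ => isRealDist_sum fun β _ =>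
      isRealDist_mul (hA _ _ _ _) (isRealDist_strain hu _ _)) _
  refine isRealDist_sum fun α _ ξ => ?_
  rw [h, h]
  simp [map_ofNat]

theorem vsq_visc_le {n : ℕ} (s : ℝ) : ∃ C : ℝ≥0∞, C ≠ ∞ ∧ ∀ (A : FTensor n) (K : ℝ≥0∞) (u : VDist n),
    WienerBound |s| K A → vsq (s - 1) (visc A u) ≤ C * (K ^ 2 * vsq (s + 1) u) := by
  set c := ENNReal.ofReal (2 ^ |s|) ^ 2
  have hc : c ≠ ∞ := by finiteness
  refine ⟨n * (n * (n * (2 * (n * (n * (n * (n * (c * 2)))))))), by finiteness,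
    fun A K u hA => ?_⟩
  have h1 : ∀ i α γ, sq (s - 1) (partialD γ fun η => ∑ j, ∑ β, mul (A i j α β) (strain u j β) η) ≤
      n * (n * (n * (n * (c * (K ^ 2 * (2 * vsq (s + 1) u)))))) := by
    intro i α γ
    refine (sq_partialD_le s _ _).trans ((sq_sum_le s _).trans ?_)
    rw [Fintype.card_fin]
    gcongr
    calc _ ≤ ∑ _j : Fin n, (n : ℝ≥0∞) * (n * (c * (K ^ 2 * (2 * vsq (s + 1) u)))) := by
          refine Finset.sum_le_sum fun j _ => (sq_sum_le s _).trans ?_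
          rw [Fintype.card_fin]
          gcongr
          calc _ ≤ ∑ _β : Fin n, c * (K ^ 2 * (2 * vsq (s + 1) u)) := by
                refine Finset.sum_le_sum fun β _ => (sq_mul_wiener s _ _).trans ?_
                gcongr
                · exact hA _ _ _ _
                · have := sq_strain_le (s + 1) u j β
                  rwa [add_sub_cancel_right] at this
            _ = _ := by simp
      _ = _ := by simp
  calc vsq (s - 1) (visc A u)
      ≤ ∑ _k : Fin n, (n : ℝ≥0∞) * ∑ _α : Fin n, 2 * (n * (n * (n * (n * (c * (K ^ 2 * (2 * vsq (s + 1) u))))))) := by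
        refine Finset.sum_le_sum fun k _ => (sq_sum_le (s - 1) _).trans ?_
        rw [Fintype.card_fin]
        gcongr
        refine (sq_half_add_le (s - 1) _ _).trans ?_
        rw [two_mul]
        gcongr <;> exact h1 _ _ _
    _ = _ := by
        simp only [Finset.sum_const, Finset.card_univ, Fintype.card_fin, nsmul_eq_mul]
        ring

/-! ### The Leray projector -/

theorem enorm_leray_le {n : ℕ} (F : VDist n) (k : Fin n) (ξ : Freq n) :
    ‖leray F k ξ‖ₑ ≤ ‖F k ξ‖ₑ + ∑ j, ‖F j ξ‖ₑ := by
  by_cases h : ξ = 0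
  · simp [leray, h]
  · have hp : 0 < freqSq ξ := zero_lt_one.trans_le (freqSq_pos h)
    simp only [leray, h, if_false]
    refine (enorm_sub_le).trans ?_
    gcongr
    rw [Finset.mul_sum, Finset.sum_div]
    refine (enorm_sum_le _ _).trans (Finset.sum_le_sum fun j _ => ?_)
    rw [← ofReal_norm, ← ofReal_norm]
    apply ENNReal.ofReal_le_ofReal
    rw [norm_div, norm_mul, norm_mul, Complex.norm_real, Real.norm_of_nonneg hp.le, div_le_iff₀ hp,
      Complex.norm_intCast, Complex.norm_intCast]
    have hk := sq_le_freqSq ξ k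
    have hj := sq_le_freqSq ξ j
    have : |(ξ k : ℝ)| * |(ξ j : ℝ)| ≤ freqSq ξ := by
      nlinarith [sq_nonneg (|(ξ k : ℝ)| - |(ξ j : ℝ)|), sq_abs (ξ k : ℝ), sq_abs (ξ j : ℝ)]
    nlinarith [norm_nonneg (F j ξ)]

/-- The projector acts frequency by frequency through a bounded matrix, so one constant serves all
`s`. -/
theorem vsq_leray_le {n : ℕ} : ∃ C : ℝ≥0∞, C ≠ ∞ ∧ ∀ (s : ℝ) (F : VDist n),
    vsq s (leray F) ≤ C * vsq s F := by
  refine ⟨2 + n * (2 * n), by finiteness, fun s F => ?_⟩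
  calc vsq s (leray F) ≤ ∑ k, (2 * sq s (F k) + 2 * (n * vsq s F)) := by
        refine Finset.sum_le_sum fun k _ => ?_
        refine (wsq_le_wsq s (enorm_leray_le F k)).trans ((wsq_add_le s _ _).trans ?_)
        gcongr
        · exact le_rfl
        · refine (wsq_sum_le s _).trans ?_
          rw [Fintype.card_fin]
          rfl
    _ = _ := by
        rw [Finset.sum_add_distrib, ← Finset.mul_sum]
        simp only [Finset.sum_const, Finset.card_univ, Fintype.card_fin, nsmul_eq_mul]
        unfold vsq
        ring

/-! ### Finite sums over frequencies -/

/-- All the Fourier coefficients outside `B` vanish. -/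
def SuppIn {n : ℕ} (B : Finset (Freq n)) (u : VDist n) : Prop := ∀ k ξ, ξ ∉ B → u k ξ = 0

/-- Real, divergence-free, with zero mean. -/
structure Solenoidal {n : ℕ} (u : VDist n) : Prop where
  real : ∀ k, IsRealDist (u k)
  div : divergence u = 0
  mean : ∀ k, u k 0 = 0

/-- The real inner product of `(H^s)ⁿ`, restricted to the frequencies in `B`. -/
def ip {n : ℕ} (B : Finset (Freq n)) (s : ℝ) (F w : VDist n) : ℝ :=
  ∑ k, ∑ ξ ∈ B, rho ξ ^ (2 * s) * (F k ξ * conj (w k ξ)).re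

/-- The square of the norm of `(H^s)ⁿ`, restricted to the frequencies in `B`. -/
def rsq {n : ℕ} (B : Finset (Freq n)) (s : ℝ) (w : VDist n) : ℝ :=
  ∑ k, ∑ ξ ∈ B, rho ξ ^ (2 * s) * ‖w k ξ‖ ^ 2

theorem rsq_nonneg {n : ℕ} (B : Finset (Freq n)) (s : ℝ) (w : VDist n) : 0 ≤ rsq B s w :=
  Finset.sum_nonneg fun _ _ => Finset.sum_nonneg fun ξ _ =>
    mul_nonneg (Real.rpow_nonneg (rho_pos ξ).le _) (sq_nonneg _)

theorem ofReal_rho_mul_norm_sq {n : ℕ} (s : ℝ) (ξ : Freq n) (z : ℂ) :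
    ENNReal.ofReal (rho ξ ^ s * ‖z‖ ^ 2) = wt s ξ * ‖z‖ₑ ^ 2 := by
  rw [ENNReal.ofReal_mul (Real.rpow_nonneg (rho_pos ξ).le _), ENNReal.ofReal_pow (norm_nonneg _),
    ofReal_norm]
  rfl

theorem ofReal_rsq {n : ℕ} (B : Finset (Freq n)) (s : ℝ) (w : VDist n) :
    ENNReal.ofReal (rsq B s w) = ∑ k, ∑ ξ ∈ B, wt (2 * s) ξ * ‖w k ξ‖ₑ ^ 2 := by
  have h0 : ∀ k ξ, 0 ≤ rho ξ ^ (2 * s) * ‖w k ξ‖ ^ 2 := fun k ξ =>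
    mul_nonneg (Real.rpow_nonneg (rho_pos ξ).le _) (sq_nonneg _)
  unfold rsq
  rw [ENNReal.ofReal_sum_of_nonneg fun k _ => Finset.sum_nonneg fun ξ _ => h0 k ξ]
  refine Finset.sum_congr rfl fun k _ => ?_
  rw [ENNReal.ofReal_sum_of_nonneg fun ξ _ => h0 k ξ]
  exact Finset.sum_congr rfl fun ξ _ => ofReal_rho_mul_norm_sq _ _ _

theorem ofReal_rsq_le {n : ℕ} (B : Finset (Freq n)) (s : ℝ) (w : VDist n) :
    ENNReal.ofReal (rsq B s w) ≤ vsq s w := by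
  rw [ofReal_rsq]
  exact Finset.sum_le_sum fun k _ => ENNReal.sum_le_tsum _

theorem rsq_le_toReal {n : ℕ} (B : Finset (Freq n)) {s : ℝ} {w : VDist n} (h : vsq s w < ∞) :
    rsq B s w ≤ (vsq s w).toReal :=
  (ENNReal.ofReal_le_iff_le_toReal h.ne).1 (ofReal_rsq_le B s w)

theorem vsq_eq_ofReal_rsq {n : ℕ} {B : Finset (Freq n)} {w : VDist n} (h : SuppIn B w) (s : ℝ) :
    vsq s w = ENNReal.ofReal (rsq B s w) := by
  rw [ofReal_rsq]
  refine Finset.sum_congr rfl fun k _ => tsum_eq_sum fun ξ hξ => ?_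
  simp [h k ξ hξ]

theorem SuppIn.vsq_lt_top {n : ℕ} {B : Finset (Freq n)} {w : VDist n} (h : SuppIn B w) (s : ℝ) :
    vsq s w < ∞ := by
  rw [vsq_eq_ofReal_rsq h]
  exact ENNReal.ofReal_lt_top

theorem SuppIn.toReal_vsq {n : ℕ} {B : Finset (Freq n)} {w : VDist n} (h : SuppIn B w) (s : ℝ) :
    (vsq s w).toReal = rsq B s w := by
  rw [vsq_eq_ofReal_rsq h, ENNReal.toReal_ofReal (rsq_nonneg _ _ _)]

theorem ip_add_left {n : ℕ} (B : Finset (Freq n)) (s : ℝ) (F G w : VDist n) :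
    ip B s (F + G) w = ip B s F w + ip B s G w := by
  unfold ip
  simp only [Pi.add_apply, add_mul, Complex.add_re, mul_add, Finset.sum_add_distrib]

theorem ip_sub_left {n : ℕ} (B : Finset (Freq n)) (s : ℝ) (F G w : VDist n) :
    ip B s (F - G) w = ip B s F w - ip B s G w := by
  unfold ip
  simp only [Pi.sub_apply, sub_mul, Complex.sub_re, mul_sub, Finset.sum_sub_distrib]

theorem ip_smul_left {n : ℕ} (B : Finset (Freq n)) (s : ℝ) (c : ℝ) (F w : VDist n) :
    ip B s (c • F) w = c * ip B s F w := by
  unfold ip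
  rw [Finset.mul_sum]
  refine Finset.sum_congr rfl fun k _ => ?_
  rw [Finset.mul_sum]
  refine Finset.sum_congr rfl fun ξ _ => ?_
  simp
  ring

/-- The inequality `2|⟨F, w⟩_s| ≤ ε⁻¹ ‖F‖²_{s-1} + ε ‖w‖²_{s+1}`. -/
theorem abs_ip_le {n : ℕ} (B : Finset (Freq n)) (s : ℝ) (F w : VDist n) {ε : ℝ} (hε : 0 < ε) :
    2 * |ip B s F w| ≤ ε⁻¹ * rsq B (s - 1) F + ε * rsq B (s + 1) w := by
  have h : ∀ k ξ, 2 * |rho ξ ^ (2 * s) * (F k ξ * conj (w k ξ)).re| ≤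
      ε⁻¹ * (rho ξ ^ (2 * (s - 1)) * ‖F k ξ‖ ^ 2) + ε * (rho ξ ^ (2 * (s + 1)) * ‖w k ξ‖ ^ 2) := by
    intro k ξ
    have hr := rho_pos ξ
    have h1 : |(F k ξ * conj (w k ξ)).re| ≤ ‖F k ξ‖ * ‖w k ξ‖ := by
      refine (Complex.abs_re_le_norm _).trans (le_of_eq ?_)
      rw [norm_mul, RCLike.norm_conj]
    have e1 : rho ξ ^ (2 * s) = rho ξ ^ (s - 1) * rho ξ ^ (s + 1) := by
      rw [← Real.rpow_add hr]; congr 1; ring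
    have e2 : rho ξ ^ (2 * (s - 1)) = (rho ξ ^ (s - 1)) ^ 2 := by
      rw [_root_.mul_comm, ← Real.rpow_mul_natCast hr.le]; norm_num
    have e3 : rho ξ ^ (2 * (s + 1)) = (rho ξ ^ (s + 1)) ^ 2 := by
      rw [_root_.mul_comm, ← Real.rpow_mul_natCast hr.le]; norm_num
    have p1 : 0 ≤ rho ξ ^ (s - 1) := by positivity
    have p2 : 0 ≤ rho ξ ^ (s + 1) := by positivity
    rw [abs_mul, abs_of_nonneg (by positivity : 0 ≤ rho ξ ^ (2 * s)), e2, e3, e1]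
    generalize rho ξ ^ (s - 1) = a at *
    generalize rho ξ ^ (s + 1) = b at *
    have h2 : a * b * |(F k ξ * conj (w k ξ)).re| ≤ a * b * (‖F k ξ‖ * ‖w k ξ‖) := by gcongr
    have h3 : 2 * ((a * ‖F k ξ‖) * (b * ‖w k ξ‖)) ≤
        ε⁻¹ * (a * ‖F k ξ‖) ^ 2 + ε * (b * ‖w k ξ‖) ^ 2 := by
      have := mul_nonneg (inv_pos.2 hε).le (sq_nonneg (a * ‖F k ξ‖ - ε * (b * ‖w k ξ‖)))
      have e : ε⁻¹ * (a * ‖F k ξ‖ - ε * (b * ‖w k ξ‖)) ^ 2 = ε⁻¹ * (a * ‖F k ξ‖) ^ 2 +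
        ε * (b * ‖w k ξ‖) ^ 2 - 2 * ((a * ‖F k ξ‖) * (b * ‖w k ξ‖)) := by
        field_simp
        ring
      linarith
    calc _ ≤ 2 * (a * b * (‖F k ξ‖ * ‖w k ξ‖)) := by linarith
      _ = 2 * ((a * ‖F k ξ‖) * (b * ‖w k ξ‖)) := by ring
      _ ≤ _ := h3
      _ = _ := by ring
  unfold ip rsq
  calc _ ≤ 2 * ∑ k, ∑ ξ ∈ B, |rho ξ ^ (2 * s) * (F k ξ * conj (w k ξ)).re| := by
        gcongr
        exact (Finset.abs_sum_le_sum_abs _ _).trans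
          (Finset.sum_le_sum fun k _ => Finset.abs_sum_le_sum_abs _ _)
    _ = ∑ k, ∑ ξ ∈ B, 2 * |rho ξ ^ (2 * s) * (F k ξ * conj (w k ξ)).re| := by
        simp only [Finset.mul_sum]
    _ ≤ ∑ k, ∑ ξ ∈ B, (ε⁻¹ * (rho ξ ^ (2 * (s - 1)) * ‖F k ξ‖ ^ 2) +
          ε * (rho ξ ^ (2 * (s + 1)) * ‖w k ξ‖ ^ 2)) :=
        Finset.sum_le_sum fun k _ => Finset.sum_le_sum fun ξ _ => h k ξ
    _ = _ := by simp only [Finset.mul_sum, Finset.sum_add_distrib]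

theorem Solenoidal.sum_mul_eq_zero {n : ℕ} {w : VDist n} (hw : divergence w = 0) (ξ : Freq n) :
    ∑ j, (ξ j : ℂ) * w j ξ = 0 := by
  have := congrFun hw ξ
  unfold divergence partialD at this
  have h2 : (2 * (Real.pi : ℂ) * Complex.I) * ∑ j, (ξ j : ℂ) * w j ξ = 0 := by
    rw [Finset.mul_sum, ← show (0 : SDist n) ξ = 0 from rfl, ← this]
    exact Finset.sum_congr rfl fun j _ => by ring
  exact (mul_eq_zero.1 h2).resolve_left Complex.two_pi_I_ne_zero

/-- The Leray projector is invisible when tested with solenoidal fields. -/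
theorem sum_leray_mul_conj {n : ℕ} (F : VDist n) {w : VDist n} (hdiv : divergence w = 0)
    (h0 : ∀ k, w k 0 = 0) (ξ : Freq n) :
    ∑ k, leray F k ξ * conj (w k ξ) = ∑ k, F k ξ * conj (w k ξ) := by
  by_cases h : ξ = 0
  · simp [h, h0]
  · have hs := congrArg conj (Solenoidal.sum_mul_eq_zero hdiv ξ)
    simp only [map_sum, map_mul, map_intCast, map_zero] at hs
    simp only [leray, h, if_false, sub_mul, Finset.sum_sub_distrib]
    rw [sub_eq_self]
    have : ∀ k, (ξ k : ℂ) * (∑ j, (ξ j : ℂ) * F j ξ) / (freqSq ξ : ℂ) * conj (w k ξ) =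
        ((∑ j, (ξ j : ℂ) * F j ξ) / (freqSq ξ : ℂ)) * ((ξ k : ℂ) * conj (w k ξ)) := fun k => by ring
    simp only [this]
    rw [← Finset.mul_sum, hs, mul_zero]

theorem ip_eq_sum {n : ℕ} (B : Finset (Freq n)) (s : ℝ) (F w : VDist n) :
    ip B s F w = ∑ ξ ∈ B, rho ξ ^ (2 * s) * (∑ k, F k ξ * conj (w k ξ)).re := by
  unfold ip
  rw [Finset.sum_comm]
  refine Finset.sum_congr rfl fun ξ _ => ?_
  rw [Complex.re_sum, Finset.mul_sum]

theorem ip_leray {n : ℕ} (B : Finset (Freq n)) (s : ℝ) (F : VDist n) {w : VDist n}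
    (hdiv : divergence w = 0) (h0 : ∀ k, w k 0 = 0) : ip B s (leray F) w = ip B s F w := by
  rw [ip_eq_sum, ip_eq_sum]
  simp only [sum_leray_mul_conj F hdiv h0]

/-! ### The viscous form on trigonometric polynomials -/

/-- The stress `∑_{jβ} a_{kj}^{αβ} E_{jβ}(u)`. -/
def stress {n : ℕ} (A : FTensor n) (u : VDist n) (k α : Fin n) : SDist n := fun ξ =>
  ∑ j, ∑ β, mul (A k j α β) (strain u j β) ξ

theorem conj_strain {n : ℕ} (w : VDist n) (k α : Fin n) (ξ : Freq n) :
    conj (strain w k α ξ) = -(2 * (Real.pi : ℂ) * Complex.I) *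
      ((ξ k : ℂ) * conj (w α ξ) + (ξ α : ℂ) * conj (w k ξ)) / 2 := by
  simp only [strain, partialD, map_div₀, map_add, map_mul, Complex.conj_ofReal, Complex.conj_I,
    map_intCast, map_ofNat]
  ring

/-- Integration by parts at one frequency. The viscous term is symmetrised in `k` and `α`, so after
relabelling the second half the factors `ξ_α` and `ξ_k` combine to the strain of `w`. -/
theorem sum_visc_mul_conj {n : ℕ} (A : FTensor n) (u w : VDist n) (ξ : Freq n) :
    ∑ k, visc A u k ξ * conj (w k ξ) = -∑ k, ∑ α, stress A u k α ξ * conj (strain w k α ξ) := by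
  have h1 : ∀ k, visc A u k ξ * conj (w k ξ) =
      ∑ α, (2 * (Real.pi : ℂ) * Complex.I) * ((ξ α : ℂ) * conj (w k ξ)) / 2 * stress A u k α ξ +
      ∑ α, (2 * (Real.pi : ℂ) * Complex.I) * ((ξ α : ℂ) * conj (w k ξ)) / 2 * stress A u α k ξ := by
    intro k
    unfold visc
    rw [Finset.sum_mul, ← Finset.sum_add_distrib]
    refine Finset.sum_congr rfl fun α _ => ?_
    unfold partialD stress
    ring
  simp only [h1]
  rw [Finset.sum_add_distrib, Finset.sum_comm (f := fun k α =>
    (2 * (Real.pi : ℂ) * Complex.I) * ((ξ α : ℂ) * conj (w k ξ)) / 2 * stress A u α k ξ),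
    ← Finset.sum_add_distrib, ← Finset.sum_neg_distrib]
  refine Finset.sum_congr rfl fun k _ => ?_
  rw [← Finset.sum_add_distrib, ← Finset.sum_neg_distrib]
  refine Finset.sum_congr rfl fun α _ => ?_
  rw [conj_strain]
  ring

theorem mul_eq_sum {n : ℕ} {B : Finset (Freq n)} (A : SDist n) {g : SDist n}
    (hg : ∀ ξ, ξ ∉ B → g ξ = 0) (ξ : Freq n) : mul A g ξ = ∑ ζ ∈ B, A (ξ - ζ) * g ζ := by
  unfold mul
  rw [← (Equiv.subLeft ξ).tsum_eq, tsum_eq_sum (s := B)]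
  · simp
  · intro ζ hζ
    simp [hg ζ hζ]

theorem SuppIn.strain {n : ℕ} {B : Finset (Freq n)} {u : VDist n} (h : SuppIn B u) (j β : Fin n)
    (ξ : Freq n) (hξ : ξ ∉ B) : strain u j β ξ = 0 := by
  simp [PeriodicNS.strain, partialD, h _ ξ hξ]

/-- The viscous form, for fields with frequencies in `B` and values in the weighted space. -/
theorem neg_ip_visc {n : ℕ} {B : Finset (Freq n)} (s : ℝ) (A : FTensor n) {u : VDist n}
    (hu : SuppIn B u) (w : VDist n) :
    -ip B s (visc A u) w = ∑ k, ∑ j, ∑ α, ∑ β, ∑ ξ ∈ B, ∑ ζ ∈ B, rho ξ ^ (2 * s) *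
      (A k j α β (ξ - ζ) * strain u j β ζ * conj (strain w k α ξ)).re := by
  rw [ip_eq_sum]
  simp only [sum_visc_mul_conj]
  have h : ∀ ξ, rho ξ ^ (2 * s) * (-∑ k, ∑ α, stress A u k α ξ * conj (strain w k α ξ)).re =
      -∑ k, ∑ α, ∑ j, ∑ β, ∑ ζ ∈ B, rho ξ ^ (2 * s) *
        (A k j α β (ξ - ζ) * strain u j β ζ * conj (strain w k α ξ)).re := by
    intro ξ
    unfold stress
    simp only [mul_eq_sum (B := B) _ (hu.strain _ _), Finset.sum_mul, Complex.neg_re,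
      Complex.re_sum, Finset.mul_sum, mul_neg]
  simp only [h, Finset.sum_neg_distrib, neg_neg]
  rw [Finset.sum_comm]
  refine Finset.sum_congr rfl fun k _ => ?_
  rw [Finset.sum_comm, Finset.sum_comm (s := (Finset.univ : Finset (Fin n)))
    (t := (Finset.univ : Finset (Fin n)))]
  refine Finset.sum_congr rfl fun α _ => ?_
  rw [Finset.sum_comm]
  refine Finset.sum_congr rfl fun j _ => ?_
  rw [Finset.sum_comm]

/-- Coercivity of the viscous form on solenoidal trigonometric polynomials. -/
def Coercive {n : ℕ} (c : ℝ) (A : FTensor n) : Prop :=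
  ∀ (N : ℕ) (u : VDist n), SuppIn (box n N) u → Solenoidal u →
    c * rsq (box n N) 1 u ≤ -ip (box n N) 0 (visc A u) u

/-- Schur's test for a convolution kernel. -/
theorem sum_conv_le {n : ℕ} (B : Finset (Freq n)) {a x y : Freq n → ℝ} {K l : ℝ}
    (ha : ∀ ξ, 0 ≤ a ξ) (hK : ∀ F : Finset (Freq n), ∑ ξ ∈ F, a ξ ≤ K) (hl : 0 < l) :
    2 * ∑ ξ ∈ B, ∑ ζ ∈ B, a (ξ - ζ) * (x ζ * y ξ) ≤
      K * (l⁻¹ * ∑ ζ ∈ B, x ζ ^ 2 + l * ∑ ξ ∈ B, y ξ ^ 2) := by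
  have h1 : ∀ ξ ζ, 2 * (x ζ * y ξ) ≤ l⁻¹ * x ζ ^ 2 + l * y ξ ^ 2 := by
    intro ξ ζ
    have := mul_nonneg (inv_pos.2 hl).le (sq_nonneg (x ζ - l * y ξ))
    have e : l⁻¹ * (x ζ - l * y ξ) ^ 2 = l⁻¹ * x ζ ^ 2 + l * y ξ ^ 2 - 2 * (x ζ * y ξ) := by
      field_simp
      ring
    linarith
  -- Rows and columns of the kernel are sums of `a` over translates and reflections of `B`, all
  -- covered by the one bound `hK`.
  have hs1 : ∀ ζ, ∑ ξ ∈ B, a (ξ - ζ) ≤ K := by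
    intro ζ
    have := hK (B.map (Equiv.subRight ζ).toEmbedding)
    rwa [Finset.sum_map] at this
  have hs2 : ∀ ξ, ∑ ζ ∈ B, a (ξ - ζ) ≤ K := by
    intro ξ
    have := hK (B.map (Equiv.subLeft ξ).toEmbedding)
    rwa [Finset.sum_map] at this
  calc 2 * ∑ ξ ∈ B, ∑ ζ ∈ B, a (ξ - ζ) * (x ζ * y ξ)
      = ∑ ξ ∈ B, ∑ ζ ∈ B, a (ξ - ζ) * (2 * (x ζ * y ξ)) := by
        simp only [Finset.mul_sum]
        exact Finset.sum_congr rfl fun ξ _ => Finset.sum_congr rfl fun ζ _ => by ring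
    _ ≤ ∑ ξ ∈ B, ∑ ζ ∈ B, a (ξ - ζ) * (l⁻¹ * x ζ ^ 2 + l * y ξ ^ 2) := by
        gcongr with ξ _ ζ _
        · exact ha _
        · exact h1 ξ ζ
    _ = ∑ ζ ∈ B, (∑ ξ ∈ B, a (ξ - ζ)) * (l⁻¹ * x ζ ^ 2) +
        ∑ ξ ∈ B, (∑ ζ ∈ B, a (ξ - ζ)) * (l * y ξ ^ 2) := by
        simp only [mul_add, Finset.sum_add_distrib, Finset.sum_mul]
        rw [Finset.sum_comm]
    _ ≤ ∑ ζ ∈ B, K * (l⁻¹ * x ζ ^ 2) + ∑ ξ ∈ B, K * (l * y ξ ^ 2) := by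
        gcongr with ζ _ ξ _
        · exact hs1 ζ
        · exact hs2 ξ
    _ = _ := by
        simp only [← Finset.mul_sum]
        ring

theorem norm_strain_le {n : ℕ} (u : VDist n) (j β : Fin n) (ξ : Freq n) :
    ‖strain u j β ξ‖ ≤ rho ξ * (‖u β ξ‖ + ‖u j ξ‖) / 2 := by
  have h : ∀ (i : Fin n) (g : SDist n), ‖partialD i g ξ‖ ≤ rho ξ * ‖g ξ‖ := by
    intro i g
    have h1 : ‖partialD i g ξ‖ = 2 * Real.pi * |(ξ i : ℝ)| * ‖g ξ‖ := by
      unfold partialD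
      simp [abs_of_pos Real.pi_pos]
    rw [h1]
    gcongr
    exact two_pi_abs_le_rho ξ i
  unfold strain
  rw [norm_div, Complex.norm_ofNat]
  gcongr
  calc _ ≤ _ := norm_add_le _ _
    _ ≤ _ := add_le_add (h _ _) (h _ _)
    _ = _ := by ring

theorem sum_strain_sq_le {n : ℕ} (B : Finset (Freq n)) (s : ℝ) (u : VDist n) :
    ∑ j, ∑ β, ∑ ξ ∈ B, (rho ξ ^ (s - 1) * ‖strain u j β ξ‖) ^ 2 ≤ n * rsq B s u := by
  have h : ∀ j β ξ, (rho ξ ^ (s - 1) * ‖strain u j β ξ‖) ^ 2 ≤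
      (rho ξ ^ (2 * s) * ‖u β ξ‖ ^ 2 + rho ξ ^ (2 * s) * ‖u j ξ‖ ^ 2) / 2 := by
    intro j β ξ
    have hr := rho_pos ξ
    have h1 : rho ξ ^ (s - 1) * ‖strain u j β ξ‖ ≤
        rho ξ ^ s * ((‖u β ξ‖ + ‖u j ξ‖) / 2) := by
      calc _ ≤ rho ξ ^ (s - 1) * (rho ξ * (‖u β ξ‖ + ‖u j ξ‖) / 2) := by
            gcongr
            exact norm_strain_le u j β ξ
        _ = rho ξ ^ (s - 1) * rho ξ * ((‖u β ξ‖ + ‖u j ξ‖) / 2) := by ring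
        _ = _ := by rw [Real.rpow_sub_one hr.ne', div_mul_cancel₀ _ hr.ne']
    have e2 : rho ξ ^ (2 * s) = (rho ξ ^ s) ^ 2 := by
      rw [_root_.mul_comm, ← Real.rpow_mul_natCast hr.le]; norm_num
    calc _ ≤ (rho ξ ^ s * ((‖u β ξ‖ + ‖u j ξ‖) / 2)) ^ 2 := by gcongr
      _ ≤ _ := by
        rw [e2]
        have := mul_nonneg (sq_nonneg (rho ξ ^ s)) (sq_nonneg (‖u β ξ‖ - ‖u j ξ‖))
        nlinarith
  calc _ ≤ ∑ j, ∑ β, ∑ ξ ∈ B, (rho ξ ^ (2 * s) * ‖u β ξ‖ ^ 2 + rho ξ ^ (2 * s) * ‖u j ξ‖ ^ 2) / 2 := by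
        gcongr with j _ β _ ξ _
        exact h j β ξ
    _ = _ := by
        simp only [← Finset.sum_div, Finset.sum_add_distrib]
        simp only [Finset.sum_const, Finset.card_univ, Fintype.card_fin, nsmul_eq_mul,
          ← Finset.mul_sum]
        unfold rsq
        ring

theorem sum_wiener_le {n : ℕ} {m : ℝ} {K : ℝ≥0∞} {A : FTensor n} (hK : K ≠ ∞)
    (hA : WienerBound m K A) (i j α β : Fin n) (F : Finset (Freq n)) :
    ∑ ξ ∈ F, rho ξ ^ m * ‖A i j α β ξ‖ ≤ K.toReal := by
  rw [← ENNReal.ofReal_le_iff_le_toReal hK, ENNReal.ofReal_sum_of_nonneg fun ξ _ =>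
    mul_nonneg (Real.rpow_nonneg (rho_pos ξ).le _) (norm_nonneg _)]
  refine le_trans (le_of_eq ?_) ((ENNReal.sum_le_tsum F).trans (hA i j α β))
  refine Finset.sum_congr rfl fun ξ _ => ?_
  rw [ENNReal.ofReal_mul (Real.rpow_nonneg (rho_pos ξ).le _), ofReal_norm]
  rfl

/-- Gårding's inequality in `H^s`. -/
theorem garding {n : ℕ} (s : ℝ) {c : ℝ} (hc : 0 < c) {K : ℝ≥0∞} (hK : K ≠ ∞) :
    ∃ C : ℝ, 0 ≤ C ∧ ∀ A : FTensor n, Coercive c A → WienerBound (1 + |s - 1|) K A →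
      ∀ (N : ℕ) (u : VDist n), SuppIn (box n N) u → Solenoidal u →
        ip (box n N) s (visc A u) u ≤ -(c / 2) * rsq (box n N) (s + 1) u + C * rsq (box n N) s u := by
  set D : ℝ := |s| * (2 ^ |s - 1| + 1) with hD
  have hD0 : 0 ≤ D := by positivity
  set Q : ℝ := D * K.toReal * n ^ 3 with hQ
  have hQ0 : 0 ≤ Q := by positivity
  -- The choice gives `Q * l ≤ c`; the commutator costs half of `Q * l`, hence at most half of the
  -- coercivity.
  set l : ℝ := c / (Q + 1) with hl
  have hl0 : 0 < l := by positivity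
  refine ⟨Q * l⁻¹, by positivity, fun A hco hW N u hu hs => ?_⟩
  set B := box n N
  -- The weight `ϱ^s` commutes with derivatives and preserves real solenoidal fields, so coercivity
  -- in `H¹` applies to `v`. Only the product with the coefficients fails to commute with it.
  set v : VDist n := fun k ξ => (rho ξ ^ s : ℝ) * u k ξ with hv
  have hsv : ∀ j β ξ, strain v j β ξ = (rho ξ ^ s : ℝ) * strain u j β ξ := by
    intro j β ξ
    simp only [strain, partialD, hv]
    ring
  have hvsupp : SuppIn B v := fun k ξ hξ => by simp [hv, hu k ξ hξ]
  have hvs : Solenoidal v := by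
    refine ⟨fun k ξ => ?_, ?_, fun k => by simp [hv, hs.mean k]⟩
    · simp only [hv, rho_neg, map_mul, Complex.conj_ofReal, hs.real k ξ]
    · ext ξ
      have := congrFun hs.div ξ
      have e : divergence v ξ = (rho ξ ^ s : ℝ) * divergence u ξ := by
        simp only [divergence, partialD, hv, Finset.mul_sum]
        exact Finset.sum_congr rfl fun j _ => by ring
      rw [e, this]
      simp
  have hcv := hco N v hvsupp hvs
  have hr1 : rsq B 1 v = rsq B (s + 1) u := by
    unfold rsq
    refine Finset.sum_congr rfl fun k _ => Finset.sum_congr rfl fun ξ _ => ?_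
    have hr := rho_pos ξ
    rw [hv]
    simp only
    rw [norm_mul, Complex.norm_real, Real.norm_of_nonneg (by positivity), mul_pow, ← mul_assoc,
      ← Real.rpow_mul_natCast hr.le, ← Real.rpow_add hr]
    congr 2
    push_cast
    ring
  rw [hr1] at hcv
  -- The commutator: term by term the two forms differ by the factor `ϱ(ξ)^s - ϱ(ζ)^s`, which is of
  -- order `s-1` in `ζ` and loads `ϱ(ξ-ζ)^(1+|s-1|)` on the coefficient. Schur's test then sums over
  -- `ξ` and `ζ`.
  have hdiff : |(-ip B s (visc A u) u) - (-ip B 0 (visc A v) v)| ≤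
      ∑ k, ∑ j, ∑ α, ∑ β, ∑ ξ ∈ B, ∑ ζ ∈ B, D * (rho (ξ - ζ) ^ (1 + |s - 1|) *
        ‖A k j α β (ξ - ζ)‖ * (rho ζ ^ (s - 1) * ‖strain u j β ζ‖ *
          (rho ξ ^ s * ‖strain u k α ξ‖))) := by
    rw [neg_ip_visc s A hu u, neg_ip_visc 0 A hvsupp v]
    simp only [← Finset.sum_sub_distrib]
    refine (Finset.abs_sum_le_sum_abs _ _).trans (Finset.sum_le_sum fun k _ => ?_)
    refine (Finset.abs_sum_le_sum_abs _ _).trans (Finset.sum_le_sum fun j _ => ?_)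
    refine (Finset.abs_sum_le_sum_abs _ _).trans (Finset.sum_le_sum fun α _ => ?_)
    refine (Finset.abs_sum_le_sum_abs _ _).trans (Finset.sum_le_sum fun β _ => ?_)
    refine (Finset.abs_sum_le_sum_abs _ _).trans (Finset.sum_le_sum fun ξ _ => ?_)
    refine (Finset.abs_sum_le_sum_abs _ _).trans (Finset.sum_le_sum fun ζ _ => ?_)
    have hr := rho_pos ξ
    have hr' := rho_pos (ξ - ζ)
    have hr'' := rho_pos ζ
    rw [hsv, hsv]
    have e1 : rho ξ ^ (2 * s) * (A k j α β (ξ - ζ) * strain u j β ζ * conj (strain u k α ξ)).re -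
        rho ξ ^ (2 * (0 : ℝ)) * (A k j α β (ξ - ζ) * ((rho ζ ^ s : ℝ) * strain u j β ζ) *
          conj ((rho ξ ^ s : ℝ) * strain u k α ξ)).re =
        (rho ξ ^ s - rho ζ ^ s) * rho ξ ^ s *
          (A k j α β (ξ - ζ) * strain u j β ζ * conj (strain u k α ξ)).re := by
      have e2 : rho ξ ^ (2 * s) = rho ξ ^ s * rho ξ ^ s := by
        rw [← Real.rpow_add hr]; congr 1; ring
      have e3 : A k j α β (ξ - ζ) * ((rho ζ ^ s : ℝ) * strain u j β ζ) *
          conj ((rho ξ ^ s : ℝ) * strain u k α ξ) = ((rho ζ ^ s * rho ξ ^ s : ℝ) : ℂ) *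
          (A k j α β (ξ - ζ) * strain u j β ζ * conj (strain u k α ξ)) := by
        rw [map_mul, Complex.conj_ofReal]
        push_cast
        ring
      rw [e3, Complex.re_ofReal_mul, e2, mul_zero, Real.rpow_zero]
      ring
    rw [e1, abs_mul, abs_mul, abs_of_nonneg (by positivity : 0 ≤ rho ξ ^ s)]
    calc _ ≤ (D * rho (ξ - ζ) ^ (1 + |s - 1|) * rho ζ ^ (s - 1)) * rho ξ ^ s *
          (‖A k j α β (ξ - ζ)‖ * ‖strain u j β ζ‖ * ‖strain u k α ξ‖) := by
          gcongr
          · exact abs_rho_rpow_sub_le s ξ ζ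
          · refine (Complex.abs_re_le_norm _).trans (le_of_eq ?_)
            rw [norm_mul, norm_mul, RCLike.norm_conj]
      _ = _ := by ring
  have hsum : 2 * ∑ k, ∑ j, ∑ α, ∑ β, ∑ ξ ∈ B, ∑ ζ ∈ B, D * (rho (ξ - ζ) ^ (1 + |s - 1|) *
        ‖A k j α β (ξ - ζ)‖ * (rho ζ ^ (s - 1) * ‖strain u j β ζ‖ *
          (rho ξ ^ s * ‖strain u k α ξ‖))) ≤
      ∑ k : Fin n, ∑ j : Fin n, ∑ α : Fin n, ∑ β : Fin n, D * (K.toReal *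
        (l⁻¹ * ∑ ζ ∈ B, (rho ζ ^ (s - 1) * ‖strain u j β ζ‖) ^ 2 +
          l * ∑ ξ ∈ B, (rho ξ ^ s * ‖strain u k α ξ‖) ^ 2)) := by
    simp only [Finset.mul_sum (s := (Finset.univ : Finset (Fin n))) (a := (2 : ℝ))]
    refine Finset.sum_le_sum fun k _ => Finset.sum_le_sum fun j _ => Finset.sum_le_sum fun α _ =>
      Finset.sum_le_sum fun β _ => ?_
    have := sum_conv_le B (a := fun ξ => rho ξ ^ (1 + |s - 1|) * ‖A k j α β ξ‖)
      (x := fun ζ => rho ζ ^ (s - 1) * ‖strain u j β ζ‖) (y := fun ξ => rho ξ ^ s * ‖strain u k α ξ‖)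
      (fun ξ => mul_nonneg (Real.rpow_nonneg (rho_pos ξ).le _) (norm_nonneg _))
      (sum_wiener_le hK hW k j α β) hl0
    simp only [← Finset.mul_sum] at this ⊢
    rw [mul_left_comm]
    gcongr
  have hfin : ∑ k : Fin n, ∑ j : Fin n, ∑ α : Fin n, ∑ β : Fin n, D * (K.toReal *
        (l⁻¹ * ∑ ζ ∈ B, (rho ζ ^ (s - 1) * ‖strain u j β ζ‖) ^ 2 +
          l * ∑ ξ ∈ B, (rho ξ ^ s * ‖strain u k α ξ‖) ^ 2)) ≤
      Q * (l⁻¹ * rsq B s u + l * rsq B (s + 1) u) := by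
    have h1 := sum_strain_sq_le B s u
    have h2 := sum_strain_sq_le B (s + 1) u
    rw [add_sub_cancel_right] at h2
    calc _ = D * K.toReal * (l⁻¹ * (n ^ 2 * ∑ j, ∑ β, ∑ ζ ∈ B, (rho ζ ^ (s - 1) * ‖strain u j β ζ‖) ^ 2) +
        l * (n ^ 2 * ∑ k, ∑ α, ∑ ξ ∈ B, (rho ξ ^ s * ‖strain u k α ξ‖) ^ 2)) := by
          simp only [← Finset.mul_sum (s := (Finset.univ : Finset (Fin n))),
            Finset.sum_add_distrib, Finset.sum_const, Finset.card_univ, Fintype.card_fin,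
            nsmul_eq_mul]
          ring
      _ ≤ D * K.toReal * (l⁻¹ * (n ^ 2 * (n * rsq B s u)) + l * (n ^ 2 * (n * rsq B (s + 1) u))) := by
          gcongr
      _ = _ := by rw [hQ]; ring
  have hQl : Q * l ≤ c := by
    rw [hl, ← mul_div_assoc, div_le_iff₀ (by positivity)]
    nlinarith
  have h5 : Q * (l * rsq B (s + 1) u) ≤ c * rsq B (s + 1) u := by
    rw [← mul_assoc]
    exact mul_le_mul_of_nonneg_right hQl (rsq_nonneg _ _ _)
  have h6 := abs_le.1 hdiff
  have h7 : 0 ≤ Q * l⁻¹ * rsq B s u := mul_nonneg (by positivity) (rsq_nonneg _ _ _)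
  nlinarith [h6.1, h6.2]

/-! ### Coercivity from the relaxed ellipticity condition -/

instance {n : ℕ} : IsProbabilityMeasure (torusMeasure n) := by
  unfold torusMeasure; infer_instance

theorem ofFun_apply {n : ℕ} (g : UnitAddTorus (Fin n) → ℝ) (ξ : Freq n) :
    ofFun g ξ = ∫ x, UnitAddTorus.mFourier (-ξ) x * (g x : ℂ) ∂(torusMeasure n) := rfl

theorem isRealDist_ofFun {n : ℕ} (g : UnitAddTorus (Fin n) → ℝ) : IsRealDist (ofFun g) := by
  intro ξ
  rw [ofFun_apply, ofFun_apply, ← integral_conj]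
  congr 1 with x
  rw [map_mul, ← UnitAddTorus.mFourier_neg, Complex.conj_ofReal]

/-- Orthonormality of the characters. With it Parseval's identity becomes the case `b = 1` of
`integral_mul_trig`. -/
theorem ofFun_one {n : ℕ} (ξ : Freq n) : ofFun (fun _ => (1 : ℝ)) ξ = if ξ = 0 then 1 else 0 := by
  have h := (orthonormal_iff_ite.1 (UnitAddTorus.orthonormal_mFourier (d := Fin n))) ξ 0
  rw [ContinuousMap.inner_toLp] at h
  rw [ofFun_apply]
  simp only [← UnitAddTorus.mFourier_neg, ← UnitAddTorus.mFourier_add, zero_add] at h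
  simp only [Complex.ofReal_one, mul_one]
  exact h

/-- The trigonometric polynomial with given coefficients. -/
def trig {n : ℕ} (B : Finset (Freq n)) (g : SDist n) (x : UnitAddTorus (Fin n)) : ℂ :=
  ∑ ξ ∈ B, g ξ * UnitAddTorus.mFourier ξ x

/-- The cubes are symmetric under `ξ ↦ -ξ`, so truncation to a cube keeps real functions real. -/
theorem conj_trig {n N : ℕ} {g : SDist n} (hg : IsRealDist g) (x : UnitAddTorus (Fin n)) :
    conj (trig (box n N) g x) = trig (box n N) g x := by
  unfold trig
  rw [map_sum]
  refine Finset.sum_nbij' (fun ξ => -ξ) (fun ξ => -ξ) (fun ξ h => neg_mem_box.2 h)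
    (fun ξ h => neg_mem_box.2 h) (fun _ _ => neg_neg _) (fun _ _ => neg_neg _) fun ξ _ => ?_
  rw [map_mul, ← UnitAddTorus.mFourier_neg, hg]

theorem integrable_mul_mFourier {n : ℕ} {b : UnitAddTorus (Fin n) → ℝ}
    (hb : Integrable b (torusMeasure n)) (ξ : Freq n) :
    Integrable (fun x => UnitAddTorus.mFourier ξ x * (b x : ℂ)) (torusMeasure n) := by
  refine hb.ofReal.bdd_mul (c := 1) (UnitAddTorus.mFourier ξ).continuous.aestronglyMeasurable
    (ae_of_all _ fun x => ?_)
  exact ((UnitAddTorus.mFourier ξ).norm_coe_le_norm x).trans UnitAddTorus.mFourier_norm.le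

theorem mul_trig_mul_conj_trig {n : ℕ} (B : Finset (Freq n)) (b : UnitAddTorus (Fin n) → ℝ)
    (g h : SDist n) (x : UnitAddTorus (Fin n)) :
    (b x : ℂ) * trig B g x * conj (trig B h x) = ∑ ξ ∈ B, ∑ ζ ∈ B,
      (g ζ * conj (h ξ)) * (UnitAddTorus.mFourier (-(ξ - ζ)) x * (b x : ℂ)) := by
  unfold trig
  rw [map_sum, mul_assoc, Finset.sum_mul_sum, Finset.sum_comm, Finset.mul_sum]
  refine Finset.sum_congr rfl fun ξ _ => ?_
  rw [Finset.mul_sum]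
  refine Finset.sum_congr rfl fun ζ _ => ?_
  rw [map_mul, ← UnitAddTorus.mFourier_neg, show -(ξ - ζ) = ζ + -ξ by abel,
    UnitAddTorus.mFourier_add]
  ring

theorem integrable_mul_trig {n : ℕ} (B : Finset (Freq n)) {b : UnitAddTorus (Fin n) → ℝ}
    (hb : Integrable b (torusMeasure n)) (g h : SDist n) :
    Integrable (fun x => (b x : ℂ) * trig B g x * conj (trig B h x)) (torusMeasure n) := by
  simp only [mul_trig_mul_conj_trig]
  exact integrable_finsetSum _ fun ξ _ => integrable_finsetSum _ fun ζ _ =>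
    (integrable_mul_mFourier hb _).const_mul _

theorem integral_mul_trig {n : ℕ} (B : Finset (Freq n)) {b : UnitAddTorus (Fin n) → ℝ}
    (hb : Integrable b (torusMeasure n)) (g h : SDist n) :
    ∫ x, (b x : ℂ) * trig B g x * conj (trig B h x) ∂(torusMeasure n) =
      ∑ ξ ∈ B, ∑ ζ ∈ B, ofFun b (ξ - ζ) * g ζ * conj (h ξ) := by
  simp only [mul_trig_mul_conj_trig]
  rw [integral_finsetSum _ fun ξ _ => integrable_finsetSum _ fun ζ _ =>
    (integrable_mul_mFourier hb _).const_mul _]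
  refine Finset.sum_congr rfl fun ξ _ => ?_
  rw [integral_finsetSum _ fun ζ _ => (integrable_mul_mFourier hb _).const_mul _]
  refine Finset.sum_congr rfl fun ζ _ => ?_
  rw [integral_const_mul, ofFun_apply]
  ring

/-- Korn's identity: the mixed terms of `|E(u)|²` add up to a multiple of `|ξ·û(ξ)|²`, which
vanishes for solenoidal fields, and what remains is half of the squared gradient. -/
theorem sum_norm_strain_sq {n : ℕ} {u : VDist n} (hu : Solenoidal u) (ξ : Freq n) :
    ∑ k, ∑ α, ‖strain u k α ξ‖ ^ 2 = 2 * Real.pi ^ 2 * freqSq ξ * ∑ k, ‖u k ξ‖ ^ 2 := by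
  have hs := Solenoidal.sum_mul_eq_zero hu.div ξ
  have hre : ∀ k α, ‖strain u k α ξ‖ ^ 2 = Real.pi ^ 2 * ((ξ k : ℝ) ^ 2 * ‖u α ξ‖ ^ 2 +
      (ξ α : ℝ) ^ 2 * ‖u k ξ‖ ^ 2 + 2 * ((ξ k * conj (u k ξ)) * (ξ α * u α ξ)).re) := by
    intro k α
    have e : strain u k α ξ = (Real.pi : ℂ) * Complex.I * (ξ k * u α ξ + ξ α * u k ξ) := by
      simp only [strain, partialD]
      ring
    rw [e, norm_mul, norm_mul, Complex.norm_I, Complex.norm_real, mul_one, mul_pow,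
      Real.norm_eq_abs, sq_abs]
    congr 1
    rw [← Complex.normSq_eq_norm_sq, Complex.normSq_add, Complex.normSq_mul, Complex.normSq_mul,
      Complex.normSq_eq_norm_sq, Complex.normSq_eq_norm_sq, Complex.normSq_eq_norm_sq,
      Complex.normSq_eq_norm_sq, Complex.norm_intCast, Complex.norm_intCast, sq_abs, sq_abs]
    congr 3
    rw [map_mul, map_intCast]
    ring
  have hz : ∑ k, ∑ α, ((ξ k * conj (u k ξ)) * (ξ α * u α ξ)).re = 0 := by
    simp only [← Complex.re_sum, ← Finset.mul_sum, hs]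
    simp
  simp only [hre, ← Finset.mul_sum, Finset.sum_add_distrib, hz]
  simp only [← Finset.sum_mul, ← Finset.mul_sum, freqSq]
  ring

theorem trig_real {n N : ℕ} {g : SDist n} (hg : IsRealDist g) (x : UnitAddTorus (Fin n)) :
    ((trig (box n N) g x).re : ℂ) = trig (box n N) g x :=
  Complex.conj_eq_iff_re.1 (conj_trig hg x)

/-- At a point `x` the ellipticity condition is applied to `ζ = E(u)(x)`, which is symmetric and has
trace `div u = 0`. Integration and Parseval's identity give `∑ ‖E(u)‖²`, and Korn's identity
finishes. In the constant, `1/CA` is the ellipticity and `1/4` comes from `ϱ² ≤ 2 (2π|ξ|)² = 4 *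
(2π²|ξ|²)` for `ξ ≠ 0`. -/
theorem coercive_of_elliptic {n : ℕ} {CA : ℝ} (hCA : 0 < CA)
    {b : Fin n → Fin n → Fin n → Fin n → UnitAddTorus (Fin n) → ℝ}
    (hb : ∀ k j α β, Integrable (b k j α β) (torusMeasure n))
    (hell : ∀ᵐ x ∂(torusMeasure n), ∀ ζ : Matrix (Fin n) (Fin n) ℝ,
      ζ.transpose = ζ → ζ.trace = 0 →
      ∑ k, ∑ α, ζ k α ^ 2 ≤ CA * ∑ k, ∑ j, ∑ α, ∑ β, b k j α β x * ζ k α * ζ j β) :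
    Coercive (1 / (4 * CA)) (fun k j α β => ofFun (b k j α β)) := by
  intro N u hu hs
  set B := box n N
  set G : Fin n → Fin n → UnitAddTorus (Fin n) → ℂ := fun k α => trig B (strain u k α) with hG
  have hreal : ∀ k α x, conj (G k α x) = G k α x := fun k α x =>
    conj_trig (isRealDist_strain hs.real k α) x
  have hre : ∀ k α x, ((G k α x).re : ℂ) = G k α x := fun k α x =>
    trig_real (isRealDist_strain hs.real k α) x
  have hI : ∀ k j α β, Integrable (fun x => b k j α β x * (G k α x).re * (G j β x).re)
      (torusMeasure n) ∧
      ∫ x, b k j α β x * (G k α x).re * (G j β x).re ∂(torusMeasure n) =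
        ∑ ξ ∈ B, ∑ ζ ∈ B, (ofFun (b k j α β) (ξ - ζ) * strain u j β ζ *
          conj (strain u k α ξ)).re := by
    intro k j α β
    have e : ∀ x, ((b k j α β x * (G k α x).re * (G j β x).re : ℝ) : ℂ) =
        (b k j α β x : ℂ) * G j β x * conj (G k α x) := by
      intro x
      push_cast
      rw [hre, hre, hreal]
      ring
    have h1 := integrable_mul_trig B (hb k j α β) (strain u j β) (strain u k α)
    have h2 := integral_mul_trig B (hb k j α β) (strain u j β) (strain u k α)
    have h1' : Integrable (fun x => ((b k j α β x * (G k α x).re * (G j β x).re : ℝ) : ℂ))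
        (torusMeasure n) := by
      simp only [e]
      exact h1
    refine ⟨by simpa only [RCLike.re_to_complex, Complex.ofReal_re] using h1'.re, ?_⟩
    have h3 := congrArg Complex.re h2
    rw [Complex.re_sum] at h3
    simp only [Complex.re_sum] at h3
    rw [← h3]
    have h4 : ∫ x, (b k j α β x : ℂ) * trig B (strain u j β) x * conj (trig B (strain u k α) x)
        ∂(torusMeasure n) = ∫ x, ((b k j α β x * (G k α x).re * (G j β x).re : ℝ) : ℂ)
        ∂(torusMeasure n) := by
      congr 1 with x
      rw [e]
    rw [h4, integral_complex_ofReal, Complex.ofReal_re]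
  have hP : ∀ k α, Integrable (fun x => (G k α x).re ^ 2) (torusMeasure n) ∧
      ∫ x, (G k α x).re ^ 2 ∂(torusMeasure n) = ∑ ξ ∈ B, ‖strain u k α ξ‖ ^ 2 := by
    intro k α
    have hone : Integrable (fun _ : UnitAddTorus (Fin n) => (1 : ℝ)) (torusMeasure n) :=
      integrable_const _
    have e : ∀ x, (((G k α x).re ^ 2 : ℝ) : ℂ) =
        ((1 : ℝ) : ℂ) * G k α x * conj (G k α x) := by
      intro x
      push_cast
      rw [hre, hreal]
      ring
    have h1 := integrable_mul_trig B hone (strain u k α) (strain u k α)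
    have h2 := integral_mul_trig B hone (strain u k α) (strain u k α)
    have h1' : Integrable (fun x => (((G k α x).re ^ 2 : ℝ) : ℂ)) (torusMeasure n) := by
      simp only [e]
      exact h1
    refine ⟨by simpa only [RCLike.re_to_complex, Complex.ofReal_re] using h1'.re, ?_⟩
    have h4 : ∫ x, ((1 : ℝ) : ℂ) * trig B (strain u k α) x * conj (trig B (strain u k α) x)
        ∂(torusMeasure n) = ∫ x, (((G k α x).re ^ 2 : ℝ) : ℂ) ∂(torusMeasure n) := by
      congr 1 with x
      rw [e]
    rw [h4, integral_complex_ofReal] at h2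
    have h5 : ∑ ξ ∈ B, ∑ ζ ∈ B, ofFun (fun _ : UnitAddTorus (Fin n) => (1 : ℝ)) (ξ - ζ) *
        strain u k α ζ * conj (strain u k α ξ) = ((∑ ξ ∈ B, ‖strain u k α ξ‖ ^ 2 : ℝ) : ℂ) := by
      push_cast
      refine Finset.sum_congr rfl fun ξ hξ => ?_
      simp only [ofFun_one, sub_eq_zero]
      rw [Finset.sum_eq_single ξ]
      · rw [if_pos rfl, one_mul, Complex.mul_conj, Complex.normSq_eq_norm_sq]
        push_cast
        rfl
      · intro ζ _ hne
        rw [if_neg (Ne.symm hne)]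
        simp
      · exact fun h => absurd hξ h
    rw [h5] at h2
    exact_mod_cast h2
  have hpt : ∀ᵐ x ∂(torusMeasure n), ∑ k, ∑ α, (G k α x).re ^ 2 ≤
      CA * ∑ k, ∑ j, ∑ α, ∑ β, b k j α β x * (G k α x).re * (G j β x).re := by
    filter_upwards [hell] with x hx
    refine hx (Matrix.of fun k α => (G k α x).re) ?_ ?_
    · ext k α
      simp only [Matrix.transpose_apply, Matrix.of_apply, hG, trig]
      congr 1
      refine Finset.sum_congr rfl fun ξ _ => ?_
      simp only [strain, add_comm]
    · simp only [Matrix.trace, Matrix.diag_apply, Matrix.of_apply, hG, trig]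
      rw [← Complex.re_sum, Finset.sum_comm]
      have : ∀ ξ, ∑ k, strain u k k ξ * UnitAddTorus.mFourier ξ x = 0 := by
        intro ξ
        have h := congrFun hs.div ξ
        rw [← Finset.sum_mul]
        have e : ∑ k, strain u k k ξ = divergence u ξ :=
          Finset.sum_congr rfl fun k _ => by simp [strain]
        rw [e, h]
        simp
      simp only [this, Finset.sum_const_zero, Complex.zero_re]
  have hint := integral_mono_ae (integrable_finsetSum _ fun k _ => integrable_finsetSum _ fun α _ =>
    (hP k α).1) ((integrable_finsetSum _ fun k _ => integrable_finsetSum _ fun j _ =>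
    integrable_finsetSum _ fun α _ => integrable_finsetSum _ fun β _ =>
    (hI k j α β).1).const_mul CA) hpt
  have hL : ∫ x, ∑ k, ∑ α, (G k α x).re ^ 2 ∂(torusMeasure n) =
      ∑ k, ∑ α, ∑ ξ ∈ B, ‖strain u k α ξ‖ ^ 2 := by
    rw [integral_finsetSum _ fun k _ => integrable_finsetSum _ fun α _ => (hP k α).1]
    refine Finset.sum_congr rfl fun k _ => ?_
    rw [integral_finsetSum _ fun α _ => (hP k α).1]
    exact Finset.sum_congr rfl fun α _ => (hP k α).2
  have hR : ∫ x, ∑ k, ∑ j, ∑ α, ∑ β, b k j α β x * (G k α x).re * (G j β x).re ∂(torusMeasure n) =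
      -ip B 0 (visc (fun k j α β => ofFun (b k j α β)) u) u := by
    rw [neg_ip_visc 0 _ hu u]
    rw [integral_finsetSum _ fun k _ => integrable_finsetSum _ fun j _ =>
      integrable_finsetSum _ fun α _ => integrable_finsetSum _ fun β _ => (hI k j α β).1]
    refine Finset.sum_congr rfl fun k _ => ?_
    rw [integral_finsetSum _ fun j _ =>
      integrable_finsetSum _ fun α _ => integrable_finsetSum _ fun β _ => (hI k j α β).1]
    refine Finset.sum_congr rfl fun j _ => ?_
    rw [integral_finsetSum _ fun α _ => integrable_finsetSum _ fun β _ => (hI k j α β).1]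
    refine Finset.sum_congr rfl fun α _ => ?_
    rw [integral_finsetSum _ fun β _ => (hI k j α β).1]
    refine Finset.sum_congr rfl fun β _ => ?_
    rw [(hI k j α β).2]
    simp
  rw [integral_const_mul, hL, hR] at hint
  have hlow : rsq B 1 u ≤ 4 * ∑ k, ∑ α, ∑ ξ ∈ B, ‖strain u k α ξ‖ ^ 2 := by
    have e : ∑ k, ∑ α, ∑ ξ ∈ B, ‖strain u k α ξ‖ ^ 2 = ∑ ξ ∈ B, ∑ k, ∑ α, ‖strain u k α ξ‖ ^ 2 := by
      rw [Finset.sum_comm (s := B)]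
      exact Finset.sum_congr rfl fun k _ => Finset.sum_comm
    rw [e, Finset.mul_sum]
    unfold rsq
    rw [Finset.sum_comm]
    refine Finset.sum_le_sum fun ξ _ => ?_
    rw [sum_norm_strain_sq hs, ← Finset.mul_sum, ← mul_assoc]
    by_cases h : ξ = 0
    · simp [h, hs.mean]
    · gcongr
      have := rho_sq_le h
      rw [mul_one, Real.rpow_two]
      linarith
  rw [div_mul_eq_mul_div, one_mul, div_le_iff₀ (by positivity)]
  linarith

/-! ### The viscous form on `H¹` -/

theorem summable_mul_conj {n : ℕ} {s : ℝ} {g h : SDist n} (hg : sq (-s) g < ∞) (hh : sq s h < ∞) :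
    Summable fun ξ => g ξ * conj (h ξ) := by
  apply summable_of_tsum_enorm
  have h1 := tsum_mul_sq_le (fun ξ => wt (-s) ξ * ‖g ξ‖ₑ) (fun ξ => wt s ξ * ‖h ξ‖ₑ)
  have e : ∀ ξ, wt (-s) ξ * ‖g ξ‖ₑ * (wt s ξ * ‖h ξ‖ₑ) = ‖g ξ * conj (h ξ)‖ₑ := by
    intro ξ
    have : wt (-s) ξ * wt s ξ = 1 := by rw [← wt_add, neg_add_cancel, wt_zero]
    rw [enorm_mul, RCLike.enorm_conj]
    calc _ = (wt (-s) ξ * wt s ξ) * (‖g ξ‖ₑ * ‖h ξ‖ₑ) := by ring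
      _ = _ := by rw [this, one_mul]
  simp only [e, mul_pow, ← wt_two_mul] at h1
  intro h0
  rw [h0] at h1
  have h2 := h1.trans_lt (ENNReal.mul_lt_top hg hh)
  simp at h2

theorem pairing_eq {n : ℕ} {g h : SDist n} (hh : IsRealDist h) :
    pairing g h = ∑' ξ, g ξ * conj (h ξ) := by
  unfold pairing
  simp only [hh _]

theorem pairingV_eq {n : ℕ} {s : ℝ} {F w : VDist n} (hF : vsq (-s) F < ∞) (hw : vsq s w < ∞)
    (hr : ∀ k, IsRealDist (w k)) : pairingV F w = ∑' ξ, ∑ k, F k ξ * conj (w k ξ) := by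
  rw [vsq_lt_top] at hF hw
  rw [Summable.tsum_finsetSum fun k _ => summable_mul_conj (hF k) (hw k)]
  exact Finset.sum_congr rfl fun k _ => pairing_eq (hr k)

theorem pairingV_leray {n : ℕ} {s : ℝ} {F w : VDist n} (hF : vsq (-s) F < ∞) (hw : vsq s w < ∞)
    (hs : Solenoidal w) : pairingV (leray F) w = pairingV F w := by
  obtain ⟨C, hC, H⟩ := vsq_leray_le (n := n)
  rw [pairingV_eq ((H (-s) F).trans_lt (by finiteness)) hw hs.real, pairingV_eq hF hw hs.real]
  simp only [sum_leray_mul_conj F hs.div hs.mean]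

theorem sq_zero_strain_lt {n : ℕ} {u : VDist n} (h : vsq 1 u < ∞) (j β : Fin n) :
    sq 0 (strain u j β) < ∞ := by
  have := sq_strain_le 1 u j β
  rw [sub_self] at this
  exact this.trans_lt (by finiteness)

theorem WienerBound.sq_mul_lt {n : ℕ} {s : ℝ} {K : ℝ≥0∞} {A : FTensor n} (hA : WienerBound |s| K A)
    (hK : K ≠ ∞) (i j α β : Fin n) {g : SDist n} (hg : sq s g < ∞) :
    sq s (mul (A i j α β) g) < ∞ := by
  refine (sq_mul_wiener s _ _).trans_lt ?_
  have := (hA i j α β).trans_lt hK.lt_top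
  finiteness

/-- The integration by parts of `sum_visc_mul_conj`, summed over all frequencies. The Wiener bound
keeps the stress in `L₂`, so every series converges absolutely and finite sums may be exchanged with
it. -/
theorem viscForm_eq {n : ℕ} {K : ℝ≥0∞} (hK : K ≠ ∞) {a : Tensor n} {t : ℝ}
    (hA : WienerBound 0 K fun i j α β => ofFun (a i j α β t)) {u w : VDist n} (hu : vsq 1 u < ∞)
    (hw : vsq 1 w < ∞) (hr : ∀ k, IsRealDist (w k)) :
    viscForm a t u w = -pairingV (visc (fun i j α β => ofFun (a i j α β t)) u) w := by
  set A : FTensor n := fun i j α β => ofFun (a i j α β t)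
  have hA' : WienerBound |0| K A := by rwa [abs_zero]
  obtain ⟨C, hC, H⟩ := vsq_visc_le (n := n) 0
  have hv : vsq (-1) (visc A u) < ∞ := by
    have := H A K u hA'
    rw [zero_sub, zero_add] at this
    exact this.trans_lt (by finiteness)
  rw [pairingV_eq hv hw hr, ← tsum_neg]
  simp only [sum_visc_mul_conj, neg_neg]
  have hsum : ∀ i j α β, Summable fun ξ =>
      mul (A i j α β) (strain u j β) ξ * conj (strain w i α ξ) := fun i j α β =>
    summable_mul_conj (s := 0) (by
      rw [neg_zero]; exact hA'.sq_mul_lt hK i j α β (sq_zero_strain_lt hu j β))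
      (sq_zero_strain_lt hw i α)
  have e : ∀ ξ, ∑ k, ∑ α, stress A u k α ξ * conj (strain w k α ξ) =
      ∑ i, ∑ j, ∑ α, ∑ β, mul (A i j α β) (strain u j β) ξ * conj (strain w i α ξ) := by
    intro ξ
    refine Finset.sum_congr rfl fun i _ => ?_
    rw [Finset.sum_comm]
    refine Finset.sum_congr rfl fun α _ => ?_
    unfold stress
    rw [Finset.sum_mul]
    refine Finset.sum_congr rfl fun j _ => ?_
    rw [Finset.sum_mul]
  simp only [e]
  rw [Summable.tsum_finsetSum fun i _ => summable_sum fun j _ => summable_sum fun α _ =>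
    summable_sum fun β _ => hsum i j α β]
  refine Finset.sum_congr rfl fun i _ => ?_
  rw [Summable.tsum_finsetSum fun j _ => summable_sum fun α _ =>
    summable_sum fun β _ => hsum i j α β]
  refine Finset.sum_congr rfl fun j _ => ?_
  rw [Summable.tsum_finsetSum fun α _ => summable_sum fun β _ => hsum i j α β]
  refine Finset.sum_congr rfl fun α _ => ?_
  rw [Summable.tsum_finsetSum fun β _ => hsum i j α β]
  exact Finset.sum_congr rfl fun β _ => pairing_eq (isRealDist_strain hr i α)

/-! ### Absolutely continuous functions of time -/

/-- `y` is the primitive of the integrable function `g` on `[0,T]`. -/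
structure IsPrim {E : Type*} [NormedAddCommGroup E] [NormedSpace ℝ E] (T : ℝ) (y g : ℝ → E) :
    Prop where
  int : Integrable g (timeMeasure T)
  eq : ∀ t ∈ Icc 0 T, y t = y 0 + ∫ s in 0..t, g s

theorem intervalIntegrable_of_timeMeasure {E : Type*} [NormedAddCommGroup E] {T t : ℝ} {g : ℝ → E}
    (h : Integrable g (timeMeasure T)) (ht : t ∈ Icc 0 T) : IntervalIntegrable g volume 0 t :=
  (intervalIntegrable_iff_integrableOn_Ioo_of_le ht.1).2
    (IntegrableOn.mono_set (t := Ioo 0 T) h (Ioo_subset_Ioo_right ht.2))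

theorem ae_timeMeasure_iff {T : ℝ} {p : ℝ → Prop} :
    (∀ᵐ t ∂(timeMeasure T), p t) ↔ ∀ᵐ t, t ∈ Ioo 0 T → p t :=
  ae_restrict_iff' measurableSet_Ioo

theorem ae_restrict_Ioc_of_timeMeasure {T t : ℝ} {p : ℝ → Prop} (h : ∀ᵐ s ∂(timeMeasure T), p s)
    (ht : t ∈ Icc 0 T) : ∀ᵐ s ∂(volume.restrict (Ioc 0 t)), p s := by
  rw [← Measure.restrict_congr_set Ioo_ae_eq_Ioc]
  exact ae_mono (Measure.restrict_mono (Ioo_subset_Ioo_right ht.2) le_rfl) h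

theorem intervalIntegral_eq_Ioo {E : Type*} [NormedAddCommGroup E] [NormedSpace ℝ E] {t : ℝ}
    (ht : 0 ≤ t) (g : ℝ → E) : ∫ s in 0..t, g s = ∫ s in Ioo 0 t, g s := by
  rw [intervalIntegral.integral_of_le ht, integral_Ioc_eq_integral_Ioo]

theorem intervalIntegral_congr_time {E : Type*} [NormedAddCommGroup E] [NormedSpace ℝ E] {T t : ℝ}
    {g h : ℝ → E} (H : ∀ᵐ s ∂(timeMeasure T), g s = h s) (ht : t ∈ Icc 0 T) :
    ∫ s in 0..t, g s = ∫ s in 0..t, h s := by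
  rw [intervalIntegral.integral_of_le ht.1, intervalIntegral.integral_of_le ht.1]
  exact integral_congr_ae (ae_restrict_Ioc_of_timeMeasure H ht)

theorem intervalIntegral_mono_time {T t : ℝ} {g h : ℝ → ℝ} (hg : Integrable g (timeMeasure T))
    (hh : Integrable h (timeMeasure T)) (H : ∀ᵐ s ∂(timeMeasure T), g s ≤ h s) (ht : t ∈ Icc 0 T) :
    ∫ s in 0..t, g s ≤ ∫ s in 0..t, h s := by
  have h1 := intervalIntegrable_of_timeMeasure hg ht
  have h2 := intervalIntegrable_of_timeMeasure hh ht
  rw [intervalIntegral.integral_of_le ht.1, intervalIntegral.integral_of_le ht.1]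
  exact integral_mono_ae h1.1 h2.1 (ae_restrict_Ioc_of_timeMeasure H ht)

theorem intervalIntegral_le_total {T t : ℝ} {h : ℝ → ℝ} (hh : Integrable h (timeMeasure T))
    (H : ∀ᵐ s ∂(timeMeasure T), 0 ≤ h s) (ht : t ∈ Icc 0 T) :
    ∫ s in 0..t, h s ≤ ∫ s in Ioo 0 T, h s := by
  rw [intervalIntegral_eq_Ioo ht.1]
  exact setIntegral_mono_set hh H (Ioo_subset_Ioo_right ht.2).eventuallyLE

theorem intervalIntegral_nonneg_time {T t : ℝ} {h : ℝ → ℝ}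
    (H : ∀ᵐ s ∂(timeMeasure T), 0 ≤ h s) (ht : t ∈ Icc 0 T) : 0 ≤ ∫ s in 0..t, h s := by
  rw [intervalIntegral.integral_of_le ht.1]
  exact integral_nonneg_of_ae (ae_restrict_Ioc_of_timeMeasure H ht)

theorem IsPrim.continuousOn {E : Type*} [NormedAddCommGroup E] [NormedSpace ℝ E] {T : ℝ}
    {y g : ℝ → E} (h : IsPrim T y g) : ContinuousOn y (Icc 0 T) := by
  rcases lt_or_ge T 0 with hT | hT
  · rw [Icc_eq_empty (not_le.2 hT)]
    exact continuousOn_empty _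
  have hi := intervalIntegrable_of_timeMeasure h.int (right_mem_Icc.2 hT)
  have := intervalIntegral.continuousOn_primitive_interval' hi left_mem_uIcc
  rw [uIcc_of_le hT] at this
  exact (continuousOn_const.add this).congr h.eq

theorem IsPrim.mono {E : Type*} [NormedAddCommGroup E] [NormedSpace ℝ E] {T S : ℝ}
    {y g : ℝ → E} (h : IsPrim T y g) (hS : S ≤ T) : IsPrim S y g :=
  ⟨IntegrableOn.mono_set (t := Ioo 0 T) h.int (Ioo_subset_Ioo_right hS), fun t ht =>
    h.eq t (Icc_subset_Icc_right hS ht)⟩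

theorem IsPrim.congr {E : Type*} [NormedAddCommGroup E] [NormedSpace ℝ E] {T : ℝ}
    {y g g' : ℝ → E} (h : IsPrim T y g) (hg : ∀ᵐ t ∂(timeMeasure T), g t = g' t) : IsPrim T y g' :=
  ⟨h.int.congr hg, fun t ht => by rw [h.eq t ht, intervalIntegral_congr_time hg ht]⟩

theorem IsPrim.add {E : Type*} [NormedAddCommGroup E] [NormedSpace ℝ E] {T : ℝ}
    {y g y' g' : ℝ → E} (h : IsPrim T y g) (h' : IsPrim T y' g') :
    IsPrim T (fun t => y t + y' t) (fun t => g t + g' t) :=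
  ⟨h.int.add h'.int, fun t ht => by
    rw [h.eq t ht, h'.eq t ht, intervalIntegral.integral_add
      (intervalIntegrable_of_timeMeasure h.int ht) (intervalIntegrable_of_timeMeasure h'.int ht)]
    abel⟩

theorem IsPrim.sub {E : Type*} [NormedAddCommGroup E] [NormedSpace ℝ E] {T : ℝ}
    {y g y' g' : ℝ → E} (h : IsPrim T y g) (h' : IsPrim T y' g') :
    IsPrim T (fun t => y t - y' t) (fun t => g t - g' t) :=
  ⟨h.int.sub h'.int, fun t ht => by
    rw [h.eq t ht, h'.eq t ht, intervalIntegral.integral_sub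
      (intervalIntegrable_of_timeMeasure h.int ht) (intervalIntegrable_of_timeMeasure h'.int ht)]
    abel⟩

theorem IsPrim.const_mul {T : ℝ} {y g : ℝ → ℝ} (h : IsPrim T y g) (c : ℝ) :
    IsPrim T (fun t => c * y t) (fun t => c * g t) :=
  ⟨h.int.const_mul c, fun t ht => by
    rw [h.eq t ht, intervalIntegral.integral_const_mul]
    ring⟩

theorem IsPrim.sum {E : Type*} [NormedAddCommGroup E] [NormedSpace ℝ E] {ι : Type*} {S : Finset ι}
    {T : ℝ} {y g : ι → ℝ → E} (h : ∀ i ∈ S, IsPrim T (y i) (g i)) :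
    IsPrim T (fun t => ∑ i ∈ S, y i t) (fun t => ∑ i ∈ S, g i t) :=
  ⟨integrable_finsetSum _ fun i hi => (h i hi).int, fun t ht => by
    rw [intervalIntegral.integral_finsetSum fun i hi =>
      intervalIntegrable_of_timeMeasure (h i hi).int ht, ← Finset.sum_add_distrib]
    exact Finset.sum_congr rfl fun i hi => (h i hi).eq t ht⟩

/-- The absolutely continuous extension of a primitive. -/
theorem IsPrim.ac {T : ℝ} {y g : ℝ → ℝ} (h : IsPrim T y g) {t : ℝ} (ht : t ∈ Icc 0 T) :
    AbsolutelyContinuousOnInterval (fun x => y 0 + ∫ s in 0..x, g s) 0 t ∧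
      ∀ᵐ x, x ∈ uIcc 0 t → HasDerivAt (fun x => y 0 + ∫ s in 0..x, g s) (g x) x := by
  have hi := intervalIntegrable_of_timeMeasure h.int ht
  constructor
  · have h1 := hi.absolutelyContinuousOnInterval_intervalIntegral (c := 0) left_mem_uIcc
    have h2 : AbsolutelyContinuousOnInterval (fun _ : ℝ => y 0) 0 t :=
      (LipschitzWith.const (y 0)).lipschitzOnWith.absolutelyContinuousOnInterval
    exact h2.add h1
  · filter_upwards [hi.ae_hasDerivAt_integral] with x hx hxt
    exact (hx hxt 0 left_mem_uIcc).const_add _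

theorem IsPrim.integrable_mul {T : ℝ} {y g q : ℝ → ℝ} (h : IsPrim T y g)
    (hq : Integrable q (timeMeasure T)) : Integrable (fun t => q t * y t) (timeMeasure T) := by
  obtain ⟨C, hC⟩ := isCompact_Icc.exists_bound_of_continuousOn h.continuousOn
  refine hq.mul_bdd (c := C) ?_ ?_
  · exact (h.continuousOn.mono Ioo_subset_Icc_self).aestronglyMeasurable measurableSet_Ioo
  · exact (ae_restrict_iff' measurableSet_Ioo).2 (ae_of_all _ fun t ht => hC t (Ioo_subset_Icc_self ht))

/-- The product rule for absolutely continuous functions. The force and the coefficients are only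
measurable in time, so each energy identity is an identity between primitives and not between
classical derivatives. -/
theorem IsPrim.mul {T : ℝ} {y g z h : ℝ → ℝ} (hy : IsPrim T y g) (hz : IsPrim T z h) :
    IsPrim T (fun t => y t * z t) (fun t => g t * z t + h t * y t) := by
  refine ⟨(hz.integrable_mul hy.int).add (hy.integrable_mul hz.int), fun t ht => ?_⟩
  obtain ⟨a1, d1⟩ := hy.ac ht
  obtain ⟨a2, d2⟩ := hz.ac ht
  have hf := a1.integral_deriv_mul_eq_sub a2
  simp only [intervalIntegral.integral_same, add_zero] at hf
  rw [← hy.eq t ht, ← hz.eq t ht] at hf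
  rw [← sub_eq_iff_eq_add', ← hf]
  apply intervalIntegral.integral_congr_ae
  filter_upwards [d1, d2] with x h1 h2 hx
  have hx' : x ∈ uIcc 0 t := uIoc_subset_uIcc hx
  rw [(h1 hx').deriv, (h2 hx').deriv]
  rw [uIcc_of_le ht.1] at hx'
  have hxT : x ∈ Icc 0 T := ⟨hx'.1, hx'.2.trans ht.2⟩
  rw [← hy.eq x hxT, ← hz.eq x hxT]
  ring

theorem IsPrim.re {T : ℝ} {y g : ℝ → ℂ} (h : IsPrim T y g) :
    IsPrim T (fun t => (y t).re) (fun t => (g t).re) :=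
  ⟨h.int.re, fun t ht => by
    rw [h.eq t ht, Complex.add_re]
    congr 1
    have := Complex.reCLM.intervalIntegral_comp_comm (intervalIntegrable_of_timeMeasure h.int ht)
    simpa using this.symm⟩

theorem IsPrim.im {T : ℝ} {y g : ℝ → ℂ} (h : IsPrim T y g) :
    IsPrim T (fun t => (y t).im) (fun t => (g t).im) :=
  ⟨h.int.im, fun t ht => by
    rw [h.eq t ht, Complex.add_im]
    congr 1
    have := Complex.imCLM.intervalIntegral_comp_comm (intervalIntegrable_of_timeMeasure h.int ht)
    simpa using this.symm⟩

theorem IsPrim.norm_sq {T : ℝ} {y g : ℝ → ℂ} (h : IsPrim T y g) :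
    IsPrim T (fun t => ‖y t‖ ^ 2) (fun t => 2 * (g t * conj (y t)).re) := by
  have := (h.re.mul h.re).add (h.im.mul h.im)
  have e1 : (fun t => ‖y t‖ ^ 2) = fun t => (y t).re * (y t).re + (y t).im * (y t).im := by
    ext t
    rw [← Complex.normSq_eq_norm_sq, Complex.normSq_apply]
  have e2 : (fun t => 2 * (g t * conj (y t)).re) = fun t => (g t).re * (y t).re +
      (g t).re * (y t).re + ((g t).im * (y t).im + (g t).im * (y t).im) := by
    ext t
    simp only [Complex.mul_re, Complex.conj_re, Complex.conj_im]
    ring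
  rwa [e1, e2]

theorem IsPrim.rsq {n : ℕ} {T : ℝ} (B : Finset (Freq n)) (s : ℝ) {u u' : ℝ → VDist n}
    (h : ∀ k, ∀ ξ ∈ B, IsPrim T (fun t => u t k ξ) (fun t => u' t k ξ)) :
    IsPrim T (fun t => rsq B s (u t)) (fun t => 2 * ip B s (u' t) (u t)) := by
  have := IsPrim.sum (S := Finset.univ) fun k _ => IsPrim.sum (S := B) fun ξ hξ =>
    (h k ξ hξ).norm_sq.const_mul (rho ξ ^ (2 * s))
  unfold PeriodicNS.rsq ip
  convert this using 2 with t
  rw [Finset.mul_sum]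
  refine Finset.sum_congr rfl fun k _ => ?_
  rw [Finset.mul_sum]
  exact Finset.sum_congr rfl fun ξ _ => by ring

/-- Grönwall's inequality with integrable coefficients. -/
theorem IsPrim.gronwall {T : ℝ} {y g b h : ℝ → ℝ} (hy : IsPrim T y g)
    (hb : Integrable b (timeMeasure T)) (hh : Integrable h (timeMeasure T))
    (hb0 : ∀ᵐ t ∂(timeMeasure T), 0 ≤ b t) (hh0 : ∀ᵐ t ∂(timeMeasure T), 0 ≤ h t)
    (hy0 : 0 ≤ y 0) (hg : ∀ᵐ t ∂(timeMeasure T), g t ≤ b t * y t + h t) {t : ℝ}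
    (ht : t ∈ Icc 0 T) :
    y t ≤ (y 0 + ∫ s in Ioo 0 T, h s) * Real.exp (∫ s in Ioo 0 T, b s) := by
  set β : ℝ → ℝ := fun x => ∫ s in 0..x, b s with hβ
  have hβp : IsPrim T β b := ⟨hb, fun t ht => by simp [hβ]⟩
  have hβ0 : ∀ t ∈ Icc 0 T, 0 ≤ β t := fun t ht => intervalIntegral_nonneg_time hb0 ht
  obtain ⟨a1, d1⟩ := hy.ac ht
  obtain ⟨a2, d2⟩ := hβp.ac ht
  have e0 : ∀ x, β 0 + ∫ s in 0..x, b s = β x := fun x => by simp [hβ]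
  simp only [e0] at a2 d2
  -- On nonnegative arguments `exp(-·)` is 1-Lipschitz; hence `exp(-β)` inherits absolute continuity
  -- from `β ≥ 0`.
  have hlip : ∀ a b : ℝ, 0 ≤ a → 0 ≤ b → dist (Real.exp (-a)) (Real.exp (-b)) ≤ dist a b := by
    intro a b ha hb
    wlog hab : a ≤ b generalizing a b
    · rw [dist_comm, dist_comm a]
      exact this b a hb ha (le_of_not_ge hab)
    rw [Real.dist_eq, Real.dist_eq, abs_of_nonneg (by
      rw [sub_nonneg]; exact Real.exp_le_exp.2 (by linarith)), abs_of_nonpos (by linarith)]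
    have h1 := Real.add_one_le_exp (a - b)
    have h2 : Real.exp (-b) = Real.exp (-a) * Real.exp (a - b) := by
      rw [← Real.exp_add]; congr 1; ring
    have h3 : Real.exp (-a) ≤ 1 := Real.exp_le_one_iff.2 (by linarith)
    have h4 := Real.exp_pos (-a)
    rw [h2]
    nlinarith
  have a3 : AbsolutelyContinuousOnInterval (fun x => Real.exp (-β x)) 0 t := by
    rw [absolutelyContinuousOnInterval_iff] at a2 ⊢
    intro ε hε
    obtain ⟨δ, hδ, H⟩ := a2 ε hε
    refine ⟨δ, hδ, fun E hE hlt => lt_of_le_of_lt ?_ (H E hE hlt)⟩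
    refine Finset.sum_le_sum fun i hi => hlip _ _ ?_ ?_
    · have := (hE.1 i hi).1
      rw [uIcc_of_le ht.1] at this
      exact hβ0 _ ⟨this.1, this.2.trans ht.2⟩
    · have := (hE.1 i hi).2
      rw [uIcc_of_le ht.1] at this
      exact hβ0 _ ⟨this.1, this.2.trans ht.2⟩
  have hf := a1.integral_deriv_mul_eq_sub a3
  simp only [intervalIntegral.integral_same, add_zero] at hf
  rw [← hy.eq t ht] at hf
  have hβ00 : β 0 = 0 := by simp [hβ]
  rw [hβ00, neg_zero, Real.exp_zero, mul_one] at hf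
  -- The integrating factor: `(y exp(-β))' = (g - b y) exp(-β) ≤ h exp(-β) ≤ h`, the last step by `h
  -- ≥ 0` and `β ≥ 0`.
  have hle : ∫ x in 0..t, (deriv (fun x => y 0 + ∫ s in 0..x, g s) x * Real.exp (-β x) +
      (y 0 + ∫ s in 0..x, g s) * deriv (fun x => Real.exp (-β x)) x) ≤ ∫ x in 0..t, h x := by
    rw [intervalIntegral.integral_of_le ht.1, intervalIntegral.integral_of_le ht.1]
    apply integral_mono_ae
    · have i1 := (a1.intervalIntegrable_deriv.mul_continuousOn a3.continuousOn).add
        (a3.intervalIntegrable_deriv.continuousOn_mul a1.continuousOn)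
      exact i1.1
    · exact (intervalIntegrable_of_timeMeasure hh ht).1
    · filter_upwards [ae_restrict_of_ae d1, ae_restrict_of_ae d2,
        ae_restrict_Ioc_of_timeMeasure hg ht, ae_restrict_Ioc_of_timeMeasure hh0 ht,
        ae_restrict_mem measurableSet_Ioc] with x h1 h2 h3 h4 hx
      have hx1 : x ∈ Icc 0 t := Ioc_subset_Icc_self hx
      have hx2 : x ∈ Icc 0 T := ⟨hx1.1, hx1.2.trans ht.2⟩
      have hx3 : x ∈ uIcc 0 t := by rwa [uIcc_of_le ht.1]
      rw [(h1 hx3).deriv, (h2 hx3).fun_neg.exp.deriv, ← hy.eq x hx2]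
      have h5 : Real.exp (-β x) ≤ 1 := Real.exp_le_one_iff.2 (by linarith [hβ0 x hx2])
      have h6 := Real.exp_pos (-β x)
      nlinarith
  rw [hf] at hle
  have h7 := intervalIntegral_le_total hh hh0 ht
  have h8 := intervalIntegral_le_total hb hb0 ht
  have h9 : y t * Real.exp (-β t) ≤ y 0 + ∫ s in Ioo 0 T, h s := by linarith
  have h10 : y t = y t * Real.exp (-β t) * Real.exp (β t) := by
    rw [mul_assoc, ← Real.exp_add]; simp
  have h11 : 0 ≤ ∫ s in Ioo 0 T, h s := integral_nonneg_of_ae hh0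
  rw [h10]
  calc _ ≤ (y 0 + ∫ s in Ioo 0 T, h s) * Real.exp (β t) := by gcongr
    _ ≤ _ := by gcongr

/-! ### Ordinary differential equations with measurable coefficients -/

/-- Carathéodory's existence theorem for a globally Lipschitz field. In the norm weighted with
`exp(-l t)` the integral operator is a contraction on the whole of `[0,T]`, so no subdivision of the
interval is needed. -/
theorem exists_isPrim_of_lipschitz {E : Type*} [NormedAddCommGroup E] [NormedSpace ℝ E]
    [CompleteSpace E] {T : ℝ} (hT : 0 < T) (G : ℝ → E → E) (K : NNReal) (c₀ : E)
    (hm : ∀ c : ℝ → E, Continuous c → AEStronglyMeasurable (fun t => G t (c t)) (timeMeasure T))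
    (hL : ∀ᵐ t ∂(timeMeasure T), LipschitzWith K (G t))
    (h0 : Integrable (fun t => G t 0) (timeMeasure T)) :
    ∃ c : ℝ → E, Continuous c ∧ c 0 = c₀ ∧ IsPrim T c (fun t => G t (c t)) := by
  set l : ℝ := 2 * K + 1 with hl
  have hl0 : 0 < l := by positivity
  -- The unknown is `v(t) = exp(-l t) c(t)`, which turns the weighted norm of `c` into the plain
  -- supremum norm of `v`. With `l = 2K+1` the contraction factor `K/l` is at most `1/2`.
  let ext : C(Icc (0 : ℝ) T, E) → ℝ → E := fun v s => Real.exp (l * s) • v (projIcc 0 T hT.le s)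
  have hext : ∀ v, Continuous (ext v) := fun v => by
    have : Continuous fun s => v (projIcc 0 T hT.le s) := v.continuous.comp continuous_projIcc
    fun_prop
  have hbd : ∀ c : ℝ → E, Continuous c → Integrable (fun t => G t (c t)) (timeMeasure T) := by
    intro c hc
    obtain ⟨D, hD⟩ := isCompact_Icc.exists_bound_of_continuousOn (hc.continuousOn (s := Icc 0 T))
    have hfin : IsFiniteMeasure (timeMeasure T) := by unfold timeMeasure; infer_instance
    refine Integrable.mono' (g := fun t => ‖G t 0‖ + K * D) (h0.norm.add (integrable_const _))
      (hm c hc) ?_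
    filter_upwards [hL, ae_restrict_mem measurableSet_Ioo] with t h1 h2
    have h3 := h1.dist_le_mul (c t) 0
    rw [dist_eq_norm, dist_zero_right] at h3
    have h4 := hD t (Ioo_subset_Icc_self h2)
    calc ‖G t (c t)‖ ≤ ‖G t (c t) - G t 0‖ + ‖G t 0‖ := by
          simpa using norm_add_le (G t (c t) - G t 0) (G t 0)
      _ ≤ K * ‖c t‖ + ‖G t 0‖ := by gcongr
      _ ≤ _ := by rw [add_comm]; gcongr
  let Φf : C(Icc (0 : ℝ) T, E) → ℝ → E := fun v t =>
    Real.exp (-(l * t)) • (c₀ + ∫ s in 0..t, G s (ext v s))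
  have hΦc : ∀ v, ContinuousOn (Φf v) (Icc 0 T) := by
    intro v
    have hp : IsPrim T (fun t => ∫ s in 0..t, G s (ext v s)) (fun s => G s (ext v s)) :=
      ⟨hbd _ (hext v), fun t _ => by simp⟩
    have h1 : Continuous fun t : ℝ => Real.exp (-(l * t)) := by fun_prop
    exact h1.continuousOn.smul (continuousOn_const.add hp.continuousOn)
  let Φ : C(Icc (0 : ℝ) T, E) → C(Icc (0 : ℝ) T, E) := fun v =>
    ⟨fun t => Φf v t, (hΦc v).domRestrict⟩
  have hcontr : ContractingWith (1 / 2) Φ := by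
    refine ⟨by rw [← NNReal.coe_lt_coe]; norm_num, LipschitzWith.of_dist_le_mul fun v w => ?_⟩
    rw [ContinuousMap.dist_le (by positivity)]
    rintro ⟨t, ht⟩
    change dist (Φf v t) (Φf w t) ≤ _
    have hi1 := intervalIntegrable_of_timeMeasure (hbd _ (hext v)) ht
    have hi2 := intervalIntegrable_of_timeMeasure (hbd _ (hext w)) ht
    have e1 : Φf v t - Φf w t =
        Real.exp (-(l * t)) • ∫ s in 0..t, (G s (ext v s) - G s (ext w s)) := by
      simp only [Φf]
      rw [intervalIntegral.integral_sub hi1 hi2, ← smul_sub]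
      congr 1
      abel
    have hint : ‖∫ s in 0..t, (G s (ext v s) - G s (ext w s))‖ ≤
        ∫ s in 0..t, K * dist v w * Real.exp (l * s) := by
      rw [intervalIntegral.integral_of_le ht.1, intervalIntegral.integral_of_le ht.1]
      refine norm_integral_le_of_norm_le ?_ ?_
      · exact (Continuous.intervalIntegrable (by fun_prop) 0 t).1
      · filter_upwards [ae_restrict_Ioc_of_timeMeasure hL ht] with s hs
        have h3 : dist (ext v s) (ext w s) ≤ Real.exp (l * s) * dist v w := by
          simp only [ext]
          rw [dist_smul₀, Real.norm_of_nonneg (Real.exp_pos _).le]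
          gcongr
          exact ContinuousMap.dist_apply_le_dist _
        rw [← dist_eq_norm]
        calc _ ≤ K * dist (ext v s) (ext w s) := hs.dist_le_mul _ _
          _ ≤ K * (Real.exp (l * s) * dist v w) := by gcongr
          _ = _ := by ring
    have hexp : ∫ s in 0..t, K * dist v w * Real.exp (l * s) =
        K * dist v w * ((Real.exp (l * t) - 1) / l) := by
      rw [intervalIntegral.integral_const_mul, intervalIntegral.integral_comp_mul_left _ hl0.ne']
      simp only [integral_exp, mul_zero, Real.exp_zero, smul_eq_mul]
      rw [div_eq_inv_mul]
    rw [dist_eq_norm, e1, norm_smul, Real.norm_of_nonneg (Real.exp_pos _).le]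
    have hk : (K : ℝ) / l ≤ 1 / 2 := by
      rw [hl, div_le_div_iff₀ (by positivity) (by norm_num)]
      linarith
    have hd : 0 ≤ dist v w := dist_nonneg
    have hpe := Real.exp_pos (-(l * t))
    have hpe1 : Real.exp (-(l * t)) ≤ 1 :=
      Real.exp_le_one_iff.2 (by linarith [mul_nonneg hl0.le ht.1])
    have hpe' : Real.exp (-(l * t)) * Real.exp (l * t) = 1 := by rw [← Real.exp_add]; simp
    calc Real.exp (-(l * t)) * ‖∫ s in 0..t, (G s (ext v s) - G s (ext w s))‖
        ≤ Real.exp (-(l * t)) * (K * dist v w * ((Real.exp (l * t) - 1) / l)) := by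
          rw [← hexp]
          gcongr
      _ = (K / l) * dist v w * (Real.exp (-(l * t)) * Real.exp (l * t) - Real.exp (-(l * t))) := by
          ring
      _ ≤ (1 / 2) * dist v w * 1 := by
          rw [hpe']
          gcongr
          linarith
      _ = _ := by simp
  set v := hcontr.fixedPoint Φ with hv
  have hfix : Φ v = v := hcontr.fixedPoint_isFixedPt
  have hvt : ∀ t (ht : t ∈ Icc 0 T), ext v t = c₀ + ∫ s in 0..t, G s (ext v s) := by
    intro t ht
    have h1 : v (projIcc 0 T hT.le t) = Φf v t := by
      conv_lhs => rw [← hfix]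
      rw [projIcc_of_mem hT.le ht]
      rfl
    simp only [ext] at h1 ⊢
    rw [h1]
    simp only [Φf]
    rw [smul_smul, ← Real.exp_add]
    simp [ext]
  have hv0 : ext v 0 = c₀ := by
    rw [hvt 0 (left_mem_Icc.2 hT.le)]
    simp
  exact ⟨ext v, hext v, hv0, hbd _ (hext v), fun t ht => by rw [hv0]; exact hvt t ht⟩

/-! ### Galerkin approximations -/

theorem IsPrim.clm {E F : Type*} [NormedAddCommGroup E] [NormedSpace ℝ E] [CompleteSpace E]
    [NormedAddCommGroup F] [NormedSpace ℝ F] [CompleteSpace F] (L : E →L[ℝ] F) {T : ℝ}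
    {y g : ℝ → E} (h : IsPrim T y g) : IsPrim T (fun t => L (y t)) (fun t => L (g t)) :=
  ⟨L.integrable_comp h.int, fun t ht => by
    rw [h.eq t ht, map_add, L.intervalIntegral_comp_comm (intervalIntegrable_of_timeMeasure h.int ht)]⟩

theorem IsPrim.eq_zero {E : Type*} [NormedAddCommGroup E] [NormedSpace ℝ E] {T : ℝ}
    {y g : ℝ → E} (h : IsPrim T y g) (h0 : y 0 = 0) (hg : ∀ t, g t = 0) {t : ℝ}
    (ht : t ∈ Icc 0 T) : y t = 0 := by
  rw [h.eq t ht, h0]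
  simp [hg]

theorem WienerBound.sq_zero_lt {n : ℕ} {K : ℝ≥0∞} {A : FTensor n} (hA : WienerBound 0 K A)
    (hK : K ≠ ∞) (i j α β : Fin n) : sq 0 (A i j α β) < ∞ := by
  have h := hA i j α β
  simp only [wt_zero, one_mul] at h
  have h1 : sq 0 (A i j α β) ≤ K * K := by
    unfold sq
    rw [wsq_zero]
    calc ∑' ξ, ‖A i j α β ξ‖ₑ ^ 2 ≤ ∑' ξ, ‖A i j α β ξ‖ₑ * K := by
          refine ENNReal.tsum_le_tsum fun ξ => ?_
          rw [pow_two]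
          gcongr
          exact (ENNReal.le_tsum ξ).trans h
      _ ≤ K * K := by
          rw [ENNReal.tsum_mul_right]
          gcongr
  exact h1.trans_lt (ENNReal.mul_lt_top hK.lt_top hK.lt_top)

theorem strain_sub {n : ℕ} (u v : VDist n) (j β : Fin n) :
    strain (u - v) j β = fun ξ => strain u j β ξ - strain v j β ξ := by
  ext ξ
  simp only [strain, partialD, Pi.sub_apply]
  ring

theorem visc_sub {n : ℕ} {K : ℝ≥0∞} {A : FTensor n} (hA : WienerBound 0 K A) (hK : K ≠ ∞)
    {u v : VDist n} (hu : vsq 1 u < ∞) (hv : vsq 1 v < ∞) :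
    visc A (u - v) = visc A u - visc A v := by
  ext k ξ
  have h : ∀ i α, (fun η => ∑ j, ∑ β, mul (A i j α β) (strain (u - v) j β) η) = fun η =>
      (∑ j, ∑ β, mul (A i j α β) (strain u j β) η) - ∑ j, ∑ β, mul (A i j α β) (strain v j β) η := by
    intro i α
    ext η
    rw [← Finset.sum_sub_distrib]
    refine Finset.sum_congr rfl fun j _ => ?_
    rw [← Finset.sum_sub_distrib]
    refine Finset.sum_congr rfl fun β _ => ?_
    rw [strain_sub, mul_sub_right (hA.sq_zero_lt hK _ _ _ _) (sq_zero_strain_lt hu _ _)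
      (sq_zero_strain_lt hv _ _)]
  simp only [visc, h, Pi.sub_apply]
  rw [← Finset.sum_sub_distrib]
  refine Finset.sum_congr rfl fun α _ => ?_
  simp only [partialD]
  ring

theorem leray_sub {n : ℕ} (F G : VDist n) : leray (F - G) = leray F - leray G := by
  ext k ξ
  by_cases h : ξ = 0
  · simp [leray, h]
  · simp only [leray, h, if_false, Pi.sub_apply, mul_sub, Finset.sum_sub_distrib]
    ring

theorem leray_add {n : ℕ} (F G : VDist n) : leray (F + G) = leray F + leray G := by
  ext k ξ
  by_cases h : ξ = 0
  · simp [leray, h]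
  · simp only [leray, h, if_false, Pi.add_apply, mul_add, Finset.sum_add_distrib]
    ring

theorem leray_smul {n : ℕ} (c : ℝ) (F : VDist n) : leray (c • F) = c • leray F := by
  ext k ξ
  by_cases h : ξ = 0
  · simp [leray, h]
  · simp only [leray, h, if_false, Pi.smul_apply, Complex.real_smul]
    have : ∑ j, (ξ j : ℂ) * ((c : ℂ) * F j ξ) = c * ∑ j, (ξ j : ℂ) * F j ξ := by
      rw [Finset.mul_sum]
      exact Finset.sum_congr rfl fun j _ => by ring
    rw [this]
    ring

theorem sum_mul_leray {n : ℕ} (F : VDist n) (ξ : Freq n) : ∑ j, (ξ j : ℂ) * leray F j ξ = 0 := by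
  by_cases h : ξ = 0
  · simp [leray, h]
  · have hq : (freqSq ξ : ℂ) ≠ 0 := by
      have := freqSq_pos h
      exact_mod_cast (by linarith : freqSq ξ ≠ 0)
    simp only [leray, h, if_false, mul_sub, Finset.sum_sub_distrib]
    have : ∀ j, (ξ j : ℂ) * ((ξ j : ℂ) * (∑ i, (ξ i : ℂ) * F i ξ) / (freqSq ξ : ℂ)) =
        (ξ j : ℂ) ^ 2 * ((∑ i, (ξ i : ℂ) * F i ξ) / (freqSq ξ : ℂ)) := fun j => by ring
    simp only [this]
    rw [← Finset.sum_mul]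
    have e : ∑ j, (ξ j : ℂ) ^ 2 = freqSq ξ := by simp [freqSq]
    rw [e]
    field_simp
    ring

theorem divergence_leray {n : ℕ} (F : VDist n) : divergence (leray F) = 0 := by
  ext ξ
  have := sum_mul_leray F ξ
  calc divergence (leray F) ξ = (2 * (Real.pi : ℂ) * Complex.I) * ∑ j, (ξ j : ℂ) * leray F j ξ := by
        rw [Finset.mul_sum]
        exact Finset.sum_congr rfl fun j _ => by unfold partialD; ring
    _ = 0 := by rw [this, mul_zero]

/-- Truncation to the frequencies in `B`. -/
def trunc {n : ℕ} (B : Finset (Freq n)) (u : VDist n) : VDist n := fun k ξ =>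
  if ξ ∈ B then u k ξ else 0

theorem suppIn_trunc {n : ℕ} (B : Finset (Freq n)) (u : VDist n) : SuppIn B (trunc B u) :=
  fun k ξ h => by simp [trunc, h]

theorem Solenoidal.trunc {n : ℕ} {u : VDist n} (h : Solenoidal u) (N : ℕ) :
    Solenoidal (trunc (box n N) u) := by
  refine ⟨fun k ξ => ?_, ?_, fun k => by simp [PeriodicNS.trunc, h.mean k]⟩
  · simp only [PeriodicNS.trunc, neg_mem_box]
    split_ifs
    · exact h.real k ξ
    · simp
  · ext ξ
    have := congrFun h.div ξ
    by_cases hξ : ξ ∈ box n N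
    · simpa [divergence, partialD, PeriodicNS.trunc, hξ] using this
    · simp [divergence, partialD, PeriodicNS.trunc, hξ]

/-- The coefficients of the Galerkin approximation. -/
abbrev State (n N : ℕ) := Fin n → box n N → ℂ

/-- The real field with given coefficients. -/
def liftState {n N : ℕ} (c : State n N) : VDist n := fun k ξ =>
  if h : ξ ∈ box n N then (c k ⟨ξ, h⟩ + conj (c k ⟨-ξ, neg_mem_box.2 h⟩)) / 2 else 0

def resState {n N : ℕ} (F : VDist n) : State n N := fun k ξ => F k ξ

theorem suppIn_liftState {n N : ℕ} (c : State n N) : SuppIn (box n N) (liftState c) :=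
  fun k ξ h => by simp [liftState, h]

theorem isRealDist_liftState {n N : ℕ} (c : State n N) (k : Fin n) :
    IsRealDist (liftState c k) := by
  intro ξ
  by_cases h : ξ ∈ box n N
  · simp only [liftState, h, neg_mem_box, dif_pos, neg_neg, map_div₀, map_add, Complex.conj_conj,
      map_ofNat]
    rw [add_comm]
  · simp [liftState, h, neg_mem_box]

theorem liftState_sub {n N : ℕ} (c d : State n N) :
    liftState (c - d) = liftState c - liftState d := by
  ext k ξ
  by_cases h : ξ ∈ box n N
  · simp only [liftState, h, dif_pos, Pi.sub_apply, map_sub]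
    ring
  · simp [liftState, h]

theorem liftState_zero {n N : ℕ} : liftState (0 : State n N) = 0 := by
  ext k ξ
  simp [liftState]

theorem norm_liftState_le {n N : ℕ} (c : State n N) (k : Fin n) (ξ : Freq n) :
    ‖liftState c k ξ‖ ≤ ‖c‖ := by
  by_cases h : ξ ∈ box n N
  · have h1 : ∀ ζ, ‖c k ζ‖ ≤ ‖c‖ := fun ζ => (norm_le_pi_norm (c k) ζ).trans (norm_le_pi_norm c k)
    simp only [liftState, h, dif_pos, norm_div, Complex.norm_ofNat]
    have := norm_add_le (c k ⟨ξ, h⟩) (conj (c k ⟨-ξ, neg_mem_box.2 h⟩))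
    rw [RCLike.norm_conj] at this
    linarith [h1 ⟨ξ, h⟩, h1 ⟨-ξ, neg_mem_box.2 h⟩]
  · simp [liftState, h]

theorem contDiff_liftState {n N : ℕ} (k : Fin n) (ξ : Freq n) :
    ContDiff ℝ 1 fun c : State n N => liftState c k ξ := by
  by_cases h : ξ ∈ box n N
  · simp only [liftState, h, dif_pos]
    have h1 : ∀ ζ, ContDiff ℝ 1 fun c : State n N => c k ζ := fun ζ => by fun_prop
    have h2 : ∀ ζ, ContDiff ℝ 1 fun c : State n N => conj (c k ζ) := fun ζ =>
      Complex.conjCLE.contDiff.comp (h1 ζ)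
    exact ((h1 _).add (h2 _)).div_const 2
  · simp only [liftState, h, dif_neg, not_false_eq_true]
    exact contDiff_const

theorem contDiff_leray {n : ℕ} {E : Type*} [NormedAddCommGroup E] [NormedSpace ℝ E]
    {F : E → VDist n} (hF : ∀ k ξ, ContDiff ℝ 1 fun c => F c k ξ) (k : Fin n) (ξ : Freq n) :
    ContDiff ℝ 1 fun c => leray (F c) k ξ := by
  by_cases h : ξ = 0
  · simp only [leray, h, if_true]
    exact contDiff_const
  · simp only [leray, h, if_false]
    exact (hF k ξ).sub ((contDiff_const.mul (ContDiff.sum fun j _ =>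
      contDiff_const.mul (hF j ξ))).div_const _)

theorem contDiff_tens_liftState {n N : ℕ} (k : Fin n) (ξ : Freq n) :
    ContDiff ℝ 1 fun c : State n N => tens (liftState c) (liftState c) k ξ := by
  simp only [tens, partialD]
  refine ContDiff.sum fun j _ => contDiff_const.mul ?_
  simp only [fun c : State n N => mul_eq_sum (B := box n N) (liftState c j)
    (g := liftState c k) (suppIn_liftState c k) ξ]
  exact ContDiff.sum fun ζ _ => (contDiff_liftState _ _).mul (contDiff_liftState _ _)

theorem vsq_liftState_le {n N : ℕ} (c : State n N) (s : ℝ) :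
    vsq s (liftState c) ≤ (∑ _k : Fin n, ∑ ξ ∈ box n N, wt (2 * s) ξ) * ‖c‖ₑ ^ 2 := by
  rw [vsq_eq_ofReal_rsq (suppIn_liftState c), ofReal_rsq, Finset.sum_mul]
  refine Finset.sum_le_sum fun k _ => ?_
  rw [Finset.sum_mul]
  refine Finset.sum_le_sum fun ξ _ => ?_
  gcongr
  rw [enorm_le_iff_norm_le]
  exact norm_liftState_le c k ξ

/-- The map is linear from `H¹` to `H⁻¹`, and on finitely many frequencies these norms are
equivalent to the norm of the coefficients. The constant depends on the tensor through `K` alone,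
hence not on time. -/
theorem exists_lipschitz_visc (n N : ℕ) {K : ℝ≥0∞} (hK : K ≠ ∞) : ∃ L : NNReal,
    ∀ A : FTensor n, WienerBound 0 K A → LipschitzWith L fun c : State n N =>
      (resState (leray (visc A (liftState c))) : State n N) := by
  obtain ⟨C₁, hC₁, h₁⟩ := vsq_visc_le (n := n) 0
  obtain ⟨C₂, hC₂, h₂⟩ := vsq_leray_le (n := n)
  set D : ℝ≥0∞ := ∑ _k : Fin n, ∑ ξ ∈ box n N, wt (2 * 1) ξ with hD
  have hDt : D ≠ ∞ := by
    simp only [hD, ne_eq, ENNReal.sum_eq_top, not_exists, not_and]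
    exact fun _ _ ξ _ => wt_ne_top _ _
  set D' : ℝ≥0∞ := ∑ ξ ∈ box n N, wt (2 * 1) ξ with hD'
  have hDt' : D' ≠ ∞ := by
    simp only [hD', ne_eq, ENNReal.sum_eq_top, not_exists, not_and]
    exact fun ξ _ => wt_ne_top _ _
  set Q : ℝ≥0∞ := D' * (C₂ * (C₁ * (K ^ 2 * D))) with hQ
  have hQt : Q ≠ ∞ := by
    have := ENNReal.pow_ne_top (n := 2) hK
    exact ENNReal.mul_ne_top hDt' (ENNReal.mul_ne_top hC₂ (ENNReal.mul_ne_top hC₁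
      (ENNReal.mul_ne_top this hDt)))
  refine ⟨NNReal.sqrt Q.toNNReal, fun A hA c d => ?_⟩
  rw [edist_pi_le_iff]
  intro k
  rw [edist_pi_le_iff]
  rintro ⟨ξ, hξ⟩
  rw [edist_eq_enorm_sub, edist_eq_enorm_sub]
  have e : (resState (leray (visc A (liftState c))) : State n N) k ⟨ξ, hξ⟩ -
      (resState (leray (visc A (liftState d))) : State n N) k ⟨ξ, hξ⟩ =
      leray (visc A (liftState (c - d))) k ξ := by
    rw [liftState_sub, visc_sub hA hK ((suppIn_liftState c).vsq_lt_top 1)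
      ((suppIn_liftState d).vsq_lt_top 1), leray_sub]
    rfl
  rw [e]
  rw [← (ENNReal.pow_right_strictMono two_ne_zero).le_iff_le, mul_pow]
  have hL : (((NNReal.sqrt Q.toNNReal : NNReal) : ℝ≥0∞)) ^ 2 = Q := by
    rw [← ENNReal.coe_pow, NNReal.sq_sqrt, ENNReal.coe_toNNReal hQt]
  rw [hL]
  set F := leray (visc A (liftState (c - d))) with hF
  have hw : wt (2 * 1) ξ * wt (2 * (-1)) ξ = 1 := by
    rw [← wt_add]; norm_num [wt_zero]
  have h3 : wt (2 * (-1)) ξ * ‖F k ξ‖ₑ ^ 2 ≤ vsq (-1) F :=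
    (ENNReal.le_tsum (f := fun ξ => wt (2 * (-1)) ξ * ‖F k ξ‖ₑ ^ 2) ξ).trans (sq_le_vsq (-1) F k)
  have h4 : vsq (-1) F ≤ C₂ * (C₁ * (K ^ 2 * (D * ‖c - d‖ₑ ^ 2))) := by
    refine (h₂ (-1) _).trans ?_
    gcongr
    have := h₁ A K (liftState (c - d)) (by simpa using hA)
    rw [zero_sub, zero_add] at this
    refine this.trans ?_
    gcongr
    exact vsq_liftState_le _ _
  calc ‖F k ξ‖ₑ ^ 2 = wt (2 * 1) ξ * (wt (2 * (-1)) ξ * ‖F k ξ‖ₑ ^ 2) := by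
        rw [← mul_assoc, hw, one_mul]
    _ ≤ D' * (C₂ * (C₁ * (K ^ 2 * (D * ‖c - d‖ₑ ^ 2)))) := by
        exact mul_le_mul' (Finset.single_le_sum (f := fun ξ : Freq n => wt (2 * 1) ξ)
            (fun _ _ => zero_le) hξ) (h3.trans h4)
    _ = _ := by rw [hQ]; ring

theorem aestronglyMeasurable_leray {n : ℕ} {μ : Measure ℝ} {F : ℝ → VDist n}
    (hF : ∀ k ξ, AEStronglyMeasurable (fun t => F t k ξ) μ) (k : Fin n) (ξ : Freq n) :
    AEStronglyMeasurable (fun t => leray (F t) k ξ) μ := by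
  by_cases h : ξ = 0
  · simp only [leray, h, if_true]
    exact aestronglyMeasurable_const
  · simp only [leray, h, if_false]
    refine (hF k ξ).sub ?_
    have : AEStronglyMeasurable (fun t => ∑ j, (ξ j : ℂ) * F t j ξ) μ :=
      Finset.aestronglyMeasurable_fun_sum _ fun j _ => (hF j ξ).const_mul _
    simpa only [div_eq_mul_inv] using ((this.const_mul (ξ k : ℂ)).mul_const ((freqSq ξ : ℂ)⁻¹))

theorem aemeasurable_mul {n : ℕ} {μ : Measure ℝ} {g h : ℝ → SDist n}
    (hg : ∀ ξ, AEMeasurable (fun t => g t ξ) μ) (hh : ∀ ξ, AEMeasurable (fun t => h t ξ) μ)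
    (ξ : Freq n) : AEMeasurable (fun t => mul (g t) (h t) ξ) μ := by
  unfold mul
  exact AEMeasurable.tsum fun η => (hg η).mul (hh _)

theorem aemeasurable_partialD {n : ℕ} {μ : Measure ℝ} {g : ℝ → SDist n}
    (hg : ∀ ξ, AEMeasurable (fun t => g t ξ) μ) (j : Fin n) (ξ : Freq n) :
    AEMeasurable (fun t => partialD j (g t) ξ) μ := (hg ξ).const_mul _

theorem aemeasurable_tens {n : ℕ} {μ : Measure ℝ} {u v : ℝ → VDist n}
    (hu : ∀ k ξ, AEMeasurable (fun t => u t k ξ) μ) (hv : ∀ k ξ, AEMeasurable (fun t => v t k ξ) μ)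
    (k : Fin n) (ξ : Freq n) : AEMeasurable (fun t => tens (u t) (v t) k ξ) μ := by
  unfold tens
  exact Finset.aemeasurable_fun_sum _ fun j _ => aemeasurable_partialD
    (aemeasurable_mul (hu j) (hv k)) j ξ

theorem aemeasurable_visc {n : ℕ} {μ : Measure ℝ} {A : ℝ → FTensor n} {u : ℝ → VDist n}
    (hA : ∀ i j α β ξ, AEMeasurable (fun t => A t i j α β ξ) μ)
    (hu : ∀ k ξ, AEMeasurable (fun t => u t k ξ) μ)
    (k : Fin n) (ξ : Freq n) : AEMeasurable (fun t => visc (A t) (u t) k ξ) μ := by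
  unfold visc
  have hs : ∀ j β η, AEMeasurable (fun t => strain (u t) j β η) μ := fun j β η =>
    ((aemeasurable_partialD (hu β) j η).add (aemeasurable_partialD (hu j) β η)).div_const 2
  have h : ∀ i α η, AEMeasurable (fun t => ∑ j, ∑ β, mul (A t i j α β) (strain (u t) j β) η) μ :=
    fun i α η => Finset.aemeasurable_fun_sum _ fun j _ => Finset.aemeasurable_fun_sum _ fun β _ =>
      aemeasurable_mul (hA i j α β) (hs j β) η
  exact Finset.aemeasurable_fun_sum _ fun α _ =>
    ((aemeasurable_partialD (h k α) α ξ).add (aemeasurable_partialD (h α k) α ξ)).div_const 2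

/-- The quadratic term is multiplied by a cutoff of the coefficients, so the vector field is
globally Lipschitz and the approximation exists on all of `[0,T]`. The factor `χ` is `1` while the
coefficients are at most `R`; `R` is chosen afterwards, from a priori bounds that hold for every `χ`
with values in `[0,1]`. -/
theorem exists_galerkin {n : ℕ} {T : ℝ} (hT : 0 < T) {K : ℝ≥0∞} (hK : K ≠ ∞) {A : ℝ → FTensor n}
    (hAm : ∀ i j α β ξ, AEMeasurable (fun t => A t i j α β ξ) (timeMeasure T))
    (hAr : ∀ t i j α β, IsRealDist (A t i j α β))
    (hAw : ∀ᵐ t ∂(timeMeasure T), WienerBound 0 K (A t)) {f : ℝ → VDist n}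
    (hfr : ∀ t k, IsRealDist (f t k)) (hfi : ∀ k ξ, Integrable (fun t => f t k ξ) (timeMeasure T))
    {u₀ : VDist n} (hu₀ : Solenoidal u₀) (N : ℕ) (R : ℝ) :
    ∃ (u : ℝ → VDist n) (χ : ℝ → ℝ), (∀ t, 0 ≤ χ t ∧ χ t ≤ 1) ∧
      (∀ t ∈ Icc 0 T, (∀ k ξ, ‖u t k ξ‖ ≤ R) → χ t = 1) ∧ u 0 = trunc (box n N) u₀ ∧
      (∀ t, SuppIn (box n N) (u t)) ∧ (∀ t ∈ Icc 0 T, Solenoidal (u t)) ∧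
      ∀ k, ∀ ξ ∈ box n N, IsPrim T (fun t => u t k ξ) fun t =>
        leray (f t + visc (A t) (u t) - χ t • tens (u t) (u t)) k ξ := by
  have hR0 : (0 : ℝ) < |R| + 1 := by positivity
  -- The inner radius must be positive for every real `R`, hence `|R| + 1`.
  let b : ContDiffBump (0 : State n N) := ⟨|R| + 1, |R| + 2, hR0, by linarith⟩
  obtain ⟨L₁, hL₁⟩ := exists_lipschitz_visc n N hK
  let Nl : State n N → State n N := fun c =>
    b c • (resState (leray (tens (liftState c) (liftState c))) : State n N)
  have hNc : ContDiff ℝ 1 Nl := by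
    refine b.contDiff.smul ?_
    rw [contDiff_pi]
    intro k
    rw [contDiff_pi]
    rintro ⟨ξ, hξ⟩
    exact contDiff_leray contDiff_tens_liftState k ξ
  -- A `C¹` map with compact support is globally Lipschitz; this is what the cutoff is for.
  obtain ⟨L₂, hL₂⟩ := hNc.lipschitzWith_of_hasCompactSupport
    (HasCompactSupport.smul_right b.hasCompactSupport) one_ne_zero
  let G : ℝ → State n N → State n N := fun t c =>
    resState (leray (f t)) + resState (leray (visc (A t) (liftState c))) - Nl c
  have hGe : ∀ t c (k : Fin n) (ξ : box n N), G t c k ξ = leray (f t + visc (A t) (liftState c) -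
      b c • tens (liftState c) (liftState c)) k ξ := by
    intro t c k ξ
    rw [leray_sub, leray_add, leray_smul]
    rfl
  have hLip : ∀ᵐ t ∂(timeMeasure T), LipschitzWith (0 + L₁ + L₂) (G t) := by
    filter_upwards [hAw] with t ht
    exact ((LipschitzWith.const _).add (hL₁ _ ht)).sub hL₂
  have hlm : ∀ c : ℝ → State n N, Continuous c → ∀ k ξ,
      AEMeasurable (fun t => liftState (c t) k ξ) (timeMeasure T) := fun c hc k ξ =>
    ((contDiff_liftState k ξ).continuous.comp hc).aemeasurable
  have hm : ∀ c : ℝ → State n N, Continuous c →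
      AEStronglyMeasurable (fun t => G t (c t)) (timeMeasure T) := by
    intro c hc
    refine AEMeasurable.aestronglyMeasurable ?_
    rw [aemeasurable_pi_iff]
    intro k
    rw [aemeasurable_pi_iff]
    intro ξ
    have h1 := aestronglyMeasurable_leray (fun k ξ => (hfi k ξ).1) k ξ
    have h2 := aestronglyMeasurable_leray
      (fun k ξ => (aemeasurable_visc hAm (hlm c hc) k ξ).aestronglyMeasurable) k ξ
    have h3 : Continuous fun t => Nl (c t) k ξ :=
      (continuous_apply ξ).comp ((continuous_apply k).comp (hNc.continuous.comp hc))
    exact (h1.aemeasurable.add h2.aemeasurable).sub h3.aemeasurable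
  have hG0 : Integrable (fun t => G t 0) (timeMeasure T) := by
    have e : (fun t => G t 0) = fun t => (resState (leray (f t)) : State n N) := by
      ext t k ξ
      rw [hGe, liftState_zero]
      have h1 : visc (A t) (0 : VDist n) = 0 := by
        ext k ξ
        simp [visc, strain, partialD, mul]
      have h2 : tens (0 : VDist n) 0 = 0 := by
        ext k ξ
        simp [tens, partialD, mul]
      rw [h1, h2]
      simp [resState]
    rw [e]
    refine Integrable.of_eval fun k => Integrable.of_eval fun ξ => ?_
    by_cases h : (ξ : Freq n) = 0
    · simp only [resState, leray, h, if_true]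
      exact integrable_zero _ _ _
    · simp only [resState, leray, h, if_false]
      exact (hfi k ξ).sub (((integrable_finsetSum _ fun j _ =>
        (hfi j ξ).const_mul _).const_mul _).div_const _)
  obtain ⟨c, hc, hc0, hcp⟩ := exists_isPrim_of_lipschitz hT G (0 + L₁ + L₂)
    (resState (trunc (box n N) u₀)) hm hLip hG0
  have hut := hu₀.trunc N
  have hG1 : ∀ t, ∀ d : State n N, ∀ k, IsRealDist (leray (f t + visc (A t) (liftState d) -
      b d • tens (liftState d) (liftState d)) k) := by
    intro t d k
    refine isRealDist_leray (fun k ξ => ?_) k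
    simp only [Pi.sub_apply, Pi.add_apply, Pi.smul_apply, Complex.real_smul, map_sub, map_add,
      map_mul, Complex.conj_ofReal, hfr t k ξ,
      isRealDist_visc (hAr t) (isRealDist_liftState d) k ξ,
      isRealDist_tens (isRealDist_liftState d) (isRealDist_liftState d) k ξ]
  -- The state space does not impose reality; it is conserved. The right-hand side is evaluated at
  -- the symmetrised field `liftState`, hence real, so the defect `c(-ξ) - conj c(ξ)` has derivative
  -- zero and starts from zero. Divergence and mean value are treated below in the same way.
  have hsym : ∀ t ∈ Icc 0 T, ∀ k (ξ : Freq n) (h : ξ ∈ box n N),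
      c t k ⟨-ξ, neg_mem_box.2 h⟩ = conj (c t k ⟨ξ, h⟩) := by
    intro t ht k ξ h
    have p1 := hcp.clm (((ContinuousLinearMap.proj (R := ℝ) (φ := fun _ : box n N => ℂ)
      ⟨-ξ, neg_mem_box.2 h⟩) ∘L (ContinuousLinearMap.proj (R := ℝ)
        (φ := fun _ : Fin n => box n N → ℂ) k)) - (Complex.conjCLE : ℂ →L[ℝ] ℂ) ∘L
      ((ContinuousLinearMap.proj (R := ℝ) (φ := fun _ : box n N => ℂ)
      ⟨ξ, h⟩) ∘L (ContinuousLinearMap.proj (R := ℝ) (φ := fun _ : Fin n => box n N → ℂ) k)))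
    refine sub_eq_zero.1 (p1.eq_zero ?_ (fun s => ?_) ht)
    · rw [hc0]
      exact sub_eq_zero.2 (hut.real k ξ)
    · refine sub_eq_zero.2 ?_
      change G s (c s) k ⟨-ξ, _⟩ = conj (G s (c s) k ⟨ξ, h⟩)
      rw [hGe, hGe]
      exact hG1 s (c s) k ξ
  have hlift : ∀ t ∈ Icc 0 T, ∀ k (ξ : Freq n) (h : ξ ∈ box n N),
      liftState (c t) k ξ = c t k ⟨ξ, h⟩ := by
    intro t ht k ξ h
    simp only [liftState, h, dif_pos, hsym t ht k ξ h, Complex.conj_conj]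
    ring
  have h0m : (0 : ℝ) ∈ Icc 0 T := left_mem_Icc.2 hT.le
  refine ⟨fun t => liftState (c t), fun t => b (c t), fun t => ⟨b.nonneg, b.le_one⟩, ?_, ?_,
    fun t => suppIn_liftState _, ?_, ?_⟩
  · intro t ht hb
    refine b.one_of_mem_closedBall ?_
    rw [mem_closedBall_zero_iff]
    refine (pi_norm_le_iff_of_nonneg hR0.le).2 fun k => (pi_norm_le_iff_of_nonneg hR0.le).2 ?_
    rintro ⟨ξ, h⟩
    rw [← hlift t ht k ξ h]
    exact (hb k ξ).trans ((le_abs_self R).trans (by linarith))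
  · ext k ξ
    by_cases h : ξ ∈ box n N
    · refine (hlift 0 h0m k ξ h).trans ?_
      rw [hc0]
      rfl
    · simp [liftState, trunc, h]
  · intro t ht
    refine ⟨isRealDist_liftState _, ?_, fun k => ?_⟩
    · ext ξ
      by_cases h : ξ ∈ box n N
      · simp only [divergence, partialD, hlift t ht _ ξ h]
        have p1 := hcp.clm (∑ j, (2 * (Real.pi : ℂ) * Complex.I * (ξ j : ℂ)) •
          ((ContinuousLinearMap.proj (R := ℝ) (φ := fun _ : box n N => ℂ)
          ⟨ξ, h⟩) ∘L (ContinuousLinearMap.proj (R := ℝ) (φ := fun _ : Fin n => box n N → ℂ) j)))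
        have p2 := p1.eq_zero ?_ (fun s => ?_) ht
        · simpa using p2
        · rw [hc0]
          simpa [divergence, partialD, resState] using congrFun hut.div ξ
        · have := congrFun (divergence_leray (f s + visc (A s) (liftState (c s)) -
            b (c s) • tens (liftState (c s)) (liftState (c s)))) ξ
          simp only [divergence, partialD] at this
          simpa [hGe] using this
      · simp [divergence, partialD, liftState, h]
    · by_cases h : (0 : Freq n) ∈ box n N
      · simp only [hlift t ht _ 0 h]
        have p1 := hcp.clm ((ContinuousLinearMap.proj (R := ℝ) (φ := fun _ : box n N => ℂ)
          ⟨0, h⟩) ∘L (ContinuousLinearMap.proj (R := ℝ) (φ := fun _ : Fin n => box n N → ℂ) k))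
        refine p1.eq_zero ?_ (fun s => ?_) ht
        · rw [hc0]
          exact hut.mean k
        · change G s (c s) k ⟨0, h⟩ = 0
          rw [hGe]
          simp [leray]
      · simp [liftState, h]
  · intro k ξ h
    have p1 := hcp.clm ((ContinuousLinearMap.proj (R := ℝ) (φ := fun _ : box n N => ℂ)
      ⟨ξ, h⟩) ∘L (ContinuousLinearMap.proj (R := ℝ) (φ := fun _ : Fin n => box n N → ℂ) k))
    refine ⟨p1.int.congr (ae_of_all _ fun t => hGe t (c t) k ⟨ξ, h⟩), fun t ht => ?_⟩
    refine (hlift t ht k ξ h).trans ((p1.eq t ht).trans ?_)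
    refine congrArg₂ (· + ·) (hlift 0 h0m k ξ h).symm ?_
    exact intervalIntegral.integral_congr fun s _ => hGe s (c s) k ⟨ξ, h⟩

/-! ### Differential inequalities for trigonometric polynomials -/

theorem le_toReal_mul_of_ofReal_le {x p : ℝ} {C : ℝ≥0∞} (hC : C ≠ ∞) (hp : 0 ≤ p)
    (h : ENNReal.ofReal x ≤ C * ENNReal.ofReal p) : x ≤ C.toReal * p := by
  have h1 : C * ENNReal.ofReal p = ENNReal.ofReal (C.toReal * p) := by
    rw [ENNReal.ofReal_mul ENNReal.toReal_nonneg, ENNReal.ofReal_toReal hC]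
  rw [h1] at h
  exact (ENNReal.ofReal_le_ofReal_iff (by positivity)).1 h

theorem rsq_le_of_vsq_le {n : ℕ} {B B' : Finset (Freq n)} {s a : ℝ} {F u : VDist n} {C : ℝ≥0∞}
    (hC : C ≠ ∞) (hu : SuppIn B' u) (h : vsq s F ≤ C * vsq a u) :
    rsq B s F ≤ C.toReal * rsq B' a u := by
  refine le_toReal_mul_of_ofReal_le hC (rsq_nonneg _ _ _) ?_
  rw [← vsq_eq_ofReal_rsq hu]
  exact (ofReal_rsq_le _ _ _).trans h

theorem rsq_le_of_vsq_le_mul {n : ℕ} {B B' B'' : Finset (Freq n)} {s a b : ℝ} {F u v : VDist n}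
    {C : ℝ≥0∞} (hC : C ≠ ∞) (hu : SuppIn B' u) (hv : SuppIn B'' v)
    (h : vsq s F ≤ C * (vsq a u * vsq b v)) :
    rsq B s F ≤ C.toReal * (rsq B' a u * rsq B'' b v) := by
  refine le_toReal_mul_of_ofReal_le hC (mul_nonneg (rsq_nonneg _ _ _) (rsq_nonneg _ _ _)) ?_
  rw [ENNReal.ofReal_mul (rsq_nonneg _ _ _), ← vsq_eq_ofReal_rsq hu, ← vsq_eq_ofReal_rsq hv]
  exact (ofReal_rsq_le _ _ _).trans h

theorem exists_rsq_visc_le {n : ℕ} (s : ℝ) {K : ℝ≥0∞} (hK : K ≠ ∞) : ∃ C : ℝ, 0 ≤ C ∧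
    ∀ (A : FTensor n), WienerBound |s| K A → ∀ (B B' : Finset (Freq n)) (u : VDist n), SuppIn B' u →
      rsq B (s - 1) (visc A u) ≤ C * rsq B' (s + 1) u := by
  obtain ⟨C, hC, h⟩ := vsq_visc_le (n := n) s
  refine ⟨(C * K ^ 2).toReal, ENNReal.toReal_nonneg, fun A hA B B' u hu => ?_⟩
  refine rsq_le_of_vsq_le (ENNReal.mul_ne_top hC (ENNReal.pow_ne_top hK)) hu ?_
  rw [mul_assoc]
  exact h A K u hA

theorem exists_rsq_tens_self_le {n : ℕ} (hn : 2 ≤ n) {s : ℝ} (hs : 0 ≤ s) : ∃ C : ℝ, 0 ≤ C ∧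
    ∀ (B B' : Finset (Freq n)) (u : VDist n), SuppIn B' u → rsq B (s - 1) (tens u u) ≤
      C * (rsq B' (s + 1 / 2) u * rsq B' ((n : ℝ) / 2 - 1 / 2) u) := by
  obtain ⟨C, hC, h⟩ := vsq_tens_self_tame hn hs
  exact ⟨C.toReal, ENNReal.toReal_nonneg, fun B B' u hu => rsq_le_of_vsq_le_mul hC hu hu (h u)⟩

theorem rsq_interp {n : ℕ} {B : Finset (Freq n)} {s t v : ℝ} (h : 2 * v = s + t) {u : VDist n}
    (hu : SuppIn B u) : rsq B v u ^ 2 ≤ n * (rsq B s u * rsq B t u) := by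
  have h1 := vsq_interp h u
  rw [vsq_eq_ofReal_rsq hu, vsq_eq_ofReal_rsq hu, vsq_eq_ofReal_rsq hu,
    ← ENNReal.ofReal_pow (rsq_nonneg _ _ _), ← ENNReal.ofReal_mul (rsq_nonneg _ _ _)] at h1
  simpa using le_toReal_mul_of_ofReal_le (ENNReal.natCast_ne_top n)
    (mul_nonneg (rsq_nonneg _ _ _) (rsq_nonneg _ _ _)) h1

theorem rsq_add_le {n : ℕ} (B : Finset (Freq n)) (s : ℝ) (u v : VDist n) :
    rsq B s (u + v) ≤ 2 * rsq B s u + 2 * rsq B s v := by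
  unfold rsq
  simp only [Finset.mul_sum, ← Finset.sum_add_distrib]
  refine Finset.sum_le_sum fun k _ => Finset.sum_le_sum fun ξ _ => ?_
  have h1 : ‖(u + v) k ξ‖ ^ 2 ≤ 2 * ‖u k ξ‖ ^ 2 + 2 * ‖v k ξ‖ ^ 2 := by
    have := norm_add_le (u k ξ) (v k ξ)
    have h2 : ‖u k ξ + v k ξ‖ ^ 2 ≤ (‖u k ξ‖ + ‖v k ξ‖) ^ 2 := by gcongr
    simp only [Pi.add_apply]
    nlinarith [sq_nonneg (‖u k ξ‖ - ‖v k ξ‖)]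
  have h2 := mul_le_mul_of_nonneg_left h1 (Real.rpow_nonneg (rho_pos ξ).le (2 * s))
  linarith

/-- Young's inequality for `X ≤ √(P Z)`, in squared form to avoid roots. In the application `Z` is
the dissipation. -/
theorem young_sq {X P Z D ε : ℝ} (hP : 0 ≤ P) (hZ : 0 ≤ Z) (hε : 0 < ε) (h : X ^ 2 ≤ P * Z) :
    D * X ≤ ε * Z + D ^ 2 / ε * P := by
  have h0 : 0 ≤ ε * Z + D ^ 2 / ε * P := by positivity
  refine (le_abs_self _).trans (abs_le_of_sq_le_sq ?_ h0)
  have h1 : 0 ≤ D ^ 2 := sq_nonneg D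
  have h2 : (ε * Z + D ^ 2 / ε * P) ^ 2 = (ε * Z) ^ 2 + (D ^ 2 / ε * P) ^ 2 + 2 * (D ^ 2 * (P * Z)) := by
    field_simp
    ring
  rw [h2, mul_pow]
  have h3 := mul_le_mul_of_nonneg_left h h1
  have h4 : 0 ≤ D ^ 2 * (P * Z) := by positivity
  nlinarith [sq_nonneg (ε * Z), sq_nonneg (D ^ 2 / ε * P)]

theorem suppIn_add {n : ℕ} {B : Finset (Freq n)} {u v : VDist n} (hu : SuppIn B u)
    (hv : SuppIn B v) : SuppIn B (u + v) := fun k ξ h => by simp [hu k ξ h, hv k ξ h]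

theorem suppIn_sub {n : ℕ} {B : Finset (Freq n)} {u v : VDist n} (hu : SuppIn B u)
    (hv : SuppIn B v) : SuppIn B (u - v) := fun k ξ h => by simp [hu k ξ h, hv k ξ h]

theorem suppIn_mono {n : ℕ} {B B' : Finset (Freq n)} (h : B ⊆ B') {u : VDist n} (hu : SuppIn B u) :
    SuppIn B' u := fun k ξ hξ => hu k ξ fun h' => hξ (h h')

theorem Solenoidal.sub {n : ℕ} {u v : VDist n} (hu : Solenoidal u) (hv : Solenoidal v) :
    Solenoidal (u - v) := by
  refine ⟨fun k ξ => ?_, ?_, fun k => by simp [hu.mean k, hv.mean k]⟩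
  · simp only [Pi.sub_apply, map_sub, hu.real k ξ, hv.real k ξ]
  · ext ξ
    have h1 := congrFun hu.div ξ
    have h2 := congrFun hv.div ξ
    have : divergence (u - v) ξ = divergence u ξ - divergence v ξ := by
      simp only [divergence, partialD, Pi.sub_apply, mul_sub, Finset.sum_sub_distrib]
    rw [this, h1, h2]
    simp

/-- The energy inequality at the critical level, after subtraction of the heat flow `h`. -/
theorem exists_critical_inequality {n : ℕ} (hn : 2 ≤ n) {c : ℝ} (hc : 0 < c) {K : ℝ≥0∞}
    (hK : K ≠ ∞) : ∃ C : ℝ, 0 < C ∧ ∀ A : FTensor n, Coercive c A →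
      WienerBound (1 + |(n : ℝ) / 2 - 2|) K A → ∀ (N : ℕ) (f w h : VDist n) (χ : ℝ), 0 ≤ χ → χ ≤ 1 →
      SuppIn (box n N) w → SuppIn (box n N) h → Solenoidal w →
      2 * ip (box n N) ((n : ℝ) / 2 - 1) (f + visc A (w + h) - χ • tens (w + h) (w + h) +
          fun k ξ => ((4 * Real.pi ^ 2 * freqSq ξ : ℝ) : ℂ) * h k ξ) w ≤
        -(c / 2) * rsq (box n N) ((n : ℝ) / 2) w +
        C * (rsq (box n N) ((n : ℝ) / 2) w * rsq (box n N) ((n : ℝ) / 2 - 1) w) +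
        C * rsq (box n N) ((n : ℝ) / 2 - 1) w + C * (rsq (box n N) ((n : ℝ) / 2 - 2) f +
          (rsq (box n N) ((n : ℝ) / 2 - 1) h + 1) * rsq (box n N) ((n : ℝ) / 2) h) := by
  have hn' : (2 : ℝ) ≤ n := by exact_mod_cast hn
  set s : ℝ := (n : ℝ) / 2 - 1 with hs
  have hs0 : 0 ≤ s := by linarith
  have e1 : (n : ℝ) / 2 = s + 1 := by rw [hs]; ring
  have e2 : (n : ℝ) / 2 - 2 = s - 1 := by rw [hs]; ring
  have e3 : (n : ℝ) / 2 - 1 / 2 = s + 1 / 2 := by rw [hs]; ring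
  rw [e2, e1]
  obtain ⟨C₁, hC₁, hG⟩ := garding (n := n) s hc hK
  obtain ⟨C₂, hC₂, hV⟩ := exists_rsq_visc_le (n := n) s hK
  obtain ⟨C₃, hC₃, hT⟩ := exists_rsq_tens_self_le hn hs0
  rw [e3] at hT
  -- Twice Gårding's inequality gives `-c W`. The force, the viscous term of `h`, the tensor term
  -- and the heat term cost `ε W` each, together `c/2 * W`.
  set ε : ℝ := c / 8 with hε
  have hε0 : 0 < ε := by positivity
  set C : ℝ := ε⁻¹ * (1 + C₂ + 8 * C₃ * n) + 2 * C₁ with hC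
  refine ⟨C, by positivity, fun A hco hW N f w h χ hχ0 hχ1 hw hh hws => ?_⟩
  set B := box n N
  have hsabs : |s| ≤ 1 + |s - 1| := by
    have := abs_sub_abs_le_abs_sub s (s - (s - 1))
    rw [sub_sub_cancel] at this
    norm_num at this ⊢
    linarith
  have hW0 : WienerBound 0 K A := hW.mono (by positivity)
  have hvisc : visc A (w + h) = visc A w + visc A h := by
    have := visc_sub hW0 hK (u := w + h) (v := h) ((suppIn_add hw hh).vsq_lt_top 1) (hh.vsq_lt_top 1)
    rw [add_sub_cancel_right] at this
    rw [this]
    abel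
  -- This is `-∂_t h`, the contribution of the subtracted heat flow to the equation of `w`.
  set L : VDist n := fun k ξ => ((4 * Real.pi ^ 2 * freqSq ξ : ℝ) : ℂ) * h k ξ with hL
  set TT := tens (w + h) (w + h)
  rw [hvisc, ip_add_left, ip_sub_left, ip_add_left, ip_add_left, ip_smul_left]
  have b1 := abs_ip_le B s f w hε0
  have b2 := hG A hco hW N w hw hws
  have b3 := abs_ip_le B s (visc A h) w hε0
  have b4 := abs_ip_le B s TT w hε0
  have b5 := abs_ip_le B s L w hε0
  have c3 := hV A (hW.mono hsabs) B B h hh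
  have c4 := hT B B (w + h) (suppIn_add hw hh)
  have c5 : rsq B (s - 1) L ≤ rsq B (s + 1) h := by
    unfold rsq
    refine Finset.sum_le_sum fun k _ => Finset.sum_le_sum fun ξ _ => ?_
    have hr := rho_pos ξ
    have h1 : ‖L k ξ‖ ≤ rho ξ ^ (2 : ℝ) * ‖h k ξ‖ := by
      simp only [hL]
      rw [norm_mul, Complex.norm_real,
        Real.norm_of_nonneg (by have := freqSq_nonneg ξ; positivity)]
      gcongr
      rw [Real.rpow_two, rho_sq]
      nlinarith [Real.pi_pos]
    calc _ ≤ rho ξ ^ (2 * (s - 1)) * (rho ξ ^ (2 : ℝ) * ‖h k ξ‖) ^ 2 := by gcongr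
      _ = _ := by
        rw [mul_pow, ← Real.rpow_mul_natCast hr.le, ← mul_assoc, ← Real.rpow_add hr]
        congr 2
        push_cast
        ring
  have c6 := rsq_add_le B (s + 1 / 2) w h
  have c7 := rsq_interp (v := s + 1 / 2) (s := s) (t := s + 1) (by ring) hw
  have c8 := rsq_interp (v := s + 1 / 2) (s := s) (t := s + 1) (by ring) hh
  -- The quadratic term is estimated in absolute value, without using any cancellation, so a factor
  -- `χ` in `[0,1]` does no harm.
  have hχ : -(2 * (χ * ip B s TT w)) ≤ 2 * |ip B s TT w| := by
    have h1 : |χ * ip B s TT w| ≤ 1 * |ip B s TT w| := by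
      rw [abs_mul, abs_of_nonneg hχ0]
      gcongr
    linarith [neg_abs_le (χ * ip B s TT w)]
  have g1 := le_abs_self (ip B s f w)
  have g3 := le_abs_self (ip B s (visc A h) w)
  have g5 := le_abs_self (ip B s L w)
  have n1 := rsq_nonneg B (s - 1) f
  have n2 := rsq_nonneg B s w
  have n3 := rsq_nonneg B (s + 1) w
  have n4 := rsq_nonneg B (s + 1) h
  have n5 := rsq_nonneg B s h
  have n6 := rsq_nonneg B (s + 1 / 2) (w + h)
  have n7 := rsq_nonneg B (s + 1 / 2) w
  have n8 := rsq_nonneg B (s + 1 / 2) h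
  generalize rsq B (s + 1 / 2) (w + h) = p at *
  generalize rsq B (s + 1 / 2) w = pw at *
  generalize rsq B (s + 1 / 2) h = ph at *
  generalize rsq B (s - 1) f = F at *
  generalize rsq B s w = y at *
  generalize rsq B (s + 1) w = W at *
  generalize rsq B (s + 1) h = H at *
  generalize rsq B s h = U at *
  -- At the critical level both intermediate norms are that of `H^{s+1/2}`, the midpoint between `y`
  -- and `W`. The product `y * W` is as strong as the dissipation and can be absorbed only for small
  -- `y`.
  have d4 : rsq B (s - 1) TT ≤ 8 * C₃ * n * (y * W + U * H) := by
    have q1 : p * p ≤ 8 * (n * (y * W) + n * (U * H)) := by nlinarith [sq_nonneg (pw - ph)]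
    calc _ ≤ C₃ * (p * p) := c4
      _ ≤ C₃ * (8 * (n * (y * W) + n * (U * H))) := by gcongr
      _ = _ := by ring
  have hi : 0 ≤ ε⁻¹ := (inv_pos.2 hε0).le
  have d3' := mul_le_mul_of_nonneg_left c3 hi
  have d4' := mul_le_mul_of_nonneg_left d4 hi
  have d5' := mul_le_mul_of_nonneg_left c5 hi
  have hε8 : c = 8 * ε := by rw [hε]; ring
  have r0 : 2 * (ip B s f w + (ip B s (visc A w) w + ip B s (visc A h) w) - χ * ip B s TT w +
      ip B s L w) ≤ -(c / 2) * W + 2 * C₁ * y + ε⁻¹ * F + ε⁻¹ * (C₂ * H) +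
        ε⁻¹ * (8 * C₃ * n * (y * W + U * H)) + ε⁻¹ * H := by
    rw [hε8]
    rw [hε8] at b2
    linarith
  refine r0.trans ?_
  have m1 : 0 ≤ ε⁻¹ * C₂ := by positivity
  have m2 : 0 ≤ ε⁻¹ * (8 * C₃ * n) := by positivity
  have m3 : 0 ≤ y * W := by positivity
  have m4 : 0 ≤ U * H := by positivity
  have t : C * (W * y) + C * y + C * (F + (U + 1) * H) - (2 * C₁ * y + ε⁻¹ * F + ε⁻¹ * (C₂ * H) +
        ε⁻¹ * (8 * C₃ * n * (y * W + U * H)) + ε⁻¹ * H) =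
      (ε⁻¹ + ε⁻¹ * C₂ + 2 * C₁) * (y * W) + (ε⁻¹ + ε⁻¹ * C₂ + ε⁻¹ * (8 * C₃ * n)) * y +
      (ε⁻¹ * C₂ + ε⁻¹ * (8 * C₃ * n) + 2 * C₁) * F + (ε⁻¹ + ε⁻¹ * C₂ + 2 * C₁) * (U * H) +
      (ε⁻¹ * (8 * C₃ * n) + 2 * C₁) * H := by
    rw [hC]
    ring
  have t' : 0 ≤ (ε⁻¹ + ε⁻¹ * C₂ + 2 * C₁) * (y * W) + (ε⁻¹ + ε⁻¹ * C₂ + ε⁻¹ * (8 * C₃ * n)) * y +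
      (ε⁻¹ * C₂ + ε⁻¹ * (8 * C₃ * n) + 2 * C₁) * F + (ε⁻¹ + ε⁻¹ * C₂ + 2 * C₁) * (U * H) +
      (ε⁻¹ * (8 * C₃ * n) + 2 * C₁) * H := by positivity
  linarith

/-- The energy inequality at a subcritical level. -/
theorem exists_subcritical_inequality {n : ℕ} (hn : 2 ≤ n) {r : ℝ} (hr : 0 ≤ r) {c : ℝ} (hc : 0 < c)
    {K : ℝ≥0∞} (hK : K ≠ ∞) : ∃ C : ℝ, 0 < C ∧ ∀ A : FTensor n, Coercive c A →
      WienerBound (1 + |r - 1|) K A → ∀ (N : ℕ) (f u : VDist n) (χ : ℝ), 0 ≤ χ → χ ≤ 1 →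
      SuppIn (box n N) u → Solenoidal u →
      2 * ip (box n N) r (f + visc A u - χ • tens u u) u ≤ -(c / 2) * rsq (box n N) (r + 1) u +
        C * (1 + rsq (box n N) ((n : ℝ) / 2 - 1) u * rsq (box n N) ((n : ℝ) / 2) u) *
          rsq (box n N) r u + C * rsq (box n N) (r - 1) f := by
  obtain ⟨C₁, hC₁, hG⟩ := garding (n := n) r hc hK
  obtain ⟨C₃, hC₃, hT⟩ := exists_rsq_tens_self_le hn hr
  -- Three terms `ε Z` are spent, one for the force and two for the tensor term; `4 ε` is half of
  -- the dissipation `c Z`.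
  set ε : ℝ := c / 8 with hε
  have hε0 : 0 < ε := by positivity
  set D : ℝ := (ε⁻¹ * C₃) ^ 2 / ε * n ^ 2 with hD
  have hD0 : 0 ≤ D := by positivity
  set C : ℝ := ε⁻¹ + 2 * C₁ + D with hC
  refine ⟨C, by positivity, fun A hco hW N f u χ hχ0 hχ1 hu hus => ?_⟩
  set B := box n N
  rw [ip_sub_left, ip_add_left, ip_smul_left]
  have b1 := abs_ip_le B r f u hε0
  have b2 := hG A hco hW N u hu hus
  have b4 := abs_ip_le B r (tens u u) u hε0
  have c4 := hT B B u hu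
  have c7 := rsq_interp (v := r + 1 / 2) (s := r) (t := r + 1) (by ring) hu
  have c8 := rsq_interp (v := (n : ℝ) / 2 - 1 / 2) (s := (n : ℝ) / 2 - 1) (t := (n : ℝ) / 2)
    (by ring) hu
  have hχ : -(2 * (χ * ip B r (tens u u) u)) ≤ 2 * |ip B r (tens u u) u| := by
    have h1 : |χ * ip B r (tens u u) u| ≤ 1 * |ip B r (tens u u) u| := by
      rw [abs_mul, abs_of_nonneg hχ0]
      gcongr
    linarith [neg_abs_le (χ * ip B r (tens u u) u)]
  have g1 := le_abs_self (ip B r f u)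
  have n1 := rsq_nonneg B (r - 1) f
  have n2 := rsq_nonneg B r u
  have n3 := rsq_nonneg B (r + 1) u
  have n4 := rsq_nonneg B ((n : ℝ) / 2) u
  have n5 := rsq_nonneg B ((n : ℝ) / 2 - 1) u
  have n6 := rsq_nonneg B (r + 1 / 2) u
  have n7 := rsq_nonneg B ((n : ℝ) / 2 - 1 / 2) u
  generalize rsq B (r + 1 / 2) u = P at *
  generalize rsq B ((n : ℝ) / 2 - 1 / 2) u = Q at *
  generalize rsq B ((n : ℝ) / 2 - 1) u = Y at *
  generalize rsq B ((n : ℝ) / 2) u = V at *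
  generalize rsq B (r + 1) u = Z at *
  generalize rsq B r u = z at *
  generalize rsq B (r - 1) f = F at *
  -- Interpolating `P` between `z` and `Z`, and `Q` between `Y` and `V`, leaves only the power `1/2`
  -- of the top norm `Z` in `P * Q`. After Young's inequality the rest is linear in `z` with the
  -- coefficient `Y * V`, which the critical bound makes integrable in time.
  have hX : (P * Q) ^ 2 ≤ ((n : ℝ) ^ 2 * (z * (Y * V))) * Z := by
    calc (P * Q) ^ 2 = P ^ 2 * Q ^ 2 := by ring
      _ ≤ (n * (z * Z)) * (n * (Y * V)) := by gcongr
      _ = _ := by ring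
  have hy := young_sq (D := ε⁻¹ * C₃) (by positivity) n3 hε0 hX
  have d4 := mul_le_mul_of_nonneg_left c4 (inv_pos.2 hε0).le
  have hε8 : c = 8 * ε := by rw [hε]; ring
  have hy' : ε⁻¹ * (C₃ * (P * Q)) ≤ ε * Z + D * (z * (Y * V)) := by
    calc _ = ε⁻¹ * C₃ * (P * Q) := by ring
      _ ≤ _ := hy
      _ = _ := by rw [hD]; ring
  have r0 : 2 * (ip B r f u + ip B r (visc A u) u - χ * ip B r (tens u u) u) ≤
      -(c / 2) * Z + 2 * C₁ * z + ε⁻¹ * F + D * (z * (Y * V)) := by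
    rw [hε8]
    rw [hε8] at b2
    linarith [mul_nonneg hε0.le n3]
  refine r0.trans ?_
  have hi : 0 < ε⁻¹ := inv_pos.2 hε0
  have t : C * (1 + Y * V) * z + C * F - (2 * C₁ * z + ε⁻¹ * F + D * (z * (Y * V))) =
      (ε⁻¹ + D) * z + (ε⁻¹ + 2 * C₁) * (z * (Y * V)) + (2 * C₁ + D) * F := by rw [hC]; ring
  have t' : 0 ≤ (ε⁻¹ + D) * z + (ε⁻¹ + 2 * C₁) * (z * (Y * V)) + (2 * C₁ + D) * F := by positivity
  linarith

/-! ### A priori estimates for the Galerkin approximations -/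

instance (T : ℝ) : IsFiniteMeasure (timeMeasure T) := by
  unfold timeMeasure
  infer_instance

theorem integrable_of_continuousOn_Icc {E : Type*} [NormedAddCommGroup E] {T : ℝ} {g : ℝ → E}
    (h : ContinuousOn g (Icc 0 T)) : Integrable g (timeMeasure T) :=
  (h.integrableOn_Icc).mono_set Ioo_subset_Icc_self

theorem integral_add_time {T : ℝ} {g h : ℝ → ℝ} (hg : Integrable g (timeMeasure T))
    (hh : Integrable h (timeMeasure T)) :
    ∫ t in Ioo 0 T, (g t + h t) = (∫ t in Ioo 0 T, g t) + ∫ t in Ioo 0 T, h t :=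
  integral_add hg hh

theorem continuousOn_rsq {n : ℕ} {S : Set ℝ} (B : Finset (Freq n)) (s : ℝ) {u : ℝ → VDist n}
    (h : ∀ k, ∀ ξ ∈ B, ContinuousOn (fun t => u t k ξ) S) :
    ContinuousOn (fun t => rsq B s (u t)) S := by
  unfold rsq
  exact continuousOn_finsetSum _ fun k _ => continuousOn_finsetSum _ fun ξ hξ =>
    ((h k ξ hξ).norm.pow 2).const_mul _

/-- Grönwall's inequality, discarding the dissipation, bounds `y`; the integrated inequality with
this bound inserted then controls the dissipation. -/
theorem IsPrim.energy {T κ : ℝ} (hT : 0 ≤ T) {y g b h Z : ℝ → ℝ} (hy : IsPrim T y g)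
    (hb : Integrable b (timeMeasure T)) (hh : Integrable h (timeMeasure T))
    (hZ : Integrable Z (timeMeasure T)) (hb0 : ∀ᵐ t ∂(timeMeasure T), 0 ≤ b t)
    (hh0 : ∀ᵐ t ∂(timeMeasure T), 0 ≤ h t) (hZ0 : ∀ t, 0 ≤ Z t) (hκ : 0 ≤ κ)
    (hy0 : ∀ t, 0 ≤ y t) (hg : ∀ᵐ t ∂(timeMeasure T), g t ≤ -κ * Z t + b t * y t + h t) :
    (∀ t ∈ Icc 0 T, y t ≤ (y 0 + ∫ s in Ioo 0 T, h s) * Real.exp (∫ s in Ioo 0 T, b s)) ∧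
      κ * ∫ s in Ioo 0 T, Z s ≤ ((y 0 + ∫ s in Ioo 0 T, h s) * Real.exp (∫ s in Ioo 0 T, b s)) *
        (1 + ∫ s in Ioo 0 T, b s) := by
  have h1 : ∀ t ∈ Icc 0 T,
      y t ≤ (y 0 + ∫ s in Ioo 0 T, h s) * Real.exp (∫ s in Ioo 0 T, b s) := fun t ht =>
    hy.gronwall hb hh hb0 hh0 (hy0 0) (hg.mono fun t ht => by nlinarith [mul_nonneg hκ (hZ0 t)]) ht
  refine ⟨h1, ?_⟩
  set E := (y 0 + ∫ s in Ioo 0 T, h s) * Real.exp (∫ s in Ioo 0 T, b s) with hE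
  have hTm : T ∈ Icc 0 T := right_mem_Icc.2 hT
  have hb1 : 0 ≤ ∫ s in Ioo 0 T, b s := integral_nonneg_of_ae hb0
  have hh1 : 0 ≤ ∫ s in Ioo 0 T, h s := integral_nonneg_of_ae hh0
  have hEl : y 0 + ∫ s in Ioo 0 T, h s ≤ E :=
    le_mul_of_one_le_right (by linarith [hy0 0]) (Real.one_le_exp hb1)
  have h2 := hy.eq T hTm
  have h3 : ∫ s in 0..T, g s ≤ ∫ s in 0..T, (-κ * Z s + E * b s + h s) := by
    refine intervalIntegral_mono_time hy.int (((hZ.const_mul _).add (hb.const_mul _)).add hh) ?_ hTm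
    filter_upwards [hg, hb0, ae_restrict_mem measurableSet_Ioo] with t h4 h5 h6
    have := mul_le_mul_of_nonneg_left (h1 t (Ioo_subset_Icc_self h6)) h5
    linarith
  have h4 : ∫ s in 0..T, (-κ * Z s + E * b s + h s) = -κ * (∫ s in Ioo 0 T, Z s) +
      E * (∫ s in Ioo 0 T, b s) + ∫ s in Ioo 0 T, h s := by
    rw [intervalIntegral_eq_Ioo hT,
      integral_add_time (g := fun s => -κ * Z s + E * b s) ((hZ.const_mul _).add (hb.const_mul _)) hh,
      integral_add_time (hZ.const_mul _) (hb.const_mul _), integral_const_mul, integral_const_mul]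
  have h5 := hy0 T
  nlinarith

/-- The hypotheses on the Fourier coefficients of the viscosity tensor. -/
structure ViscData {n : ℕ} (T c m : ℝ) (K : ℝ≥0∞) (A : ℝ → FTensor n) : Prop where
  pos : 0 < c
  fin : K ≠ ∞
  meas : ∀ i j α β ξ, AEMeasurable (fun t => A t i j α β ξ) (timeMeasure T)
  real : ∀ t i j α β, IsRealDist (A t i j α β)
  wiener : ∀ᵐ t ∂(timeMeasure T), WienerBound m K (A t)
  coercive : ∀ᵐ t ∂(timeMeasure T), Coercive c (A t)

/-- `u` is the Galerkin approximation with frequencies in `box n N` and cutoff factor `χ`. -/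
structure Galerkin {n : ℕ} (T : ℝ) (A : ℝ → FTensor n) (f : ℝ → VDist n) (u₀ : VDist n) (N : ℕ)
    (χ : ℝ → ℝ) (u : ℝ → VDist n) : Prop where
  chi : ∀ t, 0 ≤ χ t ∧ χ t ≤ 1
  init : u 0 = trunc (box n N) u₀
  supp : ∀ t, SuppIn (box n N) (u t)
  sol : ∀ t ∈ Icc 0 T, Solenoidal (u t)
  prim : ∀ k, ∀ ξ ∈ box n N, IsPrim T (fun t => u t k ξ) fun t =>
    leray (f t + visc (A t) (u t) - χ t • tens (u t) (u t)) k ξ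

theorem Solenoidal.heat {n : ℕ} {u : VDist n} (h : Solenoidal u) (t : ℝ) :
    Solenoidal (heat u t) := by
  refine ⟨fun k ξ => ?_, ?_, fun k => by simp [PeriodicNS.heat, h.mean k]⟩
  · simp only [PeriodicNS.heat, freqSq_neg, h.real k ξ, map_mul, Complex.conj_ofReal]
  · ext ξ
    have h1 := Solenoidal.sum_mul_eq_zero h.div ξ
    calc divergence (PeriodicNS.heat u t) ξ = (2 * (Real.pi : ℂ) * Complex.I) *
          (Real.exp (-(4 * Real.pi ^ 2 * freqSq ξ) * t) : ℂ) * ∑ j, (ξ j : ℂ) * u j ξ := by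
          rw [Finset.mul_sum]
          exact Finset.sum_congr rfl fun j _ => by unfold partialD PeriodicNS.heat; ring
      _ = 0 := by rw [h1, mul_zero]

theorem isPrim_heat {n : ℕ} (T : ℝ) (u : VDist n) (k : Fin n) (ξ : Freq n) :
    IsPrim T (fun t => heat u t k ξ)
      (fun t => -(((4 * Real.pi ^ 2 * freqSq ξ : ℝ) : ℂ) * heat u t k ξ)) := by
  set l : ℝ := 4 * Real.pi ^ 2 * freqSq ξ with hl
  have hc : Continuous fun t => -((l : ℂ) * heat u t k ξ) := by
    unfold heat
    fun_prop
  have hd : ∀ t, HasDerivAt (fun t => heat u t k ξ) (-((l : ℂ) * heat u t k ξ)) t := by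
    intro t
    have h1 : HasDerivAt (fun t : ℝ => Real.exp (-l * t)) (Real.exp (-l * t) * (-l * 1)) t :=
      ((hasDerivAt_id t).const_mul (-l)).exp
    refine ((h1.ofReal_comp).const_mul (u k ξ)).congr_deriv ?_
    change _ = -((l : ℂ) * (u k ξ * (Real.exp (-l * t) : ℂ)))
    push_cast
    ring
  refine ⟨integrable_of_continuousOn_Icc hc.continuousOn, fun t _ => ?_⟩
  rw [intervalIntegral.integral_eq_sub_of_hasDerivAt (fun x _ => hd x) (hc.intervalIntegrable _ _)]
  ring

theorem rsq_heat_le {n : ℕ} (B : Finset (Freq n)) (s : ℝ) (u : VDist n) {t : ℝ} (ht : 0 ≤ t) :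
    rsq B s (heat u t) ≤ rsq B s u := by
  unfold rsq
  refine Finset.sum_le_sum fun k _ => Finset.sum_le_sum fun ξ _ => ?_
  have hr := rho_pos ξ
  have h1 : ‖heat u t k ξ‖ ≤ ‖u k ξ‖ := by
    simp only [heat, norm_mul, Complex.norm_real, Real.norm_of_nonneg (Real.exp_pos _).le]
    refine mul_le_of_le_one_right (norm_nonneg _) (Real.exp_le_one_iff.2 ?_)
    have := freqSq_nonneg ξ
    rw [neg_mul, neg_nonpos]
    positivity
  gcongr

theorem rsq_trunc {n : ℕ} (B : Finset (Freq n)) (s : ℝ) (u : VDist n) :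
    rsq B s (trunc B u) = rsq B s u := by
  unfold rsq
  exact Finset.sum_congr rfl fun k _ => Finset.sum_congr rfl fun ξ hξ => by simp [trunc, hξ]

/-- A continuity argument for `y = ‖u - Ku⁰‖²` in `H^{n/2-1}`, which is zero at `t = 0`. Subtracting
the heat flow is what lets `u⁰` be large: the data enter only through time integrals, which a short
interval makes small. The bound `D` does not depend on `N` or on the cutoff. -/
theorem exists_critical_bound {n : ℕ} (hn : 2 ≤ n) (T : ℝ) {c : ℝ} (hc : 0 < c) {K : ℝ≥0∞}
    (hK : K ≠ ∞) : ∃ A₃ : ℝ, 0 < A₃ ∧ ∀ Ts, 0 < Ts → Ts ≤ T → ∀ (A : ℝ → FTensor n)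
      (f : ℝ → VDist n), ViscData Ts c (1 + |(n : ℝ) / 2 - 2|) K A → ∀ u₀ : VDist n, Solenoidal u₀ →
      ∀ (F H : ℝ → ℝ) (U : ℝ), Integrable F (timeMeasure Ts) → Integrable H (timeMeasure Ts) →
      (∀ᵐ t ∂(timeMeasure Ts), ∀ N, rsq (box n N) ((n : ℝ) / 2 - 2) (f t) ≤ F t) →
      (∀ᵐ t ∂(timeMeasure Ts), ∀ N, rsq (box n N) ((n : ℝ) / 2) (heat u₀ t) ≤ H t) →
      (∀ N, rsq (box n N) ((n : ℝ) / 2 - 1) u₀ ≤ U) →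
      (∫ t in Ioo 0 Ts, F t) + (U + 1) * (∫ t in Ioo 0 Ts, H t) < A₃ →
      ∃ D : ℝ, ∀ N χ u, Galerkin Ts A f u₀ N χ u →
        (∀ t ∈ Icc 0 Ts, rsq (box n N) ((n : ℝ) / 2 - 1) (u t) ≤ D) ∧
        ∫ t in Ioo 0 Ts, rsq (box n N) ((n : ℝ) / 2) (u t) ≤ D := by
  obtain ⟨C, hC, hineq⟩ := exists_critical_inequality hn hc hK
  -- Below this threshold `C W y ≤ (c/4) W`, half of the available dissipation.
  set δ : ℝ := c / (4 * C) with hδ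
  have hδ0 : 0 < δ := by positivity
  -- With this `A₃`, Grönwall's bound `C Q exp(C T)` stays strictly below `δ`.
  refine ⟨δ / (C * Real.exp (C * T)), by positivity, fun Ts hTs hTsT A f hA u₀ hu₀ F H U hF hH hFb hHb hU
    hsmall => ?_⟩
  set Q : ℝ := (∫ t in Ioo 0 Ts, F t) + (U + 1) * (∫ t in Ioo 0 Ts, H t) with hQ
  set s : ℝ := (n : ℝ) / 2 - 1 with hs
  have hU0 : 0 ≤ U := (rsq_nonneg (box n 0) s u₀).trans (hU 0)
  have hF0 : ∀ᵐ t ∂(timeMeasure Ts), 0 ≤ F t := hFb.mono fun t ht => (rsq_nonneg _ _ _).trans (ht 0)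
  have hH0 : ∀ᵐ t ∂(timeMeasure Ts), 0 ≤ H t := hHb.mono fun t ht => (rsq_nonneg _ _ _).trans (ht 0)
  have hQ1 : C * Q * Real.exp (C * T) < δ := by
    rw [lt_div_iff₀ (by positivity)] at hsmall
    linarith
  have hQ0 : 0 ≤ Q := add_nonneg (integral_nonneg_of_ae hF0)
    (mul_nonneg (by linarith) (integral_nonneg_of_ae hH0))
  set g : ℝ → ℝ := fun t => C * (F t + (U + 1) * H t) with hg
  have hgi : Integrable g (timeMeasure Ts) := (hF.add (hH.const_mul _)).const_mul _
  have hg0 : ∀ᵐ t ∂(timeMeasure Ts), 0 ≤ g t := by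
    filter_upwards [hF0, hH0] with t h1 h2
    simp only [hg]
    positivity
  have hgQ : ∫ t in Ioo 0 Ts, g t = C * Q := by
    simp only [hg]
    rw [integral_const_mul, integral_add_time hF (hH.const_mul _), integral_const_mul]
  refine ⟨max (2 * δ + 2 * U)
    (2 * ((C * Q * Real.exp (C * Ts)) * (1 + C * Ts) / (c / 4)) + 2 * ∫ t in Ioo 0 Ts, H t),
    fun N χ u hu => ?_⟩
  set B := box n N
  set h : ℝ → VDist n := fun t => trunc B (heat u₀ t) with hh
  set w : ℝ → VDist n := fun t => u t - h t with hw
  have hwh : ∀ t, w t + h t = u t := fun t => by simp [hw]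
  have hhs : ∀ t, SuppIn B (h t) := fun t => suppIn_trunc _ _
  have hws : ∀ t, SuppIn B (w t) := fun t => suppIn_sub (hu.supp t) (hhs t)
  have hwsol : ∀ t ∈ Icc 0 Ts, Solenoidal (w t) := fun t ht =>
    (hu.sol t ht).sub ((hu₀.heat t).trunc N)
  have hprim : ∀ k, ∀ ξ ∈ B, IsPrim Ts (fun t => w t k ξ) (fun t =>
      (leray (f t + visc (A t) (u t) - χ t • tens (u t) (u t)) +
        fun k ξ => ((4 * Real.pi ^ 2 * freqSq ξ : ℝ) : ℂ) * h t k ξ) k ξ) := by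
    intro k ξ hξ
    have := (hu.prim k ξ hξ).sub (isPrim_heat Ts u₀ k ξ)
    simpa [hw, hh, trunc, hξ] using this
  have hcont : ∀ a, Integrable (fun t => rsq B a (w t)) (timeMeasure Ts) := fun a =>
    integrable_of_continuousOn_Icc (continuousOn_rsq B a fun k ξ hξ => (hprim k ξ hξ).continuousOn)
  have hy := IsPrim.rsq B s hprim
  set y : ℝ → ℝ := fun t => rsq B s (w t) with hyd
  have hy0 : ∀ t, 0 ≤ y t := fun t => rsq_nonneg _ _ _
  have hyz : y 0 = 0 := by
    have : w 0 = 0 := by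
      simp only [hw, hh, hu.init]
      have : heat u₀ 0 = u₀ := by ext; simp [heat]
      rw [this, sub_self]
    simp [hyd, this, rsq]
  have hder : ∀ᵐ t ∂(timeMeasure Ts), 2 * ip B s (leray (f t + visc (A t) (u t) -
      χ t • tens (u t) (u t)) + fun k ξ => ((4 * Real.pi ^ 2 * freqSq ξ : ℝ) : ℂ) * h t k ξ) (w t) ≤
      -(c / 2) * rsq B ((n : ℝ) / 2) (w t) + C * (rsq B ((n : ℝ) / 2) (w t) * y t) +
        C * y t + g t := by
    filter_upwards [hA.wiener, hA.coercive, hFb, hHb, ae_restrict_mem measurableSet_Ioo]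
      with t h1 h2 h3 h4 h5
    have hsol := hwsol t (Ioo_subset_Icc_self h5)
    have h6 := hineq (A t) h2 h1 N (f t) (w t) (h t) (χ t) (hu.chi t).1 (hu.chi t).2 (hws t) (hhs t)
      hsol
    rw [ip_add_left, ip_leray B s _ hsol.div hsol.mean, ← ip_add_left]
    rw [hwh] at h6
    have e1 : rsq B ((n : ℝ) / 2) (h t) ≤ H t := by
      rw [hh, rsq_trunc]
      exact h4 N
    have e2 : rsq B s (h t) ≤ U := by
      rw [hh, rsq_trunc]
      exact (rsq_heat_le B s u₀ h5.1.le).trans (hU N)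
    have e3 := h3 N
    have e4 : (rsq B s (h t) + 1) * rsq B ((n : ℝ) / 2) (h t) ≤ (U + 1) * H t := by
      have := rsq_nonneg B ((n : ℝ) / 2) (h t)
      gcongr
    refine h6.trans ?_
    simp only [hg, hyd]
    gcongr
  -- If `y` reached `δ`, there would be a first such time `t`, by compactness. Up to `t` the bad
  -- term is absorbed, and Grönwall's inequality gives `y t < δ`, a contradiction.
  have hlt : ∀ t ∈ Icc 0 Ts, y t < δ := by
    by_contra hcon
    push Not at hcon
    have hcomp : IsCompact (Icc 0 Ts ∩ y ⁻¹' Ici δ) :=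
      isCompact_Icc.of_isClosed_subset
        (hy.continuousOn.preimage_isClosed_of_isClosed isClosed_Icc isClosed_Ici) inter_subset_left
    obtain ⟨t, ht⟩ := hcomp.exists_isLeast (by
      obtain ⟨t, ht, h1⟩ := hcon
      exact ⟨t, ht, h1⟩)
    have htm := ht.1.1
    have hm : timeMeasure t ≤ timeMeasure Ts :=
      Measure.restrict_mono (Ioo_subset_Ioo_right htm.2) le_rfl
    have hgr := (hy.mono htm.2).gronwall (b := fun _ => C) (h := g) (integrable_const C)
      (hgi.mono_measure hm) (ae_of_all _ fun _ => hC.le) (ae_mono hm hg0) (hy0 0) (by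
        filter_upwards [ae_mono hm hder, ae_restrict_mem measurableSet_Ioo] with x h1 h2
        refine h1.trans ?_
        have h3 : y x < δ := by
          by_contra h4
          exact absurd (ht.2 ⟨⟨h2.1.le, h2.2.le.trans htm.2⟩, not_lt.1 h4⟩) (not_le.2 h2.2)
        have h4 := rsq_nonneg B ((n : ℝ) / 2) (w x)
        have h5 : C * (rsq B ((n : ℝ) / 2) (w x) * y x) ≤ c / 4 * rsq B ((n : ℝ) / 2) (w x) := by
          have : C * δ = c / 4 := by rw [hδ]; field_simp
          rw [← this]
          calc _ = C * y x * rsq B ((n : ℝ) / 2) (w x) := by ring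
            _ ≤ _ := by gcongr
        nlinarith) (t := t) ⟨htm.1, le_rfl⟩
    have h1 : δ ≤ y t := ht.1.2
    rw [hyz, zero_add] at hgr
    have h2 : ∫ x in Ioo 0 t, g x ≤ C * Q := by
      rw [← hgQ]
      exact setIntegral_mono_set hgi hg0 (Ioo_subset_Ioo_right htm.2).eventuallyLE
    have h3 : ∫ x in Ioo 0 t, C = C * t := by
      simp [htm.1]
      ring
    rw [h3] at hgr
    have h4 : Real.exp (C * t) ≤ Real.exp (C * T) :=
      Real.exp_le_exp.2 (mul_le_mul_of_nonneg_left (htm.2.trans hTsT) hC.le)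
    have h5 : (∫ x in Ioo 0 t, g x) * Real.exp (C * t) ≤ C * Q * Real.exp (C * T) := by
      gcongr
    linarith
  -- Now that `y < δ` on the whole interval, `c/4` of the dissipation is left and can be integrated.
  obtain ⟨-, hen⟩ := hy.energy hTs.le (κ := c / 4) (b := fun _ => C) (h := g)
    (Z := fun t => rsq B ((n : ℝ) / 2) (w t)) (integrable_const C) hgi (hcont _)
    (ae_of_all _ fun _ => hC.le) hg0 (fun t => rsq_nonneg _ _ _) (by positivity) hy0 (by
      filter_upwards [hder, ae_restrict_mem measurableSet_Ioo] with x h1 h2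
      refine h1.trans ?_
      have h3 := hlt x (Ioo_subset_Icc_self h2)
      have h4 := rsq_nonneg B ((n : ℝ) / 2) (w x)
      have h5 : C * (rsq B ((n : ℝ) / 2) (w x) * y x) ≤ c / 4 * rsq B ((n : ℝ) / 2) (w x) := by
        have : C * δ = c / 4 := by rw [hδ]; field_simp
        rw [← this]
        calc _ = C * y x * rsq B ((n : ℝ) / 2) (w x) := by ring
          _ ≤ _ := by gcongr
      linarith)
  rw [hyz, zero_add, hgQ] at hen
  have h3 : ∫ x in Ioo 0 Ts, C = C * Ts := by
    simp [hTs.le]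
    ring
  rw [h3] at hen
  constructor
  · intro t ht
    refine le_max_of_le_left ?_
    rw [← hwh t]
    refine (rsq_add_le B s (w t) (h t)).trans ?_
    have e2 : rsq B s (h t) ≤ U := by
      rw [hh, rsq_trunc]
      exact (rsq_heat_le B s u₀ ht.1).trans (hU N)
    have := hlt t ht
    simp only [hyd] at this
    linarith
  · refine le_max_of_le_right ?_
    have hui : Integrable (fun t => rsq B ((n : ℝ) / 2) (u t)) (timeMeasure Ts) :=
      integrable_of_continuousOn_Icc (continuousOn_rsq B _ fun k ξ hξ =>
        (hu.prim k ξ hξ).continuousOn)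
    calc ∫ t in Ioo 0 Ts, rsq B ((n : ℝ) / 2) (u t) ≤
          ∫ t in Ioo 0 Ts, (2 * rsq B ((n : ℝ) / 2) (w t) + 2 * H t) := by
          refine integral_mono_ae hui (((hcont _).const_mul _).add (hH.const_mul _)) ?_
          filter_upwards [hHb] with t ht
          rw [← hwh t]
          refine (rsq_add_le B _ (w t) (h t)).trans ?_
          have e1 : rsq B ((n : ℝ) / 2) (h t) ≤ H t := by
            rw [hh, rsq_trunc]
            exact ht N
          linarith
      _ = 2 * (∫ t in Ioo 0 Ts, rsq B ((n : ℝ) / 2) (w t)) + 2 * ∫ t in Ioo 0 Ts, H t := by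
          rw [integral_add_time ((hcont _).const_mul _) (hH.const_mul _), integral_const_mul,
            integral_const_mul]
      _ ≤ _ := by
          gcongr
          rw [le_div_iff₀ (by positivity)]
          linarith

/-- The critical bound `D` turns the Grönwall coefficient into `C (1 + D V)` with `∫ V ≤ D`. Hence
the bound in `H^r` needs no smallness, and it is again independent of `N` and `χ`. -/
theorem exists_subcritical_bound {n : ℕ} (hn : 2 ≤ n) {r : ℝ} (hr : 0 ≤ r) {Ts c : ℝ} {K : ℝ≥0∞}
    (hTs : 0 < Ts) {A : ℝ → FTensor n} {f : ℝ → VDist n} (hA : ViscData Ts c (1 + |r - 1|) K A)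
    {u₀ : VDist n} {F : ℝ → ℝ} {U D : ℝ} (hF : Integrable F (timeMeasure Ts))
    (hFb : ∀ᵐ t ∂(timeMeasure Ts), ∀ N, rsq (box n N) (r - 1) (f t) ≤ F t)
    (hU : ∀ N, rsq (box n N) r u₀ ≤ U) : ∃ D' : ℝ, ∀ N χ u, Galerkin Ts A f u₀ N χ u →
      (∀ t ∈ Icc 0 Ts, rsq (box n N) ((n : ℝ) / 2 - 1) (u t) ≤ D) →
      ∫ t in Ioo 0 Ts, rsq (box n N) ((n : ℝ) / 2) (u t) ≤ D →
      (∀ t ∈ Icc 0 Ts, rsq (box n N) r (u t) ≤ D') ∧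
        ∫ t in Ioo 0 Ts, rsq (box n N) (r + 1) (u t) ≤ D' := by
  have hc := hA.pos
  obtain ⟨C, hC, hineq⟩ := exists_subcritical_inequality hn hr hA.pos hA.fin
  have hF0 : ∀ᵐ t ∂(timeMeasure Ts), 0 ≤ F t := hFb.mono fun t ht => (rsq_nonneg _ _ _).trans (ht 0)
  have hFi : 0 ≤ ∫ t in Ioo 0 Ts, F t := integral_nonneg_of_ae hF0
  have hU0 : 0 ≤ U := (rsq_nonneg (box n 0) r u₀).trans (hU 0)
  set E : ℝ := (U + C * ∫ t in Ioo 0 Ts, F t) * Real.exp (C * (Ts + D * D)) with hE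
  refine ⟨max E (E * (1 + C * (Ts + D * D)) / (c / 2)), fun N χ u hu hD1 hD2 => ?_⟩
  set B := box n N
  have hD0 : 0 ≤ D := (rsq_nonneg B _ (u 0)).trans (hD1 0 (left_mem_Icc.2 hTs.le))
  have hcont : ∀ a, Integrable (fun t => rsq B a (u t)) (timeMeasure Ts) := fun a =>
    integrable_of_continuousOn_Icc (continuousOn_rsq B a fun k ξ hξ => (hu.prim k ξ hξ).continuousOn)
  have hy := IsPrim.rsq B r hu.prim
  have hb : Integrable (fun t => C * (1 + D * rsq B ((n : ℝ) / 2) (u t))) (timeMeasure Ts) :=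
    ((integrable_const 1).add ((hcont _).const_mul D)).const_mul C
  have hbi : ∫ t in Ioo 0 Ts, C * (1 + D * rsq B ((n : ℝ) / 2) (u t)) ≤ C * (Ts + D * D) := by
    rw [integral_const_mul, integral_add_time (integrable_const (1 : ℝ))
      ((hcont _).const_mul D), integral_const_mul]
    gcongr
    simp [hTs.le]
  have hbn : ∀ t, 0 ≤ C * (1 + D * rsq B ((n : ℝ) / 2) (u t)) := fun t => by
    have := rsq_nonneg B ((n : ℝ) / 2) (u t)
    positivity
  obtain ⟨h1, h2⟩ := hy.energy hTs.le (κ := c / 2) (h := fun t => C * F t)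
    (Z := fun t => rsq B (r + 1) (u t)) hb (hF.const_mul C) (hcont _) (ae_of_all _ hbn)
    (hF0.mono fun t ht => by positivity) (fun t => rsq_nonneg _ _ _) (by positivity)
    (fun t => rsq_nonneg _ _ _) (by
      filter_upwards [hA.wiener, hA.coercive, hFb, ae_restrict_mem measurableSet_Ioo]
        with t h1 h2 h3 h5
      have hsol := hu.sol t (Ioo_subset_Icc_self h5)
      have h6 := hineq (A t) h2 h1 N (f t) (u t) (χ t) (hu.chi t).1 (hu.chi t).2 (hu.supp t) hsol
      rw [ip_leray B r _ hsol.div hsol.mean]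
      have n1 := rsq_nonneg B ((n : ℝ) / 2) (u t)
      have n2 := rsq_nonneg B r (u t)
      have n3 := hD1 t (Ioo_subset_Icc_self h5)
      refine h6.trans ?_
      gcongr
      exact h3 N)
  have e0 : rsq B r (u 0) = rsq B r u₀ := by
    rw [hu.init]
    exact rsq_trunc _ _ _
  simp only [e0] at h1 h2
  rw [integral_const_mul] at h1 h2
  have hE1 : (rsq B r u₀ + C * ∫ t in Ioo 0 Ts, F t) *
      Real.exp (∫ t in Ioo 0 Ts, C * (1 + D * rsq B ((n : ℝ) / 2) (u t))) ≤ E := by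
    rw [hE]
    have := hU N
    gcongr
  have hE0 : 0 ≤ E := by positivity
  refine ⟨fun t ht => le_max_of_le_left ((h1 t ht).trans hE1), le_max_of_le_right ?_⟩
  rw [le_div_iff₀ (by positivity), _root_.mul_comm]
  refine h2.trans ?_
  have hb0 : 0 ≤ ∫ t in Ioo 0 Ts, C * (1 + D * rsq B ((n : ℝ) / 2) (u t)) :=
    integral_nonneg hbn
  gcongr

/-- A bounded Galerkin approximation of the full system. -/
structure Approx {n : ℕ} (T : ℝ) (A : ℝ → FTensor n) (f : ℝ → VDist n) (u₀ : VDist n) (r D : ℝ)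
    (N : ℕ) (u : ℝ → VDist n) : Prop where
  init : u 0 = trunc (box n N) u₀
  supp : ∀ t, SuppIn (box n N) (u t)
  sol : ∀ t ∈ Icc 0 T, Solenoidal (u t)
  prim : ∀ k, ∀ ξ ∈ box n N, IsPrim T (fun t => u t k ξ) fun t =>
    leray (f t + visc (A t) (u t) - tens (u t) (u t)) k ξ
  bound : ∀ t ∈ Icc 0 T, rsq (box n N) r (u t) ≤ D
  bound_int : ∫ t in Ioo 0 T, rsq (box n N) (r + 1) (u t) ≤ D

theorem norm_sq_le_rsq {n : ℕ} {B : Finset (Freq n)} {s : ℝ} (hs : 0 ≤ s) (u : VDist n) (k : Fin n)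
    {ξ : Freq n} (hξ : ξ ∈ B) : ‖u k ξ‖ ^ 2 ≤ rsq B s u := by
  have h0 : ∀ k ξ, 0 ≤ rho ξ ^ (2 * s) * ‖u k ξ‖ ^ 2 := fun k ξ =>
    mul_nonneg (Real.rpow_nonneg (rho_pos ξ).le _) (sq_nonneg _)
  calc ‖u k ξ‖ ^ 2 ≤ rho ξ ^ (2 * s) * ‖u k ξ‖ ^ 2 :=
        le_mul_of_one_le_left (sq_nonneg _) (Real.one_le_rpow (one_le_rho ξ) (by linarith))
    _ ≤ ∑ ξ ∈ B, rho ξ ^ (2 * s) * ‖u k ξ‖ ^ 2 :=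
        Finset.single_le_sum (f := fun ξ => rho ξ ^ (2 * s) * ‖u k ξ‖ ^ 2) (fun ξ _ => h0 k ξ) hξ
    _ ≤ _ := Finset.single_le_sum (f := fun k => ∑ ξ ∈ B, rho ξ ^ (2 * s) * ‖u k ξ‖ ^ 2)
        (fun k _ => Finset.sum_nonneg fun ξ _ => h0 k ξ) (Finset.mem_univ k)

/-- The order of the quantifiers matters: `A₃` is fixed at the critical level, before the tensor and
`r` are known. -/
theorem exists_approx {n : ℕ} (hn : 2 ≤ n) (T : ℝ) {c : ℝ} (hc : 0 < c) {K : ℝ≥0∞}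
    (hK : K ≠ ∞) : ∃ A₃ : ℝ, 0 < A₃ ∧ ∀ Ts, 0 < Ts → Ts ≤ T → ∀ (A : ℝ → FTensor n)
      (f : ℝ → VDist n), ViscData Ts c (1 + |(n : ℝ) / 2 - 2|) K A → ∀ u₀ : VDist n, Solenoidal u₀ →
      (∀ t k, IsRealDist (f t k)) → (∀ k ξ, Integrable (fun t => f t k ξ) (timeMeasure Ts)) →
      ∀ (F H : ℝ → ℝ) (U : ℝ), Integrable F (timeMeasure Ts) → Integrable H (timeMeasure Ts) →
      (∀ᵐ t ∂(timeMeasure Ts), ∀ N, rsq (box n N) ((n : ℝ) / 2 - 2) (f t) ≤ F t) →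
      (∀ᵐ t ∂(timeMeasure Ts), ∀ N, rsq (box n N) ((n : ℝ) / 2) (heat u₀ t) ≤ H t) →
      (∀ N, rsq (box n N) ((n : ℝ) / 2 - 1) u₀ ≤ U) →
      (∫ t in Ioo 0 Ts, F t) + (U + 1) * (∫ t in Ioo 0 Ts, H t) < A₃ →
      ∀ (r : ℝ) (K' : ℝ≥0∞), 0 ≤ r → ViscData Ts c (1 + |r - 1|) K' A →
      ∀ (F' : ℝ → ℝ) (U' : ℝ), Integrable F' (timeMeasure Ts) →
      (∀ᵐ t ∂(timeMeasure Ts), ∀ N, rsq (box n N) (r - 1) (f t) ≤ F' t) →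
      (∀ N, rsq (box n N) r u₀ ≤ U') → ∃ D : ℝ, ∀ N, ∃ u, Approx Ts A f u₀ r D N u := by
  obtain ⟨A₃, hA₃, H₁⟩ := exists_critical_bound hn T hc hK
  refine ⟨A₃, hA₃, fun Ts hTs hTsT A f hA u₀ hu₀ hfr hfi F H U hF hH hFb hHb hU hsm r K' hr hA' F' U'
    hF' hFb' hU' => ?_⟩
  obtain ⟨D, hD⟩ := H₁ Ts hTs hTsT A f hA u₀ hu₀ F H U hF hH hFb hHb hU hsm
  obtain ⟨D', hD'⟩ := exists_subcritical_bound hn hr hTs hA' (D := D) hF' hFb' hU'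
  refine ⟨D', fun N => ?_⟩
  obtain ⟨u, χ, h1, h2, h3, h4, h5, h6⟩ := exists_galerkin hTs hK hA.meas hA.real
    -- The cutoff radius is the a priori bound on the coefficients, so the cutoff is never active
    -- and the full system is solved.
    (hA.wiener.mono fun t ht => ht.mono (by positivity)) hfr hfi hu₀ N (Real.sqrt D')
  have hG : Galerkin Ts A f u₀ N χ u := ⟨h1, h3, h4, h5, h6⟩
  obtain ⟨b1, b2⟩ := hD N χ u hG
  obtain ⟨b3, b4⟩ := hD' N χ u hG b1 b2
  refine ⟨u, h3, h4, h5, fun k ξ hξ => (h6 k ξ hξ).congr ?_, b3, b4⟩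
  filter_upwards [ae_restrict_mem measurableSet_Ioo] with t ht
  have ht' := Ioo_subset_Icc_self ht
  rw [h2 t ht' fun k ξ => ?_, one_smul]
  by_cases hξ : ξ ∈ box n N
  · exact Real.le_sqrt_of_sq_le ((norm_sq_le_rsq hr (u t) k hξ).trans (b3 t ht'))
  · rw [h4 t k ξ hξ, norm_zero]
    exact Real.sqrt_nonneg _

/-! ### Convergence of the Galerkin approximations -/

theorem rsq_of_subset {n : ℕ} {B B' : Finset (Freq n)} (h : B ⊆ B') (s : ℝ) {u : VDist n}
    (hu : SuppIn B u) : rsq B' s u = rsq B s u := by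
  unfold rsq
  refine Finset.sum_congr rfl fun k _ => (Finset.sum_subset h fun ξ _ hξ => ?_).symm
  simp [hu k ξ hξ]

theorem rsq_sub_trunc_le {n : ℕ} (B : Finset (Freq n)) {N : ℕ} (hN : 1 ≤ N) (s : ℝ) {r : ℝ}
    (hr : 0 ≤ r) (u : VDist n) :
    rsq B s (u - trunc (box n N) u) ≤ (N : ℝ) ^ (-(2 * r)) * rsq B (s + r) u := by
  unfold rsq
  simp only [Finset.mul_sum]
  refine Finset.sum_le_sum fun k _ => Finset.sum_le_sum fun ξ _ => ?_
  have hρ := rho_pos ξ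
  have hN0 : (0 : ℝ) < N := by exact_mod_cast hN
  by_cases hξ : ξ ∈ box n N
  · simp only [Pi.sub_apply, trunc, hξ, if_true, sub_self, norm_zero]
    rw [zero_pow two_ne_zero, mul_zero]
    positivity
  · simp only [Pi.sub_apply, trunc, hξ, if_false, sub_zero]
    rw [← mul_assoc]
    gcongr
    have h1 : rho ξ ^ (2 * s) = rho ξ ^ (-(2 * r)) * rho ξ ^ (2 * (s + r)) := by
      rw [← Real.rpow_add hρ]
      congr 1
      ring
    rw [h1]
    gcongr ?_ * _
    exact Real.rpow_le_rpow_of_nonpos hN0 (lt_rho_of_notMem_box hξ).le (by linarith)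

/-- Two approximations with cubes `N ≤ M` are compared in `L₂`. Coercivity absorbs the dissipation
terms of the two quadratic differences; the error comes from the frequencies of `X` that the smaller
cube misses. -/
theorem exists_difference_inequality {n : ℕ} (hn : 2 ≤ n) {r : ℝ} (hr : 0 ≤ r)
    (hrn : (n : ℝ) / 2 < r + 1) {c : ℝ} (hc : 0 < c) {K : ℝ≥0∞} (hK : K ≠ ∞) : ∃ C : ℝ, 0 ≤ C ∧
    ∀ A : FTensor n, Coercive c A → WienerBound 0 K A → ∀ N M : ℕ, 1 ≤ N → N ≤ M →
      ∀ f u v X Y : VDist n, SuppIn (box n N) u → SuppIn (box n M) v → Solenoidal u → Solenoidal v →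
      X = leray (f + visc A u - tens u u) → Y = leray (f + visc A v - tens v v) →
      2 * ip (box n M) 0 (trunc (box n N) X - Y) (u - v) ≤
        C * (rsq (box n M) (r + 1) u + rsq (box n M) (r + 1) v) * rsq (box n M) 0 (u - v) +
        (N : ℝ) ^ (-r) * (rsq (box n M) (-1) X + rsq (box n M) (r + 1) v) := by
  obtain ⟨C, hC, hT⟩ := vsq_tens_of_gt (by omega : 0 < n) hrn
  refine ⟨c⁻¹ * C.toReal, by positivity, fun A hco hW N M hN hNM f u v X Y hu' hv hus hvs hX hY => ?_⟩
  set B := box n M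
  have hu : SuppIn B u := suppIn_mono (box_mono n hNM) hu'
  have hN0 : (0 : ℝ) < N := by exact_mod_cast hN
  set d := u - v with hd
  have hds : SuppIn B d := suppIn_sub hu hv
  have hdsol : Solenoidal d := hus.sub hvs
  have hXY : X - Y = leray (visc A d - (tens d u + tens v d)) := by
    rw [hX, hY, ← leray_sub, visc_sub hW hK (hu.vsq_lt_top 1) (hv.vsq_lt_top 1),
      ← tens_sub_tens (hu.vsq_lt_top 0) (hv.vsq_lt_top 0)]
    congr 1
    abel
  have e0 : trunc (box n N) X - Y = (X - Y) - (X - trunc (box n N) X) := by abel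
  -- The missed frequencies lie outside the smaller cube, where `u` vanishes, so they meet only the
  -- tail of `v`.
  have e1 : ip B 0 (X - trunc (box n N) X) d = -ip B 0 (X - trunc (box n N) X)
      (v - trunc (box n N) v) := by
    unfold ip
    simp only [← Finset.sum_neg_distrib]
    refine Finset.sum_congr rfl fun k _ => Finset.sum_congr rfl fun ξ _ => ?_
    by_cases hξ : ξ ∈ box n N
    · simp [trunc, hξ]
    · simp only [hd, trunc, hξ, if_false, Pi.sub_apply, sub_zero, hu' k ξ hξ, zero_sub, map_neg,
        mul_neg, Complex.neg_re]
  have p0 : (0 : ℝ) < (N : ℝ) ^ r := Real.rpow_pos_of_pos hN0 r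
  -- The Young parameter `N^r` balances the two sides: the tail of `v` in `H¹` carries `N^(-2r)`, so
  -- both terms become `N^(-r)`.
  have b1 := abs_ip_le B 0 (X - trunc (box n N) X) (v - trunc (box n N) v) p0
  have b2 := abs_ip_le B 0 (tens d u) d hc
  have b3 := abs_ip_le B 0 (tens v d) d hc
  rw [zero_sub, zero_add] at b1 b2 b3
  have c2 : rsq B (-1) (tens d u) ≤ C.toReal * (rsq B 0 d * rsq B (r + 1) u) :=
    rsq_le_of_vsq_le_mul hC hds hu (hT d u).2
  have c3 : rsq B (-1) (tens v d) ≤ C.toReal * (rsq B (r + 1) v * rsq B 0 d) :=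
    rsq_le_of_vsq_le_mul hC hv hds (hT v d).1
  have b4 := hco M d hds hdsol
  have b5 := rsq_sub_trunc_le B hN 1 hr v
  have b6 := rsq_sub_trunc_le B hN (-1) le_rfl X
  simp only [mul_zero, neg_zero, Real.rpow_zero, one_mul, add_zero] at b6
  rw [add_comm 1 r] at b5
  rw [e0, ip_sub_left, e1, hXY, ip_leray B 0 _ hdsol.div hdsol.mean, ip_sub_left, ip_add_left]
  have hp : (N : ℝ) ^ r * ((N : ℝ) ^ (-(2 * r)) * rsq B (r + 1) v) =
      (N : ℝ) ^ (-r) * rsq B (r + 1) v := by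
    rw [← mul_assoc, ← Real.rpow_add hN0]
    congr 2
    ring
  have d5 := mul_le_mul_of_nonneg_left b5 p0.le
  rw [hp] at d5
  rw [← Real.rpow_neg hN0.le] at b1
  have d6 := mul_le_mul_of_nonneg_left b6 (Real.rpow_pos_of_pos hN0 (-r)).le
  have hi := (inv_pos.2 hc).le
  have d2 := mul_le_mul_of_nonneg_left c2 hi
  have d3 := mul_le_mul_of_nonneg_left c3 hi
  have g1 := le_abs_self (ip B 0 (X - trunc (box n N) X) (v - trunc (box n N) v))
  have g2 := neg_abs_le (ip B 0 (tens d u) d)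
  have g3 := neg_abs_le (ip B 0 (tens v d) d)
  nlinarith

theorem exists_rsq_rhs_le {n : ℕ} (hn : 2 ≤ n) {r : ℝ} (hr : 0 ≤ r)
    (hrn : (n : ℝ) / 2 < r + 1) {K : ℝ≥0∞} (hK : K ≠ ∞) : ∃ C : ℝ≥0∞, C ≠ ∞ ∧
    ∀ A : FTensor n, WienerBound 0 K A → ∀ f u : VDist n,
      vsq (-1) (leray (f + visc A u - tens u u)) ≤
        C * (vsq (r - 1) f + vsq (r + 1) u * (1 + vsq r u)) := by
  obtain ⟨C₁, hC₁, hT⟩ := vsq_tens_of_gt (by omega : 0 < n) hrn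
  obtain ⟨C₂, hC₂, hV⟩ := vsq_visc_le (n := n) 0
  obtain ⟨C₃, hC₃, hL⟩ := vsq_leray_le (n := n)
  refine ⟨C₃ * (4 + 4 * (C₂ * K ^ 2) + 2 * C₁), ?_, fun A hA f u => ?_⟩
  · have := ENNReal.pow_ne_top (n := 2) hK
    have h4 : (4 : ℝ≥0∞) ≠ ∞ := by simp
    have h2 : (2 : ℝ≥0∞) ≠ ∞ := by simp
    exact ENNReal.mul_ne_top hC₃ (ENNReal.add_ne_top.2 ⟨ENNReal.add_ne_top.2 ⟨h4,
      ENNReal.mul_ne_top h4 (ENNReal.mul_ne_top hC₂ this)⟩, ENNReal.mul_ne_top h2 hC₁⟩)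
  have h1 := hV A K u (by simpa using hA)
  rw [zero_sub, zero_add] at h1
  have h1' : vsq (-1) (visc A u) ≤ C₂ * K ^ 2 * vsq (r + 1) u := by
    rw [mul_assoc]
    refine h1.trans ?_
    gcongr
    exact vsq_mono (by linarith) u
  have h2 : vsq (-1) (tens u u) ≤ C₁ * (vsq (r + 1) u * vsq r u) :=
    (hT u u).1.trans (by gcongr; exact vsq_mono hr u)
  have h3 : vsq (-1) f ≤ vsq (r - 1) f := vsq_mono (by linarith) f
  refine (hL _ _).trans ?_
  rw [mul_assoc]
  gcongr
  calc _ ≤ 2 * vsq (-1) (f + visc A u) + 2 * vsq (-1) (tens u u) := vsq_sub_le _ _ _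
    _ ≤ 2 * (2 * vsq (r - 1) f + 2 * (C₂ * K ^ 2 * vsq (r + 1) u)) +
        2 * (C₁ * (vsq (r + 1) u * vsq r u)) := by
        gcongr
        refine (vsq_add_le _ _ _).trans ?_
        gcongr
    _ = 4 * vsq (r - 1) f + 4 * (C₂ * K ^ 2) * vsq (r + 1) u +
        2 * C₁ * (vsq (r + 1) u * vsq r u) := by ring
    _ ≤ 4 * (vsq (r - 1) f + vsq (r + 1) u * (1 + vsq r u)) +
        4 * (C₂ * K ^ 2) * (vsq (r - 1) f + vsq (r + 1) u * (1 + vsq r u)) +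
        2 * C₁ * (vsq (r - 1) f + vsq (r + 1) u * (1 + vsq r u)) := by
        gcongr
        · exact le_self_add
        · rw [mul_add, mul_one]
          exact le_trans le_self_add le_add_self
        · rw [mul_add]
          exact le_trans le_add_self le_add_self
    _ = _ := by ring

/-- The Galerkin approximations form a Cauchy sequence in `L₂`, uniformly in time. -/
theorem exists_approx_difference {n : ℕ} (hn : 2 ≤ n) {r : ℝ} (hr : 0 ≤ r)
    (hrn : (n : ℝ) / 2 < r + 1) {T c m : ℝ} (hT : 0 < T) (hm : 0 ≤ m) {K : ℝ≥0∞}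
    {A : ℝ → FTensor n} {f : ℝ → VDist n} (hA : ViscData T c m K A)
    {u₀ : VDist n} {F : ℝ → ℝ} {U D : ℝ} (hF : Integrable F (timeMeasure T))
    (hFb : ∀ᵐ t ∂(timeMeasure T), vsq (r - 1) (f t) ≤ ENNReal.ofReal (F t))
    (hF0 : ∀ t, 0 ≤ F t) (hU : ∀ N, rsq (box n N) r u₀ ≤ U) :
    ∃ E : ℝ, 0 ≤ E ∧ ∀ N M, 1 ≤ N → N ≤ M → ∀ u v, Approx T A f u₀ r D N u →
      Approx T A f u₀ r D M v → ∀ t ∈ Icc 0 T, rsq (box n M) 0 (u t - v t) ≤ E * (N : ℝ) ^ (-r) := by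
  obtain ⟨C₁, hC₁, hdiff⟩ := exists_difference_inequality hn hr hrn hA.pos hA.fin
  obtain ⟨C₂, hC₂, hrhs⟩ := exists_rsq_rhs_le hn hr hrn hA.fin
  have hFi : 0 ≤ ∫ t in Ioo 0 T, F t := integral_nonneg hF0
  have hU0 : 0 ≤ U := (rsq_nonneg (box n 0) r u₀).trans (hU 0)
  refine ⟨(U + (C₂.toReal * ((∫ t in Ioo 0 T, F t) + |D| * (1 + |D|)) + |D|)) *
    Real.exp (C₁ * (|D| + |D|)), by positivity, fun N M hN hNM u v hu hv t ht => ?_⟩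
  set B := box n M
  have hN0 : (0 : ℝ) < N := by exact_mod_cast hN
  have hD0 : 0 ≤ D := (rsq_nonneg (box n N) r (u 0)).trans (hu.bound 0 (left_mem_Icc.2 hT.le))
  rw [abs_of_nonneg hD0]
  have huB : ∀ t, SuppIn B (u t) := fun t => suppIn_mono (box_mono n hNM) (hu.supp t)
  set X : ℝ → VDist n := fun t => leray (f t + visc (A t) (u t) - tens (u t) (u t)) with hX
  set Y : ℝ → VDist n := fun t => leray (f t + visc (A t) (v t) - tens (v t) (v t)) with hY
  have hup : ∀ k, ∀ ξ, IsPrim T (fun t => u t k ξ) (fun t => trunc (box n N) (X t) k ξ) := by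
    intro k ξ
    by_cases hξ : ξ ∈ box n N
    · simpa only [trunc, hξ, if_true] using hu.prim k ξ hξ
    · simp only [trunc, hξ, if_false]
      exact ⟨integrable_zero _ _ _, fun t _ => by simp [hu.supp _ k ξ hξ]⟩
  have hp : ∀ k, ∀ ξ ∈ B, IsPrim T (fun t => (u t - v t) k ξ)
      (fun t => (trunc (box n N) (X t) - Y t) k ξ) := fun k ξ hξ => (hup k ξ).sub (hv.prim k ξ hξ)
  have hy := IsPrim.rsq B 0 hp
  have hcu : Integrable (fun t => rsq B (r + 1) (u t)) (timeMeasure T) :=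
    integrable_of_continuousOn_Icc (continuousOn_rsq B _ fun k ξ _ => (hup k ξ).continuousOn)
  have hcv : Integrable (fun t => rsq B (r + 1) (v t)) (timeMeasure T) :=
    integrable_of_continuousOn_Icc (continuousOn_rsq B _ fun k ξ hξ => (hv.prim k ξ hξ).continuousOn)
  have hiu : ∫ t in Ioo 0 T, rsq B (r + 1) (u t) ≤ D := by
    simp only [fun t => rsq_of_subset (box_mono n hNM) (r + 1) (hu.supp t), B]
    exact hu.bound_int
  have hgr := hy.gronwall (b := fun t => C₁ * (rsq B (r + 1) (u t) + rsq B (r + 1) (v t)))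
    (h := fun t => (N : ℝ) ^ (-r) * (C₂.toReal * (F t + (1 + D) * rsq B (r + 1) (u t)) +
      rsq B (r + 1) (v t))) ((hcu.add hcv).const_mul _)
    ((((hF.add (hcu.const_mul _)).const_mul _).add hcv).const_mul _)
    (ae_of_all _ fun t => by
      have := rsq_nonneg B (r + 1) (u t)
      have := rsq_nonneg B (r + 1) (v t)
      positivity)
    (ae_of_all _ fun t => by
      have := rsq_nonneg B (r + 1) (u t)
      have := rsq_nonneg B (r + 1) (v t)
      have := hF0 t
      positivity) (rsq_nonneg _ _ _) (by
        filter_upwards [hA.wiener, hA.coercive, hFb, ae_restrict_mem measurableSet_Ioo]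
          with t h1 h2 h3 h5
        have ht := Ioo_subset_Icc_self h5
        have hW := h1.mono hm
        refine (hdiff (A t) h2 hW N M hN hNM (f t) (u t) (v t) (X t) (Y t) (hu.supp t) (hv.supp t)
          (hu.sol t ht) (hv.sol t ht) rfl rfl).trans ?_
        gcongr
        have h6 := hrhs (A t) hW (f t) (u t)
        have h7 : vsq r (u t) ≤ ENNReal.ofReal D := by
          rw [vsq_eq_ofReal_rsq (hu.supp t)]
          exact ENNReal.ofReal_le_ofReal (hu.bound t ht)
        refine le_toReal_mul_of_ofReal_le hC₂ ?_ ((ofReal_rsq_le _ _ _).trans (h6.trans ?_))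
        · have := rsq_nonneg B (r + 1) (u t)
          have := hF0 t
          positivity
        · rw [ENNReal.ofReal_add (hF0 t) (mul_nonneg (by linarith) (rsq_nonneg _ _ _)),
            ENNReal.ofReal_mul (by linarith), ENNReal.ofReal_add zero_le_one hD0,
            ENNReal.ofReal_one, ← vsq_eq_ofReal_rsq (huB t), _root_.mul_comm (vsq (r + 1) (u t))]
          gcongr) ht
  refine hgr.trans ?_
  -- The initial values differ by the part of `u₀` between the two cubes, which is even of order
  -- `N^(-2r)`.
  have h0 : rsq B 0 (u 0 - v 0) ≤ (N : ℝ) ^ (-r) * U := by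
    have e : u 0 - v 0 = fun k ξ => -((trunc B u₀ - trunc (box n N) (trunc B u₀)) k ξ) := by
      ext k ξ
      rw [hu.init, hv.init]
      have h3 : box n N ≤ box n M := box_mono n hNM
      simp only [Pi.sub_apply, trunc, B]
      by_cases h1 : ξ ∈ box n N
      · simp [h1, h3 h1]
      · simp [h1]
    have e2 : rsq B 0 (u 0 - v 0) = rsq B 0 (trunc B u₀ - trunc (box n N) (trunc B u₀)) := by
      rw [e]
      simp only [rsq, norm_neg]
    rw [e2]
    refine (rsq_sub_trunc_le B hN 0 hr _).trans ?_
    rw [zero_add, rsq_trunc]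
    have h3 : (N : ℝ) ^ (-(2 * r)) ≤ (N : ℝ) ^ (-r) :=
      Real.rpow_le_rpow_of_exponent_le (by exact_mod_cast hN) (by linarith)
    exact mul_le_mul h3 (hU M) (rsq_nonneg _ _ _) (by positivity)
  have h1 : ∫ t in Ioo 0 T, (N : ℝ) ^ (-r) * (C₂.toReal * (F t + (1 + D) * rsq B (r + 1) (u t)) +
      rsq B (r + 1) (v t)) ≤
      (N : ℝ) ^ (-r) * (C₂.toReal * ((∫ t in Ioo 0 T, F t) + D * (1 + D)) + D) := by
    rw [integral_const_mul, integral_add_time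
      (g := fun t => C₂.toReal * (F t + (1 + D) * rsq B (r + 1) (u t)))
      ((hF.add (hcu.const_mul _)).const_mul _) hcv,
      integral_const_mul, integral_add_time hF (hcu.const_mul _), integral_const_mul]
    have h5 := mul_le_mul_of_nonneg_left hiu (by linarith : 0 ≤ 1 + D)
    rw [_root_.mul_comm D]
    exact mul_le_mul_of_nonneg_left (add_le_add (mul_le_mul_of_nonneg_left
      (add_le_add_right h5 _) ENNReal.toReal_nonneg) hv.bound_int) (by positivity)
  have h2 : ∫ t in Ioo 0 T, C₁ * (rsq B (r + 1) (u t) + rsq B (r + 1) (v t)) ≤ C₁ * (D + D) := by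
    rw [integral_const_mul, integral_add_time hcu hcv]
    gcongr
    exact hv.bound_int
  calc _ ≤ ((N : ℝ) ^ (-r) * U +
        (N : ℝ) ^ (-r) * (C₂.toReal * ((∫ t in Ioo 0 T, F t) + D * (1 + D)) + D)) *
        Real.exp (C₁ * (D + D)) := by gcongr
    _ = _ := by ring

/-! ### The regular solution -/

theorem tendsto_ofReal_rsq_box {n : ℕ} (s : ℝ) (u : VDist n) :
    Tendsto (fun N => ENNReal.ofReal (rsq (box n N) s u)) atTop (𝓝 (vsq s u)) := by
  simp only [ofReal_rsq]
  exact tendsto_finsetSum _ fun k _ =>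
    (ENNReal.summable.hasSum (f := fun ξ => wt (2 * s) ξ * ‖u k ξ‖ₑ ^ 2)).comp (tendsto_box_atTop n)

theorem vsq_le_of_rsq_le {n : ℕ} {s q : ℝ} {u : VDist n} (h : ∀ N, rsq (box n N) s u ≤ q) :
    vsq s u ≤ ENNReal.ofReal q :=
  le_of_tendsto' (tendsto_ofReal_rsq_box s u) fun N => ENNReal.ofReal_le_ofReal (h N)

theorem aemeasurable_vsq {n : ℕ} {μ : Measure ℝ} {u : ℝ → VDist n}
    (hu : ∀ k ξ, AEMeasurable (fun t => u t k ξ) μ) (s : ℝ) :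
    AEMeasurable (fun t => vsq s (u t)) μ := by
  unfold vsq sq wsq
  exact Finset.aemeasurable_fun_sum _ fun k _ => AEMeasurable.tsum fun ξ =>
    ((hu k ξ).enorm.pow_const 2).const_mul _

theorem continuous_rsq_of_tendsto {n : ℕ} {ι : Type*} {l : Filter ι} (B : Finset (Freq n)) (s : ℝ)
    {u : ι → VDist n} {v : VDist n} (h : ∀ k ξ, Tendsto (fun i => u i k ξ) l (𝓝 (v k ξ))) :
    Tendsto (fun i => rsq B s (u i)) l (𝓝 (rsq B s v)) := by
  unfold rsq
  exact tendsto_finsetSum _ fun k _ => tendsto_finsetSum _ fun ξ _ =>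
    ((h k ξ).norm.pow 2).const_mul _

theorem IsPrim.of_tendsto {T : ℝ} {y g : ℝ → ℂ} {yN gN : ℕ → ℝ → ℂ} {c : ℕ → ℝ} {N₀ : ℕ}
    (h : ∀ N, N₀ ≤ N → IsPrim T (yN N) (gN N))
    (hy : ∀ t ∈ Icc 0 T, Tendsto (fun N => yN N t) atTop (𝓝 (y t))) (hc : Tendsto c atTop (𝓝 0))
    (hg : ∀ N, N₀ ≤ N → ∀ᵐ t ∂(timeMeasure T), ‖gN N t - g t‖ ≤ c N) : IsPrim T y g := by
  rcases lt_or_ge T 0 with hT | hT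
  · refine ⟨?_, fun t ht => absurd (ht.1.trans ht.2) (not_le.2 hT)⟩
    have : timeMeasure T = 0 := by
      unfold timeMeasure
      rw [Ioo_eq_empty (not_lt.2 hT.le), Measure.restrict_empty]
    rw [this]
    exact integrable_zero_measure
  have hg' : ∀ᵐ t ∂(timeMeasure T), ∀ N, N₀ ≤ N → ‖gN N t - g t‖ ≤ c N := by
    rw [ae_all_iff]
    intro N
    by_cases hN : N₀ ≤ N
    · filter_upwards [hg N hN] with t ht _ using ht
    · exact ae_of_all _ fun t h => absurd h hN
  have hlim : ∀ᵐ t ∂(timeMeasure T), Tendsto (fun N => gN (N + N₀) t) atTop (𝓝 (g t)) := by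
    filter_upwards [hg'] with t ht
    rw [tendsto_iff_norm_sub_tendsto_zero]
    exact squeeze_zero (fun N => norm_nonneg _) (fun N => ht (N + N₀) (by omega))
      (hc.comp (tendsto_add_atTop_nat N₀))
  have hmeas : AEStronglyMeasurable g (timeMeasure T) :=
    aestronglyMeasurable_of_tendsto_ae atTop (fun N => (h (N + N₀) (by omega)).int.1) hlim
  have hd : ∀ N, N₀ ≤ N → Integrable (fun t => gN N t - g t) (timeMeasure T) := fun N hN =>
    Integrable.mono' (integrable_const (c N)) ((h N hN).int.1.sub hmeas) (hg N hN)
  have hint : Integrable g (timeMeasure T) := by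
    refine ((h N₀ le_rfl).int.sub (hd N₀ le_rfl)).congr (ae_of_all _ fun t => ?_)
    simp
  refine ⟨hint, fun t ht => ?_⟩
  have h1 : Tendsto (fun N => ∫ s in 0..t, gN N s) atTop (𝓝 (∫ s in 0..t, g s)) := by
    rw [tendsto_iff_norm_sub_tendsto_zero]
    have hc' : Tendsto (fun N => c N * t) atTop (𝓝 0) := by simpa using hc.mul_const t
    refine squeeze_zero' (Eventually.of_forall fun N => norm_nonneg _)
      (eventually_atTop.2 ⟨N₀, fun N hN => ?_⟩) hc'
    rw [← intervalIntegral.integral_sub (intervalIntegrable_of_timeMeasure (h N hN).int ht)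
      (intervalIntegrable_of_timeMeasure hint ht)]
    have h2 : ∀ᵐ s ∂(volume.restrict (Ioc 0 t)), ‖gN N s - g s‖ ≤ c N :=
      ae_restrict_Ioc_of_timeMeasure (hg N hN) ht
    rw [intervalIntegral.integral_of_le ht.1]
    refine (norm_integral_le_of_norm_le (integrable_const (c N)) h2).trans (le_of_eq ?_)
    simp [ht.1]
    ring
  have h2 : Tendsto (fun N => yN N 0 + ∫ s in 0..t, gN N s) atTop (𝓝 (y 0 + ∫ s in 0..t, g s)) :=
    (hy 0 (left_mem_Icc.2 hT)).add h1
  refine tendsto_nhds_unique (hy t ht) (h2.congr' ?_)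
  exact eventually_atTop.2 ⟨N₀, fun N hN => ((h N hN).eq t ht).symm⟩

/-- A coefficient of a product of two `L₂` functions is bounded by Cauchy–Schwarz. Strong
convergence in `L₂` therefore suffices to pass to the limit in the quadratic term at each frequency.
-/
theorem enorm_tens_sq_le {n : ℕ} (u v : VDist n) (k : Fin n) (ξ : Freq n) :
    ‖tens u v k ξ‖ₑ ^ 2 ≤ n * (wt 1 ξ ^ 2 * (vsq 0 u * vsq 0 v)) := by
  have h1 : ∀ j, ‖partialD j (mul (u j) (v k)) ξ‖ₑ ^ 2 ≤
      wt 1 ξ ^ 2 * (sq 0 (u j) * vsq 0 v) := by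
    intro j
    have h2 : ‖mul (u j) (v k) ξ‖ₑ ^ 2 ≤ sq 0 (u j) * vsq 0 v := by
      calc _ ≤ conv (fun η => ‖u j η‖ₑ) (fun η => ‖v k η‖ₑ) ξ ^ 2 := by
            gcongr
            exact enorm_mul_le _ _ _
        _ ≤ sq 0 (u j) * sq 0 (v k) := conv_sq_le _ _ _
        _ ≤ _ := by gcongr; exact sq_le_vsq 0 v k
    calc _ ≤ (wt 1 ξ * ‖mul (u j) (v k) ξ‖ₑ) ^ 2 := by
          gcongr
          exact enorm_partialD_le _ _ _
      _ ≤ _ := by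
        rw [mul_pow]
        gcongr
  calc ‖tens u v k ξ‖ₑ ^ 2 ≤ (∑ j, ‖partialD j (mul (u j) (v k)) ξ‖ₑ) ^ 2 := by
        gcongr
        exact enorm_sum_le _ _
    _ ≤ Fintype.card (Fin n) * ∑ j, ‖partialD j (mul (u j) (v k)) ξ‖ₑ ^ 2 := ennreal_sum_sq_le _
    _ ≤ n * ∑ j, wt 1 ξ ^ 2 * (sq 0 (u j) * vsq 0 v) := by
        rw [Fintype.card_fin]
        gcongr with j
        exact h1 j
    _ = _ := by rw [← Finset.mul_sum, ← Finset.sum_mul]; rfl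

theorem enorm_sq_le_vsq {n : ℕ} (s : ℝ) (u : VDist n) (k : Fin n) (ξ : Freq n) :
    ‖u k ξ‖ₑ ^ 2 ≤ wt (2 * -s) ξ * vsq s u := by
  have h1 : wt (2 * s) ξ * ‖u k ξ‖ₑ ^ 2 ≤ vsq s u :=
    (ENNReal.le_tsum (f := fun ξ => wt (2 * s) ξ * ‖u k ξ‖ₑ ^ 2) ξ).trans (sq_le_vsq s u k)
  calc ‖u k ξ‖ₑ ^ 2 = wt (2 * -s) ξ * (wt (2 * s) ξ * ‖u k ξ‖ₑ ^ 2) := by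
        rw [← mul_assoc, ← wt_add]
        simp [wt_zero]
    _ ≤ _ := by gcongr

/-- The right-hand side of the equation is continuous with respect to the `L₂` norm, frequency by
frequency. -/
theorem exists_enorm_rhs_sub_le {n : ℕ} {K D : ℝ≥0∞} (hK : K ≠ ∞) (hD : D ≠ ∞) (ξ : Freq n) :
    ∃ Q : ℝ≥0∞, Q ≠ ∞ ∧ ∀ A : FTensor n, WienerBound 1 K A → ∀ f u v : VDist n,
      vsq 1 u < ∞ → vsq 1 v < ∞ → vsq 0 u ≤ D → vsq 0 v ≤ D → ∀ k,
        ‖leray (f + visc A u - tens u u) k ξ - leray (f + visc A v - tens v v) k ξ‖ₑ ^ 2 ≤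
          Q * vsq 0 (u - v) := by
  -- The viscous term is read in `H⁻²`, where the `L₂` norm of the field controls it. This is why
  -- the Wiener weight must have exponent at least `1`.
  obtain ⟨C, hC, hV⟩ := vsq_visc_le (n := n) (-1)
  set Q₁ : ℝ≥0∞ := 2 * (wt (2 * - -2) ξ * (C * K ^ 2)) +
    2 * (2 * (n * (wt 1 ξ ^ 2 * D)) + 2 * (n * (wt 1 ξ ^ 2 * D))) with hQ₁
  have h2t : (2 : ℝ≥0∞) ≠ ∞ := by simp
  have hQ₁t : Q₁ ≠ ∞ := by
    have h1 := ENNReal.mul_ne_top (ENNReal.natCast_ne_top n)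
      (ENNReal.mul_ne_top (ENNReal.pow_ne_top (n := 2) (wt_ne_top 1 ξ)) hD)
    exact ENNReal.add_ne_top.2 ⟨ENNReal.mul_ne_top h2t (ENNReal.mul_ne_top (wt_ne_top _ _)
      (ENNReal.mul_ne_top hC (ENNReal.pow_ne_top hK))), ENNReal.mul_ne_top h2t
      (ENNReal.add_ne_top.2 ⟨ENNReal.mul_ne_top h2t h1, ENNReal.mul_ne_top h2t h1⟩)⟩
  refine ⟨2 * Q₁ + 2 * (n * (n * Q₁)), ENNReal.add_ne_top.2 ⟨ENNReal.mul_ne_top h2t hQ₁t,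
    ENNReal.mul_ne_top h2t (ENNReal.mul_ne_top (ENNReal.natCast_ne_top n) (ENNReal.mul_ne_top
      (ENNReal.natCast_ne_top n) hQ₁t))⟩, fun A hA f u v hu hv huD hvD k => ?_⟩
  have h0u : vsq 0 u < ∞ := huD.trans_lt hD.lt_top
  have h0v : vsq 0 v < ∞ := hvD.trans_lt hD.lt_top
  set X : VDist n := visc A (u - v) - (tens (u - v) u + tens v (u - v)) with hX
  have e : leray (f + visc A u - tens u u) - leray (f + visc A v - tens v v) = leray X := by
    rw [← leray_sub, hX, visc_sub (hA.mono zero_le_one) hK hu hv, ← tens_sub_tens h0u h0v]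
    congr 1
    abel
  have e' : leray (f + visc A u - tens u u) k ξ - leray (f + visc A v - tens v v) k ξ =
      leray X k ξ := congrFun (congrFun e k) ξ
  rw [e']
  have hXb : ∀ j, ‖X j ξ‖ₑ ^ 2 ≤ Q₁ * vsq 0 (u - v) := by
    intro j
    have h1 := hV A K (u - v) (by simpa using hA)
    norm_num at h1
    have h2 := (enorm_sq_le_vsq (-2) (visc A (u - v)) j ξ).trans (mul_le_mul_right h1 _)
    have h3 := enorm_tens_sq_le (u - v) u j ξ
    have h4 := enorm_tens_sq_le v (u - v) j ξ
    have h5 : ‖X j ξ‖ₑ ^ 2 ≤ 2 * ‖visc A (u - v) j ξ‖ₑ ^ 2 +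
        2 * (2 * ‖tens (u - v) u j ξ‖ₑ ^ 2 + 2 * ‖tens v (u - v) j ξ‖ₑ ^ 2) := by
      calc _ ≤ (‖visc A (u - v) j ξ‖ₑ + (‖tens (u - v) u j ξ‖ₑ + ‖tens v (u - v) j ξ‖ₑ)) ^ 2 := by
            gcongr
            exact (enorm_sub_le).trans (by gcongr; exact enorm_add_le _ _)
        _ ≤ _ := by
          refine (ennreal_add_sq_le _ _).trans ?_
          gcongr
          exact ennreal_add_sq_le _ _
    refine h5.trans ?_
    calc _ ≤ 2 * (wt (2 * - -2) ξ * (C * (K ^ 2 * vsq 0 (u - v)))) +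
          2 * (2 * (n * (wt 1 ξ ^ 2 * (vsq 0 (u - v) * D))) +
            2 * (n * (wt 1 ξ ^ 2 * (D * vsq 0 (u - v))))) := by
          gcongr
          · exact h3.trans (by gcongr)
          · exact h4.trans (by gcongr)
      _ = _ := by rw [hQ₁]; ring
  calc ‖leray X k ξ‖ₑ ^ 2 ≤ (‖X k ξ‖ₑ + ∑ j, ‖X j ξ‖ₑ) ^ 2 := by
        gcongr
        exact enorm_leray_le X k ξ
    _ ≤ 2 * ‖X k ξ‖ₑ ^ 2 + 2 * (∑ j, ‖X j ξ‖ₑ) ^ 2 := ennreal_add_sq_le _ _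
    _ ≤ 2 * (Q₁ * vsq 0 (u - v)) + 2 * (n * ∑ _j : Fin n, Q₁ * vsq 0 (u - v)) := by
        gcongr
        · exact hXb k
        · refine (ennreal_sum_sq_le _).trans ?_
          rw [Fintype.card_fin]
          gcongr with j
          exact hXb j
    _ = _ := by
        rw [Finset.sum_const, Finset.card_univ, Fintype.card_fin, nsmul_eq_mul]
        ring

/-- A regular solution on `[0,T]`. -/
structure RegularSolution {n : ℕ} (T : ℝ) (A : ℝ → FTensor n) (f : ℝ → VDist n) (u₀ : VDist n)
    (r : ℝ) (u : ℝ → VDist n) : Prop where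
  init : u 0 = u₀
  sol : ∀ t ∈ Icc 0 T, Solenoidal (u t)
  prim : ∀ k ξ, IsPrim T (fun t => u t k ξ) fun t =>
    leray (f t + visc (A t) (u t) - tens (u t) (u t)) k ξ
  bound : ∃ D : ℝ, ∀ t ∈ Icc 0 T, vsq r (u t) ≤ ENNReal.ofReal D
  bound_int : ∫⁻ t, vsq (r + 1) (u t) ∂(timeMeasure T) < ∞

theorem RegularSolution.aemeasurable {n : ℕ} {T : ℝ} {A : ℝ → FTensor n} {f : ℝ → VDist n}
    {u₀ : VDist n} {r : ℝ} {u : ℝ → VDist n} (h : RegularSolution T A f u₀ r u) (k : Fin n)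
    (ξ : Freq n) : AEMeasurable (fun t => u t k ξ) (timeMeasure T) :=
  (((h.prim k ξ).continuousOn.mono Ioo_subset_Icc_self).aestronglyMeasurable
    measurableSet_Ioo).aemeasurable

/-- The approximations are Cauchy in `L₂`, uniformly in time, so all coefficients converge at every
time. Bounds pass to the limit by lower semicontinuity, and the integral equation passes frequency
by frequency. -/
theorem exists_regularSolution {n : ℕ} (hn : 2 ≤ n) {r : ℝ} (hr : 0 < r)
    (hrn : (n : ℝ) / 2 < r + 1) {T c m : ℝ} (hT : 0 < T) (hm : 1 ≤ m) {K : ℝ≥0∞}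
    {A : ℝ → FTensor n} {f : ℝ → VDist n} (hA : ViscData T c m K A)
    {u₀ : VDist n} {F : ℝ → ℝ} {U D : ℝ} (hF : Integrable F (timeMeasure T))
    (hFb : ∀ᵐ t ∂(timeMeasure T), vsq (r - 1) (f t) ≤ ENNReal.ofReal (F t))
    (hF0 : ∀ t, 0 ≤ F t) (hU : ∀ N, rsq (box n N) r u₀ ≤ U)
    (happ : ∀ N, ∃ u, Approx T A f u₀ r D N u) : ∃ u, RegularSolution T A f u₀ r u := by
  obtain ⟨E, hE, hdiff⟩ := exists_approx_difference hn hr.le hrn hT (zero_le_one.trans hm) hA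
    (D := D) hF hFb hF0 hU
  choose v hv using happ
  have hD0 : 0 ≤ D := (rsq_nonneg (box n 0) r (v 0 0)).trans ((hv 0).bound 0 (left_mem_Icc.2 hT.le))
  have hpow : Tendsto (fun N : ℕ => E * (N : ℝ) ^ (-r)) atTop (𝓝 0) := by
    simpa using ((tendsto_rpow_neg_atTop hr).comp tendsto_natCast_atTop_atTop).const_mul E
  have hd0 : ∀ t ∈ Icc 0 T, ∀ B : Finset (Freq n), ∀ N M, 1 ≤ N → N ≤ M →
      rsq B 0 (v N t - v M t) ≤ E * (N : ℝ) ^ (-r) := by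
    intro t ht B N M hN hNM
    have h1 : SuppIn (box n M) (v N t - v M t) :=
      suppIn_sub (suppIn_mono (box_mono n hNM) ((hv N).supp t)) ((hv M).supp t)
    have h2 := rsq_le_of_vsq_le (B := B) (s := 0) (a := 0) ENNReal.one_ne_top h1
      (by rw [one_mul])
    rw [ENNReal.toReal_one, one_mul] at h2
    exact h2.trans (hdiff N M hN hNM _ _ (hv N) (hv M) t ht)
  have hcau : ∀ t ∈ Icc 0 T, ∀ k ξ, ∃ z, Tendsto (fun N => v N t k ξ) atTop (𝓝 z) := by
    intro t ht k ξ
    refine cauchySeq_tendsto_of_complete ?_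
    have hsq : Tendsto (fun N : ℕ => 2 * Real.sqrt (E * (N : ℝ) ^ (-r))) atTop (𝓝 0) := by
      simpa using ((Real.continuous_sqrt.tendsto 0).comp hpow).const_mul 2
    have hN : ∀ N M, 1 ≤ N → N ≤ M → dist (v N t k ξ) (v M t k ξ) ≤
        Real.sqrt (E * (N : ℝ) ^ (-r)) := by
      intro N M h1 h2
      refine Real.le_sqrt_of_sq_le ?_
      rw [dist_eq_norm]
      exact (norm_sq_le_rsq le_rfl (v N t - v M t) k (Finset.mem_singleton_self ξ)).trans
        (hd0 t ht _ N M h1 h2)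
    refine (cauchySeq_shift 1).1 (cauchySeq_of_le_tendsto_0 (fun N : ℕ =>
      2 * Real.sqrt (E * ((N + 1 : ℕ) : ℝ) ^ (-r))) (fun i j N hi hj => ?_)
      ((tendsto_add_atTop_iff_nat (f := fun N : ℕ => 2 * Real.sqrt (E * (N : ℝ) ^ (-r))) 1).2 hsq))
    have h1 := hN (N + 1) (i + 1) (by omega) (by omega)
    have h2 := hN (N + 1) (j + 1) (by omega) (by omega)
    have h3 := dist_triangle_left (v (i + 1) t k ξ) (v (j + 1) t k ξ) (v (N + 1) t k ξ)
    linarith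
  choose! z hz using hcau
  set u : ℝ → VDist n := fun t k ξ => z t k ξ with hu
  have hlim : ∀ t ∈ Icc 0 T, ∀ k ξ, Tendsto (fun N => v N t k ξ) atTop (𝓝 (u t k ξ)) := hz
  have hrb : ∀ t ∈ Icc 0 T, ∀ N a, rsq (box n N) a (v N t) = (vsq a (v N t)).toReal :=
    fun t _ N a => (((hv N).supp t).toReal_vsq a).symm
  have hvB : ∀ t ∈ Icc 0 T, ∀ N, vsq r (v N t) ≤ ENNReal.ofReal D := by
    intro t ht N
    rw [vsq_eq_ofReal_rsq ((hv N).supp t)]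
    exact ENNReal.ofReal_le_ofReal ((hv N).bound t ht)
  have hub : ∀ t ∈ Icc 0 T, vsq r (u t) ≤ ENNReal.ofReal D := by
    intro t ht
    refine vsq_le_of_rsq_le fun j => le_of_tendsto' (continuous_rsq_of_tendsto _ r (hlim t ht))
      fun N => ?_
    have h1 := rsq_le_of_vsq_le (B := box n j) (s := r) (a := r) ENNReal.one_ne_top ((hv N).supp t)
      (by rw [one_mul])
    rw [ENNReal.toReal_one, one_mul] at h1
    exact h1.trans ((hv N).bound t ht)
  have hdl : ∀ t ∈ Icc 0 T, ∀ N, 1 ≤ N → vsq 0 (v N t - u t) ≤ ENNReal.ofReal (E * (N : ℝ) ^ (-r)) := by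
    intro t ht N hN
    refine vsq_le_of_rsq_le fun j => ?_
    have h1 : Tendsto (fun M => rsq (box n j) 0 (v N t - v M t)) atTop
        (𝓝 (rsq (box n j) 0 (v N t - u t))) :=
      continuous_rsq_of_tendsto _ 0 fun k ξ => (hlim t ht k ξ).const_sub _
    exact le_of_tendsto h1 (eventually_atTop.2 ⟨N, fun M hM => hd0 t ht _ N M hN hM⟩)
  have hvm : ∀ N k ξ, AEMeasurable (fun t => v N t k ξ) (timeMeasure T) := by
    intro N k ξ
    by_cases hξ : ξ ∈ box n N
    · exact ((((hv N).prim k ξ hξ).continuousOn.mono Ioo_subset_Icc_self).aestronglyMeasurable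
        measurableSet_Ioo).aemeasurable
    · simp only [(hv N).supp _ k ξ hξ]
      exact aemeasurable_const
  have hum : ∀ k ξ, AEMeasurable (fun t => u t k ξ) (timeMeasure T) := by
    intro k ξ
    refine aemeasurable_of_tendsto_metrizable_ae atTop (fun N => hvm N k ξ) ?_
    filter_upwards [ae_restrict_mem measurableSet_Ioo] with t ht
    exact hlim t (Ioo_subset_Icc_self ht) k ξ
  -- Fatou's lemma twice: first in `N` for the frequencies in a fixed cube, then in the size `j` of
  -- the cube.
  have hint : ∫⁻ t, vsq (r + 1) (u t) ∂(timeMeasure T) ≤ ENNReal.ofReal D := by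
    have hm1 : ∀ w : ℝ → VDist n, (∀ k ξ, AEMeasurable (fun t => w t k ξ) (timeMeasure T)) → ∀ j,
        AEMeasurable (fun t => ENNReal.ofReal (rsq (box n j) (r + 1) (w t))) (timeMeasure T) := by
      intro w hw j
      simp only [ofReal_rsq]
      exact Finset.aemeasurable_fun_sum _ fun k _ => Finset.aemeasurable_fun_sum _ fun ξ _ =>
        ((hw k ξ).enorm.pow_const 2).const_mul _
    have h1 : ∀ j, ∫⁻ t, ENNReal.ofReal (rsq (box n j) (r + 1) (u t)) ∂(timeMeasure T) ≤
        ENNReal.ofReal D := by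
      intro j
      have h2 : ∫⁻ t, ENNReal.ofReal (rsq (box n j) (r + 1) (u t)) ∂(timeMeasure T) =
          ∫⁻ t, liminf (fun N => ENNReal.ofReal (rsq (box n j) (r + 1) (v N t))) atTop
            ∂(timeMeasure T) := by
        refine lintegral_congr_ae ?_
        filter_upwards [ae_restrict_mem measurableSet_Ioo] with t ht
        exact (((ENNReal.continuous_ofReal.tendsto _).comp (continuous_rsq_of_tendsto _ _
          (hlim t (Ioo_subset_Icc_self ht)))).liminf_eq).symm
      rw [h2]
      refine (lintegral_liminf_le' fun N => hm1 _ (hvm N) j).trans ?_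
      refine liminf_le_of_frequently_le' (Frequently.of_forall fun N => ?_)
      have h3 : Integrable (fun t => rsq (box n N) (r + 1) (v N t)) (timeMeasure T) :=
        integrable_of_continuousOn_Icc (continuousOn_rsq _ _ fun k ξ hξ =>
          ((hv N).prim k ξ hξ).continuousOn)
      calc _ ≤ ∫⁻ t, ENNReal.ofReal (rsq (box n N) (r + 1) (v N t)) ∂(timeMeasure T) := by
            refine lintegral_mono fun t => ?_
            rw [← vsq_eq_ofReal_rsq ((hv N).supp t)]
            exact ofReal_rsq_le _ _ _
        _ = ENNReal.ofReal (∫ t in Ioo 0 T, rsq (box n N) (r + 1) (v N t)) :=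
            (ofReal_integral_eq_lintegral_ofReal h3 (ae_of_all _ fun t => rsq_nonneg _ _ _)).symm
        _ ≤ _ := ENNReal.ofReal_le_ofReal (hv N).bound_int
    have h2 : ∫⁻ t, vsq (r + 1) (u t) ∂(timeMeasure T) =
        ∫⁻ t, liminf (fun j => ENNReal.ofReal (rsq (box n j) (r + 1) (u t))) atTop
          ∂(timeMeasure T) :=
      lintegral_congr fun t => ((tendsto_ofReal_rsq_box (r + 1) (u t)).liminf_eq).symm
    rw [h2]
    exact (lintegral_liminf_le' fun j => hm1 _ hum j).trans
      (liminf_le_of_frequently_le' (Frequently.of_forall h1))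
  have hae : ∀ᵐ t ∂(timeMeasure T), vsq (r + 1) (u t) < ∞ :=
    ae_lt_top' (aemeasurable_vsq hum _) (hint.trans_lt ENNReal.ofReal_lt_top).ne
  have hsol : ∀ t ∈ Icc 0 T, Solenoidal (u t) := by
    intro t ht
    refine ⟨fun k ξ => ?_, ?_, fun k => ?_⟩
    · have h1 := hlim t ht k (-ξ)
      simp only [fun N => ((hv N).sol t ht).real k ξ] at h1
      exact tendsto_nhds_unique h1 ((Complex.continuous_conj.tendsto _).comp (hlim t ht k ξ))
    · ext ξ
      have h1 : Tendsto (fun N => divergence (v N t) ξ) atTop (𝓝 (divergence (u t) ξ)) :=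
        tendsto_finsetSum _ fun j _ => (hlim t ht j ξ).const_mul _
      simp only [fun N => ((hv N).sol t ht).div] at h1
      exact tendsto_nhds_unique h1 tendsto_const_nhds
    · have h1 := hlim t ht k 0
      simp only [fun N => ((hv N).sol t ht).mean k] at h1
      exact tendsto_nhds_unique h1 tendsto_const_nhds
  refine ⟨u, ?_, hsol, fun k ξ => ?_, ⟨D, hub⟩, hint.trans_lt ENNReal.ofReal_lt_top⟩
  · ext k ξ
    obtain ⟨N₀, hN₀⟩ := exists_mem_box ξ
    refine tendsto_nhds_unique (hlim 0 (left_mem_Icc.2 hT.le) k ξ) (tendsto_const_nhds.congr' ?_)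
    refine eventually_atTop.2 ⟨N₀, fun N hN => ?_⟩
    have : ξ ∈ box n N := box_mono n hN hN₀
    simp [(hv N).init, trunc, this]
  · obtain ⟨N₀, hN₀⟩ := exists_mem_box ξ
    -- At the fixed frequency the right-hand sides differ by at most `√(Q E N^(-r))`, uniformly in
    -- time.
    obtain ⟨Q, hQ, hQb⟩ := exists_enorm_rhs_sub_le hA.fin (ENNReal.ofReal_ne_top (r := D)) ξ
    refine IsPrim.of_tendsto (N₀ := N₀ + 1) (yN := fun N t => v N t k ξ) (gN := fun N t =>
      leray (f t + visc (A t) (v N t) - tens (v N t) (v N t)) k ξ)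
      (c := fun N => Real.sqrt (Q.toReal * (E * (N : ℝ) ^ (-r))))
      (fun N hN => (hv N).prim k ξ (box_mono n (by omega) hN₀)) (fun t ht => hlim t ht k ξ) ?_ ?_
    · have := (Real.continuous_sqrt.tendsto 0).comp (by simpa using hpow.const_mul Q.toReal :
        Tendsto (fun N : ℕ => Q.toReal * (E * (N : ℝ) ^ (-r))) atTop (𝓝 0))
      rwa [Real.sqrt_zero] at this
    · intro N hN
      filter_upwards [hae, hA.wiener, ae_restrict_mem measurableSet_Ioo] with t h1 h2 h3
      have ht := Ioo_subset_Icc_self h3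
      have h4 := hQb (A t) (h2.mono hm) (f t) (v N t) (u t) (((hv N).supp t).vsq_lt_top 1)
        ((vsq_mono (by linarith) _).trans_lt h1) ((vsq_mono hr.le _).trans (hvB t ht N))
        ((vsq_mono hr.le _).trans (hub t ht)) k
      have h5 : 0 ≤ E * (N : ℝ) ^ (-r) := by positivity
      refine Real.le_sqrt_of_sq_le ?_
      refine le_toReal_mul_of_ofReal_le hQ h5 ?_
      rw [ENNReal.ofReal_pow (norm_nonneg _), ofReal_norm]
      refine h4.trans ?_
      gcongr
      exact hdl t ht N (by omega)

/-! ### Distributional time derivatives -/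

/-- `φ` is a test function on `(0,T)`. -/
structure IsTest (T : ℝ) (φ : ℝ → ℝ) : Prop where
  smooth : ContDiff ℝ (⊤ : ℕ∞) φ
  compact : HasCompactSupport φ
  subset : tsupport φ ⊆ Ioo 0 T

/-- `g` is the derivative of `y` in the sense of distributions on `(0,T)`. -/
def WeakDeriv (T : ℝ) (y g : ℝ → ℂ) : Prop :=
  LocallyIntegrableOn y (Ioo 0 T) ∧ LocallyIntegrableOn g (Ioo 0 T) ∧
    ∀ φ : ℝ → ℝ, ContDiff ℝ (⊤ : ℕ∞) φ → HasCompactSupport φ → tsupport φ ⊆ Ioo 0 T →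
      ∫ t in Ioo 0 T, (φ t : ℂ) * g t = -∫ t in Ioo 0 T, ((deriv φ t : ℝ) : ℂ) * y t

theorem IsTest.deriv {T : ℝ} {φ : ℝ → ℝ} (h : IsTest T φ) : IsTest T (deriv φ) :=
  ⟨(contDiff_infty_iff_deriv.1 h.smooth).2, h.compact.deriv, tsupport_deriv_subset.trans h.subset⟩

theorem IsTest.integrable {T : ℝ} {φ : ℝ → ℝ} (h : IsTest T φ) {y : ℝ → ℂ}
    (hy : LocallyIntegrableOn y (Ioo 0 T)) : Integrable (fun t => (φ t : ℂ) * y t) := by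
  have h1 : IntegrableOn y (tsupport φ) := hy.integrableOn_compact_subset h.subset h.compact
  have h2 : ContinuousOn (fun t => (φ t : ℂ)) (tsupport φ) :=
    (Complex.continuous_ofReal.comp h.smooth.continuous).continuousOn
  refine (integrableOn_iff_integrable_of_support_subset fun t ht => ?_).1
    (h1.continuousOn_mul h2 h.compact)
  by_contra hc
  exact ht (by simp [image_eq_zero_of_notMem_tsupport hc])

theorem IsTest.setIntegral {T : ℝ} {φ : ℝ → ℝ} (h : IsTest T φ) (y : ℝ → ℂ) :
    ∫ t in Ioo 0 T, (φ t : ℂ) * y t = ∫ t, (φ t : ℂ) * y t := by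
  refine setIntegral_eq_integral_of_forall_compl_eq_zero fun t ht => ?_
  rw [image_eq_zero_of_notMem_tsupport fun hc => ht (h.subset hc)]
  simp

theorem ae_eq_zero_of_forall_test {T : ℝ} {y : ℝ → ℂ} (hy : LocallyIntegrableOn y (Ioo 0 T))
    (h : ∀ φ, IsTest T φ → ∫ t, (φ t : ℂ) * y t = 0) : ∀ᵐ t ∂(timeMeasure T), y t = 0 := by
  rw [ae_timeMeasure_iff]
  refine isOpen_Ioo.ae_eq_zero_of_integral_contDiff_smul_eq_zero hy fun φ h1 h2 h3 => ?_
  simpa only [Complex.real_smul] using h φ ⟨h1, h2, h3⟩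

theorem WeakDeriv.sum_mul {T : ℝ} {ι : Type*} {S : Finset ι} {y g : ι → ℝ → ℂ} (c : ι → ℂ)
    (h : ∀ i, WeakDeriv T (y i) (g i)) :
    WeakDeriv T (fun t => ∑ i ∈ S, c i * y i t) (fun t => ∑ i ∈ S, c i * g i t) := by
  have hl : ∀ z : ι → ℝ → ℂ, (∀ i, LocallyIntegrableOn (z i) (Ioo 0 T)) →
      LocallyIntegrableOn (fun t => ∑ i ∈ S, c i * z i t) (Ioo 0 T) := by
    intro z hz
    rw [locallyIntegrableOn_iff isOpen_Ioo.isLocallyClosed] 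
    intro K hK hKc
    exact integrable_finsetSum _ fun i _ => ((hz i).integrableOn_compact_subset hK hKc).const_mul _
  refine ⟨hl y fun i => (h i).1, hl g fun i => (h i).2.1, fun φ h1 h2 h3 => ?_⟩
  have ht : IsTest T φ := ⟨h1, h2, h3⟩
  have e : ∀ (ψ : ℝ → ℝ) (z : ι → ℝ → ℂ), (∀ i, LocallyIntegrableOn (z i) (Ioo 0 T)) → IsTest T ψ →
      ∫ t in Ioo 0 T, (ψ t : ℂ) * ∑ i ∈ S, c i * z i t =
        ∑ i ∈ S, c i * ∫ t in Ioo 0 T, (ψ t : ℂ) * z i t := by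
    intro ψ z hz hψ
    rw [hψ.setIntegral]
    simp only [hψ.setIntegral, Finset.mul_sum, ← integral_const_mul]
    rw [← integral_finsetSum _ fun i _ => (hψ.integrable (hz i)).const_mul _]
    refine integral_congr_ae (ae_of_all _ fun t => Finset.sum_congr rfl fun i _ => ?_)
    ring
  rw [e φ g (fun i => (h i).2.1) ht, e _ y (fun i => (h i).1) ht.deriv, ← Finset.sum_neg_distrib]
  refine Finset.sum_congr rfl fun i _ => ?_
  rw [(h i).2.2 φ h1 h2 h3, mul_neg]

theorem WeakDeriv.eq_zero {T : ℝ} {y g : ℝ → ℂ} (h : WeakDeriv T y g)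
    (hy : ∀ᵐ t ∂(timeMeasure T), y t = 0) : ∀ᵐ t ∂(timeMeasure T), g t = 0 := by
  refine ae_eq_zero_of_forall_test h.2.1 fun φ hφ => ?_
  rw [← hφ.setIntegral, h.2.2 φ hφ.smooth hφ.compact hφ.subset, neg_eq_zero]
  exact integral_eq_zero_of_ae (hy.mono fun t ht => by simp [ht])

theorem WeakDeriv.sub {T : ℝ} {y g y' g' : ℝ → ℂ} (h : WeakDeriv T y g) (h' : WeakDeriv T y' g') :
    WeakDeriv T (fun t => y t - y' t) (fun t => g t - g' t) := by
  have := WeakDeriv.sum_mul (S := Finset.univ) (y := fun b : Bool => if b then y else y')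
    (g := fun b : Bool => if b then g else g') (fun b => if b then 1 else -1)
    (fun b => by cases b <;> simpa)
  simpa [sub_eq_add_neg] using this

theorem WeakDeriv.congr {T : ℝ} {y y' g : ℝ → ℂ} (h : WeakDeriv T y g)
    (hy : ∀ᵐ t ∂(timeMeasure T), y t = y' t) : WeakDeriv T y' g := by
  refine ⟨?_, h.2.1, fun φ h1 h2 h3 => ?_⟩
  · have h1 := h.1
    rw [locallyIntegrableOn_iff isOpen_Ioo.isLocallyClosed] at h1 ⊢
    exact fun K hK hKc => (h1 K hK hKc).congr (ae_mono (Measure.restrict_mono hK le_rfl) hy)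
  · rw [h.2.2 φ h1 h2 h3]
    congr 1
    exact integral_congr_ae (hy.mono fun t ht => by simp [ht])

theorem WeakDeriv.unique {T : ℝ} {y g g' : ℝ → ℂ} (h : WeakDeriv T y g) (h' : WeakDeriv T y g') :
    ∀ᵐ t ∂(timeMeasure T), g t = g' t := by
  filter_upwards [(h.sub h').eq_zero (ae_of_all _ fun t => sub_self _)] with t ht
  exact sub_eq_zero.1 ht

theorem IsPrim.of_re_im {T : ℝ} {y g : ℝ → ℂ} (hr : IsPrim T (fun t => (y t).re) fun t => (g t).re)
    (hi : IsPrim T (fun t => (y t).im) fun t => (g t).im) : IsPrim T y g := by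
  have h1 := (hr.clm Complex.ofRealCLM).add (hi.clm (Complex.I • Complex.ofRealCLM))
  have e : ∀ z : ℂ, Complex.ofRealCLM z.re + (Complex.I • Complex.ofRealCLM) z.im = z := by
    intro z
    simp only [Complex.ofRealCLM_apply, smul_apply, smul_eq_mul]
    rw [_root_.mul_comm Complex.I]
    exact Complex.re_add_im z
  simpa only [e] using h1

theorem IsPrim.ofReal_mul {T : ℝ} {φ φ' : ℝ → ℝ} {y g : ℝ → ℂ} (hφ : IsPrim T φ φ')
    (hy : IsPrim T y g) :
    IsPrim T (fun t => (φ t : ℂ) * y t) (fun t => (φ' t : ℂ) * y t + (φ t : ℂ) * g t) := by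
  refine IsPrim.of_re_im ?_ ?_
  · simpa [_root_.mul_comm] using hφ.mul hy.re
  · simpa [_root_.mul_comm] using hφ.mul hy.im

theorem IsPrim.weakDeriv {T : ℝ} {y g : ℝ → ℂ} (h : IsPrim T y g) : WeakDeriv T y g := by
  have hyi : Integrable y (timeMeasure T) := integrable_of_continuousOn_Icc h.continuousOn
  refine ⟨IntegrableOn.locallyIntegrableOn hyi, IntegrableOn.locallyIntegrableOn h.int,
    fun φ h1 h2 h3 => ?_⟩
  rcases lt_or_ge T 0 with hT | hT
  · simp [Ioo_eq_empty (not_lt.2 hT.le)]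
  have ht : IsTest T φ := ⟨h1, h2, h3⟩
  have hφ : IsPrim T φ (deriv φ) := by
    refine ⟨integrable_of_continuousOn_Icc ht.deriv.smooth.continuous.continuousOn, fun t _ => ?_⟩
    rw [intervalIntegral.integral_deriv_eq_sub
      (fun x _ => (h1.differentiable (by simp)).differentiableAt)
      (ht.deriv.smooth.continuous.intervalIntegrable _ _)]
    ring
  have h0 : ∀ t, t ∉ Ioo 0 T → φ t = 0 := fun t h' =>
    image_eq_zero_of_notMem_tsupport fun hc => h' (h3 hc)
  have h4 := (hφ.ofReal_mul h).eq T (right_mem_Icc.2 hT)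
  rw [h0 T (by simp), h0 0 (by simp), intervalIntegral_eq_Ioo hT, integral_add
    (ht.deriv.integrable (IntegrableOn.locallyIntegrableOn hyi)).integrableOn
    (ht.integrable (IntegrableOn.locallyIntegrableOn h.int)).integrableOn] at h4
  simp only [Complex.ofReal_zero, zero_mul, zero_add] at h4
  exact eq_neg_of_add_eq_zero_right h4.symm

/-- A function with vanishing derivative in the sense of distributions is constant. -/
theorem WeakDeriv.ae_eq_const {T : ℝ} (hT : 0 < T) {y : ℝ → ℂ} (h : WeakDeriv T y fun _ => 0) :
    ∃ c : ℂ, ∀ᵐ t ∂(timeMeasure T), y t = c := by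
  let b : ContDiffBump (T / 2) := ⟨T / 8, T / 4, by positivity, by linarith⟩
  set η : ℝ → ℝ := b.normed volume with hη
  have hηt : IsTest T η := by
    refine ⟨b.contDiff_normed, b.hasCompactSupport_normed, ?_⟩
    rw [hη, b.tsupport_normed_eq]
    intro t ht
    rw [Metric.mem_closedBall, Real.dist_eq, abs_le] at ht
    have e : b.rOut = T / 4 := rfl
    rw [e] at ht
    constructor <;> linarith [ht.1, ht.2]
  have hη1 : ∫ t, η t = 1 := b.integral_normed
  refine ⟨∫ t, (η t : ℂ) * y t, ?_⟩
  set c : ℂ := ∫ t, (η t : ℂ) * y t with hc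
  have hcl : LocallyIntegrableOn (fun _ : ℝ => c) (Ioo 0 T) :=
    (locallyIntegrable_const c).locallyIntegrableOn _
  have hyc : ∀ᵐ t ∂(timeMeasure T), y t - c = 0 := by
    refine ae_eq_zero_of_forall_test (h.1.sub hcl) fun ψ hψ => ?_
    set m : ℝ := ∫ t, ψ t with hm
    -- Removing the mean value of `ψ` makes its primitive `Φ` a test function. Testing the vanishing
    -- derivative with `Φ` gives `∫ χ y = 0`, that is `∫ ψ y = c ∫ ψ`.
    set χ : ℝ → ℝ := fun t => ψ t - m * η t with hχ
    have hχc : ContDiff ℝ (⊤ : ℕ∞) χ := hψ.smooth.sub (contDiff_const.mul hηt.smooth)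
    set Φ : ℝ → ℝ := fun t => ∫ s in 0..t, χ s with hΦ
    have hΦd : ∀ t, HasDerivAt Φ (χ t) t := fun t =>
      intervalIntegral.integral_hasDerivAt_right (hχc.continuous.intervalIntegrable _ _)
        (hχc.continuous.stronglyMeasurableAtFilter _ _) hχc.continuous.continuousAt
    have hΦ' : deriv Φ = χ := funext fun t => (hΦd t).deriv
    have hK : IsCompact (tsupport ψ ∪ tsupport η) := hψ.compact.union hηt.compact
    have hKne : (tsupport ψ ∪ tsupport η).Nonempty := by
      refine ⟨T / 2, Or.inr ?_⟩
      rw [hη, b.tsupport_normed_eq]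
      exact Metric.mem_closedBall_self (by positivity)
    have hKs : tsupport ψ ∪ tsupport η ⊆ Ioo 0 T := union_subset hψ.subset hηt.subset
    obtain ⟨p, hp⟩ := hK.exists_isLeast hKne
    obtain ⟨q, hq⟩ := hK.exists_isGreatest hKne
    have hχ0 : ∀ t, t ∉ tsupport ψ ∪ tsupport η → χ t = 0 := by
      intro t ht
      simp only [hχ]
      rw [image_eq_zero_of_notMem_tsupport fun h' => ht (Or.inl h'),
        image_eq_zero_of_notMem_tsupport fun h' => ht (Or.inr h')]
      ring
    have hψi : Integrable ψ := hψ.smooth.continuous.integrable_of_hasCompactSupport hψ.compact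
    have hηi : Integrable η := hηt.smooth.continuous.integrable_of_hasCompactSupport hηt.compact
    have hχi : ∫ t, χ t = 0 := by
      simp only [hχ]
      rw [integral_sub hψi (hηi.const_mul _), integral_const_mul, hη1]
      simp [hm]
    -- Before `p` nothing has been integrated yet, and after `q` the total integral of `χ`, which is
    -- zero, has been collected.
    have hΦs : tsupport Φ ⊆ Icc p q := by
      refine closure_minimal (fun t ht => ?_) isClosed_Icc
      by_contra hcon
      refine ht ?_
      rw [mem_Icc, not_and_or, not_le, not_le] at hcon
      rcases hcon with hcon | hcon
      · have h1 : ∀ s ∈ uIcc 0 t, χ s = 0 := by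
          intro s hs
          refine hχ0 s fun h' => ?_
          have h2 := hp.2 h'
          have h3 := (hKs hp.1).1
          rcases mem_uIcc.1 hs with h4 | h4 <;> linarith [h4.1, h4.2]
        simp only [hΦ]
        rw [intervalIntegral.integral_congr (g := fun _ => 0) h1]
        simp
      · simp only [hΦ]
        rw [intervalIntegral.integral_eq_integral_of_support_subset, hχi]
        intro s hs
        have h1 : s ∈ tsupport ψ ∪ tsupport η := by
          by_contra h'
          exact hs (hχ0 s h')
        exact ⟨(hKs h1).1, (hq.2 h1).trans hcon.le⟩
    have hΦt : IsTest T Φ := by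
      refine ⟨contDiff_infty_iff_deriv.2 ⟨fun t => (hΦd t).differentiableAt, ?_⟩,
        isCompact_Icc.of_isClosed_subset (isClosed_tsupport _) hΦs, hΦs.trans ?_⟩
      · rw [hΦ']
        exact hχc
      · exact fun t ht => ⟨(hKs hp.1).1.trans_le ht.1, ht.2.trans_lt (hKs hq.1).2⟩
    have h5 := h.2.2 Φ hΦt.smooth hΦt.compact hΦt.subset
    rw [hΦt.deriv.setIntegral, hΦ'] at h5
    simp only [mul_zero, integral_zero] at h5
    have h6 : ∫ t, (χ t : ℂ) * y t = 0 := neg_eq_zero.1 h5.symm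
    have e1 : ∀ t, (χ t : ℂ) * y t = (ψ t : ℂ) * y t - m * ((η t : ℂ) * y t) := by
      intro t
      simp only [hχ]
      push_cast
      ring
    simp only [e1] at h6
    rw [integral_sub (hψ.integrable h.1) ((hηt.integrable h.1).const_mul _), integral_const_mul] at h6
    simp only [mul_sub]
    rw [integral_sub (hψ.integrable h.1) (hψ.integrable hcl), integral_mul_const,
      integral_complex_ofReal]
    exact h6
  filter_upwards [hyc] with t ht using sub_eq_zero.1 ht

/-- A continuous function with integrable derivative in the sense of distributions. -/
theorem WeakDeriv.isPrim {T : ℝ} (hT : 0 < T) {y g : ℝ → ℂ} (h : WeakDeriv T y g)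
    (hy : ContinuousOn y (Icc 0 T)) (hg : Integrable g (timeMeasure T)) : IsPrim T y g := by
  have hp : IsPrim T (fun t => ∫ s in 0..t, g s) g := ⟨hg, fun t _ => by simp⟩
  have h1 := h.sub hp.weakDeriv
  simp only [sub_self] at h1
  obtain ⟨c, hc⟩ := h1.ae_eq_const hT
  have h2 : EqOn (fun t => y t - ∫ s in 0..t, g s) (fun _ => c) (Icc 0 T) := by
    refine Measure.eqOn_Icc_of_ae_eq volume hT.ne ?_ (hy.sub hp.continuousOn) continuousOn_const
    rw [← Measure.restrict_congr_set Ioo_ae_eq_Icc]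
    exact hc
  refine ⟨hg, fun t ht => ?_⟩
  have h3 := h2 ht
  have h4 := h2 (left_mem_Icc.2 hT.le)
  simp only [intervalIntegral.integral_same, sub_zero] at h3 h4
  rw [h4, ← h3]
  ring

/-! ### Testing with trigonometric polynomials -/

/-- The real trigonometric polynomial with coefficients `z` at `ξ` and `z̄` at `-ξ`. -/
def mode {n : ℕ} (ξ : Freq n) (z : ℂ) : SDist n := fun η =>
  (if η = ξ then z else 0) + if η = -ξ then conj z else 0

/-- The vector field with the only component `mode ξ z`. -/
def modeV {n : ℕ} (k : Fin n) (ξ : Freq n) (z : ℂ) : VDist n := fun j =>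
  if j = k then mode ξ z else 0

theorem isRealDist_mode {n : ℕ} (ξ : Freq n) (z : ℂ) : IsRealDist (mode ξ z) := by
  intro η
  simp only [mode, map_add, neg_eq_iff_eq_neg, neg_neg, apply_ite conj, map_zero, Complex.conj_conj]
  rw [add_comm]

theorem isRealDist_modeV {n : ℕ} (k : Fin n) (ξ : Freq n) (z : ℂ) (j : Fin n) :
    IsRealDist (modeV k ξ z j) := by
  unfold modeV
  split_ifs
  · exact isRealDist_mode ξ z
  · intro η
    simp

theorem suppIn_modeV {n : ℕ} (k : Fin n) (ξ : Freq n) (z : ℂ) : SuppIn {ξ, -ξ} (modeV k ξ z) := by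
  intro j η h
  simp only [Finset.mem_insert, Finset.mem_singleton, not_or] at h
  unfold modeV
  split_ifs <;> simp [mode, h.1, h.2]

theorem modeV_mem_HV {n : ℕ} (s : ℝ) (k : Fin n) (ξ : Freq n) (z : ℂ) : modeV k ξ z ∈ HV s :=
  fun j => ⟨isRealDist_modeV k ξ z j,
    sobolevNorm_lt_top.2 (vsq_lt_top.1 ((suppIn_modeV k ξ z).vsq_lt_top s) j)⟩

theorem pairing_mode {n : ℕ} (g : SDist n) (ξ : Freq n) (z : ℂ) :
    pairing g (mode ξ z) = g (-ξ) * z + g ξ * conj z := by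
  have e : ∀ η, g η * mode ξ z (-η) =
      (if η = -ξ then g (-ξ) * z else 0) + if η = ξ then g ξ * conj z else 0 := by
    intro η
    simp only [mode, neg_eq_iff_eq_neg, neg_neg, mul_add, mul_ite, mul_zero]
    congr 1 <;> split_ifs with h <;> simp [h]
  unfold pairing
  simp only [e]
  rw [Summable.tsum_add (hasSum_ite_eq _ _).summable (hasSum_ite_eq _ _).summable, tsum_ite_eq,
    tsum_ite_eq]

theorem pairingV_modeV {n : ℕ} (F : VDist n) (k : Fin n) (ξ : Freq n) (z : ℂ) :
    pairingV F (modeV k ξ z) = F k (-ξ) * z + F k ξ * conj z := by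
  unfold pairingV
  rw [Finset.sum_eq_single k]
  · simp only [modeV, if_true, pairing_mode]
  · intro j _ hj
    simp [modeV, hj, pairing]
  · simp

/-- Admissible test fields are real and mix the frequencies `ξ` and `-ξ`. Combining the amplitudes
`1` and `I` isolates one coefficient, for `F` not necessarily real. -/
theorem pairingV_modeV_one_add {n : ℕ} (F : VDist n) (k : Fin n) (ξ : Freq n) :
    (pairingV F (modeV k ξ 1) + Complex.I * pairingV F (modeV k ξ Complex.I)) / 2 = F k ξ := by
  rw [pairingV_modeV, pairingV_modeV, map_one, Complex.conj_I]
  linear_combination (F k (-ξ) - F k ξ) / 2 * Complex.I_sq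

theorem summable_pairing {n : ℕ} {s : ℝ} {g h : SDist n} (hg : sq (-s) g < ∞) (hh : sq s h < ∞)
    (hr : IsRealDist h) : Summable fun ξ => g ξ * h (-ξ) := by
  simpa only [hr _] using summable_mul_conj hg hh

theorem pairingV_add {n : ℕ} {s : ℝ} {F G w : VDist n} (hF : vsq (-s) F < ∞) (hG : vsq (-s) G < ∞)
    (hw : vsq s w < ∞) (hr : ∀ k, IsRealDist (w k)) :
    pairingV (F + G) w = pairingV F w + pairingV G w := by
  rw [vsq_lt_top] at hF hG hw
  unfold pairingV
  rw [← Finset.sum_add_distrib]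
  refine Finset.sum_congr rfl fun k _ => ?_
  unfold pairing
  rw [← Summable.tsum_add (summable_pairing (hF k) (hw k) (hr k))
    (summable_pairing (hG k) (hw k) (hr k))]
  simp only [Pi.add_apply, add_mul]

theorem pairingV_sub {n : ℕ} {s : ℝ} {F G w : VDist n} (hF : vsq (-s) F < ∞) (hG : vsq (-s) G < ∞)
    (hw : vsq s w < ∞) (hr : ∀ k, IsRealDist (w k)) :
    pairingV (F - G) w = pairingV F w - pairingV G w := by
  rw [vsq_lt_top] at hF hG hw
  unfold pairingV
  rw [← Finset.sum_sub_distrib]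
  refine Finset.sum_congr rfl fun k _ => ?_
  unfold pairing
  rw [← Summable.tsum_sub (summable_pairing (hF k) (hw k) (hr k))
    (summable_pairing (hG k) (hw k) (hr k))]
  simp only [Pi.sub_apply, sub_mul]

theorem mem_HV {n : ℕ} {s : ℝ} {v : VDist n} :
    v ∈ HV s ↔ (∀ k, IsRealDist (v k)) ∧ vsq s v < ∞ := by
  rw [vsq_lt_top]
  simp only [HV, H, mem_ofPred_eq, sobolevNorm_lt_top, forall_and]

theorem mem_dotHV {n : ℕ} {s : ℝ} {v : VDist n} :
    v ∈ dotHV s ↔ (∀ k, IsRealDist (v k)) ∧ vsq s v < ∞ ∧ ∀ k, v k 0 = 0 := by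
  rw [vsq_lt_top]
  simp only [dotHV, dotH, H, mem_ofPred_eq, sobolevNorm_lt_top, forall_and, and_assoc]

theorem mem_dotHsigma {n : ℕ} {s : ℝ} {v : VDist n} :
    v ∈ dotHsigma s ↔ Solenoidal v ∧ vsq s v < ∞ := by
  simp only [dotHsigma, mem_ofPred_eq, mem_dotHV]
  exact ⟨fun h => ⟨⟨h.1.1, h.2, h.1.2.2⟩, h.1.2.1⟩, fun h => ⟨⟨h.1.real, h.2, h.1.mean⟩, h.1.div⟩⟩

theorem leray_eq_self {n : ℕ} {w : VDist n} (h0 : ∀ k, w k 0 = 0)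
    (h : ∀ ξ, ∑ j, (ξ j : ℂ) * w j ξ = 0) : leray w = w := by
  ext k ξ
  by_cases hξ : ξ = 0
  · simp [leray, hξ, h0]
  · simp [leray, hξ, h ξ]

theorem leray_leray {n : ℕ} (F : VDist n) : leray (leray F) = leray F :=
  leray_eq_self (fun k => by simp [leray]) (sum_mul_leray F)

theorem solenoidal_leray {n : ℕ} {F : VDist n} (hF : ∀ k, IsRealDist (F k)) : Solenoidal (leray F) :=
  ⟨isRealDist_leray hF, divergence_leray F, fun k => by simp [leray]⟩

theorem Solenoidal.leray_eq {n : ℕ} {w : VDist n} (h : Solenoidal w) : leray w = w :=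
  leray_eq_self h.mean (Solenoidal.sum_mul_eq_zero h.div)

/-- A functional which vanishes on the solenoidal fields has no solenoidal part. -/
theorem leray_eq_zero {n : ℕ} {s : ℝ} {G : VDist n} (hr : ∀ k, IsRealDist (G k))
    (hG : vsq (-s) G < ∞) (h : ∀ w ∈ dotHsigma s, pairingV G w = 0) : leray G = 0 := by
  have h1 : ∀ N, rsq (box n N) 0 (leray G) = 0 := by
    intro N
    -- The test field is the truncated projection of `G` itself; it is real, solenoidal and smooth,
    -- and the pairing is its squared norm.
    set w := trunc (box n N) (leray G) with hw
    have hs : Solenoidal w := (solenoidal_leray hr).trunc N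
    have hf : vsq s w < ∞ := (suppIn_trunc _ _).vsq_lt_top s
    have h2 := h w (mem_dotHsigma.2 ⟨hs, hf⟩)
    rw [← pairingV_leray hG hf hs, pairingV_eq ?_ hf hs.real, tsum_eq_sum (s := box n N)] at h2
    · have e : ((rsq (box n N) 0 (leray G) : ℝ) : ℂ) = 0 := by
        rw [← h2]
        unfold rsq
        rw [Finset.sum_comm]
        push_cast
        refine Finset.sum_congr rfl fun ξ hξ => Finset.sum_congr rfl fun k _ => ?_
        simp only [hw, trunc, hξ, if_true, mul_zero, Real.rpow_zero, Complex.ofReal_one, one_mul]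
        rw [Complex.mul_conj']
      exact_mod_cast e
    · intro ξ hξ
      simp [hw, trunc, hξ]
    · obtain ⟨C, hC, H⟩ := vsq_leray_le (n := n)
      exact (H (-s) G).trans_lt (by finiteness)
  have h2 : vsq 0 (leray G) ≤ ENNReal.ofReal 0 := vsq_le_of_rsq_le fun N => (h1 N).le
  ext k ξ
  have h3 := enorm_sq_le_vsq 0 (leray G) k ξ
  rw [ENNReal.ofReal_zero, nonpos_iff_eq_zero] at h2
  rw [h2, mul_zero, nonpos_iff_eq_zero] at h3
  simpa using h3

/-! ### Functions of time with values in Sobolev spaces -/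

theorem lintegral_vsq {n : ℕ} {T s : ℝ} {v : ℝ → VDist n}
    (hv : ∀ k ξ, AEMeasurable (fun t => v t k ξ) (timeMeasure T)) :
    ∫⁻ t, vsq s (v t) ∂(timeMeasure T) = ∑ k, ∫⁻ t, sq s (v t k) ∂(timeMeasure T) := by
  refine lintegral_finsetSum' _ fun k _ => ?_
  unfold sq wsq
  exact AEMeasurable.tsum fun ξ => ((hv k ξ).enorm.pow_const 2).const_mul _

theorem eLpNorm_two_sobolevNorm {n : ℕ} {T s : ℝ} {g : ℝ → SDist n} :
    eLpNorm (fun t => sobolevNorm s (g t)) 2 (timeMeasure T) < ∞ ↔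
      ∫⁻ t, sq s (g t) ∂(timeMeasure T) < ∞ := by
  rw [eLpNorm_lt_top_iff_lintegral_rpow_enorm_lt_top two_ne_zero ENNReal.ofNat_ne_top]
  simp only [enorm_eq_self, ENNReal.toReal_ofNat, ENNReal.rpow_ofNat, sobolevNorm_sq]

theorem memLqDot_two {n : ℕ} {T s : ℝ} {g : ℝ → SDist n} :
    MemLqDot 2 T s g ↔ (∀ ξ, AEMeasurable (fun t => g t ξ) (timeMeasure T)) ∧
      (∀ᵐ t ∂(timeMeasure T), g t ∈ dotH s) ∧ ∫⁻ t, sq s (g t) ∂(timeMeasure T) < ∞ := by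
  unfold MemLqDot
  rw [eLpNorm_two_sobolevNorm]
  simp only [aestronglyMeasurable_iff_aemeasurable]

theorem memLqDotV_two {n : ℕ} {T s : ℝ} {v : ℝ → VDist n} :
    MemLqDotV 2 T s v ↔ (∀ k ξ, AEMeasurable (fun t => v t k ξ) (timeMeasure T)) ∧
      (∀ᵐ t ∂(timeMeasure T), v t ∈ dotHV s) ∧ ∫⁻ t, vsq s (v t) ∂(timeMeasure T) < ∞ := by
  unfold MemLqDotV
  simp only [memLqDot_two, forall_and]
  refine and_congr_right fun hm => and_congr ?_ ?_
  · simp only [dotHV, mem_ofPred_eq, ae_all_iff]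
  · rw [lintegral_vsq hm, ENNReal.sum_lt_top]
    simp

theorem memLqSigma_two {n : ℕ} {T s : ℝ} {v : ℝ → VDist n} :
    MemLqSigma 2 T s v ↔ (∀ k ξ, AEMeasurable (fun t => v t k ξ) (timeMeasure T)) ∧
      (∀ᵐ t ∂(timeMeasure T), v t ∈ dotHsigma s) ∧ ∫⁻ t, vsq s (v t) ∂(timeMeasure T) < ∞ := by
  unfold MemLqSigma
  rw [memLqDotV_two]
  simp only [dotHsigma, mem_ofPred_eq, eventually_and]
  tauto

theorem memLqSigma_top {n : ℕ} {T s : ℝ} {v : ℝ → VDist n} :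
    MemLqSigma ∞ T s v ↔ (∀ k ξ, AEMeasurable (fun t => v t k ξ) (timeMeasure T)) ∧
      (∀ᵐ t ∂(timeMeasure T), v t ∈ dotHsigma s) ∧
      ∃ D : ℝ, ∀ᵐ t ∂(timeMeasure T), vsq s (v t) ≤ ENNReal.ofReal D := by
  unfold MemLqSigma MemLqDotV MemLqDot
  simp only [forall_and, aestronglyMeasurable_iff_aemeasurable, eLpNorm_exponent_top, dotHsigma,
    dotHV, mem_ofPred_eq, eventually_and, ae_all_iff]
  refine ⟨fun ⟨⟨h1, h2, h3⟩, h4⟩ => ⟨h1, ⟨h2, h4⟩, ?_⟩, fun ⟨h1, ⟨h2, h4⟩, D, hD⟩ =>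
    ⟨⟨h1, h2, fun k => ?_⟩, h4⟩⟩
  · set Q : ℝ≥0∞ := ∑ k, eLpNormEssSup (fun t => sobolevNorm s (v t k)) (timeMeasure T) ^ 2
    have hQ : Q ≠ ∞ := (ENNReal.sum_lt_top.2 fun k _ => ENNReal.pow_lt_top (h3 k)).ne
    refine ⟨Q.toReal, ?_⟩
    rw [ENNReal.ofReal_toReal hQ]
    filter_upwards [ae_all_iff.2 fun k => enorm_ae_le_eLpNormEssSup
      (fun t => sobolevNorm s (v t k)) (timeMeasure T)] with t ht
    refine Finset.sum_le_sum fun k _ => ?_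
    rw [← sobolevNorm_sq]
    gcongr
    exact ht k
  · refine (eLpNormEssSup_le_of_ae_enorm_bound (C := ENNReal.ofReal D ^ (1 / 2 : ℝ)) ?_).trans_lt
      (ENNReal.rpow_lt_top_of_nonneg (by norm_num) ENNReal.ofReal_ne_top)
    filter_upwards [hD] with t ht
    rw [enorm_eq_self, sobolevNorm_eq]
    exact ENNReal.rpow_le_rpow ((sq_le_vsq s _ k).trans ht) (by norm_num)

theorem MemLqDotV.mono {n : ℕ} {T s s' : ℝ} {v : ℝ → VDist n} (h : MemLqDotV 2 T s v)
    (hs : s' ≤ s) : MemLqDotV 2 T s' v := by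
  rw [memLqDotV_two] at h ⊢
  refine ⟨h.1, h.2.1.mono fun t ht => ?_, (lintegral_mono fun t => vsq_mono hs _).trans_lt h.2.2⟩
  rw [mem_dotHV] at ht ⊢
  exact ⟨ht.1, (vsq_mono hs _).trans_lt ht.2.1, ht.2.2⟩

theorem integrable_of_lintegral_vsq {n : ℕ} {T s : ℝ} {G : ℝ → VDist n}
    (hG : ∀ k ξ, AEMeasurable (fun t => G t k ξ) (timeMeasure T))
    (h : ∫⁻ t, vsq s (G t) ∂(timeMeasure T) < ∞) (k : Fin n) (ξ : Freq n) :
    Integrable (fun t => G t k ξ) (timeMeasure T) := by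
  refine ⟨(hG k ξ).aestronglyMeasurable, ?_⟩
  calc ∫⁻ t, ‖G t k ξ‖ₑ ∂(timeMeasure T)
      ≤ ∫⁻ t, (1 + wt (2 * -s) ξ * vsq s (G t)) ∂(timeMeasure T) := by
        refine lintegral_mono fun t => ?_
        refine le_trans ?_ (add_le_add le_rfl (enorm_sq_le_vsq s (G t) k ξ))
        rcases le_total ‖G t k ξ‖ₑ 1 with h1 | h1
        · exact h1.trans le_self_add
        · calc ‖G t k ξ‖ₑ = ‖G t k ξ‖ₑ * 1 := (mul_one _).symm
            _ ≤ ‖G t k ξ‖ₑ ^ 2 := by rw [pow_two]; gcongr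
            _ ≤ _ := le_add_self
    _ < ∞ := by
        rw [lintegral_add_left' aemeasurable_const,
          lintegral_const_mul'' _ (aemeasurable_vsq hG s), lintegral_const]
        have := measure_lt_top (timeMeasure T) univ
        have := wt_ne_top (2 * -s) ξ
        finiteness

/-! ### The integral equation for Serrin-type solutions -/

theorem WeakDeriv.congr_deriv {T : ℝ} {y g g' : ℝ → ℂ} (h : WeakDeriv T y g)
    (hg : ∀ᵐ t ∂(timeMeasure T), g t = g' t) : WeakDeriv T y g' := by
  refine ⟨h.1, ?_, fun φ h1 h2 h3 => ?_⟩
  · have h1 := h.2.1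
    rw [locallyIntegrableOn_iff isOpen_Ioo.isLocallyClosed] at h1 ⊢
    exact fun K hK hKc => (h1 K hK hKc).congr (ae_mono (Measure.restrict_mono hK le_rfl) hg)
  · rw [← h.2.2 φ h1 h2 h3]
    exact integral_congr_ae (hg.mono fun t ht => by simp [ht])

/-- A solution of the integral equation with the integrability of a Serrin-type solution. -/
structure EnergySolution {n : ℕ} (T : ℝ) (A : ℝ → FTensor n) (f : ℝ → VDist n) (u₀ : VDist n)
    (u : ℝ → VDist n) : Prop where
  init : u 0 = u₀
  sol : ∀ t ∈ Icc 0 T, Solenoidal (u t)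
  prim : ∀ k ξ, IsPrim T (fun t => u t k ξ) fun t =>
    leray (f t + visc (A t) (u t) - tens (u t) (u t)) k ξ
  bound : ∃ D : ℝ, ∀ᵐ t ∂(timeMeasure T), vsq 0 (u t) ≤ ENNReal.ofReal D
  bound_grad : ∫⁻ t, vsq 1 (u t) ∂(timeMeasure T) < ∞
  bound_serrin : ∫⁻ t, vsq ((n : ℝ) / 2) (u t) ∂(timeMeasure T) < ∞

/-- The critical product estimate with the symmetric choice `θ = n/4`, followed by interpolation of
`H^{n/4}` between `L₂` and `H^{n/2}`. Under the Serrin condition the quadratic term is thus in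
`L₂(H⁻¹)`. -/
theorem exists_vsq_tens_serrin {n : ℕ} (hn : 0 < n) : ∃ C : ℝ≥0∞, C ≠ ∞ ∧ ∀ u : VDist n,
    vsq (-1) (tens u u) ≤ C * (vsq 0 u * vsq ((n : ℝ) / 2) u) := by
  have hn' : (0 : ℝ) < n := by exact_mod_cast hn
  obtain ⟨C, hC, H⟩ := vsq_tens_critical hn (θ := (n : ℝ) / 4) (by positivity) (by linarith)
  refine ⟨C * n, by finiteness, fun u => (H u u).trans ?_⟩
  rw [show (n : ℝ) / 2 - n / 4 = n / 4 by ring, ← pow_two, mul_assoc]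
  gcongr
  exact vsq_interp (by ring) u

theorem lintegral_vsq_rhs_lt_top {n : ℕ} (hn : 0 < n) {T c m : ℝ} {K : ℝ≥0∞} (hm : 0 ≤ m)
    {A : ℝ → FTensor n} (hA : ViscData T c m K A) {f u : ℝ → VDist n} {D : ℝ}
    (hfm : ∀ k ξ, AEMeasurable (fun t => f t k ξ) (timeMeasure T))
    (hf : ∫⁻ t, vsq (-1) (f t) ∂(timeMeasure T) < ∞)
    (hu : ∀ k ξ, AEMeasurable (fun t => u t k ξ) (timeMeasure T))
    (hD : ∀ᵐ t ∂(timeMeasure T), vsq 0 (u t) ≤ ENNReal.ofReal D)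
    (h1 : ∫⁻ t, vsq 1 (u t) ∂(timeMeasure T) < ∞)
    (h2 : ∫⁻ t, vsq ((n : ℝ) / 2) (u t) ∂(timeMeasure T) < ∞) :
    ∫⁻ t, vsq (-1) (f t + visc (A t) (u t) - tens (u t) (u t)) ∂(timeMeasure T) < ∞ := by
  obtain ⟨C₁, hC₁, H₁⟩ := vsq_visc_le (n := n) 0
  obtain ⟨C₂, hC₂, H₂⟩ := exists_vsq_tens_serrin hn
  have hK := hA.fin
  calc _ ≤ ∫⁻ t, (4 * vsq (-1) (f t) + (4 * (C₁ * K ^ 2) * vsq 1 (u t) +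
        2 * (C₂ * ENNReal.ofReal D) * vsq ((n : ℝ) / 2) (u t))) ∂(timeMeasure T) := by
        refine lintegral_mono_ae ?_
        filter_upwards [hA.wiener, hD] with t hw hd
        have e1 : vsq (-1) (visc (A t) (u t)) ≤ C₁ * (K ^ 2 * vsq 1 (u t)) := by
          have := H₁ (A t) K (u t) (by rw [abs_zero]; exact hw.mono hm)
          rwa [zero_sub, zero_add] at this
        have e2 : vsq (-1) (tens (u t) (u t)) ≤
            C₂ * (ENNReal.ofReal D * vsq ((n : ℝ) / 2) (u t)) := (H₂ _).trans (by gcongr)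
        calc _ ≤ 2 * vsq (-1) (f t + visc (A t) (u t)) + 2 * vsq (-1) (tens (u t) (u t)) :=
              vsq_sub_le _ _ _
          _ ≤ 2 * (2 * vsq (-1) (f t) + 2 * (C₁ * (K ^ 2 * vsq 1 (u t)))) +
              2 * (C₂ * (ENNReal.ofReal D * vsq ((n : ℝ) / 2) (u t))) := by
              gcongr
              exact (vsq_add_le _ _ _).trans (by gcongr)
          _ = _ := by ring
    _ < ∞ := by
        have m1 := aemeasurable_vsq hu 1
        have m0 := aemeasurable_vsq hfm (-1)
        have m2 := aemeasurable_vsq hu ((n : ℝ) / 2)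
        rw [lintegral_add_left' (m0.const_mul _), lintegral_add_left' (m1.const_mul _),
          lintegral_const_mul'' _ m0, lintegral_const_mul'' _ m1, lintegral_const_mul'' _ m2]
        finiteness

theorem lintegral_vsq_leray_lt_top {n : ℕ} {T s : ℝ} {F : ℝ → VDist n}
    (h : ∫⁻ t, vsq s (F t) ∂(timeMeasure T) < ∞) :
    ∫⁻ t, vsq s (leray (F t)) ∂(timeMeasure T) < ∞ := by
  obtain ⟨C, hC, H⟩ := vsq_leray_le (n := n)
  refine (lintegral_mono fun t => H s (F t)).trans_lt ?_
  rw [lintegral_const_mul' _ _ hC]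
  finiteness

theorem aemeasurable_rhs {n : ℕ} {T : ℝ} {A : ℝ → FTensor n} {f u : ℝ → VDist n}
    (hA : ∀ i j α β ξ, AEMeasurable (fun t => A t i j α β ξ) (timeMeasure T))
    (hf : ∀ k ξ, AEMeasurable (fun t => f t k ξ) (timeMeasure T))
    (hu : ∀ k ξ, AEMeasurable (fun t => u t k ξ) (timeMeasure T)) (k : Fin n) (ξ : Freq n) :
    AEMeasurable (fun t => (f t + visc (A t) (u t) - tens (u t) (u t)) k ξ) (timeMeasure T) :=
  ((hf k ξ).add (aemeasurable_visc hA hu k ξ)).sub (aemeasurable_tens hu hu k ξ)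

theorem integrable_leray_rhs {n : ℕ} (hn : 0 < n) {T c m : ℝ} {K : ℝ≥0∞} (hm : 0 ≤ m)
    {A : ℝ → FTensor n} (hA : ViscData T c m K A) {f u : ℝ → VDist n} {D : ℝ}
    (hf : MemLqDotV 2 T (-1) f)
    (hu : ∀ k ξ, AEMeasurable (fun t => u t k ξ) (timeMeasure T))
    (hD : ∀ᵐ t ∂(timeMeasure T), vsq 0 (u t) ≤ ENNReal.ofReal D)
    (h1 : ∫⁻ t, vsq 1 (u t) ∂(timeMeasure T) < ∞)
    (h2 : ∫⁻ t, vsq ((n : ℝ) / 2) (u t) ∂(timeMeasure T) < ∞) (k : Fin n) (ξ : Freq n) :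
    Integrable (fun t => leray (f t + visc (A t) (u t) - tens (u t) (u t)) k ξ) (timeMeasure T) := by
  rw [memLqDotV_two] at hf
  refine integrable_of_lintegral_vsq (s := -1) (fun k ξ => ?_) (lintegral_vsq_leray_lt_top
    (lintegral_vsq_rhs_lt_top hn hm hA hf.1 hf.2.2 hu hD h1 h2)) k ξ
  exact (aestronglyMeasurable_leray (fun k ξ =>
    (aemeasurable_rhs hA.meas hf.1 hu k ξ).aestronglyMeasurable) k ξ).aemeasurable

/-- The distributional derivative of a solenoidal field is solenoidal. -/
theorem IsTimeDeriv.leray_eq {n : ℕ} {T : ℝ} {u u' : ℝ → VDist n} (h : IsTimeDeriv T u u')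
    (hu : ∀ᵐ t ∂(timeMeasure T), Solenoidal (u t)) :
    ∀ᵐ t ∂(timeMeasure T), leray (u' t) = u' t := by
  have h' : ∀ k ξ, WeakDeriv T (fun t => u t k ξ) fun t => u' t k ξ := h
  have h0 : ∀ᵐ t ∂(timeMeasure T), ∀ k, u' t k 0 = 0 :=
    ae_all_iff.2 fun k => (h' k 0).eq_zero (hu.mono fun t ht => ht.mean k)
  have h1 : ∀ᵐ t ∂(timeMeasure T), ∀ ξ : Freq n, ∑ j, (ξ j : ℂ) * u' t j ξ = 0 :=
    ae_all_iff.2 fun ξ => (WeakDeriv.sum_mul (S := Finset.univ) (fun j => (ξ j : ℂ))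
      fun j => h' j ξ).eq_zero (hu.mono fun t ht => Solenoidal.sum_mul_eq_zero ht.div ξ)
  filter_upwards [h0, h1] with t a b using leray_eq_self a b

/-- The time derivative of a Serrin-type solution. -/
theorem IsSerrinSolution.exists_timeDeriv {n : ℕ} {T c m : ℝ} {K : ℝ≥0∞} (hm : 0 ≤ m)
    {a : Tensor n} (hA : ViscData T c m K fun t i j α β => ofFun (a i j α β t))
    {f u : ℝ → VDist n} {u₀ : VDist n} (hf : MemLqDotV 2 T (-1) f)
    (hu : IsSerrinSolution T a f u₀ u) :
    IsTimeDeriv T u fun t =>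
      leray (f t + visc (fun i j α β => ofFun (a i j α β t)) (u t) - tens (u t) (u t)) := by
  rw [memLqDotV_two] at hf
  have h1 := memLqSigma_two.1 hu.1.mem_grad
  obtain ⟨u', hu', heq⟩ := hu.1.equation
  obtain ⟨C, hC, H⟩ := vsq_visc_le (n := n) 0
  have hK := hA.fin
  have key : ∀ᵐ t ∂(timeMeasure T), u' t =
      leray (f t + visc (fun i j α β => ofFun (a i j α β t)) (u t) - tens (u t) (u t)) := by
    filter_upwards [heq, hf.2.1, h1.2.1, hA.wiener,
      hu'.leray_eq (h1.2.1.mono fun t ht => (mem_dotHsigma.1 ht).1)] with t ht hft hut hw hl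
    set A : FTensor n := fun i j α β => ofFun (a i j α β t) with hAt
    obtain ⟨hs, hv1⟩ := mem_dotHsigma.1 hut
    obtain ⟨hG, ht⟩ := ht
    rw [mem_HV] at hG
    obtain ⟨hfr, hfv, -⟩ := mem_dotHV.1 hft
    have hw0 : WienerBound 0 K A := hw.mono hm
    have hvv : vsq (-1) (visc A (u t)) < ∞ := by
      have := H A K (u t) (by rwa [abs_zero])
      rw [zero_sub, zero_add] at this
      exact this.trans_lt (by finiteness)
    have hfin : vsq (-1) (f t + visc A (u t)) < ∞ :=
      (vsq_add_le _ _ _).trans_lt (by finiteness)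
    -- The variational equation says that this functional annihilates every solenoidal field, hence
    -- has no solenoidal part. As `u'` is itself solenoidal, this determines it.
    have h0 : leray (u' t + leray (advection (u t)) - (f t + visc A (u t))) = 0 := by
      refine leray_eq_zero (s := 1) (fun k ξ => ?_) ((vsq_sub_le _ _ _).trans_lt ?_) fun w hw => ?_
      · have e1 := hG.1 k ξ
        have e2 := hfr k ξ
        have e3 := isRealDist_visc (A := A) (fun i j α β => isRealDist_ofFun _) hs.real k ξ
        simp only [Pi.add_apply, Pi.sub_apply, map_sub, map_add] at e1 ⊢
        rw [e1, e2, e3]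
      · have := hG.2
        finiteness
      · obtain ⟨hws, hwv⟩ := mem_dotHsigma.1 hw
        have e := ht w hw
        rw [viscForm_eq hK hw0 hv1 hwv hws.real] at e
        rw [pairingV_sub hG.2 hfin hwv hws.real, pairingV_add hfv hvv hwv hws.real, ← e]
        ring
    rw [leray_sub, leray_add, leray_leray, hl, sub_eq_zero] at h0
    rw [leray_sub, ← h0, ← advection_eq_tens hv1 hs.div]
    abel
  intro k ξ
  exact (show WeakDeriv T (fun t => u t k ξ) (fun t => u' t k ξ) from hu' k ξ).congr_deriv
    (key.mono fun t ht => by rw [ht])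

/-- Weak continuity tested with single modes makes every coefficient continuous. A continuous
function with an integrable distributional derivative is its primitive, so the weakly continuous
representative solves the integral equation at each frequency. -/
theorem IsSerrinSolution.exists_energySolution {n : ℕ} (hn : 0 < n) {T c m : ℝ} (hT : 0 < T)
    {K : ℝ≥0∞} (hm : 0 ≤ m) {a : Tensor n}
    (hA : ViscData T c m K fun t i j α β => ofFun (a i j α β t))
    {f u : ℝ → VDist n} {u₀ : VDist n} (hf : MemLqDotV 2 T (-1) f) (hu₀ : u₀ ∈ dotHsigma 0)
    (hu : IsSerrinSolution T a f u₀ u) : ∃ v : ℝ → VDist n,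
      (∀ᵐ t ∂(timeMeasure T), v t = u t) ∧
        EnergySolution T (fun t i j α β => ofFun (a i j α β t)) f u₀ v := by
  have hd := hu.exists_timeDeriv hm hA hf
  obtain ⟨v, hvu, hv, hvc, hv0⟩ := hu.1.initial
  obtain ⟨hmeas, -, D, hD⟩ := memLqSigma_top.1 hu.1.mem_energy
  obtain ⟨-, -, h1⟩ := memLqSigma_two.1 hu.1.mem_grad
  obtain ⟨-, -, h2⟩ := memLqSigma_two.1 hu.2
  refine ⟨v, hvu, ⟨?_, fun t ht => (mem_dotHsigma.1 (hv t ht)).1, fun k ξ => ?_,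
    ⟨D, ?_⟩, ?_, ?_⟩⟩
  · obtain ⟨s0, f0⟩ := mem_dotHsigma.1 hu₀
    obtain ⟨s1, f1⟩ := mem_dotHsigma.1 (hv 0 (left_mem_Icc.2 hT.le))
    have e : leray (v 0 - u₀) = 0 := by
      have f0' : vsq (-0) u₀ < ∞ := by rwa [neg_zero]
      have f1' : vsq (-0) (v 0) < ∞ := by rwa [neg_zero]
      refine leray_eq_zero (s := 0) (s1.sub s0).real ((vsq_sub_le _ _ _).trans_lt (by finiteness))
        fun w hw => ?_
      obtain ⟨hws, hwv⟩ := mem_dotHsigma.1 hw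
      rw [pairingV_sub f1' f0' hwv hws.real, hv0 w hw, sub_self]
    rw [(s1.sub s0).leray_eq, sub_eq_zero] at e
    exact e
  · have hp : IsPrim T (fun t => v t k ξ) fun t =>
        leray (f t + visc (fun i j α β => ofFun (a i j α β t)) (u t) - tens (u t) (u t)) k ξ := by
      refine WeakDeriv.isPrim hT ?_ ?_ (integrable_leray_rhs hn hm hA hf hmeas hD h1 h2 k ξ)
      · exact (show WeakDeriv T (fun t => u t k ξ) _ from hd k ξ).congr
          (hvu.mono fun t ht => by rw [ht])
      · simp only [← pairingV_modeV_one_add (v _) k ξ]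
        exact ((hvc _ (modeV_mem_HV 0 k ξ 1)).add (continuousOn_const.mul
          (hvc _ (modeV_mem_HV 0 k ξ Complex.I)))).div_const 2
    exact hp.congr (hvu.mono fun t ht => by simp only [ht])
  · filter_upwards [hD, hvu] with t a b
    rwa [b]
  · rwa [lintegral_congr_ae (hvu.mono fun t ht => by rw [ht])]
  · rwa [lintegral_congr_ae (hvu.mono fun t ht => by rw [ht])]

/-! ### Uniqueness -/

theorem vsq_eq_trunc_add {n : ℕ} (B : Finset (Freq n)) (s : ℝ) (w : VDist n) :
    vsq s w = ENNReal.ofReal (rsq B s w) + vsq s (w - trunc B w) := by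
  rw [← rsq_trunc, ← vsq_eq_ofReal_rsq (suppIn_trunc B w)]
  unfold vsq sq wsq
  rw [← Finset.sum_add_distrib]
  refine Finset.sum_congr rfl fun k _ => ?_
  rw [← ENNReal.tsum_add]
  refine tsum_congr fun ξ => ?_
  by_cases h : ξ ∈ B <;> simp [trunc, h]

theorem tendsto_vsq_sub_trunc {n : ℕ} {s : ℝ} {w : VDist n} (h : vsq s w < ∞) :
    Tendsto (fun N => vsq s (w - trunc (box n N) w)) atTop (𝓝 0) := by
  have h1 := ENNReal.Tendsto.sub (tendsto_const_nhds (x := vsq s w) (f := (atTop : Filter ℕ)))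
    (tendsto_ofReal_rsq_box s w) (Or.inl h.ne)
  rw [tsub_self] at h1
  refine h1.congr fun N => ?_
  nth_rw 1 [vsq_eq_trunc_add (box n N) s w]
  exact ENNReal.add_sub_cancel_left ENNReal.ofReal_ne_top

theorem vsq_sub_trunc_le {n : ℕ} (B : Finset (Freq n)) (s : ℝ) (w : VDist n) :
    vsq s (w - trunc B w) ≤ vsq s w := by
  rw [vsq_eq_trunc_add B s w]
  exact le_add_self

theorem tens_sub_right {n : ℕ} {u v w : VDist n} (hu : vsq 0 u < ∞) (hv : vsq 0 v < ∞)
    (hw : vsq 0 w < ∞) : tens w (u - v) = tens w u - tens w v := by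
  rw [vsq_lt_top] at hu hv hw
  ext k ξ
  simp only [Pi.sub_apply]
  unfold tens
  rw [← Finset.sum_sub_distrib]
  refine Finset.sum_congr rfl fun j _ => ?_
  unfold partialD
  rw [show (u - v) k = fun η => u k η - v k η from rfl, mul_sub_right (hw j) (hu k) (hv k) ξ]
  ring

/-- The energy inequality for the difference of two solutions, up to the frequencies outside of
`box n N`. -/
theorem exists_energy_inequality {n : ℕ} (hn : 2 ≤ n) {r : ℝ} (hrn : (n : ℝ) / 2 < r + 1)
    {c : ℝ} (hc : 0 < c) {K : ℝ≥0∞} (hK : K ≠ ∞) : ∃ C : ℝ≥0∞, C ≠ ∞ ∧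
    ∀ A : FTensor n, Coercive c A → WienerBound 0 K A → ∀ f u v : VDist n, Solenoidal u →
      Solenoidal v → vsq 1 u < ∞ → vsq 1 v < ∞ → vsq ((n : ℝ) / 2) (u - v) < ∞ →
      vsq (r + 1) v < ∞ → ∀ N : ℕ,
      2 * ip (box n N) 0 (leray (f + visc A u - tens u u) - leray (f + visc A v - tens v v)) (u - v) ≤
        (C * ((vsq ((n : ℝ) / 2) (u - v) + vsq (r + 1) v) * vsq 0 (u - v)) +
          C * vsq 1 (u - v - trunc (box n N) (u - v))).toReal := by
  have hn0 : 0 < n := by omega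
  obtain ⟨C₁, hC₁, hS⟩ := exists_vsq_tens_serrin hn0
  obtain ⟨C₂, hC₂, hT⟩ := vsq_tens_of_gt hn0 hrn
  obtain ⟨C₃, hC₃, hV⟩ := vsq_visc_le (n := n) 0
  set γ := ENNReal.ofReal c⁻¹
  have hγ : γ ≠ ∞ := ENNReal.ofReal_ne_top
  refine ⟨γ * (2 * (C₃ * K ^ 2) + 8 * C₁ + 12 * C₂), by finiteness,
    fun A hco hW f u v hus hvs hu hv hw2 hv2 N => ?_⟩
  set B := box n N
  set w := u - v with hw
  set wN := trunc B w with hwN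
  have hws : Solenoidal w := hus.sub hvs
  have hNs : Solenoidal wN := hws.trunc N
  have hN : SuppIn B wN := suppIn_trunc B w
  have hw1 : vsq 1 w < ∞ := (vsq_sub_le _ _ _).trans_lt (by finiteness)
  have u0 : vsq 0 u < ∞ := (vsq_mono zero_le_one u).trans_lt hu
  have v0 : vsq 0 v < ∞ := (vsq_mono zero_le_one v).trans_lt hv
  have w0 : vsq 0 w < ∞ := (vsq_mono zero_le_one w).trans_lt hw1
  -- Coercivity is known for trigonometric polynomials only, so it is applied to `wN`. The viscous
  -- term of the tail goes into an error that vanishes as `N` grows.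
  set X := visc A (w - wN)
  -- With `u` eliminated, the quadratic difference contains `v`, which is in `H^{r+1}` and hence in
  -- the Wiener algebra, and `w ⊗ w`, which needs only the Serrin norm of `w`.
  set R := tens w w + tens w v + tens v w
  have ewN : w - wN + wN = w := by abel
  have e1 : leray (f + visc A u - tens u u) - leray (f + visc A v - tens v v) =
      leray (visc A wN + (X - R)) := by
    have h1 : X = visc A w - visc A wN := visc_sub hW hK hw1 (hN.vsq_lt_top 1)
    have h2 : visc A w = visc A u - visc A v := visc_sub hW hK hu hv
    have h3 : tens w w = tens w u - tens w v := tens_sub_right u0 v0 w0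
    have h4 := tens_sub_tens u0 v0
    rw [← hw] at h4
    rw [← leray_sub, h1, h2]
    congr 1
    simp only [R, h3]
    rw [sub_add_cancel, ← h4]
    abel
  have e2 : ∀ F, ip B 0 F w = ip B 0 F wN := by
    intro F
    unfold ip
    exact Finset.sum_congr rfl fun k _ => Finset.sum_congr rfl fun ξ hξ => by simp [hwN, trunc, hξ]
  have b1 := hco N wN hN hNs
  have b2 := abs_ip_le B 0 (X - R) wN hc
  rw [zero_sub, zero_add] at b2
  have b3 := le_abs_self (ip B 0 (X - R) wN)
  have f1 : vsq (-1) X ≤ C₃ * (K ^ 2 * vsq 1 (w - wN)) := by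
    have := hV A K (w - wN) (by rwa [abs_zero])
    rwa [zero_sub, zero_add] at this
  have f2 : vsq (-1) R ≤ 2 * (2 * (C₁ * (vsq 0 w * vsq ((n : ℝ) / 2) w)) +
      2 * (C₂ * (vsq 0 w * vsq (r + 1) v))) + 2 * (C₂ * (vsq (r + 1) v * vsq 0 w)) := by
    refine (vsq_add_le _ _ _).trans ?_
    gcongr
    · refine (vsq_add_le _ _ _).trans ?_
      gcongr
      · exact hS w
      · exact (hT w v).2
    · exact (hT v w).1
  have f3 := vsq_sub_le (-1) X R
  have hE : γ * vsq (-1) (X - R) ≤ γ * (2 * (C₃ * K ^ 2) + 8 * C₁ + 12 * C₂) *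
      ((vsq ((n : ℝ) / 2) w + vsq (r + 1) v) * vsq 0 w) +
        γ * (2 * (C₃ * K ^ 2) + 8 * C₁ + 12 * C₂) * vsq 1 (w - wN) := by
    set a := vsq ((n : ℝ) / 2) w
    set b := vsq (r + 1) v
    set y := vsq 0 w
    set e := vsq 1 (w - wN)
    rw [mul_assoc, mul_assoc, ← mul_add]
    gcongr
    calc vsq (-1) (X - R) ≤ 2 * vsq (-1) X + 2 * vsq (-1) R := f3
      _ ≤ 2 * (C₃ * (K ^ 2 * e)) + 2 * (2 * (2 * (C₁ * (y * a)) + 2 * (C₂ * (y * b))) +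
          2 * (C₂ * (b * y))) := by gcongr
      _ ≤ 2 * (C₃ * (K ^ 2 * e)) + 2 * (2 * (2 * (C₁ * (y * a)) + 2 * (C₂ * (y * b))) +
          2 * (C₂ * (b * y))) + ((2 * (C₃ * K ^ 2) + 12 * C₂) * (a * y) +
            (2 * (C₃ * K ^ 2) + 8 * C₁) * (b * y) + (8 * C₁ + 12 * C₂) * e) := le_self_add
      _ = _ := by ring
  have wN1 : vsq 1 (w - wN) < ∞ := (vsq_sub_trunc_le B 1 w).trans_lt hw1
  have hfin : vsq (-1) (X - R) ≠ ∞ := by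
    have g1 : vsq (-1) X < ∞ := f1.trans_lt (by finiteness)
    have g2 : vsq (-1) R < ∞ := f2.trans_lt (by finiteness)
    exact (f3.trans_lt (by finiteness)).ne
  have b4 : c⁻¹ * rsq B (-1) (X - R) ≤ (γ * vsq (-1) (X - R)).toReal := by
    rw [ENNReal.toReal_mul, ENNReal.toReal_ofReal (inv_pos.2 hc).le]
    exact mul_le_mul_of_nonneg_left (rsq_le_toReal B hfin.lt_top) (inv_pos.2 hc).le
  have b5 := ENNReal.toReal_mono (by finiteness) hE
  rw [e1, ip_leray B 0 _ hws.div hws.mean, e2, ip_add_left]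
  have b6 : 0 ≤ rsq B 1 wN := rsq_nonneg _ _ _
  nlinarith

theorem EnergySolution.aemeasurable {n : ℕ} {T : ℝ} {A : ℝ → FTensor n} {f : ℝ → VDist n}
    {u₀ : VDist n} {u : ℝ → VDist n} (h : EnergySolution T A f u₀ u) (k : Fin n)
    (ξ : Freq n) : AEMeasurable (fun t => u t k ξ) (timeMeasure T) :=
  (((h.prim k ξ).continuousOn.mono Ioo_subset_Icc_self).aestronglyMeasurable
    measurableSet_Ioo).aemeasurable

theorem ae_lt_top_of_lintegral {n : ℕ} {T s : ℝ} {u : ℝ → VDist n}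
    (hu : ∀ k ξ, AEMeasurable (fun t => u t k ξ) (timeMeasure T))
    (h : ∫⁻ t, vsq s (u t) ∂(timeMeasure T) < ∞) : ∀ᵐ t ∂(timeMeasure T), vsq s (u t) < ∞ :=
  ae_lt_top' (aemeasurable_vsq hu s) h.ne

theorem ae_of_forall_mem_Icc {T : ℝ} {p : ℝ → Prop} (h : ∀ t ∈ Icc 0 T, p t) :
    ∀ᵐ t ∂(timeMeasure T), p t :=
  ae_timeMeasure_iff.2 (ae_of_all _ fun t ht => h t (Ioo_subset_Icc_self ht))

theorem lintegral_vsq_sub_lt_top {n : ℕ} {T s : ℝ} {u v : ℝ → VDist n}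
    (hu : ∀ k ξ, AEMeasurable (fun t => u t k ξ) (timeMeasure T))
    (hv : ∀ k ξ, AEMeasurable (fun t => v t k ξ) (timeMeasure T))
    (h1 : ∫⁻ t, vsq s (u t) ∂(timeMeasure T) < ∞) (h2 : ∫⁻ t, vsq s (v t) ∂(timeMeasure T) < ∞) :
    ∫⁻ t, vsq s (u t - v t) ∂(timeMeasure T) < ∞ := by
  refine (lintegral_mono fun t => vsq_sub_le s (u t) (v t)).trans_lt ?_
  rw [lintegral_add_left' ((aemeasurable_vsq hu s).const_mul _),
    lintegral_const_mul'' _ (aemeasurable_vsq hu s), lintegral_const_mul'' _ (aemeasurable_vsq hv s)]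
  finiteness

/-- A solution with the integrability of a Serrin-type solution agrees with the regular solution. -/
theorem EnergySolution.eq_regularSolution {n : ℕ} (hn : 2 ≤ n) {r : ℝ} (hr : 0 ≤ r)
    (hrn : (n : ℝ) / 2 < r + 1) {T c m : ℝ} (hm : 0 ≤ m) {K : ℝ≥0∞} {A : ℝ → FTensor n}
    (hA : ViscData T c m K A) {f : ℝ → VDist n} {u₀ : VDist n} {u v : ℝ → VDist n}
    (hu : EnergySolution T A f u₀ u) (hv : RegularSolution T A f u₀ r v) {t : ℝ}
    (ht : t ∈ Icc 0 T) : u t = v t := by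
  obtain ⟨C, hC, H⟩ := exists_energy_inequality hn hrn hA.pos hA.fin
  set μ := timeMeasure T
  have hum := hu.aemeasurable
  have hvm := hv.aemeasurable
  set w : ℝ → VDist n := fun t => u t - v t with hw
  have hwm : ∀ k ξ, AEMeasurable (fun t => w t k ξ) μ := fun k ξ => (hum k ξ).sub (hvm k ξ)
  obtain ⟨D₁, hD₁⟩ := hu.bound
  obtain ⟨D₂, hD₂⟩ := hv.bound
  have hint : ∀ s ≤ r + 1, ∫⁻ t, vsq s (v t) ∂μ < ∞ := fun s hs =>
    (lintegral_mono fun t => vsq_mono hs _).trans_lt hv.bound_int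
  have hn' : (2 : ℝ) ≤ n := by exact_mod_cast hn
  have hw1 := lintegral_vsq_sub_lt_top hum hvm hu.bound_grad (hint 1 (by linarith))
  have hw2 := lintegral_vsq_sub_lt_top hum hvm hu.bound_serrin (hint _ hrn.le)
  set Q : ℝ → ℝ≥0∞ := fun t => vsq 0 (w t) with hQ
  set b : ℝ → ℝ≥0∞ := fun t => C * (vsq ((n : ℝ) / 2) (w t) + vsq (r + 1) (v t)) with hb
  set e : ℕ → ℝ → ℝ≥0∞ := fun N t => C * vsq 1 (w t - trunc (box n N) (w t)) with he
  have hQm : AEMeasurable Q μ := aemeasurable_vsq hwm 0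
  have hbm : AEMeasurable b μ :=
    ((aemeasurable_vsq hwm _).add (aemeasurable_vsq hvm _)).const_mul _
  have hem : ∀ N, AEMeasurable (e N) μ := fun N => by
    refine (aemeasurable_vsq (fun k ξ => (hwm k ξ).sub ?_) 1).const_mul _
    unfold trunc
    split_ifs
    · exact hwm k ξ
    · exact aemeasurable_const
  have hbQm : AEMeasurable (fun t => b t * Q t) μ := hbm.mul hQm
  have hQb : ∀ᵐ t ∂μ, Q t ≤ 2 * ENNReal.ofReal D₁ + 2 * ENNReal.ofReal D₂ := by
    filter_upwards [hD₁, ae_of_forall_mem_Icc hD₂] with t a b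
    exact (vsq_sub_le _ _ _).trans (by gcongr; exact (vsq_mono hr _).trans b)
  have hbi : ∫⁻ t, b t ∂μ < ∞ := by
    simp only [hb]
    rw [lintegral_const_mul' _ _ hC, lintegral_add_left' (aemeasurable_vsq hwm _)]
    have := hv.bound_int
    finiteness
  have hbQi : ∫⁻ t, b t * Q t ∂μ < ∞ := by
    refine (lintegral_mono_ae (hQb.mono fun t h => mul_le_mul' le_rfl h)).trans_lt ?_
    rw [lintegral_mul_const'' _ hbm]
    finiteness
  -- Dominated convergence: the tail of `w` in `H¹` tends to zero at almost every time and is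
  -- dominated by the full norm.
  have heN : Tendsto (fun N => ∫⁻ t, e N t ∂μ) atTop (𝓝 0) := by
    have h1 := tendsto_lintegral_of_dominated_convergence' (μ := μ) (F := e) (f := fun _ => 0)
      (fun t => C * vsq 1 (w t)) hem
      (fun N => ae_of_all _ fun t => mul_le_mul' le_rfl (vsq_sub_trunc_le _ _ _))
      (by
        rw [lintegral_const_mul'' _ (aemeasurable_vsq hwm 1)]
        finiteness)
      (by
        filter_upwards [ae_lt_top_of_lintegral hwm hw1] with t h
        have := ENNReal.Tendsto.const_mul (a := C) (tendsto_vsq_sub_trunc h) (Or.inr hC)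
        rwa [mul_zero] at this)
    simpa using h1
  have hstep : ∀ t ∈ Icc 0 T, Q t ≤ ∫⁻ s in Ioo 0 t, b s * Q s := by
    intro t ht
    have hmono : volume.restrict (Ioo 0 t) ≤ μ :=
      Measure.restrict_mono (Ioo_subset_Ioo_right ht.2) le_rfl
    have h1 : ∀ N, ENNReal.ofReal (rsq (box n N) 0 (w t)) ≤
        (∫⁻ s in Ioo 0 t, b s * Q s) + ∫⁻ s, e N s ∂μ := by
      intro N
      have hp := IsPrim.rsq (box n N) 0 (u := w) fun k ξ _ => (hu.prim k ξ).sub (hv.prim k ξ)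
      have hg : Integrable (fun s => (b s * Q s + e N s).toReal) μ := by
        refine integrable_toReal_of_lintegral_ne_top (hbQm.add (hem N)) ?_
        rw [lintegral_add_left' hbQm]
        have : ∫⁻ s, e N s ∂μ < ∞ := by
          refine (lintegral_mono fun t => mul_le_mul' le_rfl
            (vsq_sub_trunc_le (box n N) 1 (w t))).trans_lt ?_
          rw [lintegral_const_mul'' _ (aemeasurable_vsq hwm 1)]
          finiteness
        finiteness
      have h2 : rsq (box n N) 0 (w t) ≤ ∫ s in 0..t, (b s * Q s + e N s).toReal := by
        have h0 : w 0 = 0 := by simp [hw, hu.init, hv.init]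
        rw [hp.eq t ht, h0]
        have h00 : rsq (box n N) 0 (0 : VDist n) = 0 := by simp [rsq]
        rw [h00, zero_add]
        refine intervalIntegral_mono_time hp.int hg ?_ ht
        filter_upwards [hA.coercive, hA.wiener, ae_of_forall_mem_Icc hu.sol,
          ae_of_forall_mem_Icc hv.sol, ae_lt_top_of_lintegral hum hu.bound_grad,
          ae_lt_top_of_lintegral hvm (hint 1 (by linarith)), ae_lt_top_of_lintegral hwm hw2,
          ae_lt_top_of_lintegral hvm hv.bound_int] with s c1 c2 c3 c4 c5 c6 c7 c8
        have := H (A s) c1 (c2.mono hm) (f s) (u s) (v s) c3 c4 c5 c6 c7 c8 N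
        simp only [hb, hQ, he, mul_assoc] at this ⊢
        exact this
      calc ENNReal.ofReal (rsq (box n N) 0 (w t))
          ≤ ENNReal.ofReal (∫ s in Ioo 0 t, (b s * Q s + e N s).toReal) := by
            rw [← intervalIntegral_eq_Ioo ht.1]
            exact ENNReal.ofReal_le_ofReal h2
        _ ≤ ∫⁻ s in Ioo 0 t, (b s * Q s + e N s) := by
            rw [ofReal_integral_eq_lintegral_ofReal (hg.mono_measure hmono)
              (ae_of_all _ fun s => ENNReal.toReal_nonneg)]
            exact lintegral_mono fun s => ENNReal.ofReal_toReal_le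
        _ ≤ _ := by
            rw [lintegral_add_left' (hbQm.mono_measure hmono)]
            gcongr
    have h3 := tendsto_ofReal_rsq_box 0 (w t)
    have h4 := heN.const_add (∫⁻ s in Ioo 0 t, b s * Q s)
    rw [add_zero] at h4
    exact le_of_tendsto_of_tendsto' h3 h4 h1
  have hQi : ∫⁻ t, (b t * Q t) ∂μ ≠ ∞ := hbQi.ne
  -- `Q` satisfies only an integral inequality and need not be absolutely continuous. Its majorant
  -- `Y` is, with `Y' = b Q ≤ b Y` and `Y 0 = 0`, so Grönwall's inequality applies to `Y`.
  set Y : ℝ → ℝ := fun t => ∫ s in 0..t, (b s * Q s).toReal with hY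
  have hYp : IsPrim T Y fun s => (b s * Q s).toReal :=
    ⟨integrable_toReal_of_lintegral_ne_top hbQm hQi, fun t _ => by simp [hY]⟩
  have hYe : ∀ t ∈ Icc 0 T, Q t ≤ ENNReal.ofReal (Y t) := by
    intro t ht
    have hmono : volume.restrict (Ioo 0 t) ≤ μ :=
      Measure.restrict_mono (Ioo_subset_Ioo_right ht.2) le_rfl
    refine (hstep t ht).trans_eq ?_
    simp only [hY]
    rw [intervalIntegral_eq_Ioo ht.1, integral_toReal (hbQm.mono_measure hmono)
      (ae_mono hmono (ae_lt_top' hbQm hQi)), ENNReal.ofReal_toReal]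
    exact ((lintegral_mono' hmono le_rfl).trans_lt hbQi).ne
  have hY0 : ∀ t ∈ Icc 0 T, 0 ≤ Y t := fun t ht =>
    intervalIntegral_nonneg_time (ae_of_all _ fun s => ENNReal.toReal_nonneg) ht
  have hgr := hYp.gronwall (b := fun s => (b s).toReal) (h := fun _ => 0)
    (integrable_toReal_of_lintegral_ne_top hbm hbi.ne) (integrable_zero _ _ _)
    (ae_of_all _ fun s => ENNReal.toReal_nonneg) (ae_of_all _ fun s => le_rfl) (by simp [hY])
    (by
      refine ae_of_forall_mem_Icc fun s hs => ?_
      rw [add_zero, ENNReal.toReal_mul]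
      exact mul_le_mul_of_nonneg_left (ENNReal.toReal_le_of_le_ofReal (hY0 s hs) (hYe s hs))
        ENNReal.toReal_nonneg) ht
  have hz : Q t = 0 := by
    have h1 : Y t ≤ 0 := by simpa [hY] using hgr
    have h2 := hYe t ht
    rwa [ENNReal.ofReal_of_nonpos h1, nonpos_iff_eq_zero] at h2
  ext k ξ
  have h3 := enorm_sq_le_vsq 0 (w t) k ξ
  rw [show vsq 0 (w t) = 0 from hz, mul_zero, nonpos_iff_eq_zero] at h3
  have h4 : w t k ξ = 0 := by simpa using h3
  exact sub_eq_zero.1 h4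

/-! ### Regularity of the regular solution -/

/-- The right-hand side of the equation before projection. -/
def rhs {n : ℕ} (A : FTensor n) (f u : VDist n) : VDist n := f + visc A u - tens u u

theorem isRealDist_rhs {n : ℕ} {A : FTensor n} {f u : VDist n}
    (hA : ∀ i j α β, IsRealDist (A i j α β)) (hf : ∀ k, IsRealDist (f k))
    (hu : ∀ k, IsRealDist (u k)) (k : Fin n) : IsRealDist (rhs A f u k) := by
  intro ξ
  have e1 := hf k ξ
  have e2 := isRealDist_visc hA hu k ξ
  have e3 := isRealDist_tens hu hu k ξ
  simp only [rhs, Pi.add_apply, Pi.sub_apply, map_sub, map_add]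
  rw [e1, e2, e3]

theorem exists_vsq_rhs_le {n : ℕ} (hn : 2 ≤ n) {r : ℝ} (hr : 0 ≤ r) (hrn : (n : ℝ) / 2 < r + 1)
    {K : ℝ≥0∞} (hK : K ≠ ∞) : ∃ C : ℝ≥0∞, C ≠ ∞ ∧ ∀ A : FTensor n, WienerBound |r| K A →
      ∀ f u : VDist n, vsq (r - 1) (rhs A f u) ≤
        C * (vsq (r - 1) f + vsq (r + 1) u * (1 + vsq r u)) := by
  obtain ⟨C₁, hC₁, hT⟩ := vsq_tens_self_tame hn hr
  obtain ⟨C₂, hC₂, hV⟩ := vsq_visc_le (n := n) r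
  refine ⟨4 + 4 * (C₂ * K ^ 2) + 2 * (C₁ * n), by finiteness, fun A hA f u => ?_⟩
  have h1 := hV A K u hA
  have h2 : vsq (r - 1) (tens u u) ≤ C₁ * (n * (vsq r u * vsq (r + 1) u)) := by
    refine (hT u).trans (mul_le_mul' le_rfl ?_)
    calc _ ≤ vsq (r + 1 / 2) u * vsq (r + 1 / 2) u := by
          gcongr
          exact vsq_mono (by linarith) u
      _ = vsq (r + 1 / 2) u ^ 2 := (pow_two _).symm
      _ ≤ _ := vsq_interp (by ring) u
  set x := vsq (r - 1) f
  set y := vsq (r + 1) u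
  set z := vsq r u
  calc _ ≤ 2 * vsq (r - 1) (f + visc A u) + 2 * vsq (r - 1) (tens u u) := vsq_sub_le _ _ _
    _ ≤ 2 * (2 * x + 2 * (C₂ * (K ^ 2 * y))) + 2 * (C₁ * (n * (z * y))) := by
        gcongr
        exact (vsq_add_le _ _ _).trans (by gcongr)
    _ ≤ 2 * (2 * x + 2 * (C₂ * (K ^ 2 * y))) + 2 * (C₁ * (n * (z * y))) +
        ((4 * (C₂ * K ^ 2) + 2 * (C₁ * n)) * x + (4 + 2 * (C₁ * n)) * y +
          (4 + 4 * (C₂ * K ^ 2)) * (y * z)) := le_self_add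
    _ = _ := by ring

theorem RegularSolution.lintegral_rhs {n : ℕ} (hn : 2 ≤ n) {r : ℝ} (hr : 0 ≤ r)
    (hrn : (n : ℝ) / 2 < r + 1) {T c m : ℝ} (hm : |r| ≤ m) {K : ℝ≥0∞} {A : ℝ → FTensor n}
    (hA : ViscData T c m K A) {f : ℝ → VDist n} {u₀ : VDist n} {u : ℝ → VDist n}
    (hf : MemLqDotV 2 T (r - 1) f) (hu : RegularSolution T A f u₀ r u) :
    ∫⁻ t, vsq (r - 1) (rhs (A t) (f t) (u t)) ∂(timeMeasure T) < ∞ := by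
  obtain ⟨C, hC, H⟩ := exists_vsq_rhs_le hn hr hrn hA.fin
  obtain ⟨D, hD⟩ := hu.bound
  rw [memLqDotV_two] at hf
  have m1 := aemeasurable_vsq hf.1 (r - 1)
  have m2 := aemeasurable_vsq hu.aemeasurable (r + 1)
  calc _ ≤ ∫⁻ t, C * (vsq (r - 1) (f t) + vsq (r + 1) (u t) * (1 + ENNReal.ofReal D))
        ∂(timeMeasure T) := by
        refine lintegral_mono_ae ?_
        filter_upwards [hA.wiener, ae_of_forall_mem_Icc hD] with t h1 h2
        exact (H (A t) (h1.mono hm) (f t) (u t)).trans (by gcongr)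
    _ < ∞ := by
        rw [lintegral_const_mul' _ _ hC, lintegral_add_left' m1, lintegral_mul_const'' _ m2]
        have := hf.2.2
        have := hu.bound_int
        finiteness

theorem RegularSolution.memLqSigma_deriv {n : ℕ} (hn : 2 ≤ n) {r : ℝ} (hr : 0 ≤ r)
    (hrn : (n : ℝ) / 2 < r + 1) {T c m : ℝ} (hm : |r| ≤ m) {K : ℝ≥0∞} {A : ℝ → FTensor n}
    (hA : ViscData T c m K A) {f : ℝ → VDist n} {u₀ : VDist n} {u : ℝ → VDist n}
    (hf : MemLqDotV 2 T (r - 1) f) (hu : RegularSolution T A f u₀ r u) :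
    MemLqSigma 2 T (r - 1) fun t => leray (rhs (A t) (f t) (u t)) := by
  have h1 := lintegral_vsq_leray_lt_top (hu.lintegral_rhs hn hr hrn hm hA hf)
  rw [memLqDotV_two] at hf
  have hmeas : ∀ k ξ, AEMeasurable (fun t => leray (rhs (A t) (f t) (u t)) k ξ) (timeMeasure T) :=
    fun k ξ => (aestronglyMeasurable_leray (fun k ξ =>
      (aemeasurable_rhs hA.meas hf.1 hu.aemeasurable k ξ).aestronglyMeasurable) k ξ).aemeasurable
  refine memLqSigma_two.2 ⟨hmeas, ?_, h1⟩
  filter_upwards [hf.2.1, ae_of_forall_mem_Icc hu.sol, ae_lt_top_of_lintegral hmeas h1] with t a b d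
  exact mem_dotHsigma.2 ⟨solenoidal_leray (isRealDist_rhs (hA.real t) (mem_dotHV.1 a).1 b.real), d⟩

theorem RegularSolution.isTimeDeriv {n : ℕ} {r T : ℝ} {A : ℝ → FTensor n} {f : ℝ → VDist n}
    {u₀ : VDist n} {u : ℝ → VDist n} (hu : RegularSolution T A f u₀ r u) :
    IsTimeDeriv T u fun t => leray (rhs (A t) (f t) (u t)) :=
  fun k ξ => (hu.prim k ξ).weakDeriv

theorem RegularSolution.memLqSigma_top {n : ℕ} {r s T : ℝ} (hs : s ≤ r) {A : ℝ → FTensor n}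
    {f : ℝ → VDist n} {u₀ : VDist n} {u : ℝ → VDist n} (hu : RegularSolution T A f u₀ r u) :
    MemLqSigma ∞ T s u := by
  obtain ⟨D, hD⟩ := hu.bound
  refine PeriodicNS.memLqSigma_top.2 ⟨hu.aemeasurable, ae_of_forall_mem_Icc fun t ht => ?_, D,
    ae_of_forall_mem_Icc fun t ht => (vsq_mono hs _).trans (hD t ht)⟩
  exact mem_dotHsigma.2 ⟨hu.sol t ht, (vsq_mono hs _).trans_lt
    ((hD t ht).trans_lt ENNReal.ofReal_lt_top)⟩

theorem RegularSolution.memLqSigma_two {n : ℕ} {r s T : ℝ} (hs : s ≤ r + 1) {A : ℝ → FTensor n}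
    {f : ℝ → VDist n} {u₀ : VDist n} {u : ℝ → VDist n} (hu : RegularSolution T A f u₀ r u) :
    MemLqSigma 2 T s u := by
  refine PeriodicNS.memLqSigma_two.2 ⟨hu.aemeasurable, ?_,
    (lintegral_mono fun t => vsq_mono hs _).trans_lt hu.bound_int⟩
  filter_upwards [ae_of_forall_mem_Icc hu.sol, ae_lt_top_of_lintegral hu.aemeasurable hu.bound_int]
    with t h1 h2
  exact mem_dotHsigma.2 ⟨h1, (vsq_mono hs _).trans_lt h2⟩

/-- A coefficient of an absolutely continuous function, weighted with `ϱ(ξ)^{2r}`. -/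
theorem IsPrim.wt_mul_enorm_sq_le {n : ℕ} {T r : ℝ} (ξ : Freq n) {y g : ℝ → ℂ} (h : IsPrim T y g)
    {t : ℝ} (ht : t ∈ Icc 0 T) :
    wt (2 * r) ξ * ‖y t‖ₑ ^ 2 ≤ wt (2 * r) ξ * ‖y 0‖ₑ ^ 2 +
      ∫⁻ s, (wt (2 * (r - 1)) ξ * ‖g s‖ₑ ^ 2 + wt (2 * (r + 1)) ξ * ‖y s‖ₑ ^ 2)
        ∂(timeMeasure T) := by
  have hρ := rho_pos ξ
  have hp := h.norm_sq.const_mul (rho ξ ^ (2 * r))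
  have h1 : rho ξ ^ (2 * r) * ‖y t‖ ^ 2 ≤ rho ξ ^ (2 * r) * ‖y 0‖ ^ 2 +
      ∫ s in Ioo 0 t, |rho ξ ^ (2 * r) * (2 * (g s * conj (y s)).re)| := by
    rw [hp.eq t ht, ← intervalIntegral_eq_Ioo ht.1]
    refine add_le_add le_rfl ?_
    exact intervalIntegral_mono_time hp.int hp.int.abs (ae_of_all _ fun s => le_abs_self _) ht
  have hmono : volume.restrict (Ioo 0 t) ≤ timeMeasure T :=
    Measure.restrict_mono (Ioo_subset_Ioo_right ht.2) le_rfl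
  rw [← ofReal_rho_mul_norm_sq, ← ofReal_rho_mul_norm_sq]
  refine (ENNReal.ofReal_le_ofReal h1).trans ?_
  rw [ENNReal.ofReal_add (by positivity) (integral_nonneg fun s => abs_nonneg _)]
  gcongr
  rw [ofReal_integral_eq_lintegral_ofReal (hp.int.abs.mono_measure hmono)
    (ae_of_all _ fun s => abs_nonneg _)]
  refine (lintegral_mono' hmono le_rfl).trans (lintegral_mono fun s => ?_)
  rw [← ofReal_rho_mul_norm_sq, ← ofReal_rho_mul_norm_sq, ← ENNReal.ofReal_add (by positivity)
    (by positivity)]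
  refine ENNReal.ofReal_le_ofReal ?_
  have e1 : rho ξ ^ (2 * (r - 1)) = (rho ξ ^ (r - 1)) ^ 2 := by
    rw [← Real.rpow_natCast, ← Real.rpow_mul hρ.le]
    congr 1
    push_cast
    ring
  have e2 : rho ξ ^ (2 * (r + 1)) = (rho ξ ^ (r + 1)) ^ 2 := by
    rw [← Real.rpow_natCast, ← Real.rpow_mul hρ.le]
    congr 1
    push_cast
    ring
  have e3 : rho ξ ^ (2 * r) = rho ξ ^ (r - 1) * rho ξ ^ (r + 1) := by
    rw [← Real.rpow_add hρ]
    congr 1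
    ring
  have e4 : |(g s * conj (y s)).re| ≤ ‖g s‖ * ‖y s‖ := by
    refine (Complex.abs_re_le_norm _).trans_eq ?_
    rw [norm_mul, RCLike.norm_conj]
  have p1 := Real.rpow_pos_of_pos hρ (r - 1)
  have p2 := Real.rpow_pos_of_pos hρ (r + 1)
  rw [e1, e2, e3, abs_mul, abs_of_pos (mul_pos p1 p2), abs_mul, abs_two]
  have := mul_le_mul_of_nonneg_left e4 (mul_pos p1 p2).le
  -- The weight `ϱ^(2r)` is divided as `ϱ^(r-1) * ϱ^(r+1)` between the derivative and the function.
  nlinarith [sq_nonneg (rho ξ ^ (r - 1) * ‖g s‖ - rho ξ ^ (r + 1) * ‖y s‖)]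

theorem tendsto_sq_of_dominated {n : ℕ} {ι : Type*} {l : Filter ι} [l.IsCountablyGenerated] {s : ℝ}
    {g : ι → SDist n} {M : Freq n → ℝ≥0∞} (hM : ∑' ξ, M ξ ≠ ∞)
    (hb : ∀ᶠ i in l, ∀ ξ, wt (2 * s) ξ * ‖g i ξ‖ₑ ^ 2 ≤ M ξ)
    (h : ∀ ξ, Tendsto (fun i => g i ξ) l (𝓝 0)) : Tendsto (fun i => sq s (g i)) l (𝓝 0) := by
  let _ : MeasurableSpace (Freq n) := ⊤
  have h1 := tendsto_lintegral_filter_of_dominated_convergence (μ := (Measure.count : Measure (Freq n)))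
    (l := l) (F := fun i ξ => wt (2 * s) ξ * ‖g i ξ‖ₑ ^ 2) (f := fun _ => 0) M
    (Eventually.of_forall fun i => measurable_from_top) (hb.mono fun i hi => ae_of_all _ hi)
    (by rwa [lintegral_count]) (ae_of_all _ fun ξ => ?_)
  · unfold sq wsq
    simpa only [lintegral_count, lintegral_zero] using h1
  · have h2 := ENNReal.Tendsto.const_mul (a := wt (2 * s) ξ)
      (ENNReal.Tendsto.pow (n := 2) ((continuous_enorm.tendsto 0).comp (h ξ))) (Or.inr (wt_ne_top _ _))
    simpa using h2

/-- From `u ∈ L₂ H^{r+1}` and `u' ∈ L₂ H^{r-1}` one obtains a summable majorant `M` of `ϱ(ξ)^{2r}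
|û(ξ,t)|²` that does not depend on `t`. Each coefficient is continuous in time, so dominated
convergence over the lattice gives continuity in `H^r`. -/
theorem RegularSolution.tendsto_vsq {n : ℕ} (hn : 2 ≤ n) {r : ℝ} (hr : 0 ≤ r)
    (hrn : (n : ℝ) / 2 < r + 1) {T c m : ℝ} (hm : |r| ≤ m) {K : ℝ≥0∞} {A : ℝ → FTensor n}
    (hA : ViscData T c m K A) {f : ℝ → VDist n} {u₀ : VDist n} {u : ℝ → VDist n}
    (hf : MemLqDotV 2 T (r - 1) f) (hu : RegularSolution T A f u₀ r u) {t₀ : ℝ}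
    (ht₀ : t₀ ∈ Icc 0 T) :
    Tendsto (fun t => vsq r (u t - u t₀)) (𝓝[Icc 0 T] t₀) (𝓝 0) := by
  obtain ⟨hgm, -, hgi⟩ := PeriodicNS.memLqSigma_two.1 (hu.memLqSigma_deriv hn hr hrn hm hA hf)
  obtain ⟨hum, -, hui⟩ := PeriodicNS.memLqSigma_two.1 (hu.memLqSigma_two le_rfl)
  set g : ℝ → VDist n := fun t => leray (rhs (A t) (f t) (u t)) with hg
  set M : Fin n → Freq n → ℝ≥0∞ := fun k ξ => wt (2 * r) ξ * ‖u 0 k ξ‖ₑ ^ 2 +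
    ∫⁻ s, (wt (2 * (r - 1)) ξ * ‖g s k ξ‖ₑ ^ 2 + wt (2 * (r + 1)) ξ * ‖u s k ξ‖ₑ ^ 2)
      ∂(timeMeasure T) with hM
  have hMb : ∀ t ∈ Icc 0 T, ∀ k ξ, wt (2 * r) ξ * ‖u t k ξ‖ₑ ^ 2 ≤ M k ξ := fun t ht k ξ =>
    (hu.prim k ξ).wt_mul_enorm_sq_le ξ ht
  obtain ⟨D, hD⟩ := hu.bound
  have hMs : ∀ k, ∑' ξ, M k ξ ≠ ∞ := by
    intro k
    have m1 : ∀ ξ, AEMeasurable (fun s => wt (2 * (r - 1)) ξ * ‖g s k ξ‖ₑ ^ 2) (timeMeasure T) :=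
      fun ξ => ((hgm k ξ).enorm.pow_const 2).const_mul _
    have m2 : ∀ ξ, AEMeasurable (fun s => wt (2 * (r + 1)) ξ * ‖u s k ξ‖ₑ ^ 2) (timeMeasure T) :=
      fun ξ => ((hum k ξ).enorm.pow_const 2).const_mul _
    have e1 : ∑' ξ, wt (2 * r) ξ * ‖u 0 k ξ‖ₑ ^ 2 < ∞ :=
      (sq_le_vsq r (u 0) k).trans_lt ((hD 0 (left_mem_Icc.2 (ht₀.1.trans ht₀.2))).trans_lt
        ENNReal.ofReal_lt_top)
    have m3 : ∀ ξ, AEMeasurable (fun s => wt (2 * (r - 1)) ξ * ‖g s k ξ‖ₑ ^ 2 +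
        wt (2 * (r + 1)) ξ * ‖u s k ξ‖ₑ ^ 2) (timeMeasure T) := fun ξ => (m1 ξ).add (m2 ξ)
    simp only [hM]
    rw [ENNReal.tsum_add, ← lintegral_tsum m3]
    refine ENNReal.add_ne_top.2 ⟨e1.ne, ?_⟩
    refine ((lintegral_mono (g := fun s => vsq (r - 1) (g s) + vsq (r + 1) (u s))
      fun s => ?_).trans_lt ?_).ne
    · rw [ENNReal.tsum_add]
      exact add_le_add (sq_le_vsq _ _ k) (sq_le_vsq _ _ k)
    · rw [lintegral_add_left' (aemeasurable_vsq hgm _)]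
      finiteness
  suffices h : ∀ k, Tendsto (fun t => sq r ((u t - u t₀) k)) (𝓝[Icc 0 T] t₀) (𝓝 0) by
    simpa [vsq] using tendsto_finsetSum Finset.univ fun k _ => h k
  intro k
  refine tendsto_sq_of_dominated (M := fun ξ => 4 * M k ξ) ?_ ?_ fun ξ => ?_
  · rw [ENNReal.tsum_mul_left]
    exact ENNReal.mul_ne_top (by simp) (hMs k)
  · filter_upwards [self_mem_nhdsWithin] with t ht ξ
    have h1 : ‖(u t - u t₀) k ξ‖ₑ ^ 2 ≤ 2 * ‖u t k ξ‖ₑ ^ 2 + 2 * ‖u t₀ k ξ‖ₑ ^ 2 :=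
      (pow_le_pow_left' enorm_sub_le 2).trans (ennreal_add_sq_le _ _)
    calc _ ≤ wt (2 * r) ξ * (2 * ‖u t k ξ‖ₑ ^ 2 + 2 * ‖u t₀ k ξ‖ₑ ^ 2) := by gcongr
      _ = 2 * (wt (2 * r) ξ * ‖u t k ξ‖ₑ ^ 2) + 2 * (wt (2 * r) ξ * ‖u t₀ k ξ‖ₑ ^ 2) := by ring
      _ ≤ 2 * M k ξ + 2 * M k ξ := by
          gcongr
          · exact hMb t ht k ξ
          · exact hMb t₀ ht₀ k ξ
      _ = _ := by ring
  · have h1 := ((hu.prim k ξ).continuousOn t₀ ht₀).sub_const (u t₀ k ξ)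
    have h2 : Tendsto (fun t => u t k ξ - u t₀ k ξ) (𝓝[Icc 0 T] t₀) (𝓝 (u t₀ k ξ - u t₀ k ξ)) := h1
    rwa [sub_self] at h2

theorem RegularSolution.contSigma {n : ℕ} (hn : 2 ≤ n) {r : ℝ} (hr : 0 ≤ r)
    (hrn : (n : ℝ) / 2 < r + 1) {T c m : ℝ} (hm : |r| ≤ m) {K : ℝ≥0∞} {A : ℝ → FTensor n}
    (hA : ViscData T c m K A) {f : ℝ → VDist n} {u₀ : VDist n} {u : ℝ → VDist n}
    (hf : MemLqDotV 2 T (r - 1) f) (hu : RegularSolution T A f u₀ r u) : ContSigma T r u := by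
  obtain ⟨D, hD⟩ := hu.bound
  refine ⟨fun t ht => mem_dotHsigma.2 ⟨hu.sol t ht, (hD t ht).trans_lt ENNReal.ofReal_lt_top⟩,
    fun t₀ ht₀ => ?_⟩
  simp only [sobolevNormV_eq]
  have h1 := (ENNReal.continuous_rpow_const (y := (1 / 2 : ℝ))).tendsto 0
  rw [ENNReal.zero_rpow_of_pos (by norm_num)] at h1
  exact h1.comp (hu.tendsto_vsq hn hr hrn hm hA hf ht₀)

theorem enorm_pairingV_sq_le {n : ℕ} (F w : VDist n) :
    ‖pairingV F w‖ₑ ^ 2 ≤ n * (vsq 0 F * vsq 0 w) := by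
  have h1 : ∀ k, ‖pairing (F k) (w k)‖ₑ ^ 2 ≤ sq 0 (F k) * vsq 0 w := by
    intro k
    have e : ∑' ξ, ‖w k (-ξ)‖ₑ ^ 2 = ∑' ξ, ‖w k ξ‖ₑ ^ 2 :=
      (Equiv.neg (Freq n)).tsum_eq fun ξ => ‖w k ξ‖ₑ ^ 2
    calc _ ≤ (∑' ξ, ‖F k ξ‖ₑ * ‖w k (-ξ)‖ₑ) ^ 2 := by
          gcongr
          unfold pairing
          refine enorm_tsum_le_tsum_enorm.trans_eq ?_
          simp only [enorm_mul]
      _ ≤ (∑' ξ, ‖F k ξ‖ₑ ^ 2) * ∑' ξ, ‖w k (-ξ)‖ₑ ^ 2 := tsum_mul_sq_le _ _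
      _ = sq 0 (F k) * sq 0 (w k) := by
          rw [e]
          unfold sq
          rw [wsq_zero, wsq_zero]
      _ ≤ _ := by gcongr; exact sq_le_vsq 0 w k
  calc _ ≤ (∑ k, ‖pairing (F k) (w k)‖ₑ) ^ 2 := by
        gcongr
        exact enorm_sum_le _ _
    _ ≤ Fintype.card (Fin n) * ∑ k, ‖pairing (F k) (w k)‖ₑ ^ 2 := ennreal_sum_sq_le _
    _ ≤ n * ∑ k, sq 0 (F k) * vsq 0 w := by
        rw [Fintype.card_fin]
        gcongr with k
        exact h1 k
    _ = _ := by rw [← Finset.sum_mul]; rfl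

/-- The regular solution is a Serrin-type solution. -/
theorem RegularSolution.isSerrinSolution {n : ℕ} (hn : 2 ≤ n) {r : ℝ} (hr : 0 ≤ r)
    (hrn : (n : ℝ) / 2 < r + 1) {T c m : ℝ} (hm : |r| ≤ m) {K : ℝ≥0∞}
    {a : Tensor n} (hA : ViscData T c m K fun t i j α β => ofFun (a i j α β t)) {f : ℝ → VDist n}
    {u₀ : VDist n} {u : ℝ → VDist n} (hf : MemLqDotV 2 T (r - 1) f)
    (hu : RegularSolution T (fun t i j α β => ofFun (a i j α β t)) f u₀ r u) :
    IsSerrinSolution T a f u₀ u := by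
  have hK := hA.fin
  have hn' : (2 : ℝ) ≤ n := by exact_mod_cast hn
  obtain ⟨D, hD⟩ := hu.bound
  have hf1 := hf.mono (s' := -1) (by linarith)
  obtain ⟨-, hfm, -⟩ := memLqDotV_two.1 hf1
  obtain ⟨-, hum, -⟩ := PeriodicNS.memLqSigma_two.1 (hu.memLqSigma_two (s := 1) (by linarith))
  obtain ⟨C, hC, H⟩ := vsq_visc_le (n := n) 0
  obtain ⟨C', hC', H'⟩ := vsq_leray_le (n := n)
  have h0 : ∀ t ∈ Icc 0 T, vsq 0 (u t) < ∞ := fun t ht =>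
    (vsq_mono hr _).trans_lt ((hD t ht).trans_lt ENNReal.ofReal_lt_top)
  refine ⟨⟨hu.memLqSigma_top hr, hu.memLqSigma_two (by linarith), ⟨_, hu.isTimeDeriv, ?_⟩,
    ⟨u, ae_of_all _ fun _ => rfl, fun t ht => mem_dotHsigma.2 ⟨hu.sol t ht, h0 t ht⟩,
      fun w hw => ?_, fun w hw => by rw [hu.init]⟩⟩, hu.memLqSigma_two hrn.le⟩
  · filter_upwards [hfm, hum, hA.wiener] with t hft hut hw
    set A : FTensor n := fun i j α β => ofFun (a i j α β t) with hAt
    obtain ⟨hs, hv1⟩ := mem_dotHsigma.1 hut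
    obtain ⟨hfr, hfv, -⟩ := mem_dotHV.1 hft
    have hw0 : WienerBound 0 K A := hw.mono ((abs_nonneg r).trans hm)
    have hvv : vsq (-1) (visc A (u t)) < ∞ := by
      have := H A K (u t) (by rwa [abs_zero])
      rw [zero_sub, zero_add] at this
      exact this.trans_lt (by finiteness)
    have hfin : vsq (-1) (f t + visc A (u t)) < ∞ :=
      (vsq_add_le _ _ _).trans_lt (by finiteness)
    have e : leray (rhs A (f t) (u t)) + leray (advection (u t)) = leray (f t + visc A (u t)) := by
      rw [rhs, leray_sub, advection_eq_tens hv1 hs.div, sub_add_cancel]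
    rw [e]
    refine ⟨mem_HV.2 ⟨isRealDist_leray fun k ξ => ?_, (H' _ _).trans_lt (by finiteness)⟩,
      fun w hw => ?_⟩
    · have e2 := hfr k ξ
      have e3 := isRealDist_visc (A := A) (fun i j α β => isRealDist_ofFun _) hs.real k ξ
      simp only [Pi.add_apply, map_add]
      rw [e2, e3]
    · obtain ⟨hws, hwv⟩ := mem_dotHsigma.1 hw
      rw [viscForm_eq hK hw0 hv1 hwv hws.real, pairingV_leray hfin hwv hws,
        pairingV_add hfv hvv hwv hws.real]
      ring
  · obtain ⟨hwr, hwv⟩ := mem_HV.1 hw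
    intro t₀ ht₀
    have h1 : Tendsto (fun t => vsq 0 (u t - u t₀)) (𝓝[Icc 0 T] t₀) (𝓝 0) :=
      tendsto_of_tendsto_of_tendsto_of_le_of_le tendsto_const_nhds
        (hu.tendsto_vsq hn hr hrn hm hA hf ht₀) (fun t => zero_le) fun t => vsq_mono hr _
    have h2 : Tendsto (fun t => ‖pairingV (u t) w - pairingV (u t₀) w‖ₑ ^ 2) (𝓝[Icc 0 T] t₀)
        (𝓝 0) := by
      have h3 := ENNReal.Tendsto.const_mul (a := n * vsq 0 w) h1 (Or.inr (by finiteness))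
      rw [mul_zero] at h3
      refine tendsto_of_tendsto_of_tendsto_of_le_of_le' tendsto_const_nhds h3
        (Eventually.of_forall fun t => zero_le) ?_
      filter_upwards [self_mem_nhdsWithin] with t ht
      rw [← pairingV_sub (s := 0) (by rw [neg_zero]; exact h0 t ht)
        (by rw [neg_zero]; exact h0 t₀ ht₀) hwv hwr]
      exact (enorm_pairingV_sq_le _ _).trans_eq (by ring)
    rw [ContinuousWithinAt, tendsto_iff_edist_tendsto_0]
    simp only [edist_eq_enorm_sub]
    have h4 := ((ENNReal.continuous_rpow_const (y := (1 / 2 : ℝ))).tendsto 0).comp h2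
    rw [ENNReal.zero_rpow_of_pos (by norm_num)] at h4
    refine h4.congr fun t => ?_
    rw [Function.comp_apply, ← ENNReal.rpow_natCast, ← ENNReal.rpow_mul]
    norm_num

/-! ### The pressure -/

/-- The potential of the gradient part of `F`. -/
def potential {n : ℕ} (F : VDist n) : SDist n := fun ξ =>
  (∑ j, (ξ j : ℂ) * F j ξ) / (2 * (Real.pi : ℂ) * Complex.I * (freqSq ξ : ℂ))

theorem potential_zero {n : ℕ} (F : VDist n) : potential F 0 = 0 := by simp [potential]

theorem gradient_potential {n : ℕ} {F : VDist n} (h0 : ∀ k, F k 0 = 0) :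
    gradient (potential F) = F - leray F := by
  ext k ξ
  by_cases hξ : ξ = 0
  · simp [gradient, partialD, leray, hξ, h0]
  · have hq : (freqSq ξ : ℂ) ≠ 0 := by
      have := freqSq_pos hξ
      exact_mod_cast (by linarith : freqSq ξ ≠ 0)
    have hpi := Complex.two_pi_I_ne_zero
    simp only [gradient, partialD, leray, hξ, potential, if_false, Pi.sub_apply, sub_sub_cancel]
    generalize (∑ j, (ξ j : ℂ) * F j ξ) = S
    calc _ = (2 * (Real.pi : ℂ) * Complex.I) / (2 * (Real.pi : ℂ) * Complex.I) *
          ((ξ k : ℂ) * S / (freqSq ξ : ℂ)) := by ring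
      _ = _ := by rw [div_self hpi, one_mul]

theorem isRealDist_potential {n : ℕ} {F : VDist n} (hF : ∀ k, IsRealDist (F k)) :
    IsRealDist (potential F) := by
  intro ξ
  simp only [potential, freqSq_neg, map_div₀, map_sum, map_mul, map_intCast, Complex.conj_ofReal,
    Complex.conj_I, map_ofNat, hF _ ξ, Pi.neg_apply, Int.cast_neg, neg_mul, mul_neg,
    Finset.sum_neg_distrib, neg_div, div_neg]

theorem sq_le_vsq_gradient {n : ℕ} (s : ℝ) {p : SDist n} (h0 : p 0 = 0) :
    sq s p ≤ 2 * vsq (s - 1) (gradient p) := by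
  unfold vsq sq wsq
  rw [← Summable.tsum_finsetSum fun _ _ => ENNReal.summable, ← ENNReal.tsum_mul_left]
  refine ENNReal.tsum_le_tsum fun ξ => ?_
  by_cases hξ : ξ = 0
  · simp [hξ, h0]
  have hρ := rho_pos ξ
  have e : ∑ k, wt (2 * (s - 1)) ξ * ‖gradient p k ξ‖ₑ ^ 2 =
      ENNReal.ofReal (rho ξ ^ (2 * (s - 1)) * (4 * Real.pi ^ 2 * freqSq ξ * ‖p ξ‖ ^ 2)) := by
    simp only [← ofReal_rho_mul_norm_sq]
    rw [← ENNReal.ofReal_sum_of_nonneg fun k _ => by positivity, ← Finset.mul_sum]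
    congr 2
    unfold freqSq
    rw [Finset.mul_sum, Finset.sum_mul]
    refine Finset.sum_congr rfl fun k _ => ?_
    simp only [gradient, partialD, norm_mul, Complex.norm_I, Complex.norm_intCast,
      Complex.norm_ofNat, Complex.norm_real, Real.norm_eq_abs, mul_pow, sq_abs]
    ring
  rw [e, ← ofReal_rho_mul_norm_sq, ← ENNReal.ofReal_ofNat, ← ENNReal.ofReal_mul (by norm_num)]
  refine ENNReal.ofReal_le_ofReal ?_
  have e2 : rho ξ ^ (2 * s) = rho ξ ^ (2 * (s - 1)) * rho ξ ^ 2 := by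
    rw [← Real.rpow_two, ← Real.rpow_add hρ]
    congr 1
    ring
  have h1 := mul_le_mul_of_nonneg_left (rho_sq_le hξ)
    (mul_nonneg (Real.rpow_nonneg hρ.le (2 * (s - 1))) (sq_nonneg ‖p ξ‖))
  rw [e2]
  linarith

theorem eq_of_gradient_eq {n : ℕ} {p q : SDist n} (h : gradient p = gradient q) (h0 : p 0 = q 0) :
    p = q := by
  ext ξ
  by_cases hξ : ξ = 0
  · rw [hξ, h0]
  obtain ⟨j, hj⟩ := Function.ne_iff.mp hξ
  have h1 := congrFun (congrFun h j) ξ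
  have h2 : (ξ j : ℂ) ≠ 0 := by exact_mod_cast hj
  exact mul_left_cancel₀ (mul_ne_zero Complex.two_pi_I_ne_zero h2) h1

theorem rhs_zero {n : ℕ} {A : FTensor n} {f u : VDist n} (hf : ∀ k, f k 0 = 0) (k : Fin n) :
    rhs A f u k 0 = 0 := by
  simp [rhs, hf, visc, tens, partialD]

section Pressure

variable {n : ℕ} {T c m : ℝ} {K : ℝ≥0∞} {a : Tensor n} {f u : ℝ → VDist n} {u₀ : VDist n}

/-- At almost every time all the terms of the equation of a Serrin-type solution are in `H⁻¹`. -/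
theorem IsSerrinSolution.ae_terms (hn : 0 < n) (hm : 0 ≤ m)
    (hA : ViscData T c m K fun t i j α β => ofFun (a i j α β t)) (hf : MemLqDotV 2 T (-1) f)
    (hu : IsSerrinSolution T a f u₀ u) : ∀ᵐ t ∂(timeMeasure T),
      WienerBound 0 K (fun i j α β => ofFun (a i j α β t)) ∧ vsq 1 (u t) < ∞ ∧
      advection (u t) = tens (u t) (u t) ∧ vsq (-1) (f t) < ∞ ∧
      vsq (-1) (visc (fun i j α β => ofFun (a i j α β t)) (u t)) < ∞ ∧
      vsq (-1) (tens (u t) (u t)) < ∞ := by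
  obtain ⟨C, hC, H⟩ := vsq_visc_le (n := n) 0
  obtain ⟨C', hC', H'⟩ := exists_vsq_tens_serrin hn
  have hK := hA.fin
  filter_upwards [hA.wiener, (memLqDotV_two.1 hf).2.1, (memLqSigma_two.1 hu.1.mem_grad).2.1,
    (memLqSigma_two.1 hu.2).2.1] with t hw hft h1 h2
  obtain ⟨hs, h1⟩ := mem_dotHsigma.1 h1
  have h2 := (mem_dotHsigma.1 h2).2
  have hw0 := hw.mono hm
  have h0 : vsq 0 (u t) < ∞ := (vsq_mono zero_le_one _).trans_lt h1
  refine ⟨hw0, h1, advection_eq_tens h1 hs.div, (mem_dotHV.1 hft).2.1, ?_,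
    (H' _).trans_lt (by finiteness)⟩
  have := H (fun i j α β => ofFun (a i j α β t)) K (u t) (by rwa [abs_zero])
  rw [zero_sub, zero_add] at this
  exact this.trans_lt (by finiteness)

/-- Since `u'` is the Leray projection of the right-hand side, what is missing from the unprojected
equation is the complementary part. That part is a gradient because the right-hand side has zero
mean. -/
theorem IsSerrinSolution.isPressure (hn : 0 < n) (hm : 0 ≤ m)
    (hA : ViscData T c m K fun t i j α β => ofFun (a i j α β t)) (hf : MemLqDotV 2 T (-1) f)
    (hu : IsSerrinSolution T a f u₀ u) :
    IsPressure T a f u fun t =>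
      potential (rhs (fun i j α β => ofFun (a i j α β t)) (f t) (u t)) := by
  refine ⟨_, hu.exists_timeDeriv hm hA hf, ?_⟩
  obtain ⟨C, hC, H⟩ := vsq_leray_le (n := n)
  filter_upwards [hu.ae_terms hn hm hA hf, (memLqDotV_two.1 hf).2.1] with t ht hft w hw
  obtain ⟨hW, h1, hadv, hfv, hvv, htv⟩ := ht
  obtain ⟨hwr, hwv⟩ := mem_HV.1 (hw 1)
  set A : FTensor n := fun i j α β => ofFun (a i j α β t)
  have hR : vsq (-1) (rhs A (f t) (u t)) < ∞ :=
    (vsq_sub_le _ _ _).trans_lt (by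
      have : vsq (-1) (f t + visc A (u t)) < ∞ := (vsq_add_le _ _ _).trans_lt (by finiteness)
      finiteness)
  have hL : vsq (-1) (leray (rhs A (f t) (u t))) < ∞ := (H _ _).trans_lt (by finiteness)
  have hfvv : vsq (-1) (f t + visc A (u t)) < ∞ := (vsq_add_le _ _ _).trans_lt (by finiteness)
  rw [viscForm_eq hA.fin hW h1 hwv hwr, gradient_potential (rhs_zero (mem_dotHV.1 hft).2.2), hadv,
    pairingV_sub hR hL hwv hwr, rhs, pairingV_sub hfvv htv hwv hwr, pairingV_add hfv hvv hwv hwr,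
    ← rhs, pairingV_add hL htv hwv hwr]
  ring

/-- Distributional time derivatives are unique almost everywhere. Once `u'` is known, testing with
single modes fixes every coefficient of the gradient, so a pressure is determined up to its mean
value. -/
theorem IsSerrinSolution.gradient_eq (hn : 0 < n) (hm : 0 ≤ m)
    (hA : ViscData T c m K fun t i j α β => ofFun (a i j α β t)) (hf : MemLqDotV 2 T (-1) f)
    (hu : IsSerrinSolution T a f u₀ u) {q : ℝ → SDist n} (hq : IsPressure T a f u q) :
    ∀ᵐ t ∂(timeMeasure T), gradient (q t) =
      gradient (potential (rhs (fun i j α β => ofFun (a i j α β t)) (f t) (u t))) := by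
  obtain ⟨u', hu', h⟩ := hq
  have hd := hu.exists_timeDeriv hm hA hf
  have he : ∀ᵐ t ∂(timeMeasure T), ∀ k ξ, u' t k ξ =
      leray (rhs (fun i j α β => ofFun (a i j α β t)) (f t) (u t)) k ξ :=
    ae_all_iff.2 fun k => ae_all_iff.2 fun ξ =>
      (show WeakDeriv T (fun t => u t k ξ) (fun t => u' t k ξ) from hu' k ξ).unique (hd k ξ)
  filter_upwards [hu.ae_terms hn hm hA hf, (memLqDotV_two.1 hf).2.1, he, h] with t ht hft het hwt
  obtain ⟨hW, h1, hadv, hfv, hvv, htv⟩ := ht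
  set A : FTensor n := fun i j α β => ofFun (a i j α β t)
  rw [gradient_potential (rhs_zero (mem_dotHV.1 hft).2.2)]
  ext k ξ
  have key : ∀ z : ℂ, pairingV (u' t + advection (u t)) (modeV k ξ z) -
      pairingV (visc A (u t)) (modeV k ξ z) + pairingV (gradient (q t)) (modeV k ξ z) =
        pairingV (f t) (modeV k ξ z) := by
    intro z
    have e := hwt _ fun s => modeV_mem_HV s k ξ z
    rwa [viscForm_eq hA.fin hW h1 (mem_HV.1 (modeV_mem_HV 1 k ξ z)).2 (isRealDist_modeV k ξ z),
      ← sub_eq_add_neg] at e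
  have e1 := key 1
  have e2 := key Complex.I
  have e3 : (u' t + advection (u t)) k ξ - visc A (u t) k ξ + gradient (q t) k ξ = f t k ξ := by
    rw [← pairingV_modeV_one_add (u' t + advection (u t)), ← pairingV_modeV_one_add (visc A (u t)),
      ← pairingV_modeV_one_add (gradient (q t)), ← pairingV_modeV_one_add (f t)]
    linear_combination (e1 + Complex.I * e2) / 2
  rw [hadv] at e3
  simp only [Pi.add_apply, Pi.sub_apply, het k ξ, rhs] at e3 ⊢
  linear_combination e3

end Pressure

/-! ### The data -/

theorem tensorNorm_component {n : ℕ} {T s M : ℝ} {a : Tensor n}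
    (h : tensorNorm T s a ≤ ENNReal.ofReal M) (k j α β : Fin n) :
    ∀ᵐ t ∂(timeMeasure T), sq s (ofFun (a k j α β t)) ≤ ENNReal.ofReal M ^ 2 := by
  set E : Fin n → Fin n → Fin n → Fin n → ℝ≥0∞ := fun k j α β =>
    eLpNorm (fun t => sobolevNorm s (ofFun (a k j α β t))) ∞ (timeMeasure T) ^ 2
  have h1 : E k j α β ≤ ENNReal.ofReal M ^ 2 := by
    calc E k j α β ≤ ∑ β, E k j α β :=
          Finset.single_le_sum (f := fun β => E k j α β) (fun _ _ => zero_le) (Finset.mem_univ β)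
      _ ≤ ∑ α, ∑ β, E k j α β :=
          Finset.single_le_sum (f := fun α => ∑ β, E k j α β) (fun _ _ => zero_le) (Finset.mem_univ α)
      _ ≤ ∑ j, ∑ α, ∑ β, E k j α β :=
          Finset.single_le_sum (f := fun j => ∑ α, ∑ β, E k j α β) (fun _ _ => zero_le)
            (Finset.mem_univ j)
      _ ≤ ∑ k, ∑ j, ∑ α, ∑ β, E k j α β :=
          Finset.single_le_sum (f := fun k => ∑ j, ∑ α, ∑ β, E k j α β) (fun _ _ => zero_le)
            (Finset.mem_univ k)
      _ = tensorNorm T s a ^ 2 := (ennreal_sq_rpow_half _).symm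
      _ ≤ _ := by gcongr
  filter_upwards [enorm_ae_le_eLpNormEssSup (fun t => sobolevNorm s (ofFun (a k j α β t)))
    (timeMeasure T)] with t ht
  rw [← sobolevNorm_sq]
  refine le_trans ?_ h1
  simp only [E, eLpNorm_exponent_top]
  gcongr
  exact ht

theorem timeMeasure_mono {S T : ℝ} (h : S ≤ T) : timeMeasure S ≤ timeMeasure T :=
  Measure.restrict_mono (Ioo_subset_Ioo_right h) le_rfl

/-- The tensor of the equation, frequency by frequency. -/
theorem exists_viscData {n : ℕ} (hn : 0 < n) {m p M CA : ℝ} (hmp : m + (n : ℝ) / 2 < p)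
    (hCA : 0 < CA) : ∃ K : ℝ≥0∞, K ≠ ∞ ∧ ∀ (T Ts : ℝ) (a : Tensor n), Ts ≤ T → TensorBounded T a →
      RelaxedElliptic T CA a → tensorNorm T p a ≤ ENNReal.ofReal M →
      ViscData Ts (1 / (4 * CA)) m K fun t i j α β => ofFun (a i j α β t) := by
  obtain ⟨C, hC, H⟩ := tsum_wt_mul_sq_le hn hmp
  refine ⟨1 + C * ENNReal.ofReal M ^ 2, by finiteness, fun T Ts a hTs hb hell hM => ?_⟩
  have hmono := timeMeasure_mono hTs
  refine ⟨by positivity, by finiteness, fun i j α β ξ => ?_, fun t i j α β => isRealDist_ofFun _,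
    ?_, ?_⟩
  · have h1 : AEStronglyMeasurable (fun z : ℝ × UnitAddTorus (Fin n) =>
        UnitAddTorus.mFourier (-ξ) z.2 * (a i j α β z.1 z.2 : ℂ)) (spaceTimeMeasure n T) :=
      ((ContinuousMap.continuous _).comp continuous_snd).aestronglyMeasurable.mul
        (Complex.continuous_ofReal.comp_aestronglyMeasurable (hb i j α β).1)
    exact h1.integral_prod_right'.aemeasurable.mono_measure hmono
  · refine ae_mono hmono ?_
    have h1 : ∀ᵐ t ∂(timeMeasure T), ∀ i j α β, sq p (ofFun (a i j α β t)) ≤ ENNReal.ofReal M ^ 2 := by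
      simp only [ae_all_iff]
      exact tensorNorm_component hM
    filter_upwards [h1] with t ht i j α β
    set S := ∑' ξ, wt m ξ * ‖ofFun (a i j α β t) ξ‖ₑ
    have h2 : S ^ 2 ≤ C * ENNReal.ofReal M ^ 2 := (H _).trans (by gcongr; exact ht i j α β)
    -- The bound `S ≤ 1 + S²` avoids taking a root; this explains the shape of `K`.
    rcases le_total S 1 with h3 | h3
    · exact h3.trans le_self_add
    · calc S = S * 1 := (mul_one _).symm
        _ ≤ S ^ 2 := by rw [pow_two]; gcongr
        _ ≤ _ := h2.trans le_add_self
  · refine ae_mono hmono ?_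
    have h1 : ∀ᵐ t ∂(timeMeasure T), ∀ i j α β, Integrable (a i j α β t) (torusMeasure n) := by
      simp only [ae_all_iff]
      intro i j α β
      have h2 : Integrable (fun z : ℝ × UnitAddTorus (Fin n) => a i j α β z.1 z.2)
          ((timeMeasure T).prod (torusMeasure n)) :=
        MemLp.integrable (q := ∞) le_top (hb i j α β)
      exact h2.prod_right_ae
    have h2 := Measure.ae_ae_of_ae_prod hell
    filter_upwards [h1, h2] with t b1 b2
    exact coercive_of_elliptic hCA b1 b2

theorem RegularSolution.congr_force {n : ℕ} {T r : ℝ} {A : ℝ → FTensor n} {f f' : ℝ → VDist n}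
    {u₀ : VDist n} {u : ℝ → VDist n} (h : RegularSolution T A f u₀ r u)
    (hf : ∀ᵐ t ∂(timeMeasure T), f t = f' t) : RegularSolution T A f' u₀ r u :=
  ⟨h.init, h.sol, fun k ξ => (h.prim k ξ).congr (hf.mono fun t ht => by rw [ht]), h.bound,
    h.bound_int⟩

theorem aemeasurable_heat {n : ℕ} (u₀ : VDist n) (μ : Measure ℝ) (k : Fin n) (ξ : Freq n) :
    AEMeasurable (fun t => heat u₀ t k ξ) μ := by
  unfold heat
  refine Continuous.aemeasurable ?_
  fun_prop

theorem integrable_toReal_vsq {n : ℕ} {T s : ℝ} {v : ℝ → VDist n}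
    (hv : ∀ k ξ, AEMeasurable (fun t => v t k ξ) (timeMeasure T))
    (h : ∫⁻ t, vsq s (v t) ∂(timeMeasure T) < ∞) :
    Integrable (fun t => (vsq s (v t)).toReal) (timeMeasure T) :=
  integrable_toReal_of_lintegral_ne_top (aemeasurable_vsq hv s) h.ne

theorem ae_rsq_le_toReal {n : ℕ} {T s : ℝ} {v : ℝ → VDist n}
    (hv : ∀ k ξ, AEMeasurable (fun t => v t k ξ) (timeMeasure T))
    (h : ∫⁻ t, vsq s (v t) ∂(timeMeasure T) < ∞) :
    ∀ᵐ t ∂(timeMeasure T), ∀ N, rsq (box n N) s (v t) ≤ (vsq s (v t)).toReal :=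
  (ae_lt_top_of_lintegral hv h).mono fun _ ht _ => rsq_le_toReal _ ht

theorem ofReal_integral_vsq {n : ℕ} {T s : ℝ} {v : ℝ → VDist n}
    (hv : ∀ k ξ, AEMeasurable (fun t => v t k ξ) (timeMeasure T))
    (h : ∫⁻ t, vsq s (v t) ∂(timeMeasure T) < ∞) :
    ENNReal.ofReal (∫ t in Ioo 0 T, (vsq s (v t)).toReal) = ∫⁻ t in Ioo 0 T, vsq s (v t) := by
  have e : ∫ t in Ioo 0 T, (vsq s (v t)).toReal = (∫⁻ t in Ioo 0 T, vsq s (v t)).toReal :=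
    integral_toReal (aemeasurable_vsq hv s) (ae_lt_top_of_lintegral hv h)
  rw [e]
  exact ENNReal.ofReal_toReal h.ne

/-- Existence of the regular solution for small data. -/
theorem exists_regularSolution_of_smallData {n : ℕ} (hn : 2 ≤ n) (T : ℝ) {c : ℝ} (hc : 0 < c)
    {K : ℝ≥0∞} (hK : K ≠ ∞) : ∃ A₃ : ℝ, 0 < A₃ ∧ ∀ Ts, 0 < Ts → Ts ≤ T → ∀ A : ℝ → FTensor n,
      ViscData Ts c (1 + |(n : ℝ) / 2 - 2|) K A → ∀ (r : ℝ) (K' : ℝ≥0∞), (n : ℝ) / 2 - 1 < r →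
      ViscData Ts c (1 + |r - 1|) K' A → ∀ f : ℝ → VDist n, MemLqDotV 2 Ts (r - 1) f →
      ∀ u₀ ∈ dotHsigma r, SmallData 1 1 A₃ Ts f u₀ → ∃ u, RegularSolution Ts A f u₀ r u := by
  classical
  obtain ⟨A₃, hA₃, Hx⟩ := exists_approx hn T hc hK
  refine ⟨A₃, hA₃, fun Ts hTs hTsT A hA r K' hr hA' f hf u₀ hu₀ hsm => ?_⟩
  have hn' : (2 : ℝ) ≤ n := by exact_mod_cast hn
  obtain ⟨hs₀, hv₀⟩ := mem_dotHsigma.1 hu₀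
  -- The Galerkin construction conserves reality exactly and asks for a force that is real at every
  -- time; `f` is changed on a null set of times.
  set f' : ℝ → VDist n := fun t => if ∀ k, IsRealDist (f t k) then f t else 0 with hf'
  have hff : ∀ᵐ t ∂(timeMeasure Ts), f t = f' t := by
    filter_upwards [(memLqDotV_two.1 hf).2.1] with t ht
    simp only [hf', if_pos (mem_dotHV.1 ht).1]
  have hfr : ∀ t k, IsRealDist (f' t k) := by
    intro t k
    simp only [hf']
    split_ifs with h
    · exact h k
    · intro ξ
      simp
  obtain ⟨hfm, hfd, hfi⟩ := memLqDotV_two.1 hf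
  have hfm' : ∀ k ξ, AEMeasurable (fun t => f' t k ξ) (timeMeasure Ts) := fun k ξ =>
    (hfm k ξ).congr (hff.mono fun t ht => by simp only [ht])
  have hfi' : ∫⁻ t, vsq (r - 1) (f' t) ∂(timeMeasure Ts) < ∞ := by
    rwa [← lintegral_congr_ae (hff.mono fun t ht => congrArg (vsq (r - 1)) ht)]
  have hfc : ∫⁻ t, vsq ((n : ℝ) / 2 - 2) (f' t) ∂(timeMeasure Ts) < ∞ :=
    (lintegral_mono fun t => vsq_mono (by linarith) _).trans_lt hfi'
  have hvc : vsq ((n : ℝ) / 2 - 1) u₀ < ∞ := (vsq_mono hr.le _).trans_lt hv₀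
  unfold SmallData at hsm
  simp only [sobolevNormV_sq, ENNReal.ofReal_one, one_mul] at hsm
  have hhm := aemeasurable_heat u₀ (timeMeasure Ts)
  have hhi : ∫⁻ t, vsq ((n : ℝ) / 2) (heat u₀ t) ∂(timeMeasure Ts) < ∞ := by
    refine lt_of_le_of_lt ?_ (hsm.trans ENNReal.ofReal_lt_top)
    refine le_trans ?_ le_add_self
    calc _ = 1 * ∫⁻ t in Ioo 0 Ts, vsq ((n : ℝ) / 2) (heat u₀ t) := (one_mul _).symm
      _ ≤ _ := mul_le_mul' le_add_self le_rfl
  have hsmall : (∫ t in Ioo 0 Ts, (vsq ((n : ℝ) / 2 - 2) (f' t)).toReal) +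
      ((vsq ((n : ℝ) / 2 - 1) u₀).toReal + 1) *
        (∫ t in Ioo 0 Ts, (vsq ((n : ℝ) / 2) (heat u₀ t)).toReal) < A₃ := by
    have e1 : ∫⁻ t in Ioo 0 Ts, vsq ((n : ℝ) / 2 - 2) (f t) =
        ∫⁻ t in Ioo 0 Ts, vsq ((n : ℝ) / 2 - 2) (f' t) :=
      lintegral_congr_ae (hff.mono fun t ht => congrArg (vsq ((n : ℝ) / 2 - 2)) ht)
    rw [e1, ← ofReal_integral_vsq hfm' hfc, ← ofReal_integral_vsq hhm hhi,
      ← ENNReal.ofReal_toReal hvc.ne, ← ENNReal.ofReal_one, ← ENNReal.ofReal_add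
        ENNReal.toReal_nonneg zero_le_one, ← ENNReal.ofReal_mul (by positivity),
      ← ENNReal.ofReal_add (integral_nonneg fun _ => ENNReal.toReal_nonneg)
        (mul_nonneg (by positivity) (integral_nonneg fun _ => ENNReal.toReal_nonneg)),
      ENNReal.ofReal_lt_ofReal_iff hA₃] at hsm
    exact hsm
  obtain ⟨D, hD⟩ := Hx Ts hTs hTsT A f' hA u₀ hs₀ hfr
    (integrable_of_lintegral_vsq hfm' hfi') _ _ _ (integrable_toReal_vsq hfm' hfc)
    (integrable_toReal_vsq hhm hhi) (ae_rsq_le_toReal hfm' hfc) (ae_rsq_le_toReal hhm hhi)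
    (fun N => rsq_le_toReal _ hvc) hsmall r K' (by linarith) hA' _ _
    (integrable_toReal_vsq hfm' hfi') (ae_rsq_le_toReal hfm' hfi') fun N => rsq_le_toReal _ hv₀
  obtain ⟨u, hu⟩ := exists_regularSolution hn (by linarith) (by linarith) hTs
    (by linarith [abs_nonneg (r - 1)]) hA' (integrable_toReal_vsq hfm' hfi')
    ((ae_lt_top_of_lintegral hfm' hfi').mono fun t ht => (ENNReal.ofReal_toReal ht.ne).ge)
    (fun t => ENNReal.toReal_nonneg) (fun N => rsq_le_toReal _ hv₀) hD
  exact ⟨u, hu.congr_force (hff.mono fun t ht => ht.symm)⟩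

/-! ### Almost everywhere equal functions of time -/

theorem MemLqSigma.congr {n : ℕ} {q : ℝ≥0∞} {T s : ℝ} {u v : ℝ → VDist n}
    (h : MemLqSigma q T s u) (huv : ∀ᵐ t ∂(timeMeasure T), u t = v t) : MemLqSigma q T s v := by
  refine ⟨fun k => ⟨fun ξ => ((h.1 k).1 ξ).congr (huv.mono fun t ht => by simp only [ht]), ?_, ?_⟩, ?_⟩
  · filter_upwards [(h.1 k).2.1, huv] with t a b
    rwa [← b]
  · rw [← eLpNorm_congr_ae (huv.mono fun t ht => congrArg (fun w : VDist n => sobolevNorm s (w k)) ht)]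
    exact (h.1 k).2.2
  · filter_upwards [h.2, huv] with t a b
    rwa [← b]

theorem IsTimeDeriv.congr {n : ℕ} {T : ℝ} {u v u' : ℝ → VDist n} (h : IsTimeDeriv T u u')
    (huv : ∀ᵐ t ∂(timeMeasure T), u t = v t) : IsTimeDeriv T v u' := fun k ξ =>
  (show WeakDeriv T (fun t => u t k ξ) (fun t => u' t k ξ) from h k ξ).congr
    (huv.mono fun t ht => by rw [ht])

theorem IsPressure.congr {n : ℕ} {T : ℝ} {a : Tensor n} {f u v : ℝ → VDist n} {p : ℝ → SDist n}
    (h : IsPressure T a f u p) (huv : ∀ᵐ t ∂(timeMeasure T), u t = v t) : IsPressure T a f v p := by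
  obtain ⟨u', hu', h⟩ := h
  refine ⟨u', hu'.congr huv, ?_⟩
  filter_upwards [h, huv] with t a b
  rwa [← b]

theorem RegularSolution.memLqDot_potential {n : ℕ} (hn : 2 ≤ n) {r : ℝ} (hr : 0 ≤ r)
    (hrn : (n : ℝ) / 2 < r + 1) {T c m : ℝ} (hm : |r| ≤ m) {K : ℝ≥0∞} {A : ℝ → FTensor n}
    (hA : ViscData T c m K A) {f : ℝ → VDist n} {u₀ : VDist n} {u : ℝ → VDist n}
    (hf : MemLqDotV 2 T (r - 1) f) (hu : RegularSolution T A f u₀ r u) :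
    MemLqDot 2 T r fun t => potential (rhs (A t) (f t) (u t)) := by
  obtain ⟨C, hC, H⟩ := vsq_leray_le (n := n)
  have h1 := hu.lintegral_rhs hn hr hrn hm hA hf
  obtain ⟨hfm, hfd, -⟩ := memLqDotV_two.1 hf
  have hmeas : ∀ k ξ, AEMeasurable (fun t => rhs (A t) (f t) (u t) k ξ) (timeMeasure T) :=
    aemeasurable_rhs hA.meas hfm hu.aemeasurable
  have hle : ∀ᵐ t ∂(timeMeasure T), sq r (potential (rhs (A t) (f t) (u t))) ≤
      (4 + 4 * C) * vsq (r - 1) (rhs (A t) (f t) (u t)) := by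
    filter_upwards [hfd] with t ht
    refine (sq_le_vsq_gradient r (potential_zero _)).trans ?_
    rw [gradient_potential (rhs_zero (mem_dotHV.1 ht).2.2)]
    set F := rhs (A t) (f t) (u t)
    calc _ ≤ 2 * (2 * vsq (r - 1) F + 2 * (C * vsq (r - 1) F)) := by
          gcongr
          exact (vsq_sub_le _ _ _).trans (by gcongr; exact H _ _)
      _ = _ := by ring
  refine memLqDot_two.2 ⟨fun ξ => ?_, ?_, ?_⟩
  · exact (Finset.aemeasurable_fun_sum _ fun j _ => (hmeas j ξ).const_mul _).div_const _
  · filter_upwards [hfd, hle, ae_of_forall_mem_Icc hu.sol, ae_lt_top_of_lintegral hmeas h1]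
      with t a b d e
    refine ⟨⟨isRealDist_potential (isRealDist_rhs (hA.real t) (mem_dotHV.1 a).1 d.real),
      sobolevNorm_lt_top.2 (b.trans_lt (by finiteness))⟩, potential_zero _⟩
  · refine (lintegral_mono_ae hle).trans_lt ?_
    rw [lintegral_const_mul'' _ (aemeasurable_vsq hmeas _)]
    finiteness

end PeriodicNS

end

open PeriodicNS

/-! ### Proof of the main theorem -/

theorem mainTheorem4 (n : ℕ) (hn : 2 ≤ n) (T : ℝ) (hT : 0 < T) (σ CA M : ℝ) (hCA : 0 < CA) :
    ∃ A₁ A₂ A₃ : ℝ, 0 ≤ A₁ ∧ 0 ≤ A₂ ∧ 0 < A₃ ∧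
      ∀ a : Tensor n, TensorBounded T a → TensorSymmetric T a → RelaxedElliptic T CA a →
        tensorNorm T (σ + 1) a ≤ ENNReal.ofReal M →
      ∀ r : ℝ, (n : ℝ) / 2 - 1 < r → (n : ℝ) / 2 + max |r - 1| |(n : ℝ) / 2 - 2| < σ →
      ∀ f : ℝ → VDist n, MemLqDotV 2 T (r - 1) f →
      ∀ u₀ : VDist n, u₀ ∈ dotHsigma r →
      ∀ Ts : ℝ, 0 < Ts → Ts ≤ T → SmallData A₁ A₂ A₃ Ts f u₀ →
        -- existence and uniqueness of the Serrin-type solution on `[0,T*]`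
        (∃ u : ℝ → VDist n, IsSerrinSolution Ts a f u₀ u) ∧
        (∀ u v : ℝ → VDist n, IsSerrinSolution Ts a f u₀ u → IsSerrinSolution Ts a f u₀ v →
          ∀ᵐ t ∂(timeMeasure Ts), u t = v t) ∧
        -- its regularity, and that of the associated pressure
        ∀ u : ℝ → VDist n, IsSerrinSolution Ts a f u₀ u →
          MemLqSigma ∞ Ts r u ∧ MemLqSigma 2 Ts (r + 1) u ∧
          (∃ u' : ℝ → VDist n, IsTimeDeriv Ts u u' ∧ MemLqSigma 2 Ts (r - 1) u') ∧
          (∃ ut : ℝ → VDist n, (∀ᵐ t ∂(timeMeasure Ts), ut t = u t) ∧ ContSigma Ts r ut ∧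
            Tendsto (fun t => sobolevNormV r (ut t - u₀)) (𝓝[>] 0) (𝓝 0)) ∧
          ∃ p : ℝ → SDist n, IsPressure Ts a f u p ∧ MemLqDot 2 Ts r p ∧
            ∀ (s : ℝ) (q : ℝ → SDist n), IsPressure Ts a f u q → MemLqDot 2 Ts s q →
              ∀ᵐ t ∂(timeMeasure Ts), q t = p t := by
  have hn0 : 0 < n := by omega
  have hn' : (2 : ℝ) ≤ n := by exact_mod_cast hn
  -- The constants may depend on `σ` but not on `r`. If `σ` fails at the critical level, no `r` is
  -- admissible and any constants will do.
  by_cases hσ : (n : ℝ) / 2 + |(n : ℝ) / 2 - 2| < σ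
  swap
  · refine ⟨1, 1, 1, zero_le_one, zero_le_one, one_pos, fun a _ _ _ _ r _ hσr => ?_⟩
    exact absurd ((add_le_add_right (le_max_right _ _) _).trans_lt hσr) hσ
  obtain ⟨K, hK, hV⟩ := exists_viscData hn0 (m := 1 + |(n : ℝ) / 2 - 2|) (p := σ + 1) (M := M)
    (by linarith) hCA
  obtain ⟨A₃, hA₃, hex⟩ := exists_regularSolution_of_smallData hn T (c := 1 / (4 * CA))
    (by positivity) hK
  refine ⟨1, 1, A₃, zero_le_one, zero_le_one, hA₃, fun a hb _ hell hM r hr hσr f hf u₀ hu₀ Ts hTs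
    hTsT hsm => ?_⟩
  have hr0 : 0 < r := by linarith
  have hrn : (n : ℝ) / 2 < r + 1 := by linarith
  have hσ' : (n : ℝ) / 2 + |r - 1| < σ := (add_le_add_right (le_max_left _ _) _).trans_lt hσr
  -- A second Wiener bound, for the level `r`. It is obtained after `A₃` has been fixed and does not
  -- influence it.
  obtain ⟨K', hK', hV'⟩ := exists_viscData hn0 (m := 1 + |r - 1|) (p := σ + 1) (M := M)
    (by linarith) hCA
  have hA := hV T Ts a hTsT hb hell hM
  have hA' := hV' T Ts a hTsT hb hell hM
  have hm0 : 0 ≤ 1 + |r - 1| := by positivity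
  have hm : |r| ≤ 1 + |r - 1| := by
    rw [abs_of_pos hr0]
    linarith [le_abs_self (r - 1)]
  have hfs : MemLqDotV 2 Ts (r - 1) f := by
    rw [memLqDotV_two] at hf ⊢
    have hmono := timeMeasure_mono hTsT
    exact ⟨fun k ξ => (hf.1 k ξ).mono_measure hmono, ae_mono hmono hf.2.1,
      (lintegral_mono' hmono le_rfl).trans_lt hf.2.2⟩
  have hf1 : MemLqDotV 2 Ts (-1) f := hfs.mono (by linarith)
  have hu₀' : u₀ ∈ dotHsigma 0 := by
    obtain ⟨h1, h2⟩ := mem_dotHsigma.1 hu₀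
    exact mem_dotHsigma.2 ⟨h1, (vsq_mono hr0.le _).trans_lt h2⟩
  obtain ⟨v, hv⟩ := hex Ts hTs hTsT _ hA r K' hr hA' f hfs u₀ hu₀ hsm
  have hvS := hv.isSerrinSolution hn hr0.le hrn hm hA' hfs
  -- Every Serrin-type solution agrees with the regular one. This gives uniqueness and transfers all
  -- the regularity of `v` at once.
  have huniq : ∀ u, IsSerrinSolution Ts a f u₀ u → ∀ᵐ t ∂(timeMeasure Ts), u t = v t := by
    intro u hu
    obtain ⟨w, hwu, hw⟩ := hu.exists_energySolution hn0 hTs hm0 hA' hf1 hu₀'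
    filter_upwards [hwu, ae_of_forall_mem_Icc fun t ht =>
      hw.eq_regularSolution hn hr0.le hrn hm0 hA' hv ht] with t h1 h2
    rw [← h1, h2]
  refine ⟨⟨v, hvS⟩, fun u w hu hw => ?_, fun u hu => ?_⟩
  · filter_upwards [huniq u hu, huniq w hw] with t h1 h2
    rw [h1, h2]
  have hvu : ∀ᵐ t ∂(timeMeasure Ts), v t = u t := (huniq u hu).mono fun t ht => ht.symm
  have hC := hv.contSigma hn hr0.le hrn hm hA' hfs
  refine ⟨(hv.memLqSigma_top le_rfl).congr hvu, (hv.memLqSigma_two le_rfl).congr hvu,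
    ⟨_, hv.isTimeDeriv.congr hvu, hv.memLqSigma_deriv hn hr0.le hrn hm hA' hfs⟩,
    ⟨v, hvu, hC, ?_⟩, _, (hvS.isPressure hn0 hm0 hA' hf1).congr hvu,
    hv.memLqDot_potential hn hr0.le hrn hm hA' hfs, fun s q hq hqm => ?_⟩
  · have h1 := hC.2 0 (left_mem_Icc.2 hTs.le)
    rw [hv.init] at h1
    exact h1.mono_left (nhdsWithin_le_of_mem (Icc_mem_nhdsGT hTs))
  -- The gradients agree and both pressures have zero mean. Membership in `L₂(Ḣ^s)` is used for the
  -- latter only.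
  · filter_upwards [hvS.gradient_eq hn0 hm0 hA' hf1 (hq.congr (huniq u hu)), hqm.2.1] with t h1 h2
    exact eq_of_gradient_eq h1 (h2.2.trans (potential_zero _).symm)
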